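/- Setting. Let $p=(p_i)_{i\ge 0}$ be a probability distribution on $\mathbb N=\{0,1,2,\dots\}$ with $p_0>0$, $\sum_i i\,p_i>1$, and such that, for some $\alpha>3$ and $C_1>0$, $\sum_{i\ge k}p_i\le C_1k^{-1}(\log k)^{-\alpha}$ for all $k\ge 2$. Let $\nu$ be a Borel probability measure on $\mathbb R$ whose (closed) support is contained in $(1,\infty)$. Sample a Galton–Watson tree $T$ with offspring distribution $p$, conditioned to be infinite, with root $\phi$, and give its edges $e$ independent biases $\beta_e$ of law $\nu$. Given $T$ and $\beta$, let $X$ be the Markov chain on $V(T)$ with $X(0)=\phi$ that jumps from a vertex $v\neq\phi$ with children $v_1,\dots,v_m$ to its parent with probability $1/(1+\sum_i\beta_{v,v_i})$ and to $v_j$ with probability $\beta_{v,v_j}/(1+\sum_i\beta_{v,v_i})$, and from $\phi$ to its child $\phi_j$ with probability $\beta_{\phi,\phi_j}/\sum_i\beta_{\phi,\phi_i}$. An end-distinguished tree is a locally finite infinite tree with oriented edges in which each vertex has exactly one ingoing edge, whose other end is called its parent. A weighted tree is a locally finite tree, rooted or end-distinguished, with biases on its edges. The backbone $B(T)$ of a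 weighted tree $T$ is the set of vertices from which an infinite path of successive children starts (for a rooted tree: the vertices on some infinite self-avoiding path started at the root); a trap entrance is a vertex outside $B(T)$ with a neighbour in $B(T)$. For a trap entrance $u$ and $k\in\mathbb N$, let $N^{\rm out}_k(u)$, the $k$-large backbone neighbourhood of $u$, be the weighted tree, with marked vertex $u$, induced by $u$ and the vertices of $B(T)$ at distance at most $k+1$ from $u$. Let $\Psi_k$ be the set of the trees $N^{\rm out}_k(u)$ that arise from some end-distinguished weighted tree with biases in $\operatorname{supp}\nu$ and some trap entrance $u$ of it. Weighted trees with a marked vertex are considered up to isomorphism (preserving orientation, biases and marked vertex) and carry the Borel $\sigma$-algebra of the local topology, generated by the events that the ball of some radius about the marked vertex is isomorphic to a given finite marked tree by an isomorphism for which the bias of each edge lies in a given Borel set. For $n\ge1$ let $t_n$ be the $n$-th time at which the walk $X$ is at a trap entrance that it has not visited before, and let $\mathbb Q^{\rm out}_k(n)$ be the law of $N^{\rm out}_k(X(t_n))$. Proposition. For each $k\in\mathbb N$ there is a probability measure $\mathbb Q^{\rm out}_k$ supported on $\Psi_k$ such that $$\mathrm{TV}\big(\mathbb Q_k^{\rm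 out}(n),\mathbb Q_k^{\rm out}\big)\to0\qquad(n\to\infty).$$ These measures are consistent: for $j\le k$, the ball of radius $j+1$ about the marked vertex has law $\mathbb Q^{\rm out}_j$ under $\mathbb Q^{\rm out}_k$. There is a unique probability measure $\mathbb Q^{\rm out}$ on marked weighted trees that is supported on infinite end-distinguished weighted trees with biases in $\operatorname{supp}\nu$ whose unique leaf is the marked vertex, and such that, for each $k\in\mathbb N$, the $(k+1)$-neighbourhood of the marked vertex has law $\mathbb Q_k^{\rm out}$ under $\mathbb Q^{\rm out}$. -/

import Mathlib

open MeasureTheory ProbabilityTheory Filter Topology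
open scoped ENNReal

/-! ### Weighted trees with a marked vertex -/

/-- A locally finite tree with oriented edges (away from the root, or from the distinguished end),
carrying a bias on every edge, and with a marked vertex `pt`.
`par w v` says that `w` is the parent of `v`, i.e. that there is an edge oriented from `w` to `v`;
`bias w v` is the bias of this edge (the value is irrelevant if there is no such edge).
A tree in which some vertex has no parent is rooted at this (necessarily unique) vertex. -/
structure WTree where
  V : Type
  par : V → V → Prop
  bias : V → V → ℝ
  pt : V
  par_unique : ∀ w w' v, par w v → par w' v → w = w'
  par_asymm : ∀ w v, par w v → ¬ par v w
  isTree : (SimpleGraph.fromRel par).IsTree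
  locallyFinite : ∀ v, {w | (SimpleGraph.fromRel par).Adj v w}.Finite

namespace WTree

/-- The underlying unoriented tree. -/
def graph (T : WTree) : SimpleGraph T.V := SimpleGraph.fromRel T.par

/-- Isomorphism of weighted trees, respecting orientation, biases and the marked vertex. -/
def Iso (S T : WTree) : Prop :=
  ∃ e : S.V ≃ T.V, e S.pt = T.pt ∧ (∀ v w, S.par v w ↔ T.par (e v) (e w)) ∧
    ∀ v w, S.par v w → S.bias v w = T.bias (e v) (e w)

/-- All biases lie in the set `I`. -/
def BiasesIn (T : WTree) (I : Set ℝ) : Prop := ∀ w v, T.par w v → T.bias w v ∈ I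

/-- The tree is infinite and every vertex has exactly one ingoing edge. -/
def IsEndDistinguished (T : WTree) : Prop := Infinite T.V ∧ ∀ v, ∃! w, T.par w v

/-- A leaf is a vertex with exactly one neighbour. -/
def IsLeaf (T : WTree) (v : T.V) : Prop := ∃! w, T.graph.Adj v w

/-- The vertices of the backbone: those lying on an infinite self-avoiding path that leads away
from the root (or from the distinguished end). -/
def backbone (T : WTree) : Set T.V :=
  {v | ∃ x : ℕ → T.V, x 0 = v ∧ ∀ n, T.par (x n) (x (n + 1))}

/-- The exterior vertex boundary of the backbone: the trap entrances. -/
def exteriorBoundary (T : WTree) : Set T.V :=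
  {u | u ∉ T.backbone ∧ ∃ w ∈ T.backbone, T.graph.Adj u w}

/-- The vertices that can be reached from the marked vertex by a path all of whose vertices, except
possibly the marked one, lie in `s`. -/
def reach (T : WTree) (s : Set T.V) : Set T.V :=
  {v | Relation.ReflTransGen (fun a b => T.graph.Adj a b ∧ b ∈ s) T.pt v}

theorem connected_reach (T : WTree) (s : Set T.V) :
    (SimpleGraph.fromRel fun w v : T.reach s => T.par w v).Connected := by
  have key : ∀ (v : T.V) (hv : v ∈ T.reach s),
      (SimpleGraph.fromRel fun w v : T.reach s => T.par w v).Reachable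
        ⟨T.pt, Relation.ReflTransGen.refl⟩ ⟨v, hv⟩ := by
    intro v hv
    induction hv with
    | refl => exact SimpleGraph.Reachable.refl _
    | tail h h' ih =>
      refine ih.trans (SimpleGraph.Adj.reachable ?_)
      have := h'.1
      simpa [SimpleGraph.fromRel_adj, Subtype.ext_iff, graph] using this
  exact (SimpleGraph.connected_iff_exists_forall_reachable _).2 ⟨_, fun v => key v.1 v.2⟩

/-- The weighted tree induced by the marked vertex and the set `s`; orientation, biases and the
marked vertex are inherited. (If the graph induced by these vertices is not connected, we keep the
component of the marked vertex. In the uses below it always is connected.) -/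
def sub (T : WTree) (s : Set T.V) : WTree where
  V := T.reach s
  par w v := T.par w v
  bias w v := T.bias w v
  pt := ⟨T.pt, Relation.ReflTransGen.refl⟩
  par_unique w w' v h h' := Subtype.ext (T.par_unique _ _ _ h h')
  par_asymm _ _ h := T.par_asymm _ _ h
  isTree := ⟨T.connected_reach s, by
    refine T.isTree.isAcyclic.comap ⟨Subtype.val, ?_⟩ Subtype.val_injective
    intro a b h
    simpa [SimpleGraph.fromRel_adj, Subtype.ext_iff] using h⟩
  locallyFinite v := by
    refine ((T.locallyFinite v).preimage Subtype.val_injective.injOn).subset ?_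
    intro w h
    simpa [SimpleGraph.fromRel_adj, Subtype.ext_iff] using h

/-- The ball of radius `r` about the marked vertex. -/
def ball (r : ℕ) (T : WTree) : WTree := T.sub {v | T.graph.dist T.pt v ≤ r}

/-- The `k`-large backbone neighbourhood of the marked vertex `u` (an element of the exterior
boundary of the backbone): the weighted tree induced by `u` and the vertices of the backbone at
distance at most `k + 1` from `u`. -/
def outNbhd (k : ℕ) (T : WTree) : WTree :=
  T.sub {v | v ∈ T.backbone ∧ T.graph.dist T.pt v ≤ k + 1}

/-- The trees that arise, up to isomorphism, as the `k`-large backbone neighbourhood of a trap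
entrance in an infinite end-distinguished tree with biases in `I`. -/
def Psi (I : Set ℝ) (k : ℕ) : Set WTree :=
  {G | ∃ T : WTree, T.IsEndDistinguished ∧ T.BiasesIn I ∧ T.pt ∈ T.exteriorBoundary ∧
    G.Iso (T.outNbhd k)}

/-- The event that the ball of radius `r` about the marked vertex is isomorphic to the finite
oriented tree `R` on `Fin m` with marked vertex `p`, by an isomorphism that gives to each edge
`(i, j)` a bias in `A i j`. -/
def localEvent (r m : ℕ) (R : Fin m → Fin m → Prop) (p : Fin m) (A : Fin m → Fin m → Set ℝ) :
    Set WTree :=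
  {T | ∃ e : Fin m ≃ (T.ball r).V, e p = (T.ball r).pt ∧
    (∀ i j, R i j ↔ (T.ball r).par (e i) (e j)) ∧
    ∀ i j, R i j → (T.ball r).bias (e i) (e j) ∈ A i j}

/-- The Borel `σ`-algebra of the local topology on weighted trees with a marked vertex. All
measurable sets are invariant under isomorphism, so that a measure on `WTree` is the same as a
measure on the set of isomorphism classes. -/
instance : MeasurableSpace WTree :=
  MeasurableSpace.generateFrom
    {E | ∃ r m R p A, (∀ i j, MeasurableSet (A i j)) ∧ E = localEvent r m R p A}

end WTree

/-- The total variation distance. -/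
noncomputable def tvDist {α : Type*} [MeasurableSpace α] (μ ν : Measure α) : ℝ :=
  ⨆ A : {A : Set α // MeasurableSet A}, |μ.real A - ν.real A|

/-! ### Galton-Watson trees with random biases -/

/-- Possible vertices: `[]` is the root and `i :: v` is the child with index `i` of `v`. -/
abbrev Vertex := List ℕ

instance : MeasurableSpace Vertex := ⊤

instance : DiscreteMeasurableSpace Vertex := ⟨fun _ => trivial⟩

/-- For each possible vertex `v`, the number of its children and the bias of the edge that joins
`v` to its parent. -/
abbrev Env := Vertex → ℕ × ℝ

namespace Env

/-- The vertices of the tree. -/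
def Mem (ω : Env) : Vertex → Prop
  | [] => True
  | i :: v => Mem ω v ∧ i < (ω v).1

/-- `w` is the parent of `v`. -/
def Par (ω : Env) (w v : {v : Vertex // ω.Mem v}) : Prop := ∃ i, v.1 = i :: w.1

theorem connected (ω : Env) : (SimpleGraph.fromRel ω.Par).Connected := by
  refine (SimpleGraph.connected_iff_exists_forall_reachable _).2 ⟨⟨[], trivial⟩, ?_⟩
  rintro ⟨v, hv⟩
  induction v with
  | nil => exact SimpleGraph.Reachable.refl _
  | cons i v ih =>
    refine (ih hv.1).trans (SimpleGraph.Adj.reachable ?_)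
    rw [SimpleGraph.fromRel_adj]
    exact ⟨by simp [Subtype.ext_iff], Or.inl ⟨i, rfl⟩⟩

theorem isBridge (ω : Env) (v w : {v : Vertex // ω.Mem v}) (h : ω.Par v w) :
    (SimpleGraph.fromRel ω.Par).IsBridge s(v, w) := by
  obtain ⟨i, hi⟩ := h
  rw [SimpleGraph.isBridge_iff]
  rintro ⟨q⟩
  have step : ∀ a b, ω.Par a b → s(a, b) ≠ s(v, w) → (w.1 <:+ a.1 ↔ w.1 <:+ b.1) := by
    rintro a b ⟨j, hj⟩ hne
    rw [hj, List.suffix_cons_iff]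
    refine ⟨Or.inr, fun h => h.resolve_left fun h => hne ?_⟩
    rw [hi] at h
    have h1 : v = a := Subtype.ext (List.cons.inj h).2
    have h2 : w = b := Subtype.ext (by rw [hi, hj, h])
    rw [h1, h2]
  have inv : w.1 <:+ v.1 ↔ w.1 <:+ w.1 := by
    have : ∀ x y (q : ((SimpleGraph.fromRel ω.Par).deleteEdges {s(v, w)}).Walk x y),
        (w.1 <:+ x.1 ↔ w.1 <:+ y.1) := by
      intro x y q
      induction q with
      | nil => rfl
      | cons hadj _ ih =>
        rw [← ih]
        rw [SimpleGraph.deleteEdges_adj, SimpleGraph.fromRel_adj, Set.mem_singleton_iff] at hadj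
        rcases hadj.1.2 with h | h
        · exact step _ _ h hadj.2
        · exact (step _ _ h (by rw [Sym2.eq_swap]; exact hadj.2)).symm
    exact this _ _ q
  have hlen := (inv.2 (List.suffix_refl _)).length_le
  rw [hi, List.length_cons] at hlen
  omega

theorem acyclic (ω : Env) : (SimpleGraph.fromRel ω.Par).IsAcyclic := by
  rw [SimpleGraph.isAcyclic_iff_forall_adj_isBridge]
  intro v w h
  rw [SimpleGraph.fromRel_adj] at h
  rcases h.2 with h | h
  · exact ω.isBridge v w h
  · rw [Sym2.eq_swap]
    exact ω.isBridge w v h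

open Classical in
/-- The weighted tree described by `ω`, with marked vertex `u` (the root, if `u` is not a vertex of
the tree). -/
noncomputable def tree (ω : Env) (u : Vertex) : WTree where
  V := {v : Vertex // ω.Mem v}
  par := ω.Par
  bias _ v := (ω v).2
  pt := if h : ω.Mem u then ⟨u, h⟩ else ⟨[], trivial⟩
  par_unique := by
    rintro w w' v ⟨i, h⟩ ⟨j, h'⟩
    rw [h] at h'
    exact Subtype.ext (List.cons.inj h').2
  par_asymm := by
    rintro w v ⟨i, h⟩ ⟨j, h'⟩
    rw [h'] at h
    have := congrArg List.length h
    simp only [List.length_cons] at this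
    omega
  isTree := ⟨ω.connected, ω.acyclic⟩
  locallyFinite v := by
    refine Set.Finite.of_finite_image (f := Subtype.val) ?_ Subtype.val_injective.injOn
    refine ((Set.finite_singleton v.1.tail).union
      ((Set.finite_lt_nat (ω v).1).image fun i => i :: v.1)).subset ?_
    rintro _ ⟨w, hw, rfl⟩
    have hw' : (SimpleGraph.fromRel ω.Par).Adj v w := hw
    rw [SimpleGraph.fromRel_adj] at hw'
    rcases hw'.2 with ⟨i, hi⟩ | ⟨i, hi⟩
    · have hm : ω.Mem (i :: v.1) := hi ▸ w.2
      exact Or.inr ⟨i, hm.2, hi.symm⟩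
    · left
      rw [hi]
      rfl

end Env

/-- The law of the Galton-Watson tree with offspring law `p` and independent biases of law `ν`,
conditioned on the tree being infinite. -/
noncomputable def gwLaw (p : PMF ℕ) (ν : Measure ℝ) : Measure Env :=
  cond (Measure.infinitePi fun _ : Vertex => p.toMeasure.prod ν) {ω | {v | ω.Mem v}.Infinite}

/-! ### The biased random walk -/

namespace Env

/-- The jump rates out of `v`: `1` to the parent (if `v` is not the root), and the bias of the
corresponding edge to each child. -/
noncomputable def rates (x : Env × Vertex) : Measure Vertex :=
  (if x.2 = [] then 0 else Measure.dirac x.2.tail) +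
    ∑ i ∈ Finset.range (x.1 x.2).1, ENNReal.ofReal (x.1 (i :: x.2)).2 • Measure.dirac (i :: x.2)

open Classical in
/-- The jump law out of `v`: the normalized jump rates. (If there is no edge to jump along, the
walk stays where it is; this does not occur in infinite trees with positive biases.) -/
noncomputable def jump (x : Env × Vertex) : Measure Vertex :=
  if rates x Set.univ = 0 then Measure.dirac x.2 else (rates x Set.univ)⁻¹ • rates x

theorem measurable_rates_aux (v : Vertex) : Measurable fun y : ℕ × Env =>
    (if v = [] then (0 : Measure Vertex) else Measure.dirac v.tail) +
      ∑ i ∈ Finset.range y.1, ENNReal.ofReal (y.2 (i :: v)).2 • Measure.dirac (i :: v) := by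
  refine measurable_from_prod_countable_right fun n => ?_
  refine Measure.measurable_of_measurable_coe _ fun s _ => ?_
  simp only [Measure.add_apply, Measure.finsetSum_apply, Measure.smul_apply, smul_eq_mul]
  refine measurable_const.add (Finset.measurable_sum _ fun i _ => Measurable.mul_const ?_ _)
  exact (measurable_pi_apply (i :: v)).snd.ennreal_ofReal

theorem measurable_rates : Measurable rates := by
  have h (v : Vertex) : Measurable fun ω : Env => ((ω v).1, ω) :=
    (measurable_pi_apply v).fst.prodMk measurable_id
  have h' (v : Vertex) : Measurable fun ω : Env => rates (ω, v) := by
    have := (measurable_rates_aux v).comp (h v)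
    simp only [Function.comp_def] at this
    simpa only [rates] using this
  exact measurable_from_prod_countable_left h'

theorem rates_univ_ne_top (x : Env × Vertex) : rates x Set.univ ≠ ∞ := by
  simp only [rates, Measure.add_apply, Measure.finsetSum_apply, Measure.smul_apply, smul_eq_mul]
  refine ENNReal.add_ne_top.2 ⟨by split_ifs <;> simp, ?_⟩
  exact ENNReal.sum_ne_top.2 fun i _ => by simp

theorem measurable_jump : Measurable jump := by
  have h0 : Measurable fun x => rates x Set.univ :=
    (Measure.measurable_coe MeasurableSet.univ).comp measurable_rates
  refine Measurable.ite (h0 (measurableSet_singleton 0))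
    (Measure.measurable_dirac.comp measurable_snd) ?_
  refine Measure.measurable_of_measurable_coe _ fun s hs => ?_
  simp only [Measure.smul_apply, smul_eq_mul]
  exact h0.inv.mul ((Measure.measurable_coe hs).comp measurable_rates)

/-- The jump law as a kernel. -/
noncomputable def jumpKernel : Kernel (Env × Vertex) Vertex := ⟨jump, measurable_jump⟩

instance : IsMarkovKernel jumpKernel := by
  refine ⟨fun x => ⟨?_⟩⟩
  change jump x Set.univ = 1
  unfold jump
  split_ifs with h
  · simp
  · simpa using ENNReal.inv_mul_cancel h (rates_univ_ne_top x)

/-- One step of the walk, as a kernel on pairs (environment, position) that keeps the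
environment. -/
noncomputable def stepKernel : Kernel (Env × Vertex) (Env × Vertex) :=
  Kernel.deterministic Prod.fst measurable_fst ×ₖ jumpKernel

instance : IsMarkovKernel stepKernel := by
  unfold stepKernel; infer_instance

/-- For each environment `ω`, the law of the biased random walk on the tree described by `ω`,
started at the root: the law of the second coordinate of the Markov chain with transition kernel
`stepKernel` started at `(ω, root)`. -/
noncomputable def walkKernel : Kernel Env (ℕ → Vertex) :=
  ((Kernel.traj (X := fun _ => Env × Vertex)
      (fun n => stepKernel.comap (fun x => x ⟨n, Finset.mem_Iic.2 le_rfl⟩) (by fun_prop)) 0).comap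
    (fun ω _ => (ω, [])) (by fun_prop)).map (fun x n => (x n).2)

end Env

/-- The joint law of the infinite Galton-Watson tree and of the biased random walk on it. -/
noncomputable def jointLaw (p : PMF ℕ) (ν : Measure ℝ) : Measure (Env × (ℕ → Vertex)) :=
  gwLaw p ν ⊗ₘ Env.walkKernel

/-- `u` is a trap entrance of the tree described by `ω`. -/
def IsTrapEntrance (ω : Env) (u : Vertex) : Prop := (ω.tree u).pt ∈ (ω.tree u).exteriorBoundary

open Classical in
/-- The time at which the path `X` arrives at the `n`-th trap entrance it encounters, for `n ≥ 1`:
the `n`-th time at which it is at a trap entrance that it has not visited before. -/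
noncomputable def arrivalTime (ω : Env) (X : ℕ → Vertex) (n : ℕ) : ℕ :=
  Nat.nth (fun t => IsTrapEntrance ω (X t) ∧ ∀ s < t, X s ≠ X t) (n - 1)

/-- The law of the `k`-large backbone neighbourhood of the `n`-th trap entrance encountered by the
walk. -/
noncomputable def Qout (p : PMF ℕ) (ν : Measure ℝ) (k n : ℕ) : Measure WTree :=
  (jointLaw p ν).map fun x => ((x.1).tree (x.2 (arrivalTime x.1 x.2 n))).outNbhd k

/-! ### Isomorphisms, subtrees and balls; invariance of the measurable sets -/

namespace WTree

variable {S T U : WTree}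

/-! The walk regenerates. The support of `ν` is closed and contained in `(1, ∞)`, so the biases are
at least some `q > 1`, and along a ray the function `q⁻¹ ^ common r x` is superharmonic away from
the root; hence the walk on an infinite tree is transient. At a regeneration time (`IsRegen`) it
enters the subtree at its present vertex for the first time and never leaves it again. What lies
outside this subtree is then independent of the future inside it, and this future always has the
same law `regenLaw`: a Galton–Watson tree whose root is given an extra parent, with its walk
conditioned never to step there. The independence (`lintegral_freeLaw_regen`) combines the Markov
property in a fixed environment with the resampling of a subtree of the i.i.d. environment.

New trap entrances, counted between regenerations, therefore form a renewal process. Let `r j` be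
the probability under `regenLaw` that more than `j` of them precede the first regeneration after
time `0`, and let `U m` be the expected number of regenerations preceded by exactly `m` of them.
Splitting according to the last regeneration preceded by at most `m` gives the renewal equation `∑ U
i * r (m - i) = 1`, and the renewal theorem gives `U m → κ⁻¹` with `κ = ∑ r j`. It has two inputs.
Finiteness of `κ` comes from `le_renewal_newVertex`: if new vertices are counted instead, every `U
m` is at least the unconditioned escape mass, so the renewal equation itself bounds the sum of the
tails. Aperiodicity, `r 1 < r 0`, comes from an explicit detour into a childless vertex before a
regeneration.

Successive regeneration vertices lie strictly deeper in the tree. So a trap entrance met after `k +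
3` regenerations, the one at time `0` included, is at distance more than `k + 1` from the starting
vertex of its piece of the walk, and its neighbourhood is determined by that piece. With `g m A` the
probability of such an arrival after `m` other trap entrances and with neighbourhood in `A`, the
probability that the `(n+1)`-st trap entrance has its neighbourhood in `A` is at least `∑ U (n - m)
* g m A`. This falls short of `κ⁻¹ * ∑ g m A` by an amount that tends to `0` uniformly in `A`. The
latter is a probability measure, so that the one-sided bound already gives convergence in total
variation. Passing from `regenLaw` to the law of the conditioned tree costs one more convolution,
over the first regeneration.

The limit is realised by one random tree. Cut along regenerations, the ancestry of a late trap
entrance consists of a base, which is the piece containing the trap entrance, biased by the number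
of trap entrances, and of i.i.d. pieces above it. Stacking infinitely many of these
(`Stem.limitTree`) and keeping the marked vertex and the backbone gives the tree whose balls have
the limit laws. This yields consistency and existence together; uniqueness holds because the laws of
the balls determine a measure. -/

theorem Iso.refl (T : WTree) : T.Iso T := ⟨Equiv.refl _, rfl, fun _ _ => Iff.rfl, fun _ _ _ => rfl⟩

theorem Iso.symm (h : S.Iso T) : T.Iso S := by
  obtain ⟨e, h1, h2, h3⟩ := h
  refine ⟨e.symm, by rw [← h1, e.symm_apply_apply], fun v w => by simp [h2], fun v w h => ?_⟩
  have := h3 (e.symm v) (e.symm w) (by simpa [h2] using h)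
  simpa using this.symm

theorem Iso.trans (h : S.Iso T) (h' : T.Iso U) : S.Iso U := by
  obtain ⟨e, h1, h2, h3⟩ := h
  obtain ⟨e', h1', h2', h3'⟩ := h'
  refine ⟨e.trans e', by simp [h1, h1'], fun v w => by simp [h2, h2'], fun v w h => ?_⟩
  rw [h3 v w h, h3' _ _ ((h2 v w).1 h)]
  rfl

theorem graph_adj (T : WTree) {v w : T.V} : T.graph.Adj v w ↔ T.par v w ∨ T.par w v := by
  rw [graph, SimpleGraph.fromRel_adj, and_iff_right_iff_imp]
  rintro h rfl
  rcases h with h | h <;> exact T.par_asymm _ _ h h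

theorem graph_isTree (T : WTree) : T.graph.IsTree := T.isTree

theorem graph_connected (T : WTree) : T.graph.Connected := T.isTree.connected

/-- The length of a path in a tree is the distance of its endpoints. -/
theorem length_eq_dist {v w : T.V} {q : T.graph.Walk v w} (hq : q.IsPath) :
    q.length = T.graph.dist v w := by
  obtain ⟨q', hq', hlen⟩ := (T.graph_connected v w).exists_path_of_dist
  have := (T.graph_isTree.isAcyclic.subsingleton_path v w).elim ⟨q, hq⟩ ⟨q', hq'⟩
  rw [← hlen, Subtype.mk.inj this]

/-- An injective homomorphism carries paths to paths, and in a tree every path realises the distance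
of its ends. This is why distances in a subtree need no separate treatment. -/
theorem dist_of_injective {f : S.V → T.V} (hf : Function.Injective f)
    (hadj : ∀ v w, S.graph.Adj v w → T.graph.Adj (f v) (f w)) (v w : S.V) :
    T.graph.dist (f v) (f w) = S.graph.dist v w := by
  obtain ⟨q, hq, hlen⟩ := (S.graph_connected v w).exists_path_of_dist
  let φ : S.graph →g T.graph := ⟨f, fun h => hadj _ _ h⟩
  have := length_eq_dist (hq.map (f := φ) hf)
  rw [← hlen, ← SimpleGraph.Walk.length_map φ]
  exact this.symm

theorem sub_adj (T : WTree) (s : Set T.V) {v w : (T.sub s).V} :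
    (T.sub s).graph.Adj v w ↔ T.graph.Adj v.1 w.1 := by
  rw [graph_adj, graph_adj]
  rfl

theorem dist_sub (T : WTree) (s : Set T.V) (v w : (T.sub s).V) :
    (T.sub s).graph.dist v w = T.graph.dist v.1 w.1 :=
  (dist_of_injective (S := T.sub s) (f := Subtype.val) Subtype.val_injective
    (fun _ _ h => (T.sub_adj s).1 h) v w).symm

theorem pt_mem_reach (T : WTree) (s : Set T.V) : T.pt ∈ T.reach s := Relation.ReflTransGen.refl

theorem reach_step {s : Set T.V} {v w : T.V} (hv : v ∈ T.reach s) (h : T.graph.Adj v w) (hw : w ∈ s) :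
    w ∈ T.reach s := Relation.ReflTransGen.tail hv ⟨h, hw⟩

@[elab_as_elim]
theorem reach_induction {s : Set T.V} {C : ∀ v, v ∈ T.reach s → Prop} (h0 : C T.pt (T.pt_mem_reach s))
    (h1 : ∀ v w (hv : v ∈ T.reach s) (h : T.graph.Adj v w) (hw : w ∈ s), C v hv → C w (reach_step hv h hw))
    {v : T.V} (hv : v ∈ T.reach s) : C v hv := by
  induction hv with
  | refl => exact h0
  | tail h h' ih => exact h1 _ _ h h'.1 h'.2 ih

theorem mem_of_mem_reach {s : Set T.V} {v : T.V} (hv : v ∈ T.reach s) : v = T.pt ∨ v ∈ s :=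
  reach_induction (C := fun v _ => v = T.pt ∨ v ∈ s) (Or.inl rfl) (fun _ _ _ _ hw _ => Or.inr hw) hv

/-- A local isomorphism induces an isomorphism of the subtrees where it is bijective. -/
theorem sub_iso_sub {s : Set S.V} {t : Set T.V} (f : S.V → T.V) (hf : Function.Injective f)
    (hpt : f S.pt = T.pt) (hpar : ∀ v w, S.par v w ↔ T.par (f v) (f w))
    (hbias : ∀ v w, S.par v w → S.bias v w = T.bias (f v) (f w))
    (hst : ∀ v w, v ∈ S.reach s → S.graph.Adj v w → (w ∈ s ↔ f w ∈ t))
    (hrange : ∀ v w, v ∈ S.reach s → T.graph.Adj (f v) w → w ∈ t → ∃ u, f u = w) :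
    (S.sub s).Iso (T.sub t) := by
  have hadj : ∀ v w, S.graph.Adj v w ↔ T.graph.Adj (f v) (f w) := fun v w => by
    rw [graph_adj, graph_adj, hpar, hpar]
  have h1 : ∀ v ∈ S.reach s, f v ∈ T.reach t := by
    intro v hv
    induction hv using reach_induction with
    | h0 => rw [hpt]; exact T.pt_mem_reach t
    | h1 v w hv hvw hw ih => exact reach_step ih ((hadj _ _).1 hvw) ((hst v w hv hvw).1 hw)
  have h2 : ∀ w ∈ T.reach t, ∃ v ∈ S.reach s, f v = w := by
    intro w hw
    induction hw using reach_induction with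
    | h0 => exact ⟨_, S.pt_mem_reach s, hpt⟩
    | h1 x y hx hxy hy ih =>
      obtain ⟨v, hv, rfl⟩ := ih
      obtain ⟨u, rfl⟩ := hrange v y hv hxy hy
      have := (hadj _ _).2 hxy
      exact ⟨u, reach_step hv this ((hst v u hv this).2 hy), rfl⟩
  let g : S.reach s → T.reach t := fun v => ⟨f v.1, h1 v.1 v.2⟩
  have hg : Function.Bijective g := by
    refine ⟨fun v w h => Subtype.ext (hf (congrArg Subtype.val h)), fun w => ?_⟩
    obtain ⟨v, hv, hvw⟩ := h2 w.1 w.2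
    exact ⟨⟨v, hv⟩, Subtype.ext hvw⟩
  exact ⟨Equiv.ofBijective g hg, Subtype.ext hpt, fun v w => hpar v.1 w.1, fun v w h => hbias v.1 w.1 h⟩

/-- The subtree of a subtree. -/
theorem sub_sub_iso {s : Set T.V} {s' : Set (T.sub s).V} {t : Set T.V} (h : ∀ v, v ∈ s' ↔ v.1 ∈ t) :
    ((T.sub s).sub s').Iso (T.sub (s ∩ t)) := by
  have hre : ∀ v ∈ (T.sub s).reach s', v.1 ∈ T.reach (s ∩ t) := by
    intro v hv
    induction hv using reach_induction with
    | h0 => exact T.pt_mem_reach _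
    | h1 v w _ hvw hw ih =>
      rcases mem_of_mem_reach w.2 with h' | h'
      · rw [h']; exact T.pt_mem_reach _
      · exact reach_step ih ((T.sub_adj s).1 hvw) ⟨h', (h w).1 hw⟩
  have hre' : ∀ v ∈ T.reach (s ∩ t), ∃ h : v ∈ T.reach s, ⟨v, h⟩ ∈ (T.sub s).reach s' := by
    intro v hv
    induction hv using reach_induction with
    | h0 => exact ⟨T.pt_mem_reach s, (T.sub s).pt_mem_reach s'⟩
    | h1 v w _ hvw hw ih =>
      obtain ⟨h1, h2⟩ := ih
      have hw' := reach_step h1 hvw hw.1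
      refine ⟨hw', reach_step h2 ?_ ((h _).2 hw.2)⟩
      exact (T.sub_adj s).2 hvw
  let g : (T.sub s).reach s' → T.reach (s ∩ t) := fun v => ⟨v.1.1, hre v.1 v.2⟩
  have hg : Function.Bijective g := by
    refine ⟨fun v w h => Subtype.ext (Subtype.ext (congrArg (fun x => x.1) h)), fun w => ?_⟩
    obtain ⟨h1, h2⟩ := hre' w.1 w.2
    exact ⟨⟨⟨w.1, h1⟩, h2⟩, rfl⟩
  exact ⟨Equiv.ofBijective g hg, rfl, fun v w => Iff.rfl, fun v w h => rfl⟩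

theorem ball_sub_iso (T : WTree) (s : Set T.V) (r : ℕ) :
    ((T.sub s).ball r).Iso (T.sub (s ∩ {v | T.graph.dist T.pt v ≤ r})) :=
  sub_sub_iso fun v => by
    rw [Set.mem_ofPred_eq, dist_sub]
    rfl

theorem ball_ball_iso (T : WTree) (q r : ℕ) : ((T.ball q).ball r).Iso (T.ball (min q r)) := by
  have h := T.ball_sub_iso {v | T.graph.dist T.pt v ≤ q} r
  have e : {v | T.graph.dist T.pt v ≤ q} ∩ {v | T.graph.dist T.pt v ≤ r} =
      {v | T.graph.dist T.pt v ≤ min q r} := by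
    ext v; simp
  rwa [e] at h

/-- The whole backbone, seen from the marked vertex, has all the neighbourhoods as its balls. One
infinite tree thus carries the entire consistent family. -/
theorem ball_sub_backbone_iso (T : WTree) (k : ℕ) :
    ((T.sub T.backbone).ball (k + 1)).Iso (T.outNbhd k) := T.ball_sub_iso _ _

theorem ball_outNbhd_iso (T : WTree) {j k : ℕ} (h : j ≤ k) :
    ((T.outNbhd k).ball (j + 1)).Iso (T.outNbhd j) := by
  have h1 := T.ball_sub_iso {v | v ∈ T.backbone ∧ T.graph.dist T.pt v ≤ k + 1} (j + 1)
  have e : {v | v ∈ T.backbone ∧ T.graph.dist T.pt v ≤ k + 1} ∩ {v | T.graph.dist T.pt v ≤ j + 1} =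
      {v | v ∈ T.backbone ∧ T.graph.dist T.pt v ≤ j + 1} := by
    ext v
    simp only [Set.mem_inter_iff, Set.mem_ofPred_eq]
    constructor
    · exact fun h => ⟨h.1.1, h.2⟩
    · exact fun h' => ⟨⟨h'.1, by omega⟩, h'.2⟩
  rwa [e] at h1

/-! ### Embeddings that are surjective on children -/

/-- An embedding of marked weighted trees whose image contains the children of its elements. -/
structure IsEmb (S T : WTree) (f : S.V → T.V) : Prop where
  injective : Function.Injective f
  pt : f S.pt = T.pt
  par : ∀ v w, S.par v w ↔ T.par (f v) (f w)
  bias : ∀ v w, S.par v w → S.bias v w = T.bias (f v) (f w)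
  child : ∀ v w, T.par (f v) w → ∃ u, f u = w

namespace IsEmb

variable {f : S.V → T.V}

theorem adj (h : IsEmb S T f) (v w : S.V) : S.graph.Adj v w ↔ T.graph.Adj (f v) (f w) := by
  rw [graph_adj, graph_adj, h.par, h.par]

theorem dist (h : IsEmb S T f) (v : S.V) : T.graph.dist T.pt (f v) = S.graph.dist S.pt v := by
  rw [← h.pt, dist_of_injective h.injective fun v w => (h.adj v w).1]

/-- The image contains all children of its points, so an infinite path of successive children that
starts in the image stays there and can be pulled back. -/
theorem backbone (h : IsEmb S T f) (v : S.V) : f v ∈ T.backbone ↔ v ∈ S.backbone := by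
  constructor
  · rintro ⟨x, h0, hx⟩
    have : ∀ n, ∃ u, f u = x n := by
      intro n
      induction n with
      | zero => exact ⟨v, h0.symm⟩
      | succ n ih =>
        obtain ⟨u, hu⟩ := ih
        exact h.child u _ (hu ▸ hx n)
    choose y hy using this
    refine ⟨y, h.injective (by rw [hy, h0]), fun n => (h.par _ _).2 ?_⟩
    rw [hy, hy]
    exact hx n
  · rintro ⟨x, rfl, hx⟩
    exact ⟨fun n => f (x n), rfl, fun n => (h.par _ _).1 (hx n)⟩

/-- The only neighbours that an embedding can miss are parents of image points; `hk` supplies those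
that are close enough to matter. -/
theorem outNbhd_iso (h : IsEmb S T f) {k : ℕ}
    (hk : ∀ v w, S.graph.dist S.pt v ≤ k + 1 → T.par w (f v) → ∃ u, f u = w) :
    (S.outNbhd k).Iso (T.outNbhd k) := by
  refine sub_iso_sub f h.injective h.pt h.par h.bias (fun v w _ _ => ?_) fun v w hv hvw hw => ?_
  · simp only [Set.mem_ofPred_eq, h.backbone, h.dist]
  · rcases T.graph_adj.1 hvw with h' | h'
    · exact h.child v w h'
    · refine hk v w ?_ h'
      rcases mem_of_mem_reach hv with rfl | h''
      · simp
      · exact h''.2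

end IsEmb

theorem Iso.exists_isEmb (h : S.Iso T) : ∃ f : S.V → T.V, IsEmb S T f ∧ Function.Surjective f := by
  obtain ⟨e, h1, h2, h3⟩ := h
  exact ⟨e, ⟨e.injective, h1, h2, h3, fun v w _ => ⟨e.symm w, by simp⟩⟩, e.surjective⟩

theorem Iso.ball (h : S.Iso T) (r : ℕ) : (S.ball r).Iso (T.ball r) := by
  obtain ⟨f, hf, hs⟩ := h.exists_isEmb
  refine sub_iso_sub f hf.injective hf.pt hf.par hf.bias (fun v w _ _ => ?_) fun v w _ _ _ => hs w
  simp only [Set.mem_ofPred_eq, hf.dist]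

theorem Iso.mem_localEvent (h : S.Iso T) {r m : ℕ} {R : Fin m → Fin m → Prop} {p : Fin m}
    {A : Fin m → Fin m → Set ℝ} (hS : S ∈ localEvent r m R p A) : T ∈ localEvent r m R p A := by
  obtain ⟨e, h1, h2, h3⟩ := hS
  obtain ⟨e', h1', h2', h3'⟩ := h.ball r
  refine ⟨e.trans e', by simp [h1, h1'], fun i j => by simp [h2, h2'], fun i j hij => ?_⟩
  have := h3 i j hij
  rw [h3' _ _ ((h2 i j).1 hij)] at this
  exact this

theorem Iso.mem_iff (h : S.Iso T) {E : Set WTree} (hE : MeasurableSet E) : S ∈ E ↔ T ∈ E := by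
  induction E, hE using MeasurableSpace.generateFrom_induction with
  | hC E hE _ =>
    obtain ⟨r, m, R, p, A, -, rfl⟩ := hE
    exact ⟨h.mem_localEvent, h.symm.mem_localEvent⟩
  | empty => simp
  | compl E _ ih => rw [Set.mem_compl_iff, Set.mem_compl_iff, ih]
  | iUnion E _ ih => simp only [Set.mem_iUnion, ih]

theorem measurableSet_localEvent {r m : ℕ} {R : Fin m → Fin m → Prop} {p : Fin m}
    {A : Fin m → Fin m → Set ℝ} (hA : ∀ i j, MeasurableSet (A i j)) :
    MeasurableSet (localEvent r m R p A) :=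
  MeasurableSpace.measurableSet_generateFrom ⟨r, m, R, p, A, hA, rfl⟩

theorem mem_localEvent_iff_of_iso_ball {q r m : ℕ} {R : Fin m → Fin m → Prop} {p : Fin m}
    {A : Fin m → Fin m → Set ℝ} (h : (S.ball q).Iso (T.ball r)) :
    S ∈ localEvent q m R p A ↔ T ∈ localEvent r m R p A := by
  have key : ∀ {S T : WTree} {q r : ℕ}, (S.ball q).Iso (T.ball r) → S ∈ localEvent q m R p A →
      T ∈ localEvent r m R p A := by
    rintro S T q r ⟨e', h1', h2', h3'⟩ ⟨e, h1, h2, h3⟩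
    refine ⟨e.trans e', by simp [h1, h1'], fun i j => by simp [h2, h2'], fun i j hij => ?_⟩
    have := h3 i j hij
    rw [h3' _ _ ((h2 i j).1 hij)] at this
    exact this
  exact ⟨key h, key h.symm⟩

theorem measurable_ball (r : ℕ) : Measurable (ball r) := by
  refine measurable_generateFrom ?_
  rintro _ ⟨q, m, R, p, A, hA, rfl⟩
  have : ball r ⁻¹' localEvent q m R p A = localEvent (min r q) m R p A := by
    ext T
    exact mem_localEvent_iff_of_iso_ball (T.ball_ball_iso r q)
  rw [this]
  exact measurableSet_localEvent hA

/-- Measurable sets do not separate isomorphic trees, so almost sure isomorphism is as good as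
almost sure equality for laws. -/
theorem map_congr_iso {Ω : Type*} [MeasurableSpace Ω] {μ : Measure Ω} {f g : Ω → WTree}
    (hf : Measurable f) (hg : Measurable g) (h : ∀ᵐ ω ∂μ, (f ω).Iso (g ω)) : μ.map f = μ.map g := by
  ext E hE
  rw [Measure.map_apply hf hE, Measure.map_apply hg hE]
  refine measure_congr ?_
  filter_upwards [h] with ω hω
  exact propext (hω.mem_iff hE)

/-- A probability measure is determined by the laws of the balls. -/
theorem ext_of_map_ball {μ μ' : Measure WTree} [IsProbabilityMeasure μ] [IsProbabilityMeasure μ']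
    (h : ∀ k, μ.map (ball (k + 1)) = μ'.map (ball (k + 1))) : μ = μ' := by
  have hball : ∀ {q r : ℕ} {E : Set WTree}, MeasurableSet E → q ≤ r → ball r ⁻¹' (ball q ⁻¹' E) = ball q ⁻¹' E := by
    intro q r E hE hqr
    ext T
    have := T.ball_ball_iso r q
    rw [min_eq_right hqr] at this
    exact this.mem_iff hE
  -- The events that depend on some ball form a generating π-system: two of them depend jointly on
  -- the larger ball.
  let C : Set (Set WTree) := {D | ∃ k E, MeasurableSet E ∧ D = ball (k + 1) ⁻¹' E}
  refine ext_of_generate_finite C (le_antisymm ?_ ?_) ?_ ?_ (by simp)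
  · refine MeasurableSpace.generateFrom_le ?_
    rintro _ ⟨r, m, R, p, A, hA, rfl⟩
    refine MeasurableSpace.measurableSet_generateFrom ⟨r, localEvent r m R p A, measurableSet_localEvent hA, ?_⟩
    ext T
    refine (mem_localEvent_iff_of_iso_ball ?_).symm
    have := T.ball_ball_iso (r + 1) r
    rwa [min_eq_right (Nat.le_succ r)] at this
  · refine MeasurableSpace.generateFrom_le ?_
    rintro _ ⟨k, E, hE, rfl⟩
    exact hE.preimage (measurable_ball _)
  · rintro _ ⟨k, E, hE, rfl⟩ _ ⟨l, F, hF, rfl⟩ -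
    refine ⟨max k l, ball (k + 1) ⁻¹' E ∩ ball (l + 1) ⁻¹' F,
      (hE.preimage (measurable_ball _)).inter (hF.preimage (measurable_ball _)), ?_⟩
    rw [Set.preimage_inter, hball hE (by omega), hball hF (by omega)]
  · rintro _ ⟨k, E, hE, rfl⟩
    rw [← Measure.map_apply (measurable_ball _) hE, ← Measure.map_apply (measurable_ball _) hE, h]

end WTree

/-! ### Backbone and reachability by finitely many steps -/

namespace WTree

variable {T : WTree}

/-- There is a path of length `n` that leads away from the root and starts at `v`. -/
def HasDesc (T : WTree) : ℕ → T.V → Prop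
  | 0, _ => True
  | n + 1, v => ∃ w, T.par v w ∧ HasDesc T n w

theorem HasDesc.mono {m n : ℕ} (hmn : m ≤ n) {v : T.V} (h : T.HasDesc n v) : T.HasDesc m v := by
  induction m generalizing n v with
  | zero => trivial
  | succ m ih =>
    obtain ⟨n, rfl⟩ : ∃ k, n = k + 1 := ⟨n - 1, by omega⟩
    obtain ⟨w, h1, h2⟩ := h
    exact ⟨w, h1, ih (by omega) h2⟩

/-- König's lemma. It replaces the quantifier over infinite paths by a countable intersection, which
makes the backbone measurable. -/
theorem mem_backbone_iff {v : T.V} : v ∈ T.backbone ↔ ∀ n, T.HasDesc n v := by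
  constructor
  · rintro ⟨x, rfl, hx⟩ n
    induction n generalizing x with
    | zero => trivial
    | succ n ih => exact ⟨x 1, hx 0, ih (fun n => x (n + 1)) fun n => hx (n + 1)⟩
  · intro h
    have hc : ∀ v : {v : T.V // ∀ n, T.HasDesc n v}, ∃ w : {v : T.V // ∀ n, T.HasDesc n v}, T.par v.1 w.1 := by
      rintro ⟨v, hv⟩
      by_contra! hne
      have hfin : {w | T.par v w}.Finite := (T.locallyFinite v).subset fun w hw => T.graph_adj.2 (Or.inl hw)
      have : ∀ w, ∃ n, T.par v w → ¬ T.HasDesc n w := by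
        intro w
        by_cases hw : T.par v w
        · by_contra! h'
          exact hne ⟨w, fun n => (h' n).2⟩ hw
        · exact ⟨0, fun h => absurd h hw⟩
      choose f hf using this
      -- Only finitely many children have to be considered, so their heights have a common bound
      -- `N`; then `v` could not have a descendant `N + 1` generations below.
      obtain ⟨N, hN⟩ := (hfin.image f).bddAbove
      obtain ⟨w, hw, hw'⟩ := hv (N + 1)
      exact hf w hw (hw'.mono (hN ⟨w, hw, rfl⟩))
    choose g hg using hc
    refine ⟨fun n => (g^[n] ⟨v, h⟩).1, rfl, fun n => ?_⟩
    simp only [Function.iterate_succ_apply']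
    exact hg _

/-- There is a walk of length `n` from the marked vertex to `v`, all of whose vertices, except
possibly the marked one, lie in `s`. -/
def StepReach (T : WTree) (s : Set T.V) : ℕ → T.V → Prop
  | 0, v => v = T.pt
  | n + 1, v => ∃ w, StepReach T s n w ∧ T.graph.Adj w v ∧ v ∈ s

theorem mem_reach_iff {s : Set T.V} {v : T.V} : v ∈ T.reach s ↔ ∃ n, T.StepReach s n v := by
  constructor
  · intro hv
    induction hv using reach_induction with
    | h0 => exact ⟨0, rfl⟩
    | h1 v w _ h hw ih =>
      obtain ⟨n, hn⟩ := ih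
      exact ⟨n + 1, v, hn, h, hw⟩
  · rintro ⟨n, hn⟩
    induction n generalizing v with
    | zero => rw [show v = T.pt from hn]; exact T.pt_mem_reach s
    | succ n ih =>
      obtain ⟨w, h1, h2, h3⟩ := hn
      exact reach_step (ih h1) h2 h3

theorem dist_le_iff {r : ℕ} {v : T.V} :
    T.graph.dist T.pt v ≤ r ↔ ∃ n ≤ r, T.StepReach Set.univ n v := by
  constructor
  · intro h
    have key : ∀ (x y : T.V) (q : T.graph.Walk x y), y = T.pt → T.StepReach Set.univ q.length x := by
      intro x y q
      induction q with
      | nil => exact fun h => h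
      | cons hadj q ih => exact fun h => ⟨_, ih h, hadj.symm, trivial⟩
    obtain ⟨q, hq⟩ := (T.graph_connected v T.pt).exists_walk_length_eq_dist
    refine ⟨q.length, ?_, key _ _ q rfl⟩
    rwa [hq, SimpleGraph.dist_comm]
  · rintro ⟨n, hn, h⟩
    refine le_trans ?_ hn
    clear hn
    induction n generalizing v with
    | zero => rw [show v = T.pt from h]; simp
    | succ n ih =>
      obtain ⟨w, h1, h2, -⟩ := h
      have := T.graph_connected.dist_triangle (u := T.pt) (v := w) (w := v)
      have h3 := SimpleGraph.dist_eq_one_iff_adj.2 h2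
      have := ih h1
      omega

theorem finite_dist_le (T : WTree) (r : ℕ) : {v | T.graph.dist T.pt v ≤ r}.Finite := by
  have h : ∀ n, {v | T.StepReach Set.univ n v}.Finite := by
    intro n
    induction n with
    | zero => exact Set.finite_singleton T.pt
    | succ n ih =>
      refine (ih.biUnion fun w _ => T.locallyFinite w).subset ?_
      rintro v ⟨w, h1, h2, -⟩
      exact Set.mem_biUnion h1 h2
  refine ((Set.finite_le_nat r).biUnion fun n _ => h n).subset fun v hv => ?_
  obtain ⟨n, hn, h'⟩ := dist_le_iff.1 hv
  exact Set.mem_biUnion (show n ∈ {n | n ≤ r} from hn) h'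

instance finite_ball (T : WTree) (r : ℕ) : Finite (T.ball r).V := by
  refine ((T.finite_dist_le r).subset (t := T.reach {v | T.graph.dist T.pt v ≤ r}) fun v hv => ?_).to_subtype
  rcases mem_of_mem_reach hv with rfl | h
  · simp
  · exact h

/-! ### Measurable families of weighted trees -/

/-- The vertices of the trees are identified with elements of `α`, in such a way that the trees depend
measurably on the parameter. -/
structure IsPresentation {Ω α : Type*} [MeasurableSpace Ω] (T : Ω → WTree) (ι : ∀ ω, (T ω).V → α) :
    Prop where
  injective : ∀ ω, Function.Injective (ι ω)
  measurableSet_par : ∀ a b B, MeasurableSet B → MeasurableSet {ω | ∃ v w, ι ω v = a ∧ ι ω w = b ∧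
    (T ω).par v w ∧ (T ω).bias v w ∈ B}
  measurableSet_pt : ∀ a, MeasurableSet {ω | ι ω (T ω).pt = a}
  measurableSet_mem : ∀ a, MeasurableSet {ω | ∃ v, ι ω v = a}

namespace IsPresentation

variable {Ω α : Type*} [MeasurableSpace Ω] {T : Ω → WTree} {ι : ∀ ω, (T ω).V → α}

/-- The set `s ω` depends measurably on `ω`. -/
def MeasSet (ι : ∀ ω, (T ω).V → α) (s : ∀ ω, Set (T ω).V) : Prop :=
  ∀ a, MeasurableSet {ω | ∃ v, ι ω v = a ∧ v ∈ s ω}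

theorem measSet_inter (h : IsPresentation T ι) {s t : ∀ ω, Set (T ω).V} (hs : MeasSet ι s)
    (ht : MeasSet ι t) : MeasSet ι fun ω => s ω ∩ t ω := by
  intro a
  convert (hs a).inter (ht a) using 1
  ext ω
  constructor
  · rintro ⟨v, h1, h2, h3⟩
    exact ⟨⟨v, h1, h2⟩, v, h1, h3⟩
  · rintro ⟨⟨v, h1, h2⟩, w, h3, h4⟩
    obtain rfl := h.injective ω (h1.trans h3.symm)
    exact ⟨v, h1, h2, h4⟩

theorem measurableSet_adj (h : IsPresentation T ι) (a b : α) : MeasurableSet {ω | ∃ v w, ι ω v = a ∧ ι ω w = b ∧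
    (T ω).graph.Adj v w} := by
  convert (h.measurableSet_par a b Set.univ MeasurableSet.univ).union
    (h.measurableSet_par b a Set.univ MeasurableSet.univ) using 1
  ext ω
  simp only [Set.mem_ofPred_eq, Set.mem_union, graph_adj, Set.mem_univ, and_true]
  constructor
  · rintro ⟨v, w, h1, h2, h3 | h3⟩
    · exact Or.inl ⟨v, w, h1, h2, h3⟩
    · exact Or.inr ⟨w, v, h2, h1, h3⟩
  · rintro (⟨v, w, h1, h2, h3⟩ | ⟨w, v, h2, h1, h3⟩)
    · exact ⟨v, w, h1, h2, Or.inl h3⟩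
    · exact ⟨v, w, h1, h2, Or.inr h3⟩

variable [Countable α]

theorem measSet_stepReach (h : IsPresentation T ι) {s : ∀ ω, Set (T ω).V} (hs : MeasSet ι s) (n : ℕ) :
    MeasSet ι fun ω => {v | (T ω).StepReach (s ω) n v} := by
  induction n with
  | zero =>
    intro a
    convert h.measurableSet_pt a using 1
    ext ω
    constructor
    · rintro ⟨v, h1, h2⟩
      obtain rfl : v = (T ω).pt := h2
      exact h1
    · exact fun h1 => ⟨_, h1, rfl⟩
  | succ n ih =>
    intro a
    convert MeasurableSet.iUnion fun b => (ih b).inter ((h.measurableSet_adj b a).inter (hs a)) using 1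
    ext ω
    simp only [Set.mem_iUnion]
    constructor
    · rintro ⟨v, h1, w, h2, h3, h4⟩
      exact ⟨_, ⟨w, rfl, h2⟩, ⟨w, v, rfl, h1, h3⟩, v, h1, h4⟩
    · rintro ⟨b, ⟨w, h1, h2⟩, ⟨w', v, h3, h4, h5⟩, v', h6, h7⟩
      obtain rfl := h.injective ω (h1.trans h3.symm)
      obtain rfl := h.injective ω (h4.trans h6.symm)
      exact ⟨v, h4, w, h2, h5, h7⟩

theorem measSet_reach (h : IsPresentation T ι) {s : ∀ ω, Set (T ω).V} (hs : MeasSet ι s) :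
    MeasSet ι fun ω => (T ω).reach (s ω) := by
  intro a
  convert MeasurableSet.iUnion fun n => h.measSet_stepReach hs n a using 1
  ext ω
  simp only [mem_reach_iff, Set.mem_iUnion, Set.mem_ofPred_eq]
  constructor
  · rintro ⟨v, h1, n, h2⟩
    exact ⟨n, v, h1, h2⟩
  · rintro ⟨n, v, h1, h2⟩
    exact ⟨v, h1, n, h2⟩

theorem measSet_dist_le (h : IsPresentation T ι) (r : ℕ) :
    MeasSet ι fun ω => {v | (T ω).graph.dist (T ω).pt v ≤ r} := by
  have hu : MeasSet ι fun ω => (Set.univ : Set (T ω).V) := fun a => by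
    simpa using h.measurableSet_mem a
  intro a
  convert MeasurableSet.biUnion (Set.to_countable {n | n ≤ r}) fun n _ => h.measSet_stepReach hu n a using 1
  ext ω
  simp only [dist_le_iff, Set.mem_iUnion, Set.mem_ofPred_eq]
  constructor
  · rintro ⟨v, h1, n, h2, h3⟩
    exact ⟨n, h2, v, h1, h3⟩
  · rintro ⟨n, h2, v, h1, h3⟩
    exact ⟨v, h1, n, h2, h3⟩

theorem measSet_backbone (h : IsPresentation T ι) : MeasSet ι fun ω => (T ω).backbone := by
  have hd : ∀ n, MeasSet ι fun ω => {v | (T ω).HasDesc n v} := by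
    intro n
    induction n with
    | zero =>
      intro a
      simpa [HasDesc] using h.measurableSet_mem a
    | succ n ih =>
      intro a
      convert MeasurableSet.iUnion fun b =>
        (h.measurableSet_par a b Set.univ MeasurableSet.univ).inter (ih b) using 1
      ext ω
      simp only [Set.mem_iUnion]
      constructor
      · rintro ⟨v, h1, w, h2, h3⟩
        exact ⟨_, ⟨v, w, h1, rfl, h2, trivial⟩, w, rfl, h3⟩
      · rintro ⟨b, ⟨v, w, h1, h2, h3, -⟩, w', h4, h5⟩
        obtain rfl := h.injective ω (h2.trans h4.symm)
        exact ⟨v, h1, w, h3, h5⟩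
  intro a
  convert (h.measurableSet_mem a).inter (MeasurableSet.iInter fun n => hd n a) using 1
  ext ω
  simp only [mem_backbone_iff, Set.mem_inter_iff, Set.mem_iInter, Set.mem_ofPred_eq]
  constructor
  · rintro ⟨v, h1, h2⟩
    exact ⟨⟨v, h1⟩, fun n => ⟨v, h1, h2 n⟩⟩
  · rintro ⟨⟨v, h1⟩, h2⟩
    refine ⟨v, h1, fun n => ?_⟩
    obtain ⟨w, h3, h4⟩ := h2 n
    obtain rfl := h.injective ω (h1.trans h3.symm)
    exact h4

theorem sub (h : IsPresentation T ι) {s : ∀ ω, Set (T ω).V} (hs : MeasSet ι s) :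
    IsPresentation (fun ω => (T ω).sub (s ω)) fun ω v => ι ω v.1 where
  injective ω := (h.injective ω).comp Subtype.val_injective
  measurableSet_par a b B hB := by
    convert (h.measurableSet_par a b B hB).inter ((h.measSet_reach hs a).inter (h.measSet_reach hs b)) using 1
    ext ω
    constructor
    · rintro ⟨v, w, h1, h2, h3, h4⟩
      exact ⟨⟨v.1, w.1, h1, h2, h3, h4⟩, ⟨v.1, h1, v.2⟩, w.1, h2, w.2⟩
    · rintro ⟨⟨v, w, h1, h2, h3, h4⟩, ⟨v', h5, h6⟩, w', h7, h8⟩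
      obtain rfl := h.injective ω (h1.trans h5.symm)
      obtain rfl := h.injective ω (h2.trans h7.symm)
      exact ⟨⟨v, h6⟩, ⟨w, h8⟩, h1, h2, h3, h4⟩
  measurableSet_pt a := h.measurableSet_pt a
  measurableSet_mem a := by
    convert h.measSet_reach hs a using 1
    ext ω
    constructor
    · rintro ⟨v, h1⟩
      exact ⟨v.1, h1, v.2⟩
    · rintro ⟨v, h1, h2⟩
      exact ⟨⟨v, h2⟩, h1⟩

/-- Through `ι`, an isomorphism with a tree on `Fin m` becomes an injection `Fin m → α`. There are
countably many of these, and for each of them the conditions are countable intersections of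
measurable events. -/
theorem measurable_aux (h : IsPresentation T ι) (m : ℕ) (R : Fin m → Fin m → Prop) (p : Fin m)
    (A : Fin m → Fin m → Set ℝ) (hA : ∀ i j, MeasurableSet (A i j)) :
    MeasurableSet {ω | ∃ e : Fin m ≃ (T ω).V, e p = (T ω).pt ∧
      (∀ i j, R i j ↔ (T ω).par (e i) (e j)) ∧ ∀ i j, R i j → (T ω).bias (e i) (e j) ∈ A i j} := by
  have key : {ω | ∃ e : Fin m ≃ (T ω).V, e p = (T ω).pt ∧
      (∀ i j, R i j ↔ (T ω).par (e i) (e j)) ∧ ∀ i j, R i j → (T ω).bias (e i) (e j) ∈ A i j} =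
      ⋃ x : {x : Fin m → α // Function.Injective x},
        (⋂ a : α, {ω | (∃ v, ι ω v = a) ↔ ∃ i, x.1 i = a}) ∩ ({ω | ι ω (T ω).pt = x.1 p} ∩
        ((⋂ i, ⋂ j, {ω | R i j ↔ ∃ v w, ι ω v = x.1 i ∧ ι ω w = x.1 j ∧ (T ω).par v w ∧
          (T ω).bias v w ∈ Set.univ}) ∩
        ⋂ i, ⋂ j, {ω | R i j → ∃ v w, ι ω v = x.1 i ∧ ι ω w = x.1 j ∧ (T ω).par v w ∧
          (T ω).bias v w ∈ A i j})) := by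
    ext ω
    simp only [Set.mem_iUnion, Set.mem_inter_iff, Set.mem_iInter, Set.mem_ofPred_eq, Set.mem_univ, and_true]
    constructor
    · rintro ⟨e, h1, h2, h3⟩
      refine ⟨⟨fun i => ι ω (e i), (h.injective ω).comp e.injective⟩, fun a => ?_, congrArg _ h1.symm,
        fun i j => ?_, fun i j hij => ⟨_, _, rfl, rfl, (h2 i j).1 hij, h3 i j hij⟩⟩
      · constructor
        · rintro ⟨v, rfl⟩
          exact ⟨e.symm v, by simp⟩
        · rintro ⟨i, rfl⟩
          exact ⟨_, rfl⟩
      · rw [h2]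
        constructor
        · exact fun hij => ⟨_, _, rfl, rfl, hij⟩
        · rintro ⟨v, w, h4, h5, h6⟩
          rwa [h.injective ω h4, h.injective ω h5] at h6
    · rintro ⟨⟨x, hx⟩, h1, h2, h3, h4⟩
      have : ∀ i, ∃ v, ι ω v = x i := fun i => (h1 (x i)).2 ⟨i, rfl⟩
      choose f hf using this
      have hb : Function.Bijective f := by
        refine ⟨fun i j hij => hx (by rw [← hf i, ← hf j, hij]), fun v => ?_⟩
        obtain ⟨i, hi⟩ := (h1 (ι ω v)).1 ⟨v, rfl⟩
        exact ⟨i, h.injective ω ((hf i).trans hi)⟩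
      refine ⟨Equiv.ofBijective f hb, h.injective ω ((hf p).trans h2.symm), fun i j => ?_, fun i j hij => ?_⟩
      · rw [h3]
        constructor
        · rintro ⟨v, w, h5, h6, h7⟩
          rwa [h.injective ω (h5.trans (hf i).symm), h.injective ω (h6.trans (hf j).symm)] at h7
        · exact fun h7 => ⟨_, _, hf i, hf j, h7⟩
      · obtain ⟨v, w, h5, h6, -, h7⟩ := h4 i j hij
        rwa [h.injective ω (h5.trans (hf i).symm), h.injective ω (h6.trans (hf j).symm)] at h7
  rw [key]
  refine MeasurableSet.iUnion fun x => ?_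
  refine (MeasurableSet.iInter fun a => ?_).inter ((h.measurableSet_pt _).inter
    ((MeasurableSet.iInter fun i => MeasurableSet.iInter fun j => ?_).inter
    (MeasurableSet.iInter fun i => MeasurableSet.iInter fun j => ?_)))
  · exact (h.measurableSet_mem a).iff (MeasurableSet.const _)
  · exact (MeasurableSet.const _).iff (h.measurableSet_par _ _ _ MeasurableSet.univ)
  · exact (MeasurableSet.const _).imp (h.measurableSet_par _ _ _ (hA i j))

theorem measurable (h : IsPresentation T ι) : Measurable T := by
  refine measurable_generateFrom ?_
  rintro _ ⟨r, m, R, p, A, hA, rfl⟩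
  exact (h.sub (h.measSet_dist_le r)).measurable_aux m R p A hA

theorem measurable_outNbhd (h : IsPresentation T ι) (k : ℕ) : Measurable fun ω => (T ω).outNbhd k :=
  (h.sub (h.measSet_inter h.measSet_backbone (h.measSet_dist_le (k + 1)))).measurable

theorem measurable_sub_backbone (h : IsPresentation T ι) :
    Measurable fun ω => (T ω).sub (T ω).backbone := (h.sub h.measSet_backbone).measurable

end IsPresentation

end WTree

/-! ### Almost sure properties of random trees that are read off from balls -/

namespace WTree

variable {S T : WTree}

/-- Isomorphism of the underlying trees, without the biases. -/
def ShapeIso (S T : WTree) : Prop :=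
  ∃ e : S.V ≃ T.V, e S.pt = T.pt ∧ ∀ v w, S.par v w ↔ T.par (e v) (e w)

theorem Iso.shapeIso (h : S.Iso T) : S.ShapeIso T := by
  obtain ⟨e, h1, h2, -⟩ := h
  exact ⟨e, h1, h2⟩

theorem ShapeIso.symm (h : S.ShapeIso T) : T.ShapeIso S := by
  obtain ⟨e, h1, h2⟩ := h
  exact ⟨e.symm, by rw [← h1, e.symm_apply_apply], fun v w => by simp [h2]⟩

theorem ShapeIso.trans {U : WTree} (h : S.ShapeIso T) (h' : T.ShapeIso U) : S.ShapeIso U := by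
  obtain ⟨e, h1, h2⟩ := h
  obtain ⟨e', h1', h2'⟩ := h'
  exact ⟨e.trans e', by simp [h1, h1'], fun v w => by simp [h2, h2']⟩

theorem ShapeIso.exists_equiv (h : S.ShapeIso T) : ∃ e : S.V ≃ T.V, e S.pt = T.pt ∧
    (∀ v w, S.par v w ↔ T.par (e v) (e w)) ∧ (∀ v w, S.graph.Adj v w ↔ T.graph.Adj (e v) (e w)) ∧
    ∀ v, T.graph.dist T.pt (e v) = S.graph.dist S.pt v := by
  obtain ⟨e, h1, h2⟩ := h
  have h3 : ∀ v w, S.graph.Adj v w ↔ T.graph.Adj (e v) (e w) := fun v w => by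
    rw [graph_adj, graph_adj, h2, h2]
  exact ⟨e, h1, h2, h3, fun v => by rw [← h1, dist_of_injective e.injective fun v w => (h3 v w).1]⟩

theorem Iso.biasesIn (h : S.Iso T) {I : Set ℝ} (hS : S.BiasesIn I) : T.BiasesIn I := by
  obtain ⟨e, h1, h2, h3⟩ := h.symm
  intro w v hwv
  rw [h3 w v hwv]
  exact hS _ _ ((h2 w v).1 hwv)

theorem BiasesIn.sub {I : Set ℝ} (h : T.BiasesIn I) (s : Set T.V) : (T.sub s).BiasesIn I :=
  fun w v hwv => h w.1 v.1 hwv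

/-- A ball is finite, and there are only countably many finite shapes. Hence every property of the
shape, however complicated its definition, is a countable union of local events. -/
theorem measurableSet_shape (r : ℕ) {C : WTree → Prop} (hC : ∀ S T, S.ShapeIso T → C S → C T)
    {B : Set ℝ} (hB : MeasurableSet B) : MeasurableSet {T : WTree | C (T.ball r) ∧ (T.ball r).BiasesIn B} := by
  have key : {T : WTree | C (T.ball r) ∧ (T.ball r).BiasesIn B} =
      ⋃ m : ℕ, ⋃ R : Fin m → Fin m → Prop, ⋃ p : Fin m,
        {T : WTree | (∃ S, C S ∧ ∃ e : Fin m ≃ S.V, e p = S.pt ∧ ∀ i j, R i j ↔ S.par (e i) (e j)) ∧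
          T ∈ localEvent r m R p fun _ _ => B} := by
    ext T
    simp only [Set.mem_iUnion, Set.mem_ofPred_eq]
    constructor
    · rintro ⟨h1, h2⟩
      obtain ⟨m, ⟨e⟩⟩ := Finite.exists_equiv_fin (T.ball r).V
      refine ⟨m, fun i j => (T.ball r).par (e.symm i) (e.symm j), e (T.ball r).pt, ⟨_, h1, e.symm, by simp,
        fun _ _ => Iff.rfl⟩, e.symm, by simp, fun _ _ => Iff.rfl, fun i j hij => h2 _ _ hij⟩
    · rintro ⟨m, R, p, ⟨S, hS, e, h1, h2⟩, e', h3, h4, h5⟩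
      refine ⟨hC S _ ⟨e.symm.trans e', ?_, fun v w => ?_⟩ hS, fun w v hwv => ?_⟩
      · simp [← h1, h3]
      · rw [Equiv.trans_apply, Equiv.trans_apply, ← h4, h2]
        simp
      · have := h5 (e'.symm w) (e'.symm v) (by rw [h4]; simpa using hwv)
        simpa using this
  rw [key]
  refine MeasurableSet.iUnion fun m => MeasurableSet.iUnion fun R => MeasurableSet.iUnion fun p => ?_
  exact (MeasurableSet.const _).inter (measurableSet_localEvent fun _ _ => hB)

/-- If the ball does not reach its bounding sphere, it is closed under taking neighbours, and
connectedness makes it everything. -/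
theorem reach_ball_eq_univ {r : ℕ} (h : ∀ v : (T.ball r).V, T.graph.dist T.pt v.1 < r) (v : T.V) :
    v ∈ T.reach {v | T.graph.dist T.pt v ≤ r} := by
  have key : ∀ (x y : T.V) (q : T.graph.Walk x y), y = T.pt → x ∈ T.reach {v | T.graph.dist T.pt v ≤ r} := by
    intro x y q
    induction q with
    | nil => rintro rfl; exact T.pt_mem_reach _
    | cons hadj q ih =>
      intro hy
      have h1 := ih hy
      refine reach_step h1 hadj.symm ?_
      have h2 := h ⟨_, h1⟩
      have h3 := SimpleGraph.dist_eq_one_iff_adj.2 hadj.symm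
      rename_i a b c
      have := T.graph_connected.dist_triangle (u := T.pt) (v := b) (w := a)
      simp only [Set.mem_ofPred_eq]
      simp only at h2
      omega
  obtain ⟨q⟩ := T.graph_connected v T.pt
  exact key _ _ q rfl

theorem iso_ball {r : ℕ} (h : ∀ v : (T.ball r).V, T.graph.dist T.pt v.1 < r) : (T.ball r).Iso T := by
  refine ⟨Equiv.ofBijective Subtype.val ⟨Subtype.val_injective, fun v => ⟨⟨v, reach_ball_eq_univ h v⟩, rfl⟩⟩,
    rfl, fun _ _ => Iff.rfl, fun _ _ _ => rfl⟩

theorem dist_outNbhd_le (k : ℕ) (v : (T.outNbhd k).V) : T.graph.dist T.pt v.1 ≤ k + 1 := by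
  rcases mem_of_mem_reach v.2 with h | h
  · rw [h]; simp
  · exact h.2

/-- The trees that have the shape of a backbone neighbourhood of a trap entrance. -/
def PsiShape (k : ℕ) (G : WTree) : Prop :=
  ∃ T : WTree, T.IsEndDistinguished ∧ T.pt ∈ T.exteriorBoundary ∧ G.ShapeIso (T.outNbhd k)

open Classical in
/-- The tree `T` in which the biases of the edges in the image of `f` are replaced. -/
noncomputable def rebias (T G : WTree) (s : Set T.V) (f : (T.sub s).V → G.V) (x : ℝ) : WTree where
  V := T.V
  par := T.par
  bias w v := if h : w ∈ T.reach s ∧ v ∈ T.reach s ∧ T.par w v then G.bias (f ⟨w, h.1⟩) (f ⟨v, h.2.1⟩) else x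
  pt := T.pt
  par_unique := T.par_unique
  par_asymm := T.par_asymm
  isTree := T.isTree
  locallyFinite := T.locallyFinite

/-- Shape and biases can be prescribed separately: take a tree that realises the shape, overwrite
its biases on the neighbourhood by those of `G`, and fill in any element of `I` elsewhere. -/
theorem mem_psi_of_shape {I : Set ℝ} (hI : I.Nonempty) {k : ℕ} {G : WTree} (h1 : PsiShape k (G.ball (k + 2)))
    (h2 : (G.ball (k + 2)).BiasesIn I) : G ∈ Psi I k := by
  classical
  obtain ⟨x, hx⟩ := hI
  obtain ⟨T, hT, hpt, hsh⟩ := h1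
  obtain ⟨e, e1, e2, -, e4⟩ := hsh.symm.exists_equiv
  -- The shape has no vertex beyond distance `k + 1`, so the ball of radius `k + 2` is the whole of
  -- `G`.
  have hiso : (G.ball (k + 2)).Iso G := iso_ball fun v => by
    have h3 := e4 (e.symm v)
    rw [e.apply_symm_apply] at h3
    have h4 : G.graph.dist G.pt v.1 = (G.ball (k + 2)).graph.dist (G.ball (k + 2)).pt v :=
      (dist_sub G _ (G.ball (k + 2)).pt v).symm
    have h5 : (T.outNbhd k).graph.dist (T.outNbhd k).pt (e.symm v) = T.graph.dist T.pt (e.symm v).1 :=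
      dist_sub T _ (T.outNbhd k).pt (e.symm v)
    have := dist_outNbhd_le k (e.symm v)
    omega
  let s : Set T.V := {v | v ∈ T.backbone ∧ T.graph.dist T.pt v ≤ k + 1}
  let T' := T.rebias (G.ball (k + 2)) s e x
  refine ⟨T', hT, ?_, hpt, hiso.symm.trans (Iso.symm ⟨e, e1, e2, ?_⟩)⟩
  · intro w v hwv
    show (if h : w ∈ T.reach s ∧ v ∈ T.reach s ∧ T.par w v then
      (G.ball (k + 2)).bias (e ⟨w, h.1⟩) (e ⟨v, h.2.1⟩) else x) ∈ I
    split_ifs with h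
    · exact h2 _ _ ((e2 ⟨w, h.1⟩ ⟨v, h.2.1⟩).1 h.2.2)
    · exact hx
  · intro w v hwv
    have h : w.1 ∈ T.reach s ∧ v.1 ∈ T.reach s ∧ T.par w.1 v.1 := ⟨w.2, v.2, hwv⟩
    show (if h : w.1 ∈ T.reach s ∧ v.1 ∈ T.reach s ∧ T.par w.1 v.1 then
      (G.ball (k + 2)).bias (e ⟨w.1, h.1⟩) (e ⟨v.1, h.2.1⟩) else x) = _
    rw [dif_pos h]
    rfl

/-- A random backbone neighbourhood is almost surely in `Psi`. -/
theorem ae_mem_psi {Ω : Type*} [MeasurableSpace Ω] {μ : Measure Ω} {I : Set ℝ} (hI : I.Nonempty)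
    (hI' : MeasurableSet I) {k : ℕ} {T : Ω → WTree} (hT : Measurable fun ω => (T ω).outNbhd k)
    (h : ∀ᵐ ω ∂μ, (T ω).IsEndDistinguished ∧ (T ω).BiasesIn I ∧ (T ω).pt ∈ (T ω).exteriorBoundary) :
    ∀ᵐ G ∂μ.map fun ω => (T ω).outNbhd k, G ∈ Psi I k := by
  -- Membership in `Psi` is deduced from this event about shape and biases, which is measurable and
  -- can therefore be transferred to the image measure.
  have hm := measurableSet_shape (k + 2) (C := PsiShape k) (B := I)
    (fun S T h => fun ⟨U, h1, h2, h3⟩ => ⟨U, h1, h2, h.symm.trans h3⟩) hI'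
  have : ∀ᵐ G ∂μ.map fun ω => (T ω).outNbhd k, PsiShape k (G.ball (k + 2)) ∧ (G.ball (k + 2)).BiasesIn I := by
    rw [ae_map_iff hT.aemeasurable hm]
    filter_upwards [h] with ω hω
    have hiso : (((T ω).outNbhd k).ball (k + 2)).Iso ((T ω).outNbhd k) := iso_ball fun v => by
      have h5 : ((T ω).outNbhd k).graph.dist ((T ω).outNbhd k).pt v.1 = (T ω).graph.dist (T ω).pt v.1.1 :=
        dist_sub (T ω) _ ((T ω).outNbhd k).pt v.1
      have := dist_outNbhd_le k v.1
      omega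
    exact ⟨⟨T ω, hω.1, hω.2.2, hiso.shapeIso⟩, hiso.symm.biasesIn (hω.2.1.sub _)⟩
  filter_upwards [this] with G hG
  exact mem_psi_of_shape hI hG.1 hG.2

/-- The properties of the `r`-ball of an infinite end-distinguished tree whose only leaf is the marked
vertex. -/
def LimitShape (r : ℕ) (S : WTree) : Prop :=
  (∃ v, r ≤ S.graph.dist S.pt v) ∧ (∀ v, S.graph.dist S.pt v < r → ∃ w, S.par w v) ∧
    ∀ v, S.graph.dist S.pt v < r → (S.IsLeaf v ↔ v = S.pt)

theorem LimitShape.of_shapeIso {r : ℕ} (h : S.ShapeIso T) (hS : S.LimitShape r) : T.LimitShape r := by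
  obtain ⟨e, e1, e2, e3, e4⟩ := h.exists_equiv
  obtain ⟨⟨v, hv⟩, h2, h3⟩ := hS
  refine ⟨⟨e v, by rwa [e4]⟩, fun w hw => ?_, fun w hw => ?_⟩
  · obtain ⟨v, rfl⟩ := e.surjective w
    rw [e4] at hw
    obtain ⟨u, hu⟩ := h2 v hw
    exact ⟨e u, (e2 _ _).1 hu⟩
  · obtain ⟨v, rfl⟩ := e.surjective w
    rw [e4] at hw
    rw [← e1, e.injective.eq_iff, ← h3 v hw]
    constructor
    · rintro ⟨u, hu, hu'⟩
      obtain ⟨u, rfl⟩ := e.surjective u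
      exact ⟨u, (e3 _ _).2 hu, fun y hy => e.injective (hu' _ ((e3 _ _).1 hy))⟩
    · rintro ⟨u, hu, hu'⟩
      refine ⟨e u, (e3 _ _).1 hu, fun y hy => ?_⟩
      obtain ⟨y, rfl⟩ := e.surjective y
      rw [hu' y ((e3 _ _).2 hy)]

/-- The distances from the marked vertex in a ball. -/
theorem mem_reach_ball_of_adj {r : ℕ} {v : T.V} (hv : v ∈ T.reach {v | T.graph.dist T.pt v ≤ r})
    (hlt : T.graph.dist T.pt v < r) {w : T.V} (h : T.graph.Adj v w) :
    w ∈ T.reach {v | T.graph.dist T.pt v ≤ r} := by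
  refine reach_step hv h ?_
  have h3 := SimpleGraph.dist_eq_one_iff_adj.2 h
  have := T.graph_connected.dist_triangle (u := T.pt) (v := v) (w := w)
  simp only [Set.mem_ofPred_eq]
  omega

theorem mem_reach_ball (T : WTree) {r : ℕ} {v : T.V} (hv : T.graph.dist T.pt v ≤ r) :
    v ∈ T.reach {v | T.graph.dist T.pt v ≤ r} := by
  obtain ⟨n, hn, h⟩ := dist_le_iff.1 hv
  clear hv
  have key : ∀ n v, T.StepReach Set.univ n v → n ≤ r → v ∈ T.reach {v | T.graph.dist T.pt v ≤ r} := by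
    intro n
    induction n with
    | zero => intro v h _; rw [show v = T.pt from h]; exact T.pt_mem_reach _
    | succ n ih =>
      intro v h hn
      have h' := h
      obtain ⟨w, h1, h2, -⟩ := h
      exact reach_step (ih w h1 (by omega)) h2 (dist_le_iff.2 ⟨n + 1, hn, h'⟩)
  exact key n v h hn

/-- The conditions concern vertices at distance less than `r` only, and all neighbours of these
belong to the ball. -/
theorem limitShape_ball_iff (T : WTree) (r : ℕ) : (T.ball r).LimitShape r ↔ T.LimitShape r := by
  have hd : ∀ v : (T.ball r).V, (T.ball r).graph.dist (T.ball r).pt v = T.graph.dist T.pt v.1 :=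
    fun v => dist_sub T _ (T.ball r).pt v
  have hleaf : ∀ v : (T.ball r).V, T.graph.dist T.pt v.1 < r → ((T.ball r).IsLeaf v ↔ T.IsLeaf v.1) := by
    intro v hv
    constructor
    · rintro ⟨u, hu, hu'⟩
      refine ⟨u.1, (T.sub_adj _).1 hu, fun y hy => ?_⟩
      exact congrArg Subtype.val (hu' ⟨y, mem_reach_ball_of_adj v.2 hv hy⟩ ((T.sub_adj _).2 hy))
    · rintro ⟨u, hu, hu'⟩
      refine ⟨⟨u, mem_reach_ball_of_adj v.2 hv hu⟩, (T.sub_adj _).2 hu, fun y hy => Subtype.ext ?_⟩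
      exact hu' _ ((T.sub_adj _).1 hy)
  have hpt : ∀ v : (T.ball r).V, v = (T.ball r).pt ↔ v.1 = T.pt := fun v => Subtype.ext_iff
  constructor
  · rintro ⟨⟨v, hv⟩, h2, h3⟩
    refine ⟨⟨v.1, by rwa [← hd]⟩, fun w hw => ?_, fun w hw => ?_⟩
    · obtain ⟨w, rfl⟩ : ∃ w' : (T.ball r).V, w'.1 = w := ⟨⟨w, T.mem_reach_ball hw.le⟩, rfl⟩
      obtain ⟨u, hu⟩ := h2 w (by rwa [hd])
      exact ⟨u.1, hu⟩
    · obtain ⟨w, rfl⟩ : ∃ w' : (T.ball r).V, w'.1 = w := ⟨⟨w, T.mem_reach_ball hw.le⟩, rfl⟩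
      rw [← hleaf w hw, h3 _ (by rwa [hd]), hpt]
  · rintro ⟨⟨v, hv⟩, h2, h3⟩
    refine ⟨?_, fun w hw => ?_, fun w hw => ?_⟩
    · by_contra! hne
      have := fun v : (T.ball r).V => hd v ▸ hne v
      exact absurd (this ⟨v, reach_ball_eq_univ this v⟩) (by simpa using hv)
    · rw [hd] at hw
      obtain ⟨u, hu⟩ := h2 w.1 hw
      exact ⟨⟨u, mem_reach_ball_of_adj w.2 hw (T.graph_adj.2 (Or.inr hu))⟩, hu⟩
    · rw [hd] at hw
      rw [hleaf w hw, h3 _ hw, hpt]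

theorem infinite_of_dist (h : ∀ r : ℕ, ∃ v, r ≤ T.graph.dist T.pt v) : Infinite T.V := by
  by_contra hf
  rw [not_infinite_iff_finite] at hf
  obtain ⟨N, hN⟩ := (Set.finite_range fun v => T.graph.dist T.pt v).bddAbove
  obtain ⟨v, hv⟩ := h (N + 1)
  have := hN ⟨v, rfl⟩
  simp only at this
  omega

theorem exists_le_dist [Infinite T.V] (r : ℕ) : ∃ v, r ≤ T.graph.dist T.pt v := by
  by_contra! h
  exact Set.infinite_univ ((T.finite_dist_le r).subset fun v _ => (h v).le)

/-- The global properties are countable intersections of properties of balls, which are measurable,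
so they pass from the random tree to its law. -/
theorem ae_limit {Ω : Type*} [MeasurableSpace Ω] {μ : Measure Ω} {I : Set ℝ} (hI : MeasurableSet I)
    {T : Ω → WTree} (hT : Measurable T)
    (h : ∀ᵐ ω ∂μ, (T ω).IsEndDistinguished ∧ (T ω).BiasesIn I ∧ ∀ v, (T ω).IsLeaf v ↔ v = (T ω).pt) :
    ∀ᵐ S ∂μ.map T, S.IsEndDistinguished ∧ S.BiasesIn I ∧ ∀ v, S.IsLeaf v ↔ v = S.pt := by
  have hr : ∀ r, ∀ᵐ S ∂μ.map T, S.LimitShape r ∧ (S.ball r).BiasesIn I := by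
    intro r
    have hm := measurableSet_shape r (C := LimitShape r) (B := I) (fun S T h => LimitShape.of_shapeIso h) hI
    simp only [limitShape_ball_iff] at hm
    rw [ae_map_iff hT.aemeasurable hm]
    filter_upwards [h] with ω hω
    have := hω.1.1
    exact ⟨⟨exists_le_dist r, fun v _ => (hω.1.2 v).exists, fun v _ => hω.2.2 v⟩, hω.2.1.sub _⟩
  filter_upwards [ae_all_iff.2 hr] with S hS
  refine ⟨⟨infinite_of_dist fun r => (hS r).1.1, fun v => ?_⟩, fun w v hwv => ?_, fun v => ?_⟩
  · obtain ⟨w, hw⟩ := (hS (S.graph.dist S.pt v + 1)).1.2.1 v (Nat.lt_succ_self _)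
    exact ⟨w, hw, fun y hy => S.par_unique _ _ _ hy hw⟩
  · have h1 := (hS (max (S.graph.dist S.pt v) (S.graph.dist S.pt w))).2
    exact h1 ⟨w, S.mem_reach_ball (le_max_right _ _)⟩ ⟨v, S.mem_reach_ball (le_max_left _ _)⟩ hwv
  · exact (hS (S.graph.dist S.pt v + 1)).1.2.2 v (Nat.lt_succ_self _)

end WTree

/-! ### The walk from an arbitrary vertex and its Markov property -/

namespace Env

/-- The law of the walk on the tree described by `x.1`, started at `x.2`. -/
noncomputable def walkFrom : Kernel (Env × Vertex) (ℕ → Vertex) :=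
  ((Kernel.traj (X := fun _ => Env × Vertex)
      (fun n => stepKernel.comap (fun x => x ⟨n, Finset.mem_Iic.2 le_rfl⟩) (by fun_prop)) 0).comap
    (fun x _ => x) (by fun_prop)).map (fun x n => (x n).2)

theorem measurable_path_snd :
    Measurable (fun (x : ℕ → Env × Vertex) n => (x n).2) := by fun_prop

instance : IsMarkovKernel walkFrom := by
  unfold walkFrom
  exact Kernel.IsMarkovKernel.map _ measurable_path_snd

theorem walkKernel_apply (ω : Env) : walkKernel ω = walkFrom (ω, []) := by
  unfold walkKernel walkFrom
  rw [Kernel.map_apply _ measurable_path_snd, Kernel.map_apply _ measurable_path_snd]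
  rfl

theorem lintegral_stepKernel (x : Env × Vertex) {f : Env × Vertex → ℝ≥0∞} (hf : Measurable f) :
    ∫⁻ z, f z ∂stepKernel x = ∫⁻ v, f (x.1, v) ∂jump x := by
  unfold stepKernel
  rw [Kernel.prod_apply, Kernel.deterministic_apply, Measure.dirac_prod, lintegral_map hf (by fun_prop)]
  rfl

theorem lintegral_partialTraj_succ (x₀ : (i : Finset.Iic 0) → Env × Vertex) (n : ℕ)
    {f : ((i : Finset.Iic (n + 1)) → Env × Vertex) → ℝ≥0∞} (hf : Measurable f) :
    ∫⁻ x, f x ∂Kernel.partialTraj (X := fun _ => Env × Vertex)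
      (fun n => stepKernel.comap (fun x => x ⟨n, Finset.mem_Iic.2 le_rfl⟩) (by fun_prop)) 0 (n + 1) x₀
    = ∫⁻ x, ∫⁻ z, f (IicProdIoc (X := fun _ => Env × Vertex) n (n + 1) (x, MeasurableEquiv.piSingleton (X := fun _ => Env × Vertex) n z))
        ∂stepKernel (x ⟨n, Finset.mem_Iic.2 le_rfl⟩) ∂Kernel.partialTraj (X := fun _ => Env × Vertex)
      (fun n => stepKernel.comap (fun x => x ⟨n, Finset.mem_Iic.2 le_rfl⟩) (by fun_prop)) 0 n x₀ := by
  have hI : Measurable (IicProdIoc (X := fun _ => Env × Vertex) n (n + 1)) := measurable_IicProdIoc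
  rw [Kernel.partialTraj_succ_of_le (Nat.zero_le n), Kernel.map_apply _ (by fun_prop),
    lintegral_map hf (by fun_prop), Kernel.lintegral_comp _ _ _ (by fun_prop)]
  refine lintegral_congr fun x => ?_
  rw [Kernel.prod_apply, Kernel.id_apply, Measure.dirac_prod, lintegral_map (by fun_prop) (by fun_prop),
    Kernel.map_apply _ (by fun_prop), lintegral_map (by fun_prop) (by fun_prop)]
  rfl

/-- The chain carries the environment along, and a priori it is random at later times. Allowing an
arbitrary `g` of the environment at time `n` makes the induction work: the probability of the last
jump is absorbed into `g`. -/
theorem lintegral_partialTraj_cylinder (ω : Env) (v : Vertex) (y : ℕ → Vertex) (n : ℕ)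
    (g : Env → ℝ≥0∞) (hg : Measurable g) :
    ∫⁻ x, {x : (i : Finset.Iic n) → Env × Vertex | ∀ i : Finset.Iic n, (x i).2 = y i.1}.indicator
      (fun x => g (x ⟨n, Finset.mem_Iic.2 le_rfl⟩).1) x
      ∂Kernel.partialTraj (X := fun _ => Env × Vertex)
      (fun n => stepKernel.comap (fun x => x ⟨n, Finset.mem_Iic.2 le_rfl⟩) (by fun_prop)) 0 n
        (fun _ => (ω, v))
    = g ω * ((if y 0 = v then 1 else 0) * ∏ i ∈ Finset.range n, jump (ω, y i) {y (i + 1)}) := by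
  have hms : ∀ n, MeasurableSet {x : (i : Finset.Iic n) → Env × Vertex | ∀ i : Finset.Iic n, (x i).2 = y i.1} := by
    intro n
    have : {x : (i : Finset.Iic n) → Env × Vertex | ∀ i : Finset.Iic n, (x i).2 = y i.1} = ⋂ i, {x | (x i).2 = y i.1} := by
      ext; simp
    rw [this]
    exact MeasurableSet.iInter fun i => (measurableSet_singleton (y i)).preimage (by fun_prop)
  induction n generalizing g with
  | zero =>
    rw [Kernel.partialTraj_self, Kernel.id_apply, lintegral_dirac' _ (Measurable.indicator (by fun_prop) (hms 0))]
    by_cases h : y 0 = v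
    · rw [Set.indicator_of_mem]
      · simp [h]
      · rintro ⟨i, hi⟩
        obtain rfl : i = 0 := by simpa using hi
        exact h.symm
    · rw [Set.indicator_of_notMem]
      · simp [h]
      · intro h'
        exact h (h' ⟨0, by simp⟩).symm
  | succ n ih =>
    rw [lintegral_partialTraj_succ _ _ (Measurable.indicator (by fun_prop) (hms _))]
    have key := ih (fun ω' => g ω' * jump (ω', y n) {y (n + 1)})
      (hg.mul ((Measure.measurable_coe (measurableSet_singleton _)).comp
        (measurable_jump.comp (by fun_prop))))
    rw [Finset.prod_range_succ]
    have : g ω * ((if y 0 = v then 1 else 0) * ((∏ i ∈ Finset.range n, jump (ω, y i) {y (i + 1)}) *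
        jump (ω, y n) {y (n + 1)})) = (g ω * jump (ω, y n) {y (n + 1)}) *
         ((if y 0 = v then 1 else 0) * (∏ i ∈ Finset.range n, jump (ω, y i) {y (i + 1)})) := by ring
    rw [this, ← key]
    refine lintegral_congr fun x => ?_
    have hps : ∀ (z : Env × Vertex) h, (MeasurableEquiv.piSingleton (X := fun _ => Env × Vertex) n) z
        ⟨n + 1, h⟩ = z := fun _ _ => rfl
    have hmem : ∀ z : Env × Vertex, (IicProdIoc (X := fun _ => Env × Vertex) n (n + 1)
        (x, MeasurableEquiv.piSingleton (X := fun _ => Env × Vertex) n z) ∈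
        {x : (i : Finset.Iic (n + 1)) → Env × Vertex | ∀ i : Finset.Iic (n + 1), (x i).2 = y i.1}) ↔
        (x ∈ {x : (i : Finset.Iic n) → Env × Vertex | ∀ i : Finset.Iic n, (x i).2 = y i.1}) ∧
        z.2 = y (n + 1) := by
      intro z
      constructor
      · intro h
        refine ⟨fun i => ?_, ?_⟩
        · have hi := Finset.mem_Iic.1 i.2
          have := h ⟨i.1, Finset.mem_Iic.2 (by omega)⟩
          simpa [IicProdIoc, hi] using this
        · have := h ⟨n + 1, Finset.mem_Iic.2 le_rfl⟩
          simpa [IicProdIoc, hps] using this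
      · rintro ⟨h1, h2⟩ ⟨i, hi⟩
        rw [Finset.mem_Iic] at hi
        by_cases hin : i ≤ n
        · simpa [IicProdIoc, hin] using h1 ⟨i, Finset.mem_Iic.2 hin⟩
        · obtain rfl : i = n + 1 := by omega
          simpa [IicProdIoc, hps] using h2
    have hval : ∀ z : Env × Vertex, (IicProdIoc (X := fun _ => Env × Vertex) n (n + 1)
        (x, MeasurableEquiv.piSingleton (X := fun _ => Env × Vertex) n z))
          ⟨n + 1, Finset.mem_Iic.2 le_rfl⟩ = z := by
      intro z
      simp [IicProdIoc, hps]
    simp only [Set.indicator_apply, hmem, hval]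
    by_cases hx : x ∈ {x : (i : Finset.Iic n) → Env × Vertex | ∀ i : Finset.Iic n, (x i).2 = y i.1}
    · simp only [hx, true_and, if_true]
      have h2 : Measurable fun z : Env × Vertex => if z.2 = y (n + 1) then g z.1 else 0 :=
        Measurable.ite ((measurableSet_singleton (y (n + 1))).preimage measurable_snd)
          (by fun_prop) measurable_const
      rw [lintegral_stepKernel _ h2]
      have h3 : (x ⟨n, Finset.mem_Iic.2 le_rfl⟩).2 = y n := hx _
      rw [show jump (x ⟨n, Finset.mem_Iic.2 le_rfl⟩)
        = jump ((x ⟨n, Finset.mem_Iic.2 le_rfl⟩).1, y n) by rw [← h3]]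
      rw [← lintegral_indicator_const (measurableSet_singleton (y (n + 1)))]
      refine lintegral_congr fun v => ?_
      simp [Set.indicator_apply]
    · simp only [hx, false_and, if_false, lintegral_zero]

theorem measurableSet_cylinder (y : ℕ → Vertex) (n : ℕ) :
    MeasurableSet {X : ℕ → Vertex | ∀ i ≤ n, X i = y i} := by
  have : {X : ℕ → Vertex | ∀ i ≤ n, X i = y i} = ⋂ i, ⋂ (_ : i ≤ n), {X | X i = y i} := by
    ext; simp
  rw [this]
  exact MeasurableSet.iInter fun i => MeasurableSet.iInter fun _ =>
    (measurableSet_singleton (y i)).preimage (measurable_pi_apply i)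

theorem walkFrom_cylinder (ω : Env) (v : Vertex) (y : ℕ → Vertex) (n : ℕ) :
    walkFrom (ω, v) {X | ∀ i ≤ n, X i = y i} =
      (if y 0 = v then 1 else 0) * ∏ i ∈ Finset.range n, jump (ω, y i) {y (i + 1)} := by
  have key := lintegral_partialTraj_cylinder ω v y n (fun _ => 1) measurable_const
  rw [one_mul] at key
  rw [← key]
  have hms : MeasurableSet
      {x : (i : Finset.Iic n) → Env × Vertex | ∀ i : Finset.Iic n, (x i).2 = y i.1} := by
    have : {x : (i : Finset.Iic n) → Env × Vertex | ∀ i : Finset.Iic n, (x i).2 = y i.1} =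
      ⋂ i : Finset.Iic n, {x | (x i).2 = y i.1} := by
      ext; simp
    rw [this]
    exact MeasurableSet.iInter fun i => (measurableSet_singleton (y i)).preimage (by fun_prop)
  rw [lintegral_indicator_const hms, one_mul, ← Kernel.traj_map_frestrictLe_apply,
    Measure.map_apply (by fun_prop) hms]
  unfold walkFrom
  rw [Kernel.map_apply' _ measurable_path_snd _ (measurableSet_cylinder y n), Kernel.comap_apply]
  congr 1
  ext x
  simp [Preorder.frestrictLe]

/-- The path with initial segment `y`. -/
def extend {n : ℕ} (y : Fin (n + 1) → Vertex) (i : ℕ) : Vertex :=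
  if h : i < n + 1 then y ⟨i, h⟩ else []

theorem extend_of_le {n : ℕ} (y : Fin (n + 1) → Vertex) {i : ℕ} (h : i ≤ n) :
    extend y i = y ⟨i, Nat.lt_succ_of_le h⟩ := by
  simp [extend, Nat.lt_succ_of_le h]

theorem extend_restrict_mem {n : ℕ} (X : ℕ → Vertex) :
    ∀ i ≤ n, X i = extend (fun j : Fin (n + 1) => X j) i := by
  intro i hi
  rw [extend_of_le _ hi]

theorem extend_injective {n : ℕ} {y y' : Fin (n + 1) → Vertex} {X : ℕ → Vertex}
    (h : ∀ i ≤ n, X i = extend y i) (h' : ∀ i ≤ n, X i = extend y' i) : y = y' := by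
  ext1 j
  have hj : j.1 ≤ n := Nat.le_of_lt_succ j.2
  have := (h j.1 hj).symm.trans (h' j.1 hj)
  rwa [extend_of_le _ hj, extend_of_le _ hj] at this

theorem iUnion_cylinder (n : ℕ) (S : Set (ℕ → Vertex))
    (hS : ∀ X X' : ℕ → Vertex, (∀ i ≤ n, X i = X' i) → X ∈ S → X' ∈ S) :
    S = ⋃ y : {y : Fin (n + 1) → Vertex // extend y ∈ S}, {X | ∀ i ≤ n, X i = extend y.1 i} := by
  ext X
  simp only [Set.mem_iUnion, Set.mem_ofPred_eq]
  constructor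
  · intro h
    exact ⟨⟨_, hS _ _ (extend_restrict_mem X) h⟩, extend_restrict_mem X⟩
  · rintro ⟨y, hy⟩
    exact hS _ _ (fun i hi => (hy i hi).symm) y.2

theorem pathMeasurableSpace_eq :
    (MeasurableSpace.pi : MeasurableSpace (ℕ → Vertex)) =
      MeasurableSpace.generateFrom {S | ∃ (y : ℕ → Vertex) (n : ℕ), S = {X : ℕ → Vertex | ∀ i ≤ n, X i = y i}} := by
  apply le_antisymm
  · refine iSup_le fun i => ?_
    rw [← measurable_iff_comap_le]
    refine @measurable_to_countable' _ _ _ _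
      (MeasurableSpace.generateFrom {S | ∃ (y : ℕ → Vertex) (n : ℕ), S = {X : ℕ → Vertex | ∀ i ≤ n, X i = y i}})
      _ fun v => ?_
    rw [iUnion_cylinder i ((fun X : ℕ → Vertex => X i) ⁻¹' {v})]
    · refine MeasurableSet.iUnion fun y => ?_
      exact MeasurableSpace.measurableSet_generateFrom ⟨_, _, rfl⟩
    · intro X X' h hX
      simpa [← h i le_rfl] using hX
  · apply MeasurableSpace.generateFrom_le
    rintro _ ⟨y, n, rfl⟩
    exact measurableSet_cylinder y n

/-- Cylinders form a π-system. Equality of the total masses comes for free, since the space of paths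
is a countable disjoint union of cylinders of length `0`. -/
theorem path_measure_ext {μ μ' : Measure (ℕ → Vertex)} [IsFiniteMeasure μ]
    (h : ∀ (y : ℕ → Vertex) (n : ℕ), μ {X | ∀ i ≤ n, X i = y i} = μ' {X | ∀ i ≤ n, X i = y i}) :
    μ = μ' := by
  refine ext_of_generate_finite _ pathMeasurableSpace_eq ?_ ?_ ?_
  · rintro _ ⟨y, n, rfl⟩ _ ⟨y', n', rfl⟩ ⟨X, hX, hX'⟩
    refine ⟨X, max n n', ?_⟩
    ext X'
    simp only [Set.mem_inter_iff, Set.mem_ofPred_eq] at hX hX' ⊢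
    constructor
    · rintro ⟨h1, h2⟩ i hi
      rcases le_max_iff.1 hi with h | h
      · rw [h1 i h, hX i h]
      · rw [h2 i h, hX' i h]
    · intro h
      refine ⟨fun i hi => ?_, fun i hi => ?_⟩
      · rw [h i (le_max_of_le_left hi), hX i hi]
      · rw [h i (le_max_of_le_right hi), hX' i hi]
  · rintro _ ⟨y, n, rfl⟩
    exact h y n
  · have hu := iUnion_cylinder 0 Set.univ (fun _ _ _ _ => trivial)
    have hd : Pairwise (Function.onFun Disjoint
        fun y : {y : Fin (0 + 1) → Vertex // extend y ∈ Set.univ} =>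
          {X : ℕ → Vertex | ∀ i ≤ 0, X i = extend y.1 i}) := by
      intro y y' hne
      refine Set.disjoint_left.2 fun X h h' => hne (Subtype.ext (extend_injective h h'))
    rw [hu, measure_iUnion hd fun y => measurableSet_cylinder _ _,
      measure_iUnion hd fun y => measurableSet_cylinder _ _]
    exact tsum_congr fun y => h _ _

/-- The path after time `n`. -/
def shift (n : ℕ) (X : ℕ → Vertex) : ℕ → Vertex := fun s => X (n + s)

theorem measurable_shift (n : ℕ) : Measurable (shift n) := by unfold shift; fun_prop

/-- The Markov property. -/
theorem map_shift_restrict_cylinder (ω : Env) (v : Vertex) (y : ℕ → Vertex) (n : ℕ) :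
    ((walkFrom (ω, v)).restrict {X | ∀ i ≤ n, X i = y i}).map (shift n) =
      walkFrom (ω, v) {X | ∀ i ≤ n, X i = y i} • walkFrom (ω, y n) := by
  refine path_measure_ext fun z m => ?_
  rw [Measure.map_apply (measurable_shift n) (measurableSet_cylinder z m),
    Measure.restrict_apply ((measurableSet_cylinder z m).preimage (measurable_shift n)),
    Measure.smul_apply, walkFrom_cylinder, walkFrom_cylinder, smul_eq_mul]
  by_cases hz : z 0 = y n
  -- If `z` starts where `y` ends, the two events combine to one cylinder for the concatenated path,
  -- and its probability factorises; otherwise both sides vanish.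
  · have : shift n ⁻¹' {X | ∀ i ≤ m, X i = z i} ∩ {X | ∀ i ≤ n, X i = y i} =
        {X | ∀ i ≤ n + m, X i = (fun i => if i ≤ n then y i else z (i - n)) i} := by
      ext X
      simp only [Set.mem_inter_iff, Set.mem_preimage, Set.mem_ofPred_eq, shift]
      constructor
      · rintro ⟨h1, h2⟩ i hi
        split_ifs with h
        · exact h2 i h
        · rw [← h1 (i - n) (by omega)]
          congr 1
          omega
      · intro h
        refine ⟨fun i hi => ?_, fun i hi => ?_⟩
        · rw [h (n + i) (by omega)]
          split_ifs with h'
          · obtain rfl : i = 0 := by omega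
            exact hz.symm
          · simp
        · rw [h i (by omega), if_pos hi]
    rw [this, walkFrom_cylinder, Finset.prod_range_add]
    simp only [hz, if_true, Nat.zero_le, one_mul]
    rw [mul_assoc]
    congr 2
    · refine Finset.prod_congr rfl fun i hi => ?_
      rw [Finset.mem_range] at hi
      rw [if_pos hi.le, if_pos (by omega)]
    · refine Finset.prod_congr rfl fun i _ => ?_
      rw [if_neg (by omega : ¬ n + i + 1 ≤ n), show n + i + 1 - n = i + 1 by omega]
      split_ifs with h
      · obtain rfl : i = 0 := by omega
        rw [hz]; rfl
      · simp
  · rw [if_neg hz, zero_mul, mul_zero]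
    convert measure_empty (μ := walkFrom (ω, v))
    refine Set.eq_empty_of_forall_notMem fun X hX => hz ?_
    rw [← hX.1 0 (Nat.zero_le _), ← hX.2 n le_rfl]
    rfl

/-- Decomposition of an integral according to the initial segment of the path. -/
theorem lintegral_eq_tsum_cylinder (μ : Measure (ℕ → Vertex)) (n : ℕ) (f : (ℕ → Vertex) → ℝ≥0∞) :
    ∫⁻ X, f X ∂μ = ∑' y : Fin (n + 1) → Vertex, ∫⁻ X in {X | ∀ i ≤ n, X i = extend y i}, f X ∂μ := by
  rw [← lintegral_iUnion (fun y => measurableSet_cylinder _ _), Set.eq_univ_of_forall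
    (s := ⋃ y : Fin (n + 1) → Vertex, {X : ℕ → Vertex | ∀ i ≤ n, X i = extend y i}),
    Measure.restrict_univ]
  · exact fun X => Set.mem_iUnion.2 ⟨_, extend_restrict_mem X⟩
  · intro y y' hne
    exact Set.disjoint_left.2 fun X h h' => hne (extend_injective h h')

theorem setLIntegral_cylinder_shift (ω : Env) (v : Vertex) (y : ℕ → Vertex) (n : ℕ)
    {g : (ℕ → Vertex) → ℝ≥0∞} (hg : Measurable g) :
    ∫⁻ X in {X | ∀ i ≤ n, X i = y i}, g (shift n X) ∂walkFrom (ω, v) =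
      walkFrom (ω, v) {X | ∀ i ≤ n, X i = y i} * ∫⁻ X, g X ∂walkFrom (ω, y n) := by
  rw [← lintegral_map hg (measurable_shift n), map_shift_restrict_cylinder, lintegral_smul_measure,
    smul_eq_mul]

/-- The Markov property at time `n`, in integral form: `f` depends on the path up to time `n`. -/
theorem lintegral_mul_shift (ω : Env) (v : Vertex) (n : ℕ) {f g : (ℕ → Vertex) → ℝ≥0∞}
    (hf : ∀ X X' : ℕ → Vertex, (∀ i ≤ n, X i = X' i) → f X = f X') (hg : Measurable g) :
    ∫⁻ X, f X * g (shift n X) ∂walkFrom (ω, v) =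
      ∫⁻ X, f X * ∫⁻ X', g X' ∂walkFrom (ω, X n) ∂walkFrom (ω, v) := by
  rw [lintegral_eq_tsum_cylinder _ n, lintegral_eq_tsum_cylinder (n := n)]
  refine tsum_congr fun y => ?_
  have h1 : ∫⁻ X in {X | ∀ i ≤ n, X i = extend y i}, f X * g (shift n X) ∂walkFrom (ω, v) =
      ∫⁻ X in {X | ∀ i ≤ n, X i = extend y i}, f (extend y) * g (shift n X) ∂walkFrom (ω, v) :=
    setLIntegral_congr_fun (measurableSet_cylinder _ _) fun X hX => by
      simp only [hf X (extend y) hX]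
  have h2 : ∫⁻ X in {X | ∀ i ≤ n, X i = extend y i},
        f X * ∫⁻ X', g X' ∂walkFrom (ω, X n) ∂walkFrom (ω, v) =
      ∫⁻ X in {X | ∀ i ≤ n, X i = extend y i},
        f (extend y) * ∫⁻ X', g X' ∂walkFrom (ω, extend y n) ∂walkFrom (ω, v) :=
    setLIntegral_congr_fun (measurableSet_cylinder _ _) fun X hX => by
      simp only [hf X (extend y) hX, hX n le_rfl]
  rw [h1, h2, lintegral_const_mul (f := fun X => g (shift n X)) _ (hg.comp (measurable_shift n)), setLIntegral_cylinder_shift _ _ _ _ hg,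
    setLIntegral_const]
  ring

end Env

/-! ### One step of the walk; exit from finite sets -/

namespace Env

theorem measurableSet_path (s : ℕ) (A : Set Vertex) : MeasurableSet {X : ℕ → Vertex | X s ∈ A} :=
  (Set.to_countable A).measurableSet.preimage (measurable_pi_apply s)

/-- The total bias of the edges to the children of `x`. -/
noncomputable def childRate (ω : Env) (x : Vertex) : ℝ≥0∞ :=
  ∑ i ∈ Finset.range (ω x).1, ENNReal.ofReal (ω (i :: x)).2

theorem childRate_ne_top (ω : Env) (x : Vertex) : childRate ω x ≠ ∞ :=
  ENNReal.sum_ne_top.2 fun _ _ => ENNReal.ofReal_ne_top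

theorem lintegral_rates (ω : Env) (x : Vertex) (f : Vertex → ℝ≥0∞) :
    ∫⁻ y, f y ∂rates (ω, x) = (if x = [] then 0 else f x.tail) +
      ∑ i ∈ Finset.range (ω x).1, ENNReal.ofReal (ω (i :: x)).2 * f (i :: x) := by
  unfold rates
  rw [lintegral_add_measure, lintegral_finsetSum_measure]
  congr 1
  · split_ifs <;> simp
  · simp

theorem rates_univ (ω : Env) (x : Vertex) :
    rates (ω, x) Set.univ = (if x = [] then 0 else 1) + childRate ω x := by
  have := lintegral_rates ω x 1
  simpa [childRate] using this

theorem jump_of_ne_nil (ω : Env) {x : Vertex} (hx : x ≠ []) :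
    jump (ω, x) = (1 + childRate ω x)⁻¹ • rates (ω, x) := by
  unfold jump
  rw [rates_univ, if_neg hx, if_neg (by simp)]

theorem lintegral_jump_of_ne_nil (ω : Env) {x : Vertex} (hx : x ≠ []) (f : Vertex → ℝ≥0∞) :
    ∫⁻ y, f y ∂jump (ω, x) = (1 + childRate ω x)⁻¹ * (f x.tail +
      ∑ i ∈ Finset.range (ω x).1, ENNReal.ofReal (ω (i :: x)).2 * f (i :: x)) := by
  rw [jump_of_ne_nil ω hx, lintegral_smul_measure, lintegral_rates, if_neg hx, smul_eq_mul]

theorem jump_nil (ω : Env) (h : childRate ω [] ≠ 0) :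
    jump (ω, []) = (childRate ω [])⁻¹ • rates (ω, []) := by
  unfold jump
  rw [rates_univ, if_pos rfl, zero_add, if_neg h]

theorem walkFrom_zero_ne (ω : Env) (x : Vertex) : ∀ᵐ X ∂walkFrom (ω, x), X 0 = x := by
  have h := walkFrom_cylinder ω x (fun _ => x) 0
  simp only [Nat.le_zero, forall_eq, if_true, Finset.range_zero, Finset.prod_empty, one_mul] at h
  have := prob_compl_eq_zero_iff (μ := walkFrom (ω, x)) (measurableSet_path 0 {x})
  exact this.2 h

theorem map_walkFrom_one (ω : Env) (x : Vertex) :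
    (walkFrom (ω, x)).map (fun X => X 1) = jump (ω, x) := by
  refine Measure.ext_of_singleton fun y => ?_
  rw [Measure.map_apply (measurable_pi_apply 1) (measurableSet_singleton y)]
  have h := walkFrom_cylinder ω x (fun i => if i = 0 then x else y) 1
  simp only [if_true, Finset.range_one, Finset.prod_singleton, one_mul, zero_add, one_ne_zero,
    if_false] at h
  rw [← h]
  refine measure_congr ?_
  filter_upwards [walkFrom_zero_ne ω x] with X hX
  apply propext
  constructor
  · intro h1 i hi
    rcases Nat.le_one_iff_eq_zero_or_eq_one.1 hi with rfl | rfl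
    · simpa using hX
    · simpa using! h1
  · intro h1
    simpa using! h1 1 le_rfl

theorem lintegral_shift_one (ω : Env) (x : Vertex) {g : (ℕ → Vertex) → ℝ≥0∞} (hg : Measurable g) :
    ∫⁻ X, g (shift 1 X) ∂walkFrom (ω, x) = ∫⁻ y, ∫⁻ X, g X ∂walkFrom (ω, y) ∂jump (ω, x) := by
  have := lintegral_mul_shift ω x 1 (f := fun _ => 1) (fun _ _ _ => rfl) hg
  simp only [one_mul] at this
  rw [this, ← map_walkFrom_one, lintegral_map (by fun_prop) (by fun_prop)]

theorem walkFrom_shift_one (ω : Env) (x : Vertex) {B : Set (ℕ → Vertex)} (hB : MeasurableSet B) :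
    walkFrom (ω, x) (shift 1 ⁻¹' B) = ∫⁻ y, walkFrom (ω, y) B ∂jump (ω, x) := by
  have := lintegral_shift_one ω x (g := B.indicator 1) (by fun_prop (disch := assumption))
  simp only [lintegral_indicator_one hB] at this
  rw [← this, ← lintegral_indicator_one (hB.preimage (measurable_shift 1))]
  rfl

/-- The possible steps of the walk. -/
def Step (ω : Env) (x y : Vertex) : Prop := y = x.tail ∨ ∃ i < (ω x).1, y = i :: x

theorem ae_jump_step (ω : Env) (x : Vertex) : ∀ᵐ y ∂jump (ω, x), Step ω x y := by
  have hr : ∀ᵐ y ∂rates (ω, x), Step ω x y := by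
    unfold rates
    rw [ae_add_measure_iff]
    constructor
    · split_ifs
      · simp
      · rw [ae_dirac_iff (Set.to_countable _).measurableSet]
        exact Or.inl rfl
    · rw [← Measure.sum_coe_finset, Measure.ae_sum_iff]
      rintro ⟨i, hi⟩
      refine Measure.ae_smul_measure ?_ _
      rw [ae_dirac_iff (Set.to_countable _).measurableSet]
      exact Or.inr ⟨i, Finset.mem_range.1 hi, rfl⟩
  unfold jump
  split_ifs with h
  · rw [ae_dirac_iff (Set.to_countable _).measurableSet]
    rw [rates_univ] at h
    have hx : x = [] := by
      by_contra hx
      simp [hx] at h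
    subst hx
    exact Or.inl rfl
  · exact Measure.ae_smul_measure hr _

theorem ae_step (ω : Env) (x : Vertex) : ∀ᵐ X ∂walkFrom (ω, x), ∀ s, Step ω (X s) (X (s + 1)) := by
  rw [ae_all_iff]
  intro s
  have hm : MeasurableSet {X : ℕ → Vertex | ¬ Step ω (X 0) (X 1)} := by
    have : MeasurableSet {q : Vertex × Vertex | ¬ Step ω q.1 q.2} := (Set.to_countable _).measurableSet
    exact this.preimage (f := fun X : ℕ → Vertex => (X 0, X 1)) (by fun_prop)
  have key := lintegral_mul_shift ω x s (f := fun _ => 1) (fun _ _ _ => rfl)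
    (g := {X : ℕ → Vertex | ¬ Step ω (X 0) (X 1)}.indicator 1) (by fun_prop (disch := assumption))
  have h0 : ∀ z, walkFrom (ω, z) {X : ℕ → Vertex | ¬ Step ω (X 0) (X 1)} = 0 := by
    intro z
    have h1 : ∀ᵐ X ∂walkFrom (ω, z), Step ω z (X 1) := by
      have := ae_jump_step ω z
      rw [← map_walkFrom_one] at this
      exact ae_of_ae_map (measurable_pi_apply 1).aemeasurable this
    have h2 : ∀ᵐ X ∂walkFrom (ω, z), Step ω (X 0) (X 1) := by
      filter_upwards [h1, walkFrom_zero_ne ω z] with X hX hX'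
      rwa [hX']
    exact h2
  simp only [one_mul, lintegral_indicator_one hm, h0, lintegral_zero] at key
  have e : ∫⁻ X, ({X : ℕ → Vertex | ¬ Step ω (X 0) (X 1)}.indicator 1 (shift s X) : ℝ≥0∞) ∂walkFrom (ω, x)
      = walkFrom (ω, x) (shift s ⁻¹' {X : ℕ → Vertex | ¬ Step ω (X 0) (X 1)}) := by
    rw [← lintegral_indicator_one (hm.preimage (measurable_shift s))]
    rfl
  rw [e] at key
  exact key

/-- A maximum principle. The probability of staying in `F` and away from the root forever is bounded
by its mean over one step, and it vanishes at the root and outside `F`. -/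
theorem ae_forall_mem (ω : Env) (x : Vertex) (F : Finset Vertex) :
    walkFrom (ω, x) {X | ∀ s, X s ∈ F ∧ X s ≠ []} = 0 := by
  set A : Set (ℕ → Vertex) := {X | ∀ s, X s ∈ F ∧ X s ≠ []} with hA
  have hAm : MeasurableSet A := by
    rw [hA, Set.ofPred_forall]
    exact MeasurableSet.iInter fun s => measurableSet_path s {x | x ∈ F ∧ x ≠ []}
  set a : Vertex → ℝ≥0∞ := fun x => walkFrom (ω, x) A with ha
  have hout : ∀ x, x ∉ F ∨ x = [] → a x = 0 := by
    intro x hx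
    refine measure_mono_null (t := {X | X 0 ≠ x}) ?_ (walkFrom_zero_ne ω x)
    intro X hX h0
    have := hX 0
    rw [h0] at this
    tauto
  have hstep : ∀ x, a x ≤ ∫⁻ y, a y ∂jump (ω, x) := by
    intro x
    rw [← walkFrom_shift_one ω x hAm]
    exact measure_mono fun X hX s => hX (1 + s)
  by_contra hne
  have hxF : x ∈ F := by
    by_contra h
    exact hne (hout x (Or.inl h))
  obtain ⟨m, hmF, hm⟩ := F.exists_max_image a ⟨x, hxF⟩
  -- Take a maximiser closest to the root. None of its children exceeds the maximum, so its parent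
  -- must attain it too, and the parent is shorter.
  obtain ⟨z, hz, hzmin⟩ := (F.filter fun z => a z = a m).exists_min_image List.length
    ⟨m, by simp [hmF]⟩
  rw [Finset.mem_filter] at hz
  have hpos : a m ≠ 0 := fun h => hne (le_antisymm ((hm x hxF).trans h.le) bot_le)
  have hle : ∀ y, a y ≤ a m := by
    intro y
    by_cases hy : y ∈ F
    · exact hm y hy
    · rw [hout y (Or.inl hy)]; exact bot_le
  have hznil : z ≠ [] := fun h => hpos (by rw [← hz.2]; exact hout z (Or.inr h))
  have hfin : a m ≠ ∞ := measure_ne_top _ _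
  have h1 := hstep z
  rw [lintegral_jump_of_ne_nil ω hznil, hz.2] at h1
  have h2 : (1 + childRate ω z) * a m ≤ a z.tail + childRate ω z * a m := by
    calc (1 + childRate ω z) * a m
        ≤ (1 + childRate ω z) * ((1 + childRate ω z)⁻¹ * (a z.tail + childRate ω z * a m)) := by
          gcongr
          refine h1.trans ?_
          gcongr
          rw [childRate, Finset.sum_mul]
          gcongr
          exact hle _
      _ = a z.tail + childRate ω z * a m := by
          rw [← mul_assoc, ENNReal.mul_inv_cancel (by simp) (by simp [childRate_ne_top]), one_mul]
  rw [add_mul, one_mul] at h2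
  have h3 : a m ≤ a z.tail :=
    (ENNReal.add_le_add_iff_right (ENNReal.mul_ne_top (childRate_ne_top _ _) hfin)).1 h2
  have h4 : z.tail ∈ F := by
    by_contra h
    exact hpos (le_antisymm (h3.trans (hout _ (Or.inl h)).le) bot_le)
  have h5 := hzmin z.tail (by
    rw [Finset.mem_filter]
    exact ⟨h4, le_antisymm (hle _) h3⟩)
  rw [List.length_tail] at h5
  have := List.length_pos_iff.2 hznil
  omega

end Env

/-! ### Transience along a ray -/

namespace Env

/-- The path visits the root only finitely often. -/
def FinVisits (X : ℕ → Vertex) : Prop := ∃ N, ∀ s ≥ N, X s ≠ []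

/-- The walk after its last visit to the root cannot stay in a finite set, by the Markov property at
each of countably many times. -/
theorem ae_not_forall_mem_of_finVisits (ω : Env) (x : Vertex) :
    ∀ᵐ X ∂walkFrom (ω, x), FinVisits X → ∀ F : Finset Vertex, ¬ ∀ s, X s ∈ F := by
  have h : ∀ (N : ℕ) (F : Finset Vertex), ∀ᵐ X ∂walkFrom (ω, x),
      ¬ ∀ s, shift N X s ∈ F ∧ shift N X s ≠ [] := by
    intro N F
    set A : Set (ℕ → Vertex) := {X | ∀ s, X s ∈ F ∧ X s ≠ []} with hA
    have hAm : MeasurableSet A := by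
      rw [hA, Set.ofPred_forall]
      exact MeasurableSet.iInter fun s => measurableSet_path s {x | x ∈ F ∧ x ≠ []}
    have key := lintegral_mul_shift ω x N (f := fun _ => 1) (fun _ _ _ => rfl)
      (g := A.indicator 1) (by fun_prop (disch := assumption))
    have h0 : ∀ y, walkFrom (ω, y) A = 0 := fun y => ae_forall_mem ω y F
    simp only [one_mul, lintegral_indicator_one hAm, h0, lintegral_zero] at key
    have e : ∫⁻ X, (A.indicator 1 (shift N X) : ℝ≥0∞) ∂walkFrom (ω, x)
        = walkFrom (ω, x) (shift N ⁻¹' A) := by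
      rw [← lintegral_indicator_one (hAm.preimage (measurable_shift N))]
      rfl
    rw [e] at key
    have : walkFrom (ω, x) {X | ¬ ¬ ∀ s, shift N X s ∈ F ∧ shift N X s ≠ []} = 0 := by
      simp only [not_not]
      exact key
    exact this
  filter_upwards [ae_all_iff.2 fun N => ae_all_iff.2 fun F => h N F] with X hX ⟨N, hN⟩ F hF
  exact hX N F fun s => ⟨hF _, hN _ (Nat.le_add_right _ _)⟩

/-- An infinite path of successive children, started at the root, along which the biases are at
least `q`. -/
structure IsRay (ω : Env) (q : ℝ) (r : ℕ → Vertex) : Prop where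
  zero : r 0 = []
  succ : ∀ n, ∃ i < (ω (r n)).1, r (n + 1) = i :: r n
  le_bias : ∀ n, q ≤ (ω (r (n + 1))).2

/-- The length of the common part of the ray `r` and of the path to a vertex. -/
def common (r : ℕ → Vertex) : Vertex → ℕ
  | [] => 0
  | i :: x => if i :: x = r (x.length + 1) then x.length + 1 else common r x

namespace IsRay

variable {ω : Env} {q : ℝ} {r : ℕ → Vertex}

theorem length_eq (h : IsRay ω q r) (n : ℕ) : (r n).length = n := by
  induction n with
  | zero => simp [h.zero]
  | succ n ih =>
    obtain ⟨i, _, hi⟩ := h.succ n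
    simp [hi, ih]

theorem common_eq (h : IsRay ω q r) (n : ℕ) : common r (r n) = n := by
  cases n with
  | zero => simp [h.zero, common]
  | succ n =>
    obtain ⟨i, _, hi⟩ := h.succ n
    rw [hi, common, h.length_eq, ← hi, if_pos rfl]

theorem common_cons_of_off (h : IsRay ω q r) {x : Vertex} (hx : x ≠ r x.length) (i : ℕ) :
    common r (i :: x) = common r x := by
  rw [common, if_neg]
  intro h'
  obtain ⟨j, _, hj⟩ := h.succ x.length
  rw [hj] at h'
  exact hx (List.cons.inj h').2

theorem common_tail_of_off (_h : IsRay ω q r) {x : Vertex} (hx : x ≠ r x.length) :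
    common r x.tail = common r x := by
  cases x with
  | nil => rfl
  | cons i x => exact (if_neg hx).symm

/-- With `θ = q⁻¹` this says `(1 - θ) * (1 - b * θ) ≤ 0`. -/
theorem superharmonic_aux {q b : ℝ} (hq : 1 < q) (hb : q ≤ b) :
    1 + ENNReal.ofReal b * (ENNReal.ofReal q⁻¹ * ENNReal.ofReal q⁻¹) ≤
      ENNReal.ofReal q⁻¹ + ENNReal.ofReal b * ENNReal.ofReal q⁻¹ := by
  have hq0 : 0 < q := by linarith
  have hb0 : 0 ≤ b := by linarith
  have hi : 0 ≤ q⁻¹ := by positivity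
  rw [← ENNReal.ofReal_mul hi, ← ENNReal.ofReal_mul hb0, ← ENNReal.ofReal_mul hb0,
    ← ENNReal.ofReal_one, ← ENNReal.ofReal_add (by norm_num) (by positivity),
    ← ENNReal.ofReal_add (by positivity) (by positivity)]
  apply ENNReal.ofReal_le_ofReal
  have h1 : q⁻¹ ≤ 1 := inv_le_one_of_one_le₀ hq.le
  have h2 : 1 ≤ b * q⁻¹ := by rw [← div_eq_mul_inv, le_div_iff₀ hq0]; linarith
  nlinarith

/-- Off the ray, no step changes `common`. On the ray, the parent has a value larger by a factor
`q`, with rate `1`, and the next vertex of the ray has a value smaller by the factor `q`, with rate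
at least `q`; the other children do not change it. So the mean cannot increase. -/
theorem superharmonic (h : IsRay ω q r) (hq : 1 < q) {x : Vertex} (hx : x ≠ []) :
    ∫⁻ y, ENNReal.ofReal q⁻¹ ^ common r y ∂jump (ω, x) ≤ ENNReal.ofReal q⁻¹ ^ common r x := by
  set θ := ENNReal.ofReal q⁻¹ with hθ
  rw [lintegral_jump_of_ne_nil ω hx]
  suffices θ ^ common r x.tail + ∑ i ∈ Finset.range (ω x).1,
      ENNReal.ofReal (ω (i :: x)).2 * θ ^ common r (i :: x) ≤ (1 + childRate ω x) * θ ^ common r x by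
    calc _ ≤ (1 + childRate ω x)⁻¹ * ((1 + childRate ω x) * θ ^ common r x) := by gcongr
      _ = _ := by
        rw [← mul_assoc, ENNReal.inv_mul_cancel (by simp) (by simp [childRate_ne_top]), one_mul]
  by_cases hr : x = r x.length
  · obtain ⟨n, hn⟩ : ∃ n, x.length = n + 1 :=
      Nat.exists_eq_succ_of_ne_zero (List.length_pos_iff.2 hx).ne'
    rw [hn] at hr
    obtain ⟨j, _, hj⟩ := h.succ n
    obtain ⟨i, hi, hi'⟩ := h.succ (n + 1)
    have ht : x.tail = r n := by rw [hr, hj, List.tail_cons]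
    rw [← hr] at hi hi'
    rw [ht, h.common_eq, show common r x = n + 1 by conv_lhs => rw [hr, h.common_eq]]
    have hc : ∀ k, common r (k :: x) = if k = i then n + 2 else n + 1 := by
      intro k
      rw [common, hn, hi']
      by_cases hk : k = i
      · simp [hk]
      · rw [if_neg (by simpa using hk), if_neg hk]
        conv_lhs => rw [hr, h.common_eq]
    have hb := h.le_bias (n + 1)
    rw [hi'] at hb
    rw [childRate, ← Finset.add_sum_erase _ _ (Finset.mem_range.2 hi),
      ← Finset.add_sum_erase _ _ (Finset.mem_range.2 hi), hc, if_pos rfl]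
    have hs : ∑ k ∈ (Finset.range (ω x).1).erase i,
          ENNReal.ofReal (ω (k :: x)).2 * θ ^ common r (k :: x) =
        (∑ k ∈ (Finset.range (ω x).1).erase i, ENNReal.ofReal (ω (k :: x)).2) * θ ^ (n + 1) := by
      rw [Finset.sum_mul]
      refine Finset.sum_congr rfl fun k hk => ?_
      rw [hc, if_neg (Finset.ne_of_mem_erase hk)]
    rw [hs, ← add_assoc, ← add_assoc, add_mul]
    gcongr
    calc θ ^ n + ENNReal.ofReal (ω (i :: x)).2 * θ ^ (n + 2)
        = θ ^ n * (1 + ENNReal.ofReal (ω (i :: x)).2 * (θ * θ)) := by ring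
      _ ≤ θ ^ n * (θ + ENNReal.ofReal (ω (i :: x)).2 * θ) := by
          exact mul_le_mul' le_rfl (superharmonic_aux hq hb)
      _ = _ := by ring
  · rw [h.common_tail_of_off hr, childRate, add_mul, one_mul, Finset.sum_mul]
    refine add_le_add le_rfl (Finset.sum_le_sum fun i _ => ?_)
    rw [h.common_cons_of_off hr]

/-- The superharmonic function equals `1` at the root. Stopping at the root, which is carried out as
an induction over a bounded number of steps, bounds the hitting probability by its initial value. -/
theorem hit_le (h : IsRay ω q r) (hq : 1 < q) (x : Vertex) :
    walkFrom (ω, x) {X | ∃ s, X s = []} ≤ ENNReal.ofReal q⁻¹ ^ common r x := by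
  have hm : ∀ m, MeasurableSet {X : ℕ → Vertex | ∃ s ≤ m, X s = []} := by
    intro m
    have : {X : ℕ → Vertex | ∃ s ≤ m, X s = []} = ⋃ s, ⋃ (_ : s ≤ m), {X | X s ∈ ({[]} : Set Vertex)} := by
      ext; simp
    rw [this]
    exact MeasurableSet.iUnion fun s => MeasurableSet.iUnion fun _ => measurableSet_path s _
  have key : ∀ m x, walkFrom (ω, x) {X | ∃ s ≤ m, X s = []} ≤ ENNReal.ofReal q⁻¹ ^ common r x := by
    intro m
    induction m with
    | zero =>
      intro x
      by_cases hx : x = []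
      · rw [hx, common, pow_zero]
        exact prob_le_one
      · refine le_trans (le_of_eq ?_) bot_le
        refine measure_mono_null ?_ (walkFrom_zero_ne ω x)
        rintro X ⟨s, hs, hX⟩ h0
        obtain rfl : s = 0 := by omega
        exact hx (h0.symm.trans hX)
    | succ m ih =>
      intro x
      by_cases hx : x = []
      · rw [hx, common, pow_zero]
        exact prob_le_one
      · calc walkFrom (ω, x) {X | ∃ s ≤ m + 1, X s = []}
            ≤ walkFrom (ω, x) ({X | X 0 ≠ x} ∪ shift 1 ⁻¹' {X | ∃ s ≤ m, X s = []}) := by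
              refine measure_mono ?_
              rintro X ⟨s, hs, hX⟩
              rcases s with _ | s
              · left
                intro h0
                exact hx (h0.symm.trans hX)
              · right
                exact ⟨s, by omega, by rw [shift, add_comm]; exact hX⟩
          _ ≤ 0 + ∫⁻ y, walkFrom (ω, y) {X | ∃ s ≤ m, X s = []} ∂jump (ω, x) := by
              refine (measure_union_le _ _).trans ?_
              rw [walkFrom_shift_one ω x (hm m)]
              gcongr
              exact (walkFrom_zero_ne ω x).le
          _ ≤ ∫⁻ y, ENNReal.ofReal q⁻¹ ^ common r y ∂jump (ω, x) := by
              rw [zero_add]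
              exact lintegral_mono fun y => ih y
          _ ≤ _ := h.superharmonic hq hx
  have hu : {X : ℕ → Vertex | ∃ s, X s = []} = ⋃ m, {X | ∃ s ≤ m, X s = []} := by
    ext X
    simp only [Set.mem_iUnion, Set.mem_ofPred_eq]
    exact ⟨fun ⟨s, hs⟩ => ⟨s, s, le_rfl, hs⟩, fun ⟨_, s, _, hs⟩ => ⟨s, hs⟩⟩
  rw [hu, Monotone.measure_iUnion]
  · exact iSup_le fun m => key m x
  · rintro m m' hmm X ⟨s, hs, hX⟩
    exact ⟨s, hs.trans hmm, hX⟩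

/-- The first step goes along the ray with positive probability, and from there the root is hit with
probability at most `q⁻¹ < 1`. -/
theorem escape_pos (h : IsRay ω q r) (hq : 1 < q) :
    walkFrom (ω, []) {X | ∀ s ≥ 1, X s ≠ []} ≠ 0 := by
  have hq0 : 0 < q := by linarith
  set B : Set (ℕ → Vertex) := {X | ∀ s, X s ≠ []} with hB
  have hBm : MeasurableSet B := by
    rw [hB, Set.ofPred_forall]
    exact MeasurableSet.iInter fun s => measurableSet_path s {x | x ≠ []}
  have e : {X : ℕ → Vertex | ∀ s ≥ 1, X s ≠ []} = shift 1 ⁻¹' B := by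
    ext X
    simp only [hB, shift, Set.mem_preimage, Set.mem_ofPred_eq]
    constructor
    · intro h s
      exact h _ (by omega)
    · intro h s hs
      have := h (s - 1)
      rwa [show 1 + (s - 1) = s by omega] at this
  rw [e, walkFrom_shift_one ω [] hBm]
  have h1 : walkFrom (ω, r 1) B ≠ 0 := by
    have h2 := h.hit_le hq (r 1)
    have h3 : B = {X | ∃ s, X s = []}ᶜ := by ext; simp [hB]
    intro h0
    have hc : MeasurableSet {X : ℕ → Vertex | ∃ s, X s = []} := by
      rw [← compl_compl {X : ℕ → Vertex | ∃ s, X s = []}, ← h3]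
      exact hBm.compl
    rw [h3, prob_compl_eq_zero_iff hc] at h0
    rw [h0, h.common_eq, pow_one] at h2
    have : ENNReal.ofReal q⁻¹ < 1 := by
      rw [← ENNReal.ofReal_one, ENNReal.ofReal_lt_ofReal_iff (by norm_num)]
      exact inv_lt_one_of_one_lt₀ hq
    exact absurd h2 (not_le.2 this)
  have h4 : jump (ω, []) {r 1} ≠ 0 := by
    obtain ⟨i, hi, hi'⟩ := h.succ 0
    have hb := h.le_bias 0
    rw [hi', h.zero] at hb
    rw [h.zero] at hi hi'
    have hpos : ENNReal.ofReal (ω [i]).2 ≠ 0 := by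
      rw [Ne, ENNReal.ofReal_eq_zero, not_le]
      linarith
    have hS : childRate ω [] ≠ 0 := by
      rw [childRate, Ne, Finset.sum_eq_zero_iff]
      intro h0
      exact hpos (h0 i (Finset.mem_range.2 hi))
    rw [jump_nil ω hS, Measure.smul_apply, smul_eq_mul]
    refine mul_ne_zero (by simp [childRate_ne_top]) ?_
    have := lintegral_rates ω [] (({r 1} : Set Vertex).indicator 1)
    rw [lintegral_indicator_one (measurableSet_singleton _), if_pos rfl, zero_add] at this
    rw [this]
    intro h0
    rw [Finset.sum_eq_zero_iff] at h0
    have := h0 i (Finset.mem_range.2 hi)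
    rw [hi', Set.indicator_of_mem (by simp)] at this
    simp at this
    exact absurd this (not_le.2 (by linarith))
  intro h0
  rw [lintegral_eq_zero_iff (measurable_of_countable _)] at h0
  have h5 : jump (ω, []) {r 1} ≤ 0 := by
    rw [← h0]
    refine measure_mono ?_
    rintro y rfl
    exact h1
  exact h4 (le_antisymm h5 bot_le)

/-- The events that a visit to the root at time `s` is the last one are disjoint, and by the Markov
property each has probability `κ` times that of a visit at time `s`. So the expected number of
visits is at most `κ⁻¹`, and Borel–Cantelli applies. -/
theorem ae_finVisits (h : IsRay ω q r) (hq : 1 < q) :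
    ∀ᵐ X ∂walkFrom (ω, []), FinVisits X := by
  set E : Set (ℕ → Vertex) := {X | ∀ s ≥ 1, X s ≠ []} with hE
  have hEm : MeasurableSet E := by
    rw [hE, Set.ofPred_forall]
    refine MeasurableSet.iInter fun s => ?_
    rw [Set.ofPred_forall]
    exact MeasurableSet.iInter fun _ => measurableSet_path s {x | x ≠ []}
  set κ := walkFrom (ω, []) E with hκ
  have hκ0 : κ ≠ 0 := h.escape_pos hq
  have hV : ∀ s, MeasurableSet {X : ℕ → Vertex | X s = []} := fun s => measurableSet_path s {[]}
  have h1 : ∀ s, walkFrom (ω, []) {X | X s = []} * κ =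
      walkFrom (ω, []) ({X | X s = []} ∩ shift s ⁻¹' E) := by
    intro s
    have key := lintegral_mul_shift ω [] s (f := {X : ℕ → Vertex | X s = []}.indicator 1)
      (g := E.indicator 1) (fun X X' hX => by simp [Set.indicator_apply, hX s le_rfl])
      (by fun_prop (disch := assumption))
    simp only [lintegral_indicator_one hEm] at key
    rw [← lintegral_indicator_one (hV s), ← lintegral_mul_const _ (by fun_prop (disch := exact hV s)),
      ← lintegral_indicator_one ((hV s).inter (hEm.preimage (measurable_shift s)))]
    refine Eq.trans ?_ (key.symm.trans ?_)
    · refine lintegral_congr fun X => ?_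
      by_cases hX : X s = []
      · simp [hX, hκ]
      · simp [hX]
    · rw [Set.inter_indicator_one]
      rfl
  have hd : Pairwise (Function.onFun Disjoint
      fun s => ({X : ℕ → Vertex | X s = []} ∩ shift s ⁻¹' E)) := by
    have : ∀ s s', s < s' → Disjoint ({X : ℕ → Vertex | X s = []} ∩ shift s ⁻¹' E)
        ({X : ℕ → Vertex | X s' = []} ∩ shift s' ⁻¹' E) := by
      intro s s' hss
      refine Set.disjoint_left.2 fun X hX hX' => ?_
      have := hX.2 (s' - s) (by omega)
      rw [shift, show s + (s' - s) = s' by omega] at this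
      exact this hX'.1
    intro s s' hne
    rcases lt_or_gt_of_ne hne with h | h
    · exact this _ _ h
    · exact (this _ _ h).symm
  have h2 : (∑' s, walkFrom (ω, []) {X | X s = []}) * κ ≤ 1 := by
    rw [← ENNReal.tsum_mul_right]
    simp only [h1]
    rw [← measure_iUnion hd fun s => (hV s).inter (hEm.preimage (measurable_shift s))]
    exact prob_le_one
  have h3 : ∑' s, walkFrom (ω, []) {X | X s = []} ≠ ∞ := by
    intro h
    rw [h, ENNReal.top_mul hκ0] at h2
    exact absurd h2 (by simp)
  filter_upwards [ae_eventually_notMem h3] with X hX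
  obtain ⟨N, hN⟩ := eventually_atTop.1 hX
  exact ⟨N, hN⟩

end IsRay

end Env

/-! ### The walk inside a subtree -/

namespace Env

/-- The address of `x` relative to its ancestor of generation `n`. -/
def strip (n : ℕ) (x : Vertex) : Vertex := x.take (x.length - n)

@[simp]
theorem strip_append (y v : Vertex) : strip v.length (y ++ v) = y := by
  simp [strip]

theorem strip_append_self {v x : Vertex} (h : v <:+ x) : strip v.length x ++ v = x := by
  obtain ⟨y, rfl⟩ := h
  simp

/-- The subtree at `v`, as an environment of its own. The bias of the root, which has no meaning,
is set to `0`. -/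
def sub (v : Vertex) (ω : Env) : Env :=
  fun y => ((ω (y ++ v)).1, if y = [] then 0 else (ω (y ++ v)).2)

theorem measurable_sub (v : Vertex) : Measurable (sub v) := by
  unfold sub
  refine measurable_pi_lambda _ fun y => ?_
  refine Measurable.prodMk (by fun_prop) ?_
  split_ifs <;> fun_prop

@[simp]
theorem childRate_sub (v : Vertex) (ω : Env) (x : Vertex) :
    childRate (sub v ω) x = childRate ω (x ++ v) := by
  simp [childRate, sub]

/-- The probability that a walk at the root, if it had an additional parent with an edge of rate
`1`, would go to a child. -/
noncomputable def stayProb (ω : Env) : ℝ≥0∞ := childRate ω [] * (1 + childRate ω [])⁻¹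

theorem stayProb_le_one (ω : Env) : stayProb ω ≤ 1 := by
  rw [stayProb, ← div_eq_mul_inv]
  exact ENNReal.div_le_of_le_mul (by rw [one_mul]; exact le_add_self)

open Classical in
/-- The probability that the first `n` steps of the path do not lead to the additional parent of
the root. -/
noncomputable def weightUpTo (ω : Env) (X : ℕ → Vertex) (n : ℕ) : ℝ≥0∞ :=
  ∏ s ∈ Finset.range n, if X s = [] then stayProb ω else 1

/-- The probability that the walk never goes to the additional parent of the root, given its other
steps. -/
noncomputable def weight (ω : Env) (X : ℕ → Vertex) : ℝ≥0∞ := ⨅ n, weightUpTo ω X n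

theorem antitone_weightUpTo (ω : Env) (X : ℕ → Vertex) : Antitone (weightUpTo ω X) := by
  refine antitone_nat_of_succ_le fun n => ?_
  rw [weightUpTo, Finset.prod_range_succ]
  refine mul_le_of_le_one_right' ?_
  split_ifs
  · exact stayProb_le_one ω
  · exact le_rfl

theorem weightUpTo_le_one (ω : Env) (X : ℕ → Vertex) (n : ℕ) : weightUpTo ω X n ≤ 1 :=
  antitone_weightUpTo ω X (Nat.zero_le n)

theorem weight_le_one (ω : Env) (X : ℕ → Vertex) : weight ω X ≤ 1 :=
  iInf_le_of_le 0 (weightUpTo_le_one ω X 0)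

theorem measurable_childRate (x : Vertex) : Measurable fun ω => childRate ω x := by
  have h : Measurable fun y : ℕ × Env =>
      ∑ i ∈ Finset.range y.1, ENNReal.ofReal (y.2 (i :: x)).2 := by
    refine measurable_from_prod_countable_right fun n => ?_
    show Measurable fun ω : Env => ∑ i ∈ Finset.range n, ENNReal.ofReal (ω (i :: x)).2
    exact Finset.measurable_sum _ fun i _ => ((measurable_pi_apply (i :: x)).snd.ennreal_ofReal :
      Measurable fun ω : Env => ENNReal.ofReal (ω (i :: x)).2)
  exact h.comp ((measurable_pi_apply x).fst.prodMk measurable_id)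

theorem measurable_stayProb : Measurable stayProb := by
  unfold stayProb
  exact (measurable_childRate []).mul (measurable_const.add (measurable_childRate [])).inv

theorem measurable_weightUpTo (n : ℕ) :
    Measurable fun z : Env × (ℕ → Vertex) => weightUpTo z.1 z.2 n := by
  unfold weightUpTo
  refine Finset.measurable_prod _ fun s _ => ?_
  refine Measurable.ite ?_ (measurable_stayProb.comp measurable_fst) measurable_const
  exact (measurableSet_path s {[]}).preimage measurable_snd

theorem measurable_weight : Measurable fun z : Env × (ℕ → Vertex) => weight z.1 z.2 :=
  Measurable.iInf measurable_weightUpTo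

/-- Inside the subtree the rates are those of the subtree. Only at its root is there an additional
rate `1` to the parent, and the factor `stayProb` compensates for the different normalisation. -/
theorem jump_append (ω : Env) {v : Vertex} (hv : v ≠ []) (y z : Vertex) :
    jump (ω, y ++ v) {z ++ v} =
      (if y = [] then stayProb (sub v ω) else 1) * jump (sub v ω, y) {z} := by
  have hne : y ++ v ≠ [] := by simp [hv]
  have hsum : ∑ i ∈ Finset.range (ω (y ++ v)).1, ENNReal.ofReal (ω (i :: (y ++ v))).2 *
        ({z ++ v} : Set Vertex).indicator 1 (i :: (y ++ v)) =
      ∑ i ∈ Finset.range (sub v ω y).1, ENNReal.ofReal (sub v ω (i :: y)).2 *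
        ({z} : Set Vertex).indicator 1 (i :: y) := by
    refine Finset.sum_congr rfl fun i _ => ?_
    have : ({z ++ v} : Set Vertex).indicator (1 : Vertex → ℝ≥0∞) (i :: (y ++ v)) =
        ({z} : Set Vertex).indicator 1 (i :: y) := by
      simp only [Set.indicator_apply, Set.mem_singleton_iff, ← List.cons_append,
        List.append_cancel_right_eq, Pi.one_apply]
    rw [this]
    simp [sub]
  have h1 := lintegral_jump_of_ne_nil ω hne (({z ++ v} : Set Vertex).indicator 1)
  rw [lintegral_indicator_one (measurableSet_singleton _), hsum] at h1
  rw [h1]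
  by_cases hy : y = []
  · subst hy
    have ht : ({z ++ v} : Set Vertex).indicator (1 : Vertex → ℝ≥0∞) ([] ++ v).tail = 0 := by
      rw [Set.indicator_of_notMem]
      intro h
      have := congrArg List.length (Set.mem_singleton_iff.1 h)
      have hl := List.length_pos_iff.2 hv
      simp at this
      omega
    rw [ht, zero_add, if_pos rfl, stayProb, childRate_sub]
    -- If the root of the subtree has no positive rate to a child, its jump law there is the default
    -- Dirac mass; this is harmless because `stayProb` vanishes.
    by_cases hS : childRate ω ([] ++ v) = 0
    · rw [← childRate_sub v ω []] at hS
      rw [childRate_sub] at hS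
      rw [hS]
      rw [← childRate_sub, childRate, Finset.sum_eq_zero_iff] at hS
      rw [Finset.sum_eq_zero fun i hi => by rw [hS i hi, zero_mul]]
      simp
    · have hS' : childRate (sub v ω) [] ≠ 0 := by rwa [childRate_sub]
      have h2 := lintegral_rates (sub v ω) [] (({z} : Set Vertex).indicator 1)
      rw [lintegral_indicator_one (measurableSet_singleton _), if_pos rfl, zero_add] at h2
      rw [jump_nil _ hS', Measure.smul_apply, smul_eq_mul, h2, childRate_sub]
      rw [mul_comm (childRate ω ([] ++ v)), mul_assoc, ← mul_assoc (childRate ω ([] ++ v)),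
        ENNReal.mul_inv_cancel hS (childRate_ne_top _ _), one_mul]
  · have h2 := lintegral_jump_of_ne_nil (sub v ω) hy (({z} : Set Vertex).indicator 1)
    rw [lintegral_indicator_one (measurableSet_singleton _), childRate_sub] at h2
    rw [if_neg hy, one_mul, h2]
    congr 2
    cases y with
    | nil => exact absurd rfl hy
    | cons a y =>
      simp only [Set.indicator_apply, Set.mem_singleton_iff, List.cons_append, List.tail_cons,
        List.append_cancel_right_eq, Pi.one_apply]

theorem walkFrom_cylinder_append (ω : Env) {v : Vertex} (hv : v ≠ []) (y : ℕ → Vertex) (n : ℕ) :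
    walkFrom (ω, v) {X | ∀ i ≤ n, X i = y i ++ v} =
      weightUpTo (sub v ω) y n * walkFrom (sub v ω, []) {X | ∀ i ≤ n, X i = y i} := by
  rw [walkFrom_cylinder ω v (fun i => y i ++ v), walkFrom_cylinder, weightUpTo]
  have h0 : y 0 ++ v = v ↔ y 0 = [] := by simp
  simp only [jump_append ω hv, Finset.prod_mul_distrib, h0]
  rw [mul_left_comm]

theorem weightUpTo_congr (ω : Env) {X X' : ℕ → Vertex} {n : ℕ} (h : ∀ i < n, X i = X' i) :
    weightUpTo ω X n = weightUpTo ω X' n :=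
  Finset.prod_congr rfl fun i hi => by rw [h i (Finset.mem_range.1 hi)]

theorem measurable_strip_path (n : ℕ) : Measurable fun (X : ℕ → Vertex) s => strip n (X s) :=
  measurable_pi_lambda _ fun s =>
    (measurable_of_countable (strip n)).comp (measurable_pi_apply s)

theorem measurableSet_staysIn (v : Vertex) : MeasurableSet {X : ℕ → Vertex | ∀ s, v <:+ X s} := by
  rw [Set.ofPred_forall]
  exact MeasurableSet.iInter fun s => measurableSet_path s {x | v <:+ x}

/-- The walk in the subtree at `v`, restricted to the event that it stays there. -/
theorem map_strip_restrict_staysIn (ω : Env) {v : Vertex} (hv : v ≠ []) :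
    ((walkFrom (ω, v)).restrict {X | ∀ s, v <:+ X s}).map (fun X s => strip v.length (X s)) =
      (walkFrom (sub v ω, [])).withDensity (weight (sub v ω)) := by
  set ω' := sub v ω
  refine path_measure_ext fun y n => ?_
  have hc := measurableSet_cylinder y n
  rw [Measure.map_apply (measurable_strip_path _) hc,
    Measure.restrict_apply (hc.preimage (measurable_strip_path _)), withDensity_apply _ hc]
  -- Staying forever is the decreasing limit of staying up to time `n + m`, just as `weight` is the
  -- decreasing limit of `weightUpTo`. The identity is proved for each `m` by summing over cylinders
  -- of length `n + m`, and both sides converge.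
  set A : ℕ → Set (ℕ → Vertex) := fun m =>
    {X | ∀ i ≤ n, X i = y i ++ v} ∩ {X | ∀ s ≤ n + m, v <:+ X s} with hA
  have hAm : ∀ m, MeasurableSet (A m) := by
    intro m
    refine (measurableSet_cylinder (fun i => y i ++ v) n).inter ?_
    rw [Set.ofPred_forall]
    refine MeasurableSet.iInter fun s => ?_
    rw [Set.ofPred_forall]
    exact MeasurableSet.iInter fun _ => measurableSet_path s {x | v <:+ x}
  have hset : (fun (X : ℕ → Vertex) s => strip v.length (X s)) ⁻¹' {X | ∀ i ≤ n, X i = y i} ∩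
      {X | ∀ s, v <:+ X s} = ⋂ m, A m := by
    ext X
    simp only [hA, Set.mem_inter_iff, Set.mem_preimage, Set.mem_ofPred_eq, Set.mem_iInter]
    constructor
    · rintro ⟨h1, h2⟩ m
      exact ⟨fun i hi => by rw [← h1 i hi, strip_append_self (h2 i)], fun s _ => h2 s⟩
    · intro h
      refine ⟨fun i hi => by rw [(h 0).1 i hi, strip_append], fun s => (h s).2 s (by omega)⟩
  have hanti : Antitone A := fun m m' hmm X hX => ⟨hX.1, fun s hs => hX.2 s (by omega)⟩
  rw [hset, hanti.measure_iInter (fun m => (hAm m).nullMeasurableSet) ⟨0, measure_ne_top _ _⟩]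
  have hw : ∀ X, weight ω' X = ⨅ m, weightUpTo ω' X (n + m) := by
    intro X
    rw [weight, ← (antitone_weightUpTo ω' X).iInf_nat_add n]
    simp only [add_comm]
  simp only [hw]
  have hmeas : ∀ m, Measurable fun X : ℕ → Vertex => weightUpTo ω' X (n + m) := fun m =>
    (measurable_weightUpTo (n + m)).comp (measurable_prodMk_left (x := ω'))
  rw [lintegral_iInf hmeas
    (fun m m' hmm X => antitone_weightUpTo ω' X (by omega)) ?_]
  swap
  · refine ne_top_of_le_ne_top (b := 1) (by simp) ?_
    refine (lintegral_mono fun X => weightUpTo_le_one ω' X _).trans ?_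
    rw [lintegral_one, Measure.restrict_apply_univ]
    exact prob_le_one
  refine iInf_congr fun m => ?_
  have hS : ∀ X X' : ℕ → Vertex, (∀ i ≤ n + m, X i = X' i) → X ∈ {X | ∀ i ≤ n, X i = y i} →
      X' ∈ {X | ∀ i ≤ n, X i = y i} :=
    fun X X' h hX i hi => (h i (by omega)).symm.trans (hX i hi)
  have e1 : A m = ⋃ z : {z : Fin (n + m + 1) → Vertex // extend z ∈ {X | ∀ i ≤ n, X i = y i}},
      {X | ∀ i ≤ n + m, X i = extend z.1 i ++ v} := by
    ext X
    simp only [hA, Set.mem_inter_iff, Set.mem_ofPred_eq, Set.mem_iUnion]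
    constructor
    · rintro ⟨h1, h2⟩
      have h3 : ∀ i ≤ n + m, X i = extend (fun j : Fin (n + m + 1) => strip v.length (X j)) i ++ v := by
        intro i hi
        rw [extend_of_le _ hi, strip_append_self (h2 i hi)]
      refine ⟨⟨_, fun i hi => ?_⟩, h3⟩
      have := h3 i (by omega)
      rw [h1 i hi] at this
      exact (List.append_cancel_right this).symm
    · rintro ⟨⟨z, hz⟩, hX⟩
      exact ⟨fun i hi => by rw [hX i (by omega), hz i hi], fun s hs => ⟨_, (hX s hs).symm⟩⟩
  rw [e1, measure_iUnion _ fun z => measurableSet_cylinder _ _]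
  swap
  · intro z z' hne
    refine Set.disjoint_left.2 fun X h h' => hne (Subtype.ext ?_)
    refine extend_injective (X := fun i => strip v.length (X i)) (fun i hi => ?_) fun i hi => ?_
    · rw [h i hi, strip_append]
    · rw [h' i hi, strip_append]
  have e2 : ∫⁻ X in {X | ∀ i ≤ n, X i = y i}, weightUpTo ω' X (n + m) ∂walkFrom (ω', []) =
      ∑' z : {z : Fin (n + m + 1) → Vertex // extend z ∈ {X | ∀ i ≤ n, X i = y i}},
        ∫⁻ X in {X | ∀ i ≤ n + m, X i = extend z.1 i}, weightUpTo ω' X (n + m)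
          ∂walkFrom (ω', []) := by
    conv_lhs => rw [iUnion_cylinder (n + m) _ hS]
    refine lintegral_iUnion (fun z => measurableSet_cylinder _ _) ?_ _
    intro z z' hne
    exact Set.disjoint_left.2 fun X h h' => hne (Subtype.ext (extend_injective h h'))
  rw [e2]
  refine tsum_congr fun z => ?_
  rw [walkFrom_cylinder_append ω hv (extend z.1) (n + m), ← setLIntegral_const]
  refine setLIntegral_congr_fun (measurableSet_cylinder _ _) fun X hX => ?_
  exact weightUpTo_congr _ fun i hi => (hX i hi.le).symm

end Env

/-! ### Resampling a subtree of the environment -/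

namespace Env

theorem measurable_replace {ι α : Type*} [MeasurableSpace α] (S : Set ι) [DecidablePred (· ∈ S)]
    (f : ι → ι) :
    Measurable fun (z : (ι → α) × (ι → α)) w => if w ∈ S then z.2 (f w) else z.1 w := by
  refine measurable_pi_lambda _ fun w => ?_
  split_ifs <;> fun_prop

/-- Replacing some coordinates of an i.i.d. family by coordinates of an independent copy. -/
theorem map_replace_infinitePi {ι α : Type*} [MeasurableSpace α] (μ : Measure α)
    [IsProbabilityMeasure μ] (S : Set ι) [DecidablePred (· ∈ S)] (f : ι → ι) (hf : S.InjOn f) :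
    ((Measure.infinitePi fun _ : ι => μ).prod (Measure.infinitePi fun _ : ι => μ)).map
      (fun z w => if w ∈ S then z.2 (f w) else z.1 w) = Measure.infinitePi fun _ : ι => μ := by
  classical
  refine Measure.eq_infinitePi _ fun s t ht => ?_
  have hm := measurable_replace (α := α) S f
  rcases isEmpty_or_nonempty ι with hι | hι
  · have hs : s = ∅ := Finset.eq_empty_of_isEmpty s
    subst hs
    rw [Measure.map_apply hm (by simp)]
    simp
  rw [Measure.map_apply hm (MeasurableSet.pi s.countable_toSet fun i _ => ht i)]
  set g := Function.invFunOn f S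
  have hg : ∀ w ∈ S, g (f w) = w := fun w hw => hf.leftInvOn_invFunOn hw
  have e : (fun (z : (ι → α) × (ι → α)) w => if w ∈ S then z.2 (f w) else z.1 w) ⁻¹' (Set.pi s t) =
      (Set.pi (s.filter (· ∉ S) : Finset ι) t) ×ˢ
        (Set.pi ((s.filter (· ∈ S)).image f : Finset ι) fun u => t (g u)) := by
    ext ⟨a, b⟩
    simp only [Set.mem_preimage, Set.mem_pi, Set.mem_prod, Finset.mem_coe, Finset.mem_filter,
      Finset.mem_image]
    constructor
    · intro h
      refine ⟨fun i hi => by simpa [hi.2] using h i hi.1, ?_⟩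
      rintro _ ⟨i, hi, rfl⟩
      rw [hg i hi.2]
      simpa [hi.2] using h i hi.1
    · rintro ⟨h1, h2⟩ i hi
      by_cases hS : i ∈ S
      · have := h2 (f i) ⟨i, ⟨hi, hS⟩, rfl⟩
        rw [hg i hS] at this
        simpa [hS] using this
      · simpa [hS] using h1 i ⟨hi, hS⟩
  rw [e, Measure.prod_prod, Measure.infinitePi_pi _ fun i _ => ht i,
    Measure.infinitePi_pi _ fun i _ => ht _, Finset.prod_image, mul_comm,
    ← Finset.prod_filter_mul_prod_filter_not s (· ∈ S)]
  · congr 1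
    refine Finset.prod_congr rfl fun i hi => ?_
    rw [hg i (Finset.mem_filter.1 hi).2]
  · intro i hi j hj h
    exact hf (Finset.mem_filter.1 hi).2 (Finset.mem_filter.1 hj).2 h

theorem map_zip_infinitePi {ι α β : Type*} [MeasurableSpace α] [MeasurableSpace β] (μ : Measure α)
    [IsProbabilityMeasure μ] (ν : Measure β) [IsProbabilityMeasure ν] :
    ((Measure.infinitePi fun _ : ι => μ).prod (Measure.infinitePi fun _ : ι => ν)).map
      (fun z w => (z.1 w, z.2 w)) = Measure.infinitePi fun _ : ι => μ.prod ν := by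
  refine Measure.eq_infinitePi _ fun s t ht => ?_
  have hm : Measurable fun (z : (ι → α) × (ι → β)) w => (z.1 w, z.2 w) := by fun_prop
  rw [Measure.map_apply hm (MeasurableSet.pi s.countable_toSet fun i _ => ht i)]
  have hB : MeasurableSet (Set.univ.pi fun i : s => t i) :=
    MeasurableSet.univ_pi fun i => ht i
  have e : (fun (z : (ι → α) × (ι → β)) w => (z.1 w, z.2 w)) ⁻¹' (Set.pi s t) =
      Prod.map s.restrict s.restrict ⁻¹'
        ((MeasurableEquiv.arrowProdEquivProdArrow α β s).symm ⁻¹' (Set.univ.pi fun i : s => t i)) := by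
    ext z
    simp [Set.mem_pi, MeasurableEquiv.arrowProdEquivProdArrow, Equiv.arrowProdEquivProdArrow]
  rw [e, ← Measure.map_apply (by fun_prop) (hB.preimage (MeasurableEquiv.measurable _)),
    ← Measure.map_prod_map _ _ (by fun_prop) (by fun_prop), Measure.infinitePi_map_restrict,
    Measure.infinitePi_map_restrict,
    ((measurePreserving_arrowProdEquivProdArrow α β s (fun _ => μ) fun _ => ν).symm).measure_preimage
      hB.nullMeasurableSet, Measure.pi_pi, Finset.prod_coe_sort s fun i => (μ.prod ν) (t i)]

/-- The tree `ω` in which the subtree at `v` is replaced by `ω'`. The edge that leads to `v` keeps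
its bias. -/
def glue (v : Vertex) (ω ω' : Env) : Env := fun w =>
  ((if v <:+ w then ω' (strip v.length w) else ω w).1,
    (if v <:+ w ∧ w ≠ v then ω' (strip v.length w) else ω w).2)

theorem glue_append (v : Vertex) (ω ω' : Env) (y : Vertex) :
    glue v ω ω' (y ++ v) = ((ω' y).1, if y = [] then (ω v).2 else (ω' y).2) := by
  by_cases hy : y = []
  · subst hy
    have := strip_append [] v
    simp only [List.nil_append] at this
    simp [glue, this]
  · simp [glue, hy]

theorem glue_of_not_suffix {v w : Vertex} (ω ω' : Env) (h : ¬ v <:+ w) : glue v ω ω' w = ω w := by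
  simp [glue, h]

theorem sub_glue (v : Vertex) (ω ω' : Env) : sub v (glue v ω ω') = sub [] ω' := by
  funext y
  simp only [sub, glue_append, List.append_nil]
  split_ifs <;> rfl

theorem measurable_glue (v : Vertex) : Measurable fun z : Env × Env => glue v z.1 z.2 := by
  refine measurable_pi_lambda _ fun w => ?_
  unfold glue
  refine Measurable.prodMk ?_ ?_ <;> split_ifs <;> fun_prop

/-- The law of the environment: offspring numbers of law `p`, biases of law `ν`. -/
noncomputable def envLaw (p : PMF ℕ) (ν : Measure ℝ) : Measure Env :=
  Measure.infinitePi fun _ : Vertex => p.toMeasure.prod ν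

instance (p : PMF ℕ) (ν : Measure ℝ) [IsProbabilityMeasure ν] : IsProbabilityMeasure (envLaw p ν) := by
  unfold envLaw; infer_instance

theorem map_prod_prod {α β α' β' : Type*} [MeasurableSpace α] [MeasurableSpace β]
    [MeasurableSpace α'] [MeasurableSpace β'] (μ : Measure α) (ν : Measure β) [SFinite μ] [SFinite ν]
    {f : α × α → α'} {g : β × β → β'} (hf : Measurable f) (hg : Measurable g) :
    ((μ.prod ν).prod (μ.prod ν)).map (fun z => (f (z.1.1, z.2.1), g (z.1.2, z.2.2))) =
      ((μ.prod μ).map f).prod ((ν.prod ν).map g) := by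
  rw [Measure.map_prod_map _ _ hf hg]
  ext s hs
  have h1 : Measurable fun z : (α × β) × (α × β) => (f (z.1.1, z.2.1), g (z.1.2, z.2.2)) := by fun_prop
  have hi : Measurable (s.indicator (1 : α' × β' → ℝ≥0∞)) := measurable_one.indicator hs
  rw [← lintegral_indicator_one hs, ← lintegral_indicator_one hs, lintegral_map hi h1,
    lintegral_map hi (by fun_prop), lintegral_prod _ (by fun_prop), lintegral_prod _ (by fun_prop),
    lintegral_prod _ (by fun_prop), lintegral_prod _ (by fun_prop)]
  refine lintegral_congr fun a => ?_
  have : ∀ b : β, ∫⁻ z : α × β, s.indicator (1 : α' × β' → ℝ≥0∞) (f (a, z.1), g (b, z.2)) ∂(μ.prod ν) =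
      ∫⁻ a', ∫⁻ b', s.indicator 1 (f (a, a'), g (b, b')) ∂ν ∂μ := fun b => by
    rw [lintegral_prod _ (by fun_prop)]
  simp only [this]
  rw [lintegral_lintegral_swap (by fun_prop)]
  refine lintegral_congr fun a' => ?_
  simp only [Prod.map_apply]
  rw [lintegral_prod _ (by fun_prop)]

/-- Gluing replaces coordinates of an i.i.d. family by those of an independent copy. The bias at `v`
belongs to the edge above `v` and is kept, so different sets of coordinates are replaced for the
offspring numbers and for the biases. The two families are therefore separated, resampled and zipped
again. -/
theorem map_glue_envLaw (p : PMF ℕ) (ν : Measure ℝ) [IsProbabilityMeasure ν] (v : Vertex) :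
    ((envLaw p ν).prod (envLaw p ν)).map (fun z => glue v z.1 z.2) = envLaw p ν := by
  have hz : Measurable fun (z : (Vertex → ℕ) × (Vertex → ℝ)) w => (z.1 w, z.2 w) := by fun_prop
  have hinj : ∀ S ⊆ {w : Vertex | v <:+ w}, S.InjOn (strip v.length) := by
    intro S hS a ha b hb h
    have h1 := strip_append_self (hS ha)
    have h2 := strip_append_self (hS hb)
    rw [← h1, ← h2, h]
  have h1 := map_replace_infinitePi (p.toMeasure) {w : Vertex | v <:+ w} (strip v.length)
    (hinj _ le_rfl)
  have h2 := map_replace_infinitePi ν {w : Vertex | v <:+ w ∧ w ≠ v} (strip v.length)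
    (hinj _ fun w h => h.1)
  unfold envLaw
  conv_lhs => rw [← map_zip_infinitePi, Measure.map_prod_map _ _ hz hz,
    Measure.map_map (measurable_glue v) (by fun_prop)]
  conv_rhs => rw [← map_zip_infinitePi]
  conv_rhs => rw [← h1, ← h2]
  rw [← map_prod_prod, Measure.map_map hz]
  · congr 1
    funext z w
    simp only [glue, Function.comp_apply, Set.mem_ofPred_eq]
    refine Prod.ext ?_ ?_
    · dsimp only
      split_ifs <;> rfl
    · dsimp only
      split_ifs <;> rfl
  · exact ((measurable_replace _ _).comp (by fun_prop)).prodMk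
      ((measurable_replace _ _).comp (by fun_prop))
  · exact measurable_replace _ _
  · exact measurable_replace _ _

end Env

/-- An environment together with a path of the walk. -/
abbrev Sample := Env × (ℕ → Vertex)

/-! ### Regeneration for the unconditioned law -/

namespace Env

theorem walkKernel_eq : walkKernel = walkFrom.comap (fun ω => (ω, [])) (by fun_prop) := by
  ext1 ω
  rw [walkKernel_apply, Kernel.comap_apply]

instance : IsMarkovKernel walkKernel := by
  rw [walkKernel_eq]; infer_instance

theorem jump_congr {ω ω' : Env} {x : Vertex} (h : (ω x).1 = (ω' x).1)
    (h' : ∀ i, (ω (i :: x)).2 = (ω' (i :: x)).2) : jump (ω, x) = jump (ω', x) := by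
  have : rates (ω, x) = rates (ω', x) := by
    simp only [rates, h, h']
  simp only [jump, this]

theorem jump_sub_nil (ω : Env) (x : Vertex) : jump (sub [] ω, x) = jump (ω, x) :=
  jump_congr (by simp [sub]) (by simp [sub])

theorem walkFrom_sub_nil (ω : Env) (x : Vertex) : walkFrom (sub [] ω, x) = walkFrom (ω, x) :=
  path_measure_ext fun y n => by simp only [walkFrom_cylinder, jump_sub_nil]

theorem stayProb_congr {ω ω' : Env} (h : (ω []).1 = (ω' []).1)
    (h' : ∀ i, (ω [i]).2 = (ω' [i]).2) : stayProb ω = stayProb ω' := by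
  simp only [stayProb, childRate, h, h']

theorem weightUpTo_sub_nil (ω : Env) (X : ℕ → Vertex) (n : ℕ) :
    weightUpTo (sub [] ω) X n = weightUpTo ω X n := by
  rw [weightUpTo, weightUpTo, stayProb_congr (ω' := ω)] <;> simp [sub]

theorem weight_sub_nil (ω : Env) (X : ℕ → Vertex) : weight (sub [] ω) X = weight ω X := by
  simp only [weight, weightUpTo_sub_nil]

theorem glue_glue (v : Vertex) (ω ω' ω'' : Env) : glue v (glue v ω ω') ω'' = glue v ω ω'' := by
  funext w
  by_cases h : v <:+ w
  · obtain ⟨y, rfl⟩ := h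
    have h0 : (glue v ω ω' v).2 = (ω v).2 := by
      have := glue_append v ω ω' []
      rw [List.nil_append] at this
      rw [this]
      rfl
    rw [glue_append, glue_append, h0]
  · rw [glue_of_not_suffix _ _ h, glue_of_not_suffix _ _ h, glue_of_not_suffix _ _ h]

theorem glue_self_snd (v : Vertex) (ω ω' : Env) : (glue v ω ω' v).2 = (ω v).2 := by
  simp [glue]

/-- From outside the subtree only the bias of the edge leading to `v` is seen, and gluing keeps it.
-/
theorem jump_glue {v x : Vertex} (ω ω' : Env) (h : ¬ v <:+ x) :
    jump (glue v ω ω', x) = jump (ω, x) := by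
  refine jump_congr (by rw [glue_of_not_suffix _ _ h]) fun i => ?_
  by_cases hi : v <:+ i :: x
  · rcases List.suffix_cons_iff.1 hi with rfl | h'
    · rw [glue_self_snd]
    · exact absurd h' h
  · rw [glue_of_not_suffix _ _ hi]

/-- No vertex of the subtree at `X t` is visited before time `t`. -/
def IsFresh (X : ℕ → Vertex) (t : ℕ) : Prop := ∀ s < t, ¬ X t <:+ X s

/-- The path enters the subtree at `X t` at time `t`, and stays there forever. -/
def IsRegen (X : ℕ → Vertex) (t : ℕ) : Prop := IsFresh X t ∧ ∀ s ≥ t, X t <:+ X s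

/-- The information outside the subtree at `X t`, where the subtree is replaced by a ray, and up to
time `t`. -/
def past (t : ℕ) (z : Sample) : Sample :=
  (glue (z.2 t) z.1 (fun _ => (1, 0)), fun s => z.2 (min s t))

/-- The subtree at `X t` and the walk on it after time `t`. -/
def next (t : ℕ) (z : Sample) : Sample :=
  (sub (z.2 t) z.1, fun s => strip (z.2 t).length (z.2 (t + s)))

theorem measurable_eval_env : Measurable fun q : Env × Vertex => q.1 q.2 :=
  measurable_from_prod_countable_left fun v => measurable_pi_apply v

theorem measurable_sub_uncurry : Measurable fun q : Env × Vertex => sub q.2 q.1 :=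
  measurable_from_prod_countable_left fun v => measurable_sub v

theorem measurable_glue_uncurry : Measurable fun q : (Env × Env) × Vertex => glue q.2 q.1.1 q.1.2 :=
  measurable_from_prod_countable_left fun v => measurable_glue v

theorem measurable_past (t : ℕ) : Measurable (past t) := by
  refine Measurable.prodMk ?_ (by fun_prop)
  exact measurable_glue_uncurry.comp (f := fun z : Sample => ((z.1, fun _ => (1, 0)), z.2 t))
    (by fun_prop)

theorem measurable_next (t : ℕ) : Measurable (next t) := by
  refine Measurable.prodMk ?_ ?_
  · exact measurable_sub_uncurry.comp (f := fun z : Sample => (z.1, z.2 t)) (by fun_prop)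
  · refine measurable_pi_lambda _ fun s => ?_
    exact (measurable_of_countable fun q : Vertex × Vertex => strip q.1.length q.2).comp
      (f := fun z : Sample => (z.2 t, z.2 (t + s))) (by fun_prop)

theorem measurableSet_path_pair (s t : ℕ) (R : Vertex → Vertex → Prop) :
    MeasurableSet {X : ℕ → Vertex | R (X s) (X t)} :=
  (Set.to_countable {q : Vertex × Vertex | R q.1 q.2}).measurableSet.preimage
    (f := fun X : ℕ → Vertex => (X s, X t)) (by fun_prop)

theorem measurableSet_isFresh (t : ℕ) : MeasurableSet {X | IsFresh X t} := by
  unfold IsFresh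
  rw [Set.ofPred_forall]
  refine MeasurableSet.iInter fun s => ?_
  rw [Set.ofPred_forall]
  exact MeasurableSet.iInter fun _ => measurableSet_path_pair t s fun x y => ¬ x <:+ y

theorem measurableSet_isRegen (t : ℕ) : MeasurableSet {X | IsRegen X t} := by
  refine (measurableSet_isFresh t).inter (?_ : MeasurableSet {X : ℕ → Vertex | ∀ s ≥ t, X t <:+ X s})
  rw [Set.ofPred_forall]
  refine MeasurableSet.iInter fun s => ?_
  rw [Set.ofPred_forall]
  exact MeasurableSet.iInter fun _ => measurableSet_path_pair t s fun x y => x <:+ y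

/-- The law of the tree and of the walk, without conditioning. -/
noncomputable def freeLaw (p : PMF ℕ) (ν : Measure ℝ) : Measure Sample := envLaw p ν ⊗ₘ walkKernel

/-- The law of the tree and the walk, when the root is given an additional parent, restricted to
the event that the walk does not go there. -/
noncomputable def escapeLaw (p : PMF ℕ) (ν : Measure ℝ) : Measure Sample :=
  ((freeLaw p ν).withDensity fun z => weight z.1 z.2).map (Prod.map (sub []) id)

variable (p : PMF ℕ) (ν : Measure ℝ)

theorem lintegral_escapeLaw {G : Sample → ℝ≥0∞} (hG : Measurable G) :
    ∫⁻ z, G z ∂escapeLaw p ν =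
      ∫⁻ z, weight z.1 z.2 * G (sub [] z.1, z.2) ∂freeLaw p ν := by
  have hm : Measurable (Prod.map (sub []) (id : (ℕ → Vertex) → _)) :=
    (measurable_sub []).prodMap measurable_id
  have hc : Measurable fun z => G (Prod.map (sub []) (id : (ℕ → Vertex) → _) z) := hG.comp hm
  rw [escapeLaw, lintegral_map hG hm, lintegral_withDensity_eq_lintegral_mul _ measurable_weight hc]
  rfl

theorem lintegral_walk_stays (ω : Env) {v : Vertex} (hv : v ≠ []) {G : Sample → ℝ≥0∞}
    (hG : Measurable G) :
    ∫⁻ X, {X : ℕ → Vertex | ∀ s, X 0 <:+ X s}.indicator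
        (fun X => G (sub (X 0) ω, fun s => strip (X 0).length (X s))) X ∂walkFrom (ω, v) =
      ∫⁻ X, weight (sub v ω) X * G (sub v ω, X) ∂walkFrom (sub v ω, []) := by
  have hw : Measurable (weight (sub v ω)) := measurable_weight.comp (measurable_prodMk_left (x := sub v ω))
  have hG' : Measurable fun X => G (sub v ω, X) := hG.comp measurable_prodMk_left
  have := lintegral_withDensity_eq_lintegral_mul (walkFrom (sub v ω, [])) hw hG'
  simp only [Pi.mul_apply] at this
  rw [← this, ← map_strip_restrict_staysIn ω hv, lintegral_map hG' (measurable_strip_path _),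
    ← lintegral_indicator (measurableSet_staysIn v)]
  refine lintegral_congr_ae ?_
  classical
  filter_upwards [walkFrom_zero_ne ω v] with X hX
  simp only [Set.indicator_apply, Set.mem_ofPred_eq, hX]

variable [IsProbabilityMeasure ν]

/-- Invariance of `h` under gluing says that it depends on the environment outside the subtree at
`v` only; resampling the subtree then factorises the integral. -/
theorem lintegral_envLaw_glue (v : Vertex) {h r : Env → ℝ≥0∞} (hh : Measurable h) (hr : Measurable r)
    (hglue : ∀ ω ω', h (glue v ω ω') = h ω) :
    ∫⁻ ω, h ω * r (sub v ω) ∂envLaw p ν =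
      (∫⁻ ω, h ω ∂envLaw p ν) * ∫⁻ ω, r (sub [] ω) ∂envLaw p ν := by
  conv_lhs => rw [← map_glue_envLaw p ν v]
  have hm : Measurable fun ω => h ω * r (sub v ω) := hh.mul (hr.comp (measurable_sub v))
  rw [lintegral_map hm (measurable_glue v)]
  simp only [hglue, sub_glue]
  exact lintegral_prod_mul hh.aemeasurable (hr.comp (measurable_sub [])).aemeasurable

/-- The regeneration property: at a regeneration time, the future is independent of the past. -/
theorem lintegral_freeLaw_regen {t : ℕ} (ht : 1 ≤ t) {F G : Sample → ℝ≥0∞} (hF : Measurable F)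
    (hG : Measurable G) :
    ∫⁻ z in {z | IsRegen z.2 t}, F (past t z) * G (next t z) ∂freeLaw p ν =
      (∫⁻ z in {z | IsFresh z.2 t}, F (past t z) ∂freeLaw p ν) * ∫⁻ z, G z ∂escapeLaw p ν := by
  classical
  have hR : MeasurableSet {z : Sample | IsRegen z.2 t} := (measurableSet_isRegen t).preimage measurable_snd
  have hFr : MeasurableSet {z : Sample | IsFresh z.2 t} := (measurableSet_isFresh t).preimage measurable_snd
  set r : Env → ℝ≥0∞ := fun ω => ∫⁻ X, weight ω X * G (ω, X) ∂walkKernel ω with hr_def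
  have hr : Measurable r :=
    Measurable.lintegral_kernel_prod_right' (f := fun z : Sample => weight z.1 z.2 * G z)
      (measurable_weight.mul hG)
  set f : Sample → ℝ≥0∞ := fun z =>
    {z : Sample | IsFresh z.2 t}.indicator (fun z => F (past t z)) z with hf_def
  have hf : Measurable f := (hF.comp (measurable_past t)).indicator hFr
  have hfloc : ∀ ω X X', (∀ i ≤ t, X i = X' i) → f (ω, X) = f (ω, X') := by
    intro ω X X' h
    have h1 : past t (ω, X) = past t (ω, X') := by
      simp only [past, h t le_rfl]
      congr 1
      funext s
      exact h _ (min_le_right _ _)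
    have h2 : IsFresh X t ↔ IsFresh X' t := by
      unfold IsFresh
      refine forall_congr' fun s => forall_congr' fun hs => ?_
      rw [h t le_rfl, h s hs.le]
    simp only [hf_def, Set.indicator_apply, Set.mem_ofPred_eq, h1, h2]
  have hnil : ∀ ω, ∀ᵐ X ∂walkFrom (ω, []), f (ω, X) ≠ 0 → X t ≠ [] := by
    intro ω
    filter_upwards [walkFrom_zero_ne ω []] with X hX hfX hXt
    refine hfX (Set.indicator_of_notMem ?_ _)
    intro h
    exact h 0 (by omega) (by change X t <:+ X 0; rw [hXt, hX])
  -- For a fixed environment, the Markov property at time `t` replaces the future by its conditional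
  -- expectation, a function `r` of the subtree at `X t`. Freshness excludes `X t = []`.
  have quenched : ∀ ω, ∫⁻ X, {z : Sample | IsRegen z.2 t}.indicator
        (fun z => F (past t z) * G (next t z)) (ω, X) ∂walkKernel ω =
      ∫⁻ X, f (ω, X) * r (sub (X t) ω) ∂walkKernel ω := by
    intro ω
    set g : (ℕ → Vertex) → ℝ≥0∞ := {X : ℕ → Vertex | ∀ s, X 0 <:+ X s}.indicator
        (fun X => G (sub (X 0) ω, fun s => strip (X 0).length (X s))) with hg_def
    have hg : Measurable g := by
      refine Measurable.indicator ?_ ?_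
      · refine hG.comp (Measurable.prodMk ?_ ?_)
        · exact measurable_sub_uncurry.comp (f := fun X : ℕ → Vertex => (ω, X 0)) (by fun_prop)
        · refine measurable_pi_lambda _ fun s => ?_
          exact (measurable_of_countable fun q : Vertex × Vertex => strip q.1.length q.2).comp
            (f := fun X : ℕ → Vertex => (X 0, X s)) (by fun_prop)
      · rw [Set.ofPred_forall]
        exact MeasurableSet.iInter fun s => measurableSet_path_pair 0 s fun x y => x <:+ y
    rw [walkKernel_apply]
    have key := lintegral_mul_shift ω [] t (f := fun X => f (ω, X)) (hfloc ω) hg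
    refine Eq.trans ?_ (key.trans ?_)
    · refine lintegral_congr fun X => ?_
      simp only [hf_def, hg_def]
      have : shift t X ∈ {X : ℕ → Vertex | ∀ s, X 0 <:+ X s} ↔ ∀ s ≥ t, X t <:+ X s := by
        constructor
        · intro h s hs
          have : X (t + 0) <:+ X (t + (s - t)) := h (s - t)
          rwa [add_zero, show t + (s - t) = s by omega] at this
        · intro h s
          exact h _ (by omega)
      by_cases h1 : IsFresh X t
      · rw [Set.indicator_of_mem (s := {z : Sample | IsFresh z.2 t}) h1]
        by_cases h2 : ∀ s ≥ t, X t <:+ X s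
        · rw [Set.indicator_of_mem (s := {z : Sample | IsRegen z.2 t}) ⟨h1, h2⟩,
            Set.indicator_of_mem (this.2 h2)]
          rfl
        · rw [Set.indicator_of_notMem (s := {z : Sample | IsRegen z.2 t}) fun h => h2 h.2,
            Set.indicator_of_notMem (mt this.1 h2), mul_zero]
      · rw [Set.indicator_of_notMem (s := {z : Sample | IsFresh z.2 t}) h1,
          Set.indicator_of_notMem (s := {z : Sample | IsRegen z.2 t}) fun h => h1 h.1, zero_mul]
    · refine lintegral_congr_ae ?_
      filter_upwards [hnil ω] with X hX
      by_cases h0 : f (ω, X) = 0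
      · simp only [h0, zero_mul]
      · rw [hg_def, lintegral_walk_stays ω (hX h0) hG, hr_def]
        simp only [walkKernel_apply]
  have hFG : Measurable fun z => {z : Sample | IsRegen z.2 t}.indicator
      (fun z => F (past t z) * G (next t z)) z :=
    Measurable.indicator ((hF.comp (measurable_past t)).mul (hG.comp (measurable_next t))) hR
  rw [← lintegral_indicator hR, ← lintegral_indicator hFr, freeLaw,
    Measure.lintegral_compProd hFG, Measure.lintegral_compProd hf]
  simp only [quenched]
  have hrm : ∀ v, Measurable fun ω => r (sub v ω) := fun v => hr.comp (measurable_sub v)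
  -- The subtree sits at a random vertex. Summing over the path up to time `t` makes this vertex
  -- deterministic, so that the independence of the inside and the outside of a fixed subtree
  -- applies.
  have sum1 : ∀ ω, ∫⁻ X, f (ω, X) * r (sub (X t) ω) ∂walkKernel ω =
      ∑' y : Fin (t + 1) → Vertex, (f (ω, extend y) * walkFrom (ω, []) {X | ∀ i ≤ t, X i = extend y i}) *
        r (sub (extend y t) ω) := by
    intro ω
    rw [walkKernel_apply, lintegral_eq_tsum_cylinder _ t]
    refine tsum_congr fun y => ?_
    rw [mul_right_comm, ← setLIntegral_const]
    refine setLIntegral_congr_fun (measurableSet_cylinder _ _) fun X hX => ?_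
    simp only [hfloc ω X (extend y) hX, hX t le_rfl]
  have sum2 : ∀ ω, ∫⁻ X, f (ω, X) ∂walkKernel ω =
      ∑' y : Fin (t + 1) → Vertex, f (ω, extend y) * walkFrom (ω, []) {X | ∀ i ≤ t, X i = extend y i} := by
    intro ω
    rw [walkKernel_apply, lintegral_eq_tsum_cylinder _ t]
    refine tsum_congr fun y => ?_
    rw [← setLIntegral_const]
    refine setLIntegral_congr_fun (measurableSet_cylinder _ _) fun X hX => ?_
    simp only [hfloc ω X (extend y) hX]
  have hWm : ∀ y : ℕ → Vertex, Measurable fun ω => walkFrom (ω, []) {X | ∀ i ≤ t, X i = y i} := by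
    intro y
    exact (Kernel.measurable_coe walkFrom (measurableSet_cylinder y t)).comp
      (f := fun ω : Env => (ω, ([] : Vertex))) (by fun_prop)
  have hhm : ∀ y : ℕ → Vertex, Measurable fun ω =>
      f (ω, y) * walkFrom (ω, []) {X | ∀ i ≤ t, X i = y i} := fun y =>
    (hf.comp measurable_prodMk_right).mul (hWm y)
  simp only [sum1, sum2]
  have hhrm : ∀ y : ℕ → Vertex, Measurable fun ω =>
      f (ω, y) * walkFrom (ω, []) {X | ∀ i ≤ t, X i = y i} * r (sub (y t) ω) := fun y =>
    (hhm y).mul (hrm _)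
  rw [lintegral_tsum fun y => (hhrm (extend y)).aemeasurable,
    lintegral_tsum fun y => (hhm (extend y)).aemeasurable, ← ENNReal.tsum_mul_right]
  have hrG : ∫⁻ ω, r (sub [] ω) ∂envLaw p ν = ∫⁻ z, G z ∂escapeLaw p ν := by
    rw [lintegral_escapeLaw p ν hG, freeLaw, Measure.lintegral_compProd]
    · refine lintegral_congr fun ω => ?_
      simp only [hr_def, weight_sub_nil, walkKernel_apply, walkFrom_sub_nil]
    · exact measurable_weight.mul (hG.comp ((measurable_sub []).prodMap measurable_id))
  refine tsum_congr fun y => ?_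
  rw [← hrG]
  refine lintegral_envLaw_glue p ν (extend y t) (hhm _) hr fun ω ω' => ?_
  -- Along a fresh path all jumps before time `t` start outside the subtree, so their probabilities
  -- do not feel the gluing; a path that is not fresh contributes nothing.
  by_cases hfr : IsFresh (extend y) t
  · congr 1
    · simp only [hf_def, Set.indicator_apply, Set.mem_ofPred_eq, past, glue_glue]
    · rw [walkFrom_cylinder, walkFrom_cylinder]
      congr 1
      refine Finset.prod_congr rfl fun i hi => ?_
      rw [jump_glue _ _ (hfr i (Finset.mem_range.1 hi))]
  · have : ∀ ω, f (ω, extend y) = 0 := fun ω => Set.indicator_of_notMem hfr _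
    rw [this, this, zero_mul, zero_mul]

end Env

/-! ### Membership and survival of subtrees -/

namespace Env

theorem mem_append (ω : Env) (y v : Vertex) : ω.Mem (y ++ v) ↔ ω.Mem v ∧ (sub v ω).Mem y := by
  induction y with
  | nil => simp [Mem]
  | cons i y ih =>
    rw [List.cons_append, Mem, ih, Mem]
    simp only [sub]
    tauto

theorem mem_congr {ω ω' : Env} {v : Vertex} (h : ∀ w, w <:+ v → w ≠ v → (ω w).1 = (ω' w).1) :
    ω.Mem v ↔ ω'.Mem v := by
  induction v with
  | nil => simp [Mem]
  | cons i v ih =>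
    rw [Mem, Mem, h v (List.suffix_cons i v) (by simp), ih fun w hw hne => h w (hw.trans (List.suffix_cons i v)) ?_]
    rintro rfl
    have := hw.length_le
    simp at this

theorem mem_sub_nil (ω : Env) (v : Vertex) : (sub [] ω).Mem v ↔ ω.Mem v :=
  mem_congr fun w _ _ => by simp [sub]

theorem sub_sub (ω : Env) (v w : Vertex) : sub w (sub v ω) = sub (w ++ v) ω := by
  funext y
  simp only [sub, List.append_assoc]
  split_ifs with h1 h2
  · rfl
  · simp_all
  · rfl

theorem Mem.of_suffix {ω : Env} {v w : Vertex} (h : ω.Mem w) (hvw : v <:+ w) : ω.Mem v := by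
  obtain ⟨y, rfl⟩ := hvw
  exact ((mem_append ω y v).1 h).1

/-- The subtree at `v` is infinite. -/
def Survives (ω : Env) (v : Vertex) : Prop := {y | (sub v ω).Mem y}.Infinite

theorem survives_sub (ω : Env) (v w : Vertex) : Survives (sub v ω) w ↔ Survives ω (w ++ v) := by
  rw [Survives, Survives, sub_sub]

theorem survives_nil (ω : Env) : Survives ω [] ↔ {v | ω.Mem v}.Infinite := by
  simp only [Survives, mem_sub_nil]

theorem Survives.exists_child {ω : Env} {v : Vertex} (h : Survives ω v) :
    ∃ i < (ω v).1, Survives ω (i :: v) := by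
  by_contra! hne
  refine h ?_
  have hfin : ({[]} ∪ ⋃ i ∈ Finset.range (ω v).1, (fun y => y ++ [i]) '' {y | (sub (i :: v) ω).Mem y} :
      Set Vertex).Finite := by
    refine (Set.finite_singleton _).union (Set.Finite.biUnion (Finset.finite_toSet _) fun i hi => ?_)
    exact (Set.not_infinite.1 (hne i (Finset.mem_range.1 hi))).image _
  refine hfin.subset fun y hy => ?_
  rcases List.eq_nil_or_concat y with rfl | ⟨y, i, rfl⟩
  · exact Or.inl rfl
  · right
    rw [List.concat_eq_append] at hy ⊢
    rw [Set.mem_ofPred_eq, mem_append, sub_sub] at hy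
    simp only [Set.mem_iUnion]
    refine ⟨i, ?_, y, hy.2, rfl⟩
    have := hy.1.2
    simpa [sub] using this

theorem survives_of_path {ω : Env} {x : ℕ → Vertex}
    (hx : ∀ n, ∃ i < (ω (x n)).1, x (n + 1) = i :: x n) : Survives ω (x 0) := by
  have : ∀ n, ∃ y, y.length = n ∧ x n = y ++ x 0 ∧ (sub (x 0) ω).Mem y := by
    intro n
    induction n with
    | zero => exact ⟨[], rfl, rfl, trivial⟩
    | succ n ih =>
      obtain ⟨y, h1, h2, h3⟩ := ih
      obtain ⟨i, hi, hi'⟩ := hx n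
      refine ⟨i :: y, by simp [h1], by rw [hi', h2]; rfl, h3, ?_⟩
      rw [h2] at hi
      exact hi
  choose y h1 h2 h3 using this
  refine Set.infinite_of_injective_forall_mem (f := y) (fun a b hab => ?_) h3
  rw [← h1 a, ← h1 b, hab]

theorem Survives.exists_path {ω : Env} {v : Vertex} (h : Survives ω v) :
    ∃ x : ℕ → Vertex, x 0 = v ∧ (∀ n, ∃ i < (ω (x n)).1, x (n + 1) = i :: x n) ∧
      ∀ n, Survives ω (x n) := by
  have hc : ∀ w : {w : Vertex // Survives ω w}, ∃ w' : {w : Vertex // Survives ω w},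
      ∃ i < (ω w.1).1, w'.1 = i :: w.1 := by
    rintro ⟨w, hw⟩
    obtain ⟨i, hi, hi'⟩ := hw.exists_child
    exact ⟨⟨_, hi'⟩, i, hi, rfl⟩
  choose f hf using hc
  refine ⟨fun n => (f^[n] ⟨v, h⟩).1, rfl, fun n => ?_, fun n => (f^[n] ⟨v, h⟩).2⟩
  simp only [Function.iterate_succ_apply']
  exact hf _

theorem Survives.parent {ω : Env} {i : ℕ} {v : Vertex} (h : Survives ω (i :: v)) (hi : i < (ω v).1) :
    Survives ω v := by
  obtain ⟨x, h0, hx, _⟩ := h.exists_path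
  have := survives_of_path (ω := ω) (x := fun n => Nat.casesOn n v x) (fun n => by
    cases n with
    | zero => exact ⟨i, hi, h0⟩
    | succ n => exact hx n)
  exact this

theorem Survives.of_suffix {ω : Env} {v w : Vertex} (hw : ω.Mem w) (h : Survives ω w) (hvw : v <:+ w) :
    Survives ω v := by
  obtain ⟨y, rfl⟩ := hvw
  induction y with
  | nil => exact h
  | cons i y ih => exact ih hw.1 (h.parent hw.2)

theorem measurableSet_mem (v : Vertex) : MeasurableSet {ω : Env | ω.Mem v} := by
  induction v with
  | nil => simp [Mem]
  | cons i v ih =>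
    refine ih.inter (?_ : MeasurableSet {ω : Env | i < (ω v).1})
    exact (Set.to_countable (Set.Ioi i)).measurableSet.preimage
      (f := fun ω : Env => (ω v).1) (by fun_prop)

/-- Finiteness means containment in one of the countably many finite sets of addresses. -/
theorem measurableSet_survives (v : Vertex) : MeasurableSet {ω : Env | Survives ω v} := by
  have : {ω : Env | Survives ω v} = (⋃ F : Finset Vertex, ⋂ y, {ω : Env | (sub v ω).Mem y → y ∈ F})ᶜ := by
    ext ω
    simp only [Set.mem_ofPred_eq, Set.mem_compl_iff, Set.mem_iUnion, Set.mem_iInter, Survives]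
    rw [Set.Infinite, not_iff_not]
    constructor
    · intro h
      exact ⟨h.toFinset, fun y hy => by simpa using hy⟩
    · rintro ⟨F, hF⟩
      exact F.finite_toSet.subset hF
  rw [this]
  refine (MeasurableSet.iUnion fun F => MeasurableSet.iInter fun y => ?_).compl
  by_cases hy : y ∈ F
  · simp [hy]
  · simp only [hy, imp_false]
    exact ((measurableSet_mem y).preimage (measurable_sub v)).compl

/-! ### Survival of the supercritical Galton-Watson tree -/

theorem sub_glue_of_ne (ω ω' : Env) {i j : ℕ} (h : i ≠ j) :
    sub [i] (glue [j] ω ω') = sub [i] ω := by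
  funext y
  have : ¬ [j] <:+ y ++ [i] := by
    intro hs
    have := List.suffix_of_suffix_length_le hs (List.suffix_append y [i]) (by simp)
    have := this.eq_of_length (by simp)
    exact h (List.cons.inj this).1.symm
  simp only [sub, glue_of_not_suffix _ _ this]

/-- The subtrees at the children are resampled one at a time; the others and the root's offspring
number are not affected. -/
theorem lintegral_children (p : PMF ℕ) (ν : Measure ℝ) [IsProbabilityMeasure ν] {g : ℕ → ℝ≥0∞}
    {A : Set Env} (hA : MeasurableSet A) (hA' : ∀ ω, sub [] ω ∈ A ↔ ω ∈ A) (k : ℕ) :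
    ∫⁻ ω, g (ω []).1 * ∏ i ∈ Finset.range k, A.indicator 1 (sub [i] ω) ∂envLaw p ν =
      (∫⁻ ω, g (ω []).1 ∂envLaw p ν) * envLaw p ν A ^ k := by
  have hg : Measurable fun ω : Env => g (ω []).1 :=
    (measurable_of_countable g).comp (f := fun ω : Env => (ω []).1) (by fun_prop)
  have hi : Measurable (A.indicator (1 : Env → ℝ≥0∞)) := measurable_one.indicator hA
  induction k with
  | zero => simp
  | succ k ih =>
    simp only [Finset.prod_range_succ, ← mul_assoc]
    rw [lintegral_envLaw_glue p ν [k] (r := A.indicator 1)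
      (h := fun ω => g (ω []).1 * ∏ i ∈ Finset.range k, A.indicator 1 (sub [i] ω)) ?_ hi, ih, pow_succ,
      mul_assoc]
    · congr 2
      rw [← lintegral_indicator_one hA]
      refine lintegral_congr fun ω => ?_
      by_cases h : ω ∈ A
      · rw [Set.indicator_of_mem h, Set.indicator_of_mem ((hA' ω).2 h)]
        rfl
      · rw [Set.indicator_of_notMem h, Set.indicator_of_notMem (mt (hA' ω).1 h)]
    · intro ω ω'
      rw [glue_of_not_suffix _ _ (by simp)]
      congr 1
      refine Finset.prod_congr rfl fun i hi => ?_
      rw [sub_glue_of_ne _ _ (Finset.mem_range.1 hi).ne]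
    · exact hg.mul (Finset.measurable_prod _ fun i _ => hi.comp (measurable_sub [i]))

theorem envLaw_offspring (p : PMF ℕ) (ν : Measure ℝ) [IsProbabilityMeasure ν] (v : Vertex) (m : ℕ) :
    envLaw p ν {ω | (ω v).1 = m} = p m := by
  have h := (measurePreserving_eval_infinitePi (fun _ : Vertex => p.toMeasure.prod ν) v).measure_preimage
    (s := {m} ×ˢ Set.univ) (by measurability)
  rw [Measure.prod_prod, measure_univ, mul_one,
    p.toMeasure_apply_singleton _ (measurableSet_singleton m)] at h
  rw [← h, envLaw]
  congr 1
  ext ω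
  simp

/-- The tree is extinct before generation `n`. -/
def extinct (n : ℕ) : Set Env := {ω | ∀ y : Vertex, y.length = n → ¬ ω.Mem y}

theorem measurableSet_extinct (n : ℕ) : MeasurableSet (extinct n) := by
  rw [extinct, Set.ofPred_forall]
  refine MeasurableSet.iInter fun y => ?_
  rw [Set.ofPred_forall]
  exact MeasurableSet.iInter fun _ => (measurableSet_mem y).compl

theorem extinct_succ (n m : ℕ) : {ω : Env | (ω []).1 = m} ∩ extinct (n + 1) =
    {ω : Env | (ω []).1 = m} ∩ {ω | ∀ i < m, sub [i] ω ∈ extinct n} := by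
  ext ω
  simp only [Set.mem_inter_iff, Set.mem_ofPred_eq, extinct, and_congr_right_iff]
  rintro rfl
  constructor
  · intro h i hi y hy hm
    refine h (y ++ [i]) (by simp [hy]) ((mem_append _ _ _).2 ⟨⟨trivial, hi⟩, hm⟩)
  · intro h y hy hm
    rcases List.eq_nil_or_concat y with rfl | ⟨y, i, rfl⟩
    · simp at hy
    · rw [List.concat_eq_append] at hy hm
      rw [mem_append] at hm
      exact h i hm.1.2 y (by simpa using hy) hm.2

/-- The generating function has slope greater than `1` at `1`, hence lies below the diagonal just to
the left of `1`. -/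
theorem exists_subinvariant (p : PMF ℕ) (hmean : 1 < ∑' i : ℕ, (i : ℝ≥0∞) * p i) :
    ∃ s : ℝ≥0∞, s < 1 ∧ ∑' m, p m * s ^ m ≤ s := by
  -- The mean may be infinite, so finitely many terms with sum greater than `1` are selected. On
  -- these, `1 - x ^ i = (1 - x) * ∑ x ^ j`, and continuity at `1` is available.
  obtain ⟨F, hF⟩ : ∃ F : Finset ℕ, 1 < ∑ i ∈ F, (i : ℝ≥0∞) * p i := by
    rw [ENNReal.tsum_eq_iSup_sum] at hmean
    exact lt_iSup_iff.1 hmean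
  have hpt : ∀ i, p i ≠ ∞ := fun i => p.apply_ne_top i
  set c : ℕ → ℝ := fun i => (p i).toReal
  have hc : ∀ i, 0 ≤ c i := fun i => ENNReal.toReal_nonneg
  have hF' : 1 < ∑ i ∈ F, c i * ∑ _j ∈ Finset.range i, (1 : ℝ) := by
    have h1 : ∑ i ∈ F, (i : ℝ≥0∞) * p i = ENNReal.ofReal (∑ i ∈ F, c i * ∑ _j ∈ Finset.range i, (1 : ℝ)) := by
      rw [ENNReal.ofReal_sum_of_nonneg fun i _ => mul_nonneg (hc i) (by simp)]
      refine Finset.sum_congr rfl fun i _ => ?_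
      rw [ENNReal.ofReal_mul (hc i), ENNReal.ofReal_toReal (hpt i), mul_comm]
      simp
    rw [h1, ← ENNReal.ofReal_one, ENNReal.ofReal_lt_ofReal_iff'] at hF
    exact hF.1
  have hcont : Continuous fun x : ℝ => ∑ i ∈ F, c i * ∑ j ∈ Finset.range i, x ^ j := by fun_prop
  have hev : ∀ᶠ x in 𝓝[<] (1 : ℝ), 1 < ∑ i ∈ F, c i * ∑ j ∈ Finset.range i, x ^ j := by
    refine (hcont.tendsto 1).mono_left nhdsWithin_le_nhds |>.eventually_const_lt ?_
    simpa using hF'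
  have hev0 : ∀ᶠ x in 𝓝[<] (1 : ℝ), 0 < x := nhdsWithin_le_nhds (lt_mem_nhds zero_lt_one)
  obtain ⟨x, hx, hx0, hx1⟩ := (hev.and (hev0.and self_mem_nhdsWithin)).exists
  have hx1' : x < 1 := hx1
  refine ⟨ENNReal.ofReal x, by rw [← ENNReal.ofReal_one]; exact (ENNReal.ofReal_lt_ofReal_iff one_pos).2 hx1, ?_⟩
  set s := ENNReal.ofReal x with hs
  have hs1 : s ≤ 1 := by rw [hs, ← ENNReal.ofReal_one]; exact ENNReal.ofReal_le_ofReal hx1'.le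
  have h1 : 1 - s ≤ ∑ i ∈ F, p i * (1 - s ^ i) := by
    have e1 : 1 - s = ENNReal.ofReal (1 - x) := by
      rw [ENNReal.ofReal_sub _ hx0.le, ENNReal.ofReal_one]
    have e2 : ∀ i, p i * (1 - s ^ i) = ENNReal.ofReal (c i * (1 - x ^ i)) := by
      intro i
      rw [ENNReal.ofReal_mul (hc i), ENNReal.ofReal_toReal (hpt i),
        ENNReal.ofReal_sub _ (by positivity), ENNReal.ofReal_one, ENNReal.ofReal_pow hx0.le]
    have hpow : ∀ i : ℕ, 0 ≤ 1 - x ^ i := fun i => by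
      have := pow_le_one₀ hx0.le hx1'.le (n := i)
      linarith
    simp only [e1, e2]
    rw [← ENNReal.ofReal_sum_of_nonneg fun i _ => mul_nonneg (hc i) (hpow i)]
    apply ENNReal.ofReal_le_ofReal
    have e3 : ∑ i ∈ F, c i * (1 - x ^ i) = (1 - x) * ∑ i ∈ F, c i * ∑ j ∈ Finset.range i, x ^ j := by
      rw [Finset.mul_sum]
      refine Finset.sum_congr rfl fun i _ => ?_
      rw [← mul_neg_geom_sum x i]
      ring
    rw [e3]
    nlinarith
  have h2 : ∑' m, p m * s ^ m + (1 - s) ≤ 1 := by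
    calc ∑' m, p m * s ^ m + (1 - s)
        ≤ ∑' m, p m * s ^ m + ∑' m, p m * (1 - s ^ m) := by
          gcongr
          exact h1.trans (ENNReal.sum_le_tsum F)
      _ = ∑' m, (p m * s ^ m + p m * (1 - s ^ m)) := ENNReal.tsum_add.symm
      _ = ∑' m, p m := by
          refine tsum_congr fun m => ?_
          rw [← mul_add, add_tsub_cancel_of_le (pow_le_one₀ bot_le hs1), mul_one]
      _ = 1 := p.tsum_coe
  have h3 : ∑' m, p m * s ^ m + (1 - s) ≤ s + (1 - s) := by
    rwa [add_tsub_cancel_of_le hs1]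
  exact (ENNReal.add_le_add_iff_right (by simp)).1 h3

/-- By branching at the root, the probabilities of extinction before generation `n` iterate the
generating function from `0`. They never exceed a subinvariant `s < 1`, and neither does their
limit. -/
theorem envLaw_survives_ne_zero (p : PMF ℕ) (ν : Measure ℝ) [IsProbabilityMeasure ν]
    (hmean : 1 < ∑' i : ℕ, (i : ℝ≥0∞) * p i) : envLaw p ν {ω | Survives ω []} ≠ 0 := by
  obtain ⟨s, hs1, hs⟩ := exists_subinvariant p hmean
  have hrec : ∀ n, envLaw p ν (extinct (n + 1)) = ∑' m, p m * envLaw p ν (extinct n) ^ m := by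
    intro n
    have hD : ∀ m, MeasurableSet {ω : Env | (ω []).1 = m} := fun m =>
      (measurableSet_singleton m).preimage (f := fun ω : Env => (ω []).1) (by fun_prop)
    have hu : extinct (n + 1) = ⋃ m, {ω : Env | (ω []).1 = m} ∩ extinct (n + 1) := by
      ext ω; simp
    rw [hu, measure_iUnion ?_ fun m => (hD m).inter (measurableSet_extinct _)]
    · refine tsum_congr fun m => ?_
      have key := lintegral_children p ν (g := ({m} : Set ℕ).indicator 1) (measurableSet_extinct n)
        (fun ω => by simp only [extinct, Set.mem_ofPred_eq, mem_sub_nil]) m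
      have e1 : ∫⁻ ω, ({m} : Set ℕ).indicator 1 (ω []).1 ∂envLaw p ν = p m := by
        rw [← envLaw_offspring p ν [] m, ← lintegral_indicator_one (hD m)]
        rfl
      rw [e1] at key
      rw [← key, extinct_succ, ← lintegral_indicator_one]
      · refine lintegral_congr fun ω => ?_
        classical
        by_cases h1 : (ω []).1 = m
        · by_cases h2 : ∀ i < m, sub [i] ω ∈ extinct n
          · rw [Set.indicator_of_mem (by exact ⟨h1, h2⟩), Set.indicator_of_mem (by exact h1),
              Finset.prod_eq_one]
            · simp
            · intro i hi
              rw [Set.indicator_of_mem (h2 i (Finset.mem_range.1 hi))]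
              rfl
          · rw [Set.indicator_of_notMem fun h => h2 h.2]
            push Not at h2
            obtain ⟨i, hi, hi'⟩ := h2
            rw [Finset.prod_eq_zero (Finset.mem_range.2 hi) (Set.indicator_of_notMem hi' _), mul_zero]
        · rw [Set.indicator_of_notMem fun h => h1 h.1, Set.indicator_of_notMem (by exact h1), zero_mul]
      · rw [← extinct_succ]
        exact (hD m).inter (measurableSet_extinct _)
    · intro m m' hne
      exact Set.disjoint_left.2 fun ω h h' => hne (h.1.symm.trans h'.1)
  have hle : ∀ n, envLaw p ν (extinct n) ≤ s := by
    intro n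
    induction n with
    | zero =>
      have : extinct 0 = ∅ := by
        ext ω
        simp only [extinct, Set.mem_ofPred_eq, Set.mem_empty_iff_false, iff_false, not_forall, not_not]
        exact ⟨[], rfl, trivial⟩
      rw [this, measure_empty]
      exact bot_le
    | succ n ih =>
      rw [hrec]
      refine le_trans ?_ hs
      gcongr
  have hmono : Monotone extinct := by
    refine monotone_nat_of_le_succ fun n ω h y hy hm => ?_
    cases y with
    | nil => simp at hy
    | cons i y => exact h y (by simpa using hy) hm.1
  have hsub : {ω | Survives ω []}ᶜ ⊆ ⋃ n, extinct n := by
    intro ω hω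
    by_contra h
    simp only [Set.mem_iUnion, not_exists] at h
    refine hω ((survives_nil ω).2 ?_)
    have : ∀ n, ∃ y : Vertex, y.length = n ∧ ω.Mem y := by
      intro n
      by_contra! h'
      exact h n h'
    choose y h1 h2 using this
    refine Set.infinite_of_injective_forall_mem (f := y) (fun a b hab => ?_) h2
    rw [← h1 a, ← h1 b, hab]
  intro h0
  have h1 : envLaw p ν {ω | Survives ω []}ᶜ = 1 :=
    (prob_compl_eq_one_iff (measurableSet_survives [])).2 h0
  have h2 : envLaw p ν (⋃ n, extinct n) ≤ s := by
    rw [hmono.measure_iUnion]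
    exact iSup_le hle
  exact absurd (h1 ▸ measure_mono hsub |>.trans h2) (not_le.2 hs1)

end Env

namespace Env

/-! ### Almost sure properties of the walk -/

theorem stayProb_lt_one (ω : Env) : stayProb ω < 1 := by
  rw [stayProb, ← div_eq_mul_inv]
  refine ENNReal.div_lt_of_lt_mul ?_
  rw [one_mul, add_comm]
  exact ENNReal.lt_add_right (childRate_ne_top _ _) one_ne_zero

/-- Each visit to the root contributes a factor `stayProb ω < 1`. -/
theorem finVisits_of_weight_ne_zero {ω : Env} {X : ℕ → Vertex} (h : weight ω X ≠ 0) : FinVisits X := by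
  by_contra hX
  simp only [FinVisits, not_exists] at hX
  push Not at hX
  refine h ?_
  have key : ∀ k : ℕ, ∃ n, weightUpTo ω X n ≤ stayProb ω ^ k := by
    intro k
    induction k with
    | zero => exact ⟨0, by simp [weightUpTo]⟩
    | succ k ih =>
      obtain ⟨n, hn⟩ := ih
      obtain ⟨s, hs, hs'⟩ := hX n
      refine ⟨s + 1, ?_⟩
      rw [weightUpTo, Finset.prod_range_succ, if_pos hs', pow_succ]
      exact mul_le_mul_left ((antitone_weightUpTo ω X hs).trans hn) _
  have := ENNReal.tendsto_pow_atTop_nhds_zero_of_lt_one (stayProb_lt_one ω)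
  refine le_antisymm (ge_of_tendsto' this fun k => ?_) bot_le
  obtain ⟨n, hn⟩ := key k
  exact (iInf_le _ n).trans hn

theorem weight_eq_weightUpTo {ω : Env} {X : ℕ → Vertex} {N : ℕ} (h : ∀ s ≥ N, X s ≠ []) :
    weight ω X = weightUpTo ω X N := by
  refine le_antisymm (iInf_le _ N) (le_iInf fun n => ?_)
  rcases le_total n N with hn | hn
  · exact antitone_weightUpTo ω X hn
  · induction n, hn using Nat.le_induction with
    | base => exact le_rfl
    | succ n hn ih =>
      rw [weightUpTo, weightUpTo, Finset.prod_range_succ, if_neg (h n hn), mul_one]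
      exact ih

theorem weight_ne_zero {ω : Env} {X : ℕ → Vertex} (h : FinVisits X) (hω : stayProb ω ≠ 0) :
    weight ω X ≠ 0 := by
  obtain ⟨N, hN⟩ := h
  rw [weight_eq_weightUpTo hN, weightUpTo, Finset.prod_ne_zero_iff]
  intro s _
  split_ifs
  · exact hω
  · exact one_ne_zero

theorem measurableSet_finVisits : MeasurableSet {X : ℕ → Vertex | FinVisits X} := by
  have : {X : ℕ → Vertex | FinVisits X} = ⋃ N : ℕ, ⋂ s ≥ N, {X : ℕ → Vertex | X s ∈ ({[]}ᶜ : Set Vertex)} := by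
    ext X; simp [FinVisits]
  rw [this]
  exact MeasurableSet.iUnion fun N => MeasurableSet.biInter (Set.to_countable _) fun s _ =>
    measurableSet_path s _

theorem measurableSet_infinite_range : MeasurableSet {X : ℕ → Vertex | (Set.range X).Infinite} := by
  have : {X : ℕ → Vertex | (Set.range X).Infinite} =
      ⋂ F : Finset Vertex, ⋃ s, {X : ℕ → Vertex | X s ∈ ((F : Set Vertex)ᶜ : Set Vertex)} := by
    ext X
    simp only [Set.mem_iInter, Set.mem_iUnion, Set.mem_ofPred_eq]
    constructor
    · intro h F
      by_contra! hF
      exact h (F.finite_toSet.subset (by rintro _ ⟨s, rfl⟩; simpa using hF s))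
    · intro h hf
      obtain ⟨s, hs⟩ := h hf.toFinset
      exact hs (by simp)
  rw [this]
  exact MeasurableSet.iInter fun F => MeasurableSet.iUnion fun s => measurableSet_path s _

theorem measurableSet_step (s : ℕ) : MeasurableSet {z : Sample | Step z.1 (z.2 s) (z.2 (s + 1))} := by
  have : {z : Sample | Step z.1 (z.2 s) (z.2 (s + 1))} =
      (fun z : Sample => ((z.1 (z.2 s)).1, z.2 s, z.2 (s + 1))) ⁻¹'
        {q : ℕ × Vertex × Vertex | q.2.2 = q.2.1.tail ∨ ∃ i < q.1, q.2.2 = i :: q.2.1} := rfl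
  rw [this]
  refine (Set.to_countable _).measurableSet.preimage ?_
  refine Measurable.prodMk ?_ (by fun_prop)
  exact measurable_fst.comp (measurable_eval_env.comp (f := fun z : Sample => (z.1, z.2 s)) (by fun_prop))

/-- The properties of the tree and of a transient walk that hold almost surely; `I` is the set of
possible biases. -/
structure IsGood (I : Set ℝ) (z : Sample) : Prop where
  zero : z.2 0 = []
  step : ∀ s, Step z.1 (z.2 s) (z.2 (s + 1))
  infinite : (Set.range z.2).Infinite
  bias : ∀ v ≠ [], (z.1 v).2 ∈ I

theorem measurableSet_isGood {I : Set ℝ} (hI : MeasurableSet I) : MeasurableSet {z | IsGood I z} := by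
  have : {z : Sample | IsGood I z} = {z : Sample | z.2 0 ∈ ({[]} : Set Vertex)} ∩
      ((⋂ s, {z : Sample | Step z.1 (z.2 s) (z.2 (s + 1))}) ∩
      ({z : Sample | (Set.range z.2).Infinite} ∩
        ⋂ v : Vertex, {z : Sample | v ≠ [] → (z.1 v).2 ∈ I})) := by
    ext z
    simp only [Set.mem_inter_iff, Set.mem_iInter, Set.mem_ofPred_eq, Set.mem_singleton_iff]
    exact ⟨fun h => ⟨h.1, h.2, h.3, h.4⟩, fun h => ⟨h.1, h.2.1, h.2.2.1, h.2.2.2⟩⟩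
  rw [this]
  refine ((measurableSet_path 0 _).preimage measurable_snd).inter
    ((MeasurableSet.iInter measurableSet_step).inter
    ((measurableSet_infinite_range.preimage measurable_snd).inter (MeasurableSet.iInter fun v => ?_)))
  by_cases hv : v = []
  · simp [hv]
  · simp only [ne_eq, hv, not_false_eq_true, forall_const]
    exact hI.preimage (f := fun z : Sample => (z.1 v).2) (by fun_prop)

variable (p : PMF ℕ) (ν : Measure ℝ) [IsProbabilityMeasure ν]

theorem ae_envLaw_bias (v : Vertex) : ∀ᵐ ω ∂envLaw p ν, (ω v).2 ∈ ν.support := by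
  have h1 := measurePreserving_eval_infinitePi (fun _ : Vertex => p.toMeasure.prod ν) v
  have h2 : MeasurePreserving Prod.snd (p.toMeasure.prod ν) ν := measurePreserving_snd
  have h3 := (h2.comp h1).quasiMeasurePreserving.ae (p := (· ∈ ν.support)) Measure.support_mem_ae
  exact h3

theorem ae_freeLaw {P : Sample → Prop} (hP : MeasurableSet {z | P z})
    (h : ∀ᵐ ω ∂envLaw p ν, ∀ᵐ X ∂walkFrom (ω, []), P (ω, X)) : ∀ᵐ z ∂freeLaw p ν, P z := by
  refine Measure.ae_compProd_of_ae_ae hP ?_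
  filter_upwards [h] with ω hω
  rwa [walkKernel_apply]

theorem ae_freeLaw_isGood : ∀ᵐ z ∂freeLaw p ν, FinVisits z.2 → IsGood ν.support z := by
  refine ae_freeLaw p ν ?_ ?_
  · exact (measurableSet_finVisits.preimage measurable_snd).imp
      (measurableSet_isGood Measure.isClosed_support.measurableSet)
  · filter_upwards [ae_all_iff.2 fun v => ae_envLaw_bias p ν v] with ω hω
    filter_upwards [walkFrom_zero_ne ω [], ae_step ω [], ae_not_forall_mem_of_finVisits ω []]
      with X h0 h1 h2 hX
    refine ⟨h0, h1, fun hf => h2 hX hf.toFinset fun s => by simp, fun v _ => hω v⟩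

/-- The support is closed and bounded below, so its infimum belongs to it: the biases are bounded
away from `1`. -/
theorem exists_lt_of_support_subset (hν : ν.support ⊆ Set.Ioi 1) :
    ∃ q : ℝ, 1 < q ∧ ∀ x ∈ ν.support, q ≤ x := by
  have hne : ν.support.Nonempty := by
    rw [Measure.nonempty_support_iff]
    exact IsProbabilityMeasure.ne_zero ν
  have hb : BddBelow ν.support := ⟨1, fun x hx => (hν hx).le⟩
  exact ⟨sInf ν.support, hν (Measure.isClosed_support.csInf_mem hne hb), fun x hx => csInf_le hb hx⟩

/-- A surviving tree contains a ray, so the walk visits the root finitely often, and `weight` is a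
finite product of positive factors. -/
theorem ae_freeLaw_weight_ne_zero (hν : ν.support ⊆ Set.Ioi 1) :
    ∀ᵐ z ∂freeLaw p ν, Survives z.1 [] → weight z.1 z.2 ≠ 0 := by
  obtain ⟨q, hq, hq'⟩ := exists_lt_of_support_subset ν hν
  refine ae_freeLaw p ν ?_ ?_
  · exact ((measurableSet_survives []).preimage measurable_fst).imp
      (measurable_weight (measurableSet_singleton 0).compl)
  · filter_upwards [ae_all_iff.2 fun v => ae_envLaw_bias p ν v] with ω hω
    by_cases hs : Survives ω []
    · obtain ⟨x, h0, hx, -⟩ := hs.exists_path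
      have hr : IsRay ω q x := ⟨h0, hx, fun n => hq' _ (hω _)⟩
      filter_upwards [hr.ae_finVisits hq] with X hX _
      refine weight_ne_zero hX ?_
      obtain ⟨i, hi, -⟩ := hx 0
      rw [h0] at hi
      rw [stayProb]
      refine mul_ne_zero ?_ (by simpa using childRate_ne_top ω [])
      rw [childRate]
      refine fun h => ?_
      rw [Finset.sum_eq_zero_iff] at h
      have := h i (Finset.mem_range.2 hi)
      rw [ENNReal.ofReal_eq_zero] at this
      have := hq' _ (hω [i])
      linarith
    · exact Eventually.of_forall fun X h => absurd h hs

theorem ae_escapeLaw_iff {P : Sample → Prop} (hP : MeasurableSet {z | P z}) :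
    (∀ᵐ z ∂escapeLaw p ν, P z) ↔
      ∀ᵐ z ∂freeLaw p ν, weight z.1 z.2 ≠ 0 → P (sub [] z.1, z.2) := by
  rw [escapeLaw, ae_map_iff ((measurable_sub []).prodMap measurable_id).aemeasurable hP,
    ae_withDensity_iff measurable_weight]
  rfl

instance : IsProbabilityMeasure (freeLaw p ν) := by
  unfold freeLaw; infer_instance

theorem escapeLaw_univ_le_one : escapeLaw p ν Set.univ ≤ 1 := by
  have := lintegral_escapeLaw p ν (G := fun _ => 1) measurable_const
  simp only [lintegral_one, mul_one] at this
  rw [this]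
  calc ∫⁻ z, weight z.1 z.2 ∂freeLaw p ν ≤ ∫⁻ _, 1 ∂freeLaw p ν :=
        lintegral_mono fun z => weight_le_one _ _
    _ = 1 := by simp

theorem escapeLaw_univ_ne_zero (hmean : 1 < ∑' i : ℕ, (i : ℝ≥0∞) * p i) (hν : ν.support ⊆ Set.Ioi 1) :
    escapeLaw p ν Set.univ ≠ 0 := by
  intro h
  have := lintegral_escapeLaw p ν (G := fun _ => 1) measurable_const
  simp only [lintegral_one, mul_one] at this
  rw [h, eq_comm, lintegral_eq_zero_iff measurable_weight] at this
  refine envLaw_survives_ne_zero p ν hmean ?_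
  have h2 : ∀ᵐ z ∂freeLaw p ν, ¬ Survives z.1 [] := by
    filter_upwards [this, ae_freeLaw_weight_ne_zero p ν hν] with z h1 h2 h3
    exact h2 h3 h1
  have h3 : (freeLaw p ν).map Prod.fst = envLaw p ν := by
    rw [← Measure.fst, freeLaw, Measure.fst_compProd]
  rw [← h3, Measure.map_apply measurable_fst (measurableSet_survives [])]
  exact (ae_iff.1 h2 : _) ▸ (by simp [Set.preimage])

theorem step_sub_nil (ω : Env) (x y : Vertex) : Step (sub [] ω) x y ↔ Step ω x y := by
  simp [Step, sub]

theorem ae_escapeLaw_isGood : ∀ᵐ z ∂escapeLaw p ν, IsGood ν.support z := by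
  rw [ae_escapeLaw_iff p ν (measurableSet_isGood Measure.isClosed_support.measurableSet)]
  filter_upwards [ae_freeLaw_isGood p ν] with z hz hw
  have h := hz (finVisits_of_weight_ne_zero hw)
  refine ⟨h.zero, fun s => (step_sub_nil _ _ _).2 (h.step s), h.infinite, fun v hv => ?_⟩
  simpa [sub, hv] using h.bias v hv

/-! ### Regenerations -/

theorem ne_nil_of_isFresh {X : ℕ → Vertex} {t : ℕ} (ht : 1 ≤ t) (h : IsFresh X t) : X t ≠ [] := by
  intro h0
  exact h 0 ht (h0 ▸ List.nil_suffix)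

/-- Under `μ`, if `t` is a regeneration time, then the future after `t` has law `P` and is independent
of the past. -/
def RegenerativeAt (P μ : Measure Sample) (t : ℕ) : Prop :=
  ∀ F G : Sample → ℝ≥0∞, Measurable F → Measurable G →
    ∫⁻ z in {z | IsRegen z.2 t}, F (past t z) * G (next t z) ∂μ =
      (∫⁻ z in {z | IsRegen z.2 t}, F (past t z) ∂μ) * ∫⁻ z, G z ∂P

/-- Under `μ`, the future after a regeneration time has law `P` and is independent of the past. -/
def Regenerative (P μ : Measure Sample) : Prop := ∀ t ≥ 1, RegenerativeAt P μ t

/-- The law of the tree and the walk, when the root is given an additional parent, conditioned on the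
event that the walk does not go there. -/
noncomputable def regenLaw : Measure Sample := (escapeLaw p ν Set.univ)⁻¹ • escapeLaw p ν

/-- The factor `φ` need not be understood: the case `G = 1` identifies it up to the total mass of
the escape law, which is exactly the normalisation in `regenLaw`. -/
theorem Regenerative.of_escapeLaw {μ : Measure Sample} (he : escapeLaw p ν Set.univ ≠ 0)
    {φ : ℕ → (Sample → ℝ≥0∞) → ℝ≥0∞}
    (h : ∀ t ≥ 1, ∀ F G : Sample → ℝ≥0∞, Measurable F → Measurable G →
      ∫⁻ z in {z | IsRegen z.2 t}, F (past t z) * G (next t z) ∂μ =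
        φ t F * ∫⁻ z, G z ∂escapeLaw p ν) : Regenerative (regenLaw p ν) μ := by
  have htop : escapeLaw p ν Set.univ ≠ ∞ := ne_top_of_le_ne_top ENNReal.one_ne_top (escapeLaw_univ_le_one p ν)
  intro t ht F G hF hG
  have h1 := h t ht F (fun _ => 1) hF measurable_const
  simp only [mul_one, lintegral_one] at h1
  rw [h t ht F G hF hG, h1, regenLaw, lintegral_smul_measure, smul_eq_mul, mul_assoc, ← mul_assoc _ _⁻¹,
    ENNReal.mul_inv_cancel he htop, one_mul]

theorem regenerative_freeLaw (he : escapeLaw p ν Set.univ ≠ 0) :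
    Regenerative (regenLaw p ν) (freeLaw p ν) :=
  Regenerative.of_escapeLaw p ν he (φ := fun t F => ∫⁻ z in {z | IsFresh z.2 t}, F (past t z) ∂freeLaw p ν)
    fun _ ht _ _ hF hG => lintegral_freeLaw_regen p ν ht hF hG

theorem Regenerative.smul {P μ : Measure Sample} (h : Regenerative P μ) (c : ℝ≥0∞) :
    Regenerative P (c • μ) := by
  intro t ht F G hF hG
  rw [Measure.restrict_smul, lintegral_smul_measure, lintegral_smul_measure, h t ht F G hF hG,
    smul_eq_mul, smul_eq_mul, mul_assoc]

theorem glue_sub_nil {v : Vertex} (hv : v ≠ []) (ω ω' : Env) :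
    glue v (sub [] ω) ω' = sub [] (glue v ω ω') := by
  funext w
  by_cases hw : w = []
  · subst hw
    rw [glue_of_not_suffix _ _ (by simpa using hv)]
    simp only [sub, List.append_nil, if_true]
    rw [glue_of_not_suffix _ _ (by simpa using hv)]
  · simp only [sub, List.append_nil, if_neg hw, glue]

theorem past_sub_nil {t : ℕ} {z : Sample} (h : z.2 t ≠ []) :
    past t (sub [] z.1, z.2) = (sub [] (past t z).1, (past t z).2) := by
  simp only [past, glue_sub_nil h]

theorem next_sub_nil (t : ℕ) (z : Sample) : next t (sub [] z.1, z.2) = next t z := by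
  simp only [next, sub_sub, List.append_nil]

theorem weightUpTo_past {t : ℕ} {z : Sample} (hne : z.2 t ≠ []) :
    weightUpTo (past t z).1 (past t z).2 t = weightUpTo z.1 z.2 t := by
  have h1 : stayProb (past t z).1 = stayProb z.1 := by
    refine stayProb_congr ?_ fun i => ?_
    · simp only [past]
      rw [glue_of_not_suffix _ _ (by simpa using hne)]
    · simp only [past]
      by_cases hi : z.2 t <:+ [i]
      · have : z.2 t = [i] := hi.eq_of_length (by
          have := hi.length_le
          have := List.length_pos_iff.2 hne
          simp at *
          omega)
        rw [this, glue_self_snd]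
      · rw [glue_of_not_suffix _ _ hi]
  rw [weightUpTo, weightUpTo, h1]
  refine Finset.prod_congr rfl fun s hs => ?_
  simp only [past, min_eq_left (Finset.mem_range.1 hs).le]

/-- After a regeneration at a time `t ≥ 1` the root is never visited again, so the full weight is
accumulated before `t`. -/
theorem weight_eq_past {t : ℕ} (ht : 1 ≤ t) {z : Sample} (h : IsRegen z.2 t) :
    weight z.1 z.2 = weightUpTo (past t z).1 (past t z).2 t := by
  have hne := ne_nil_of_isFresh ht h.1
  rw [weightUpTo_past hne, weight_eq_weightUpTo (N := t) fun s hs h0 =>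
    hne (List.suffix_nil.1 (h0 ▸ h.2 s hs))]

/-- On regenerations the density of the escape law is a function of the past. It can be absorbed
into `F`, which reduces the claim to the unconditioned law. -/
theorem lintegral_escapeLaw_regen {t : ℕ} (ht : 1 ≤ t) {F G : Sample → ℝ≥0∞} (hF : Measurable F)
    (hG : Measurable G) :
    ∫⁻ z in {z | IsRegen z.2 t}, F (past t z) * G (next t z) ∂escapeLaw p ν =
      (∫⁻ z in {z | IsFresh z.2 t}, weightUpTo (past t z).1 (past t z).2 t *
        F (sub [] (past t z).1, (past t z).2) ∂freeLaw p ν) * ∫⁻ z, G z ∂escapeLaw p ν := by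
  have hS : MeasurableSet {z : Sample | IsRegen z.2 t} := (measurableSet_isRegen t).preimage measurable_snd
  have hFG : Measurable fun z => F (past t z) * G (next t z) :=
    (hF.comp (measurable_past t)).mul (hG.comp (measurable_next t))
  have hF' : Measurable fun z : Sample => weightUpTo z.1 z.2 t * F (sub [] z.1, z.2) :=
    (measurable_weightUpTo t).mul (hF.comp ((measurable_sub []).prodMap measurable_id))
  rw [← lintegral_indicator hS, lintegral_escapeLaw p ν (hFG.indicator hS),
    ← lintegral_freeLaw_regen p ν ht hF' hG, ← lintegral_indicator hS]
  refine lintegral_congr fun z => ?_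
  by_cases hz : IsRegen z.2 t
  · rw [Set.indicator_of_mem (by exact hz), Set.indicator_of_mem (by exact hz),
      past_sub_nil (ne_nil_of_isFresh ht hz.1), next_sub_nil, weight_eq_past ht hz, mul_assoc]
  · rw [Set.indicator_of_notMem (by exact hz), Set.indicator_of_notMem (by exact hz), mul_zero]

theorem regenerative_regenLaw (he : escapeLaw p ν Set.univ ≠ 0) :
    Regenerative (regenLaw p ν) (regenLaw p ν) :=
  (Regenerative.of_escapeLaw p ν he (φ := fun t F => ∫⁻ z in {z | IsFresh z.2 t},
    weightUpTo (past t z).1 (past t z).2 t * F (sub [] (past t z).1, (past t z).2) ∂freeLaw p ν)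
    fun _ ht _ _ hF hG => lintegral_escapeLaw_regen p ν ht hF hG).smul _

theorem isProbabilityMeasure_regenLaw (he : escapeLaw p ν Set.univ ≠ 0) :
    IsProbabilityMeasure (regenLaw p ν) := by
  refine ⟨?_⟩
  rw [regenLaw, Measure.smul_apply, smul_eq_mul, ENNReal.inv_mul_cancel he]
  exact ne_top_of_le_ne_top ENNReal.one_ne_top (escapeLaw_univ_le_one p ν)

theorem gwLaw_eq : gwLaw p ν = (envLaw p ν {ω | Survives ω []})⁻¹ •
    (envLaw p ν).restrict {ω | Survives ω []} := by
  rw [gwLaw, ← envLaw, ProbabilityTheory.cond]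
  simp only [survives_nil]

theorem jointLaw_eq : jointLaw p ν = (envLaw p ν {ω | Survives ω []})⁻¹ •
    (freeLaw p ν).restrict {z | Survives z.1 []} := by
  have h : ((envLaw p ν).restrict {ω | Survives ω []}) ⊗ₘ walkKernel =
      (freeLaw p ν).restrict {z | Survives z.1 []} := by
    rw [freeLaw]
    ext s hs
    have hA : MeasurableSet {z : Sample | Survives z.1 []} :=
      (measurableSet_survives []).preimage measurable_fst
    rw [Measure.compProd_apply hs, Measure.restrict_apply hs, Measure.compProd_apply (hs.inter hA),
      ← lintegral_indicator (measurableSet_survives [])]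
    refine lintegral_congr fun ω => ?_
    by_cases hω : Survives ω []
    · rw [Set.indicator_of_mem (by exact hω)]
      congr 1
      ext X
      simp [hω]
    · rw [Set.indicator_of_notMem (by exact hω)]
      have : Prod.mk ω ⁻¹' (s ∩ {z : Sample | Survives z.1 []}) = ∅ := by
        ext X
        simp [hω]
      rw [this, measure_empty]
  rw [jointLaw, gwLaw_eq, Measure.compProd_smul_left, h]

theorem isProbabilityMeasure_jointLaw (hmean : 1 < ∑' i : ℕ, (i : ℝ≥0∞) * p i) :
    IsProbabilityMeasure (jointLaw p ν) := by
  have h := envLaw_survives_ne_zero p ν hmean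
  have : IsProbabilityMeasure (gwLaw p ν) := by
    rw [gwLaw_eq]
    refine ⟨?_⟩
    rw [Measure.smul_apply, Measure.restrict_apply_univ, smul_eq_mul,
      ENNReal.inv_mul_cancel h (measure_ne_top _ _)]
  unfold jointLaw
  infer_instance

theorem ae_jointLaw (P : Sample → Prop) (h : ∀ᵐ z ∂freeLaw p ν, Survives z.1 [] → P z) :
    ∀ᵐ z ∂jointLaw p ν, P z := by
  rw [jointLaw_eq]
  refine Measure.ae_smul_measure ?_ _
  have hA : MeasurableSet {z : Sample | Survives z.1 []} :=
    (measurableSet_survives []).preimage measurable_fst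
  rw [ae_restrict_iff' hA]
  exact h

theorem ae_jointLaw_isGood (hν : ν.support ⊆ Set.Ioi 1) : ∀ᵐ z ∂jointLaw p ν, IsGood ν.support z := by
  refine ae_jointLaw p ν _ ?_
  filter_upwards [ae_freeLaw_isGood p ν, ae_freeLaw_weight_ne_zero p ν hν] with z h1 h2 hz
  exact h1 (finVisits_of_weight_ne_zero (h2 hz))

namespace IsGood

variable {I : Set ℝ} {z : Sample}

theorem mem (h : IsGood I z) (s : ℕ) : z.1.Mem (z.2 s) := by
  induction s with
  | zero => rw [h.zero]; trivial
  | succ s ih =>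
    rcases h.step s with h' | ⟨i, hi, h'⟩
    · rw [h']
      exact ih.of_suffix (List.tail_suffix _)
    · rw [h']
      exact ⟨ih, hi⟩

/-- The walk visits infinitely many vertices, and all but finitely many of them lie in the subtree.
-/
theorem survives_of_isRegen (h : IsGood I z) {t : ℕ} (ht : IsRegen z.2 t) : Survives z.1 (z.2 t) := by
  intro hfin
  refine h.infinite ?_
  refine ((Set.finite_range fun s : Fin t => z.2 s).union
    (hfin.image fun y => y ++ z.2 t)).subset ?_
  rintro _ ⟨s, rfl⟩
  rcases lt_or_ge s t with hs | hs
  · exact Or.inl ⟨⟨s, hs⟩, rfl⟩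
  · right
    obtain ⟨y, hy⟩ := ht.2 s hs
    exact ⟨y, ((mem_append _ _ _).1 (hy ▸ h.mem s)).2, hy⟩

/-- The walk moves along edges from the root, so it passes through every ancestor before it reaches
a descendant. In particular the first visit to a vertex is also the first visit to its subtree. -/
theorem exists_eq_of_suffix (h : IsGood I z) {v : Vertex} {s : ℕ} (hv : v <:+ z.2 s) :
    ∃ s' ≤ s, z.2 s' = v := by
  induction s with
  | zero =>
    rw [h.zero, List.suffix_nil] at hv
    exact ⟨0, le_rfl, by rw [h.zero, hv]⟩
  | succ s ih =>
    by_cases hv' : v <:+ z.2 s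
    · obtain ⟨s', hs', h'⟩ := ih hv'
      exact ⟨s', by omega, h'⟩
    · refine ⟨s + 1, le_rfl, ?_⟩
      rcases h.step s with h' | ⟨i, hi, h'⟩
      · exact absurd (hv.trans (h' ▸ List.tail_suffix _)) hv'
      · rw [h'] at hv ⊢
        exact ((List.suffix_cons_iff.1 hv).resolve_right hv').symm

theorem isFresh (h : IsGood I z) {t : ℕ} (ht : ∀ s < t, z.2 s ≠ z.2 t) : IsFresh z.2 t := by
  intro s hs hv
  obtain ⟨s', hs', h'⟩ := h.exists_eq_of_suffix hv
  exact ht s' (by omega) h'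

theorem survives_nil (h : IsGood I z) : Survives z.1 [] :=
  (Env.survives_nil z.1).2 (h.infinite.mono (by rintro _ ⟨s, rfl⟩; exact h.mem s))

end IsGood

/-- A regeneration at a time `t ≥ 1` forces finitely many visits to the root and hence survival.
Conditioning on survival therefore changes nothing on this event except the normalisation. -/
theorem regenerative_jointLaw (he : escapeLaw p ν Set.univ ≠ 0) :
    Regenerative (regenLaw p ν) (jointLaw p ν) := by
  rw [jointLaw_eq]
  refine Regenerative.smul ?_ _
  intro t ht F G hF hG
  have hS : MeasurableSet {z : Sample | IsRegen z.2 t} := (measurableSet_isRegen t).preimage measurable_snd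
  have key : ∀ H : Sample → ℝ≥0∞, ∫⁻ z in {z | IsRegen z.2 t}, H z ∂(freeLaw p ν).restrict {z | Survives z.1 []} =
      ∫⁻ z in {z | IsRegen z.2 t}, H z ∂freeLaw p ν := by
    intro H
    rw [Measure.restrict_restrict hS]
    refine setLIntegral_congr ?_
    filter_upwards [ae_freeLaw_isGood p ν] with z hz
    refine propext ⟨fun h => h.1, fun h => ⟨h, ?_⟩⟩
    have h' : IsRegen z.2 t := h
    refine (hz ⟨t, fun s hs h0 => ne_nil_of_isFresh ht h'.1 (List.suffix_nil.1 (h0 ▸ h'.2 s hs))⟩).survives_nil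
  rw [key, key]
  exact regenerative_freeLaw p ν he t ht F G hF hG

end Env

namespace Env

/-! ### Trap entrances -/

theorem mem_backbone_tree (ω : Env) (u : Vertex) (v : (ω.tree u).V) :
    v ∈ (ω.tree u).backbone ↔ Survives ω v.1 := by
  constructor
  · rintro ⟨x, rfl, hx⟩
    refine survives_of_path (x := fun n => (x n).1) fun n => ?_
    obtain ⟨i, hi⟩ := hx n
    exact ⟨i, (hi ▸ (x (n + 1)).2 : ω.Mem (i :: (x n).1)).2, hi⟩
  · intro h
    obtain ⟨x, h0, hx, -⟩ := h.exists_path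
    have hm : ∀ n, ω.Mem (x n) := by
      intro n
      induction n with
      | zero => rw [h0]; exact v.2
      | succ n ih =>
        obtain ⟨i, hi, hi'⟩ := hx n
        rw [hi']
        exact ⟨ih, hi⟩
    refine ⟨fun n => ⟨x n, hm n⟩, Subtype.ext h0, fun n => ?_⟩
    obtain ⟨i, -, hi⟩ := hx n
    exact ⟨i, hi⟩

theorem graph_tree_adj (ω : Env) (u : Vertex) (v w : (ω.tree u).V) :
    (ω.tree u).graph.Adj v w ↔ (∃ i, w.1 = i :: v.1) ∨ ∃ i, v.1 = i :: w.1 := by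
  constructor
  · intro h
    exact ((SimpleGraph.fromRel_adj _ _ _).1 h).2
  · intro h
    refine (SimpleGraph.fromRel_adj _ _ _).2 ⟨?_, h⟩
    rintro rfl
    rcases h with ⟨i, h⟩ | ⟨i, h⟩ <;> simpa using congrArg List.length h

theorem tree_pt_val {ω : Env} {u : Vertex} (hu : ω.Mem u) : (ω.tree u).pt = ⟨u, hu⟩ := by
  simp [tree, hu]

theorem isTrapEntrance_iff (ω : Env) (u : Vertex) :
    IsTrapEntrance ω u ↔ ∃ i w, u = i :: w ∧ ω.Mem u ∧ Survives ω w ∧ ¬ Survives ω u := by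
  constructor
  · rintro ⟨h1, w, hw, hadj⟩
    rw [mem_backbone_tree] at h1 hw
    rw [graph_tree_adj] at hadj
    rcases hadj with ⟨i, hi⟩ | ⟨i, hi⟩
    · refine absurd (Survives.parent (hi ▸ hw) ?_) h1
      exact (hi ▸ w.2 : ω.Mem (i :: (ω.tree u).pt.1)).2
    · by_cases hu : ω.Mem u
      · rw [tree_pt_val hu] at hi h1
        exact ⟨i, w.1, hi, hu, hw, h1⟩
      · exfalso
        simp [tree, hu] at hi
  · rintro ⟨i, w, rfl, hm, hw, hu⟩
    refine ⟨?_, ⟨w, hm.1⟩, (mem_backbone_tree _ _ _).2 hw, ?_⟩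
    · rw [mem_backbone_tree, tree_pt_val hm]
      exact hu
    · exact (graph_tree_adj _ _ _ _).2 (Or.inr ⟨i, congrArg Subtype.val (tree_pt_val hm)⟩)

theorem _root_.IsTrapEntrance.mem {ω : Env} {u : Vertex} (h : IsTrapEntrance ω u) : ω.Mem u := by
  obtain ⟨i, w, -, h, -⟩ := (isTrapEntrance_iff ω u).1 h
  exact h

theorem _root_.IsTrapEntrance.not_survives {ω : Env} {u : Vertex} (h : IsTrapEntrance ω u) :
    ¬ Survives ω u := by
  obtain ⟨i, w, -, -, -, h⟩ := (isTrapEntrance_iff ω u).1 h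
  exact h

theorem isTrapEntrance_append {ω : Env} {v : Vertex} (hv : ω.Mem v) (hs : Survives ω v) (y : Vertex) :
    IsTrapEntrance ω (y ++ v) ↔ IsTrapEntrance (sub v ω) y := by
  cases y with
  | nil =>
    refine ⟨fun h => absurd hs h.not_survives, fun h => ?_⟩
    obtain ⟨i, w, h, -⟩ := (isTrapEntrance_iff _ _).1 h
    cases h
  | cons i y =>
    simp only [isTrapEntrance_iff, List.cons_append, List.cons.injEq]
    constructor
    · rintro ⟨j, w, ⟨rfl, rfl⟩, h1, h2, h3⟩
      refine ⟨i, y, ⟨rfl, rfl⟩, ?_, (survives_sub _ _ _).2 h2, fun h => h3 ((survives_sub _ _ _).1 h)⟩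
      exact ((mem_append ω (i :: y) v).1 h1).2
    · rintro ⟨j, w, ⟨rfl, rfl⟩, h1, h2, h3⟩
      refine ⟨i, y ++ v, ⟨rfl, rfl⟩, ?_, (survives_sub _ _ _).1 h2, fun h => h3 ((survives_sub _ _ _).2 h)⟩
      exact (mem_append ω (i :: y) v).2 ⟨hv, h1⟩

theorem measurableSet_isTrapEntrance (u : Vertex) : MeasurableSet {ω : Env | IsTrapEntrance ω u} := by
  cases u with
  | nil => simp [isTrapEntrance_iff]
  | cons i w =>
    have : {ω : Env | IsTrapEntrance ω (i :: w)} = {ω : Env | ω.Mem (i :: w)} ∩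
        ({ω : Env | Survives ω w} ∩ {ω : Env | Survives ω (i :: w)}ᶜ) := by
      ext ω
      simp only [isTrapEntrance_iff, Set.mem_inter_iff, Set.mem_compl_iff, Set.mem_ofPred_eq,
        List.cons.injEq]
      constructor
      · rintro ⟨j, w, ⟨rfl, rfl⟩, h⟩
        exact h
      · exact fun h => ⟨i, w, ⟨rfl, rfl⟩, h⟩
    rw [this]
    exact (measurableSet_mem _).inter ((measurableSet_survives _).inter (measurableSet_survives _).compl)

section Glue

variable {ω ω' : Env} {v w : Vertex}

theorem mem_glue (h : v <:+ w → w = v) : (glue v ω ω').Mem w ↔ ω.Mem w := by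
  refine mem_congr fun u hu hne => ?_
  rw [glue_of_not_suffix]
  intro hvu
  have := h (hvu.trans hu)
  subst this
  exact hne (hu.eq_of_length_le hvu.length_le)

theorem survives_glue_self (hs' : Survives ω' []) : Survives (glue v ω ω') v := by
  rw [Survives, sub_glue]
  exact hs'

/-- Replacing a surviving subtree by a surviving one does not change which vertices outside it
survive. This is why `past` fills the gap with a ray: the trap entrances outside remain visible. -/
theorem survives_glue (hv : ω.Mem v) (hs : Survives ω v) (hs' : Survives ω' []) (hw : ¬ v <:+ w) :
    Survives (glue v ω ω') w ↔ Survives ω w := by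
  by_cases hwv : w <:+ v
  · refine iff_of_true ?_ (hs.of_suffix hv hwv)
    exact (survives_glue_self hs').of_suffix ((mem_glue fun _ => rfl).2 hv) hwv
  · have : sub w (glue v ω ω') = sub w ω := by
      funext y
      have : ¬ v <:+ y ++ w := fun h =>
        (List.suffix_or_suffix_of_suffix h (List.suffix_append y w)).elim hw hwv
      simp only [sub, glue_of_not_suffix _ _ this]
    rw [Survives, Survives, this]

theorem isTrapEntrance_glue (hv : ω.Mem v) (hs : Survives ω v) (hs' : Survives ω' []) (hw : ¬ v <:+ w) :
    IsTrapEntrance (glue v ω ω') w ↔ IsTrapEntrance ω w := by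
  cases w with
  | nil => simp [isTrapEntrance_iff]
  | cons i w =>
    have hw' : ¬ v <:+ w := fun h => hw (h.trans (List.suffix_cons _ _))
    simp only [isTrapEntrance_iff, List.cons.injEq, mem_glue fun h => absurd h hw, survives_glue hv hs hs' hw]
    constructor
    · rintro ⟨j, w, ⟨rfl, rfl⟩, h1, h2, h3⟩
      exact ⟨_, _, ⟨rfl, rfl⟩, h1, (survives_glue hv hs hs' hw').1 h2, h3⟩
    · rintro ⟨j, w, ⟨rfl, rfl⟩, h1, h2, h3⟩
      exact ⟨_, _, ⟨rfl, rfl⟩, h1, (survives_glue hv hs hs' hw').2 h2, h3⟩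

theorem glue_glue_sub (v : Vertex) (ω ω' : Env) : glue v (glue v ω ω') (sub v ω) = ω := by
  rw [glue_glue]
  funext w
  by_cases hw : v <:+ w
  · obtain ⟨y, rfl⟩ := hw
    rw [glue_append]
    by_cases hy : y = []
    · simp [hy, sub]
    · simp [hy, sub]
  · rw [glue_of_not_suffix _ _ hw]

theorem survives_ray : Survives (fun _ => (1, 0)) [] := by
  have := survives_of_path (ω := fun _ => (1, 0)) (x := fun n => List.replicate n 0) fun n =>
    ⟨0, by norm_num, rfl⟩
  exact this

end Glue

/-! ### Decomposition at a regeneration time -/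

/-- At time `t`, the walk arrives at a new trap entrance. -/
def NewTrap (z : Sample) (t : ℕ) : Prop := IsTrapEntrance z.1 (z.2 t) ∧ ∀ s < t, z.2 s ≠ z.2 t

theorem measurableSet_newTrap (t : ℕ) : MeasurableSet {z | NewTrap z t} := by
  have h1 : MeasurableSet {q : Env × Vertex | IsTrapEntrance q.1 q.2} :=
    measurableSet_setOfPred.2 (measurable_from_prod_countable_left fun u =>
      measurableSet_setOfPred.1 (measurableSet_isTrapEntrance u))
  have h2 : MeasurableSet {z : Sample | ∀ s < t, z.2 s ≠ z.2 t} := by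
    have : {z : Sample | ∀ s < t, z.2 s ≠ z.2 t} = ⋂ s < t, {z : Sample | z.2 s ≠ z.2 t} := by
      ext z; simp
    rw [this]
    exact MeasurableSet.biInter (Set.to_countable _) fun s _ =>
      (measurableSet_path_pair s t fun x y => x ≠ y).preimage measurable_snd
  exact (h1.preimage (f := fun z : Sample => (z.1, z.2 t)) (by fun_prop)).inter h2

theorem next_append {z : Sample} {t : ℕ} (ht : IsRegen z.2 t) (s : ℕ) :
    (next t z).2 s ++ z.2 t = z.2 (t + s) :=
  strip_append_self (ht.2 (t + s) (Nat.le_add_right t s))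

theorem suffix_next {z : Sample} {t : ℕ} (ht : IsRegen z.2 t) (a b : ℕ) :
    (next t z).2 a <:+ (next t z).2 b ↔ z.2 (t + a) <:+ z.2 (t + b) := by
  rw [← next_append ht a, ← next_append ht b, List.suffix_append_self_iff]

theorem eq_next {z : Sample} {t : ℕ} (ht : IsRegen z.2 t) (a b : ℕ) :
    (next t z).2 a = (next t z).2 b ↔ z.2 (t + a) = z.2 (t + b) := by
  rw [← next_append ht a, ← next_append ht b, List.append_cancel_right_eq]

theorem isRegen_next {z : Sample} {t : ℕ} (ht : IsRegen z.2 t) (s : ℕ) :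
    IsRegen (next t z).2 s ↔ IsRegen z.2 (t + s) := by
  constructor
  · rintro ⟨h1, h2⟩
    refine ⟨fun a ha h => ?_, fun a ha => ?_⟩
    · rcases lt_or_ge a t with h' | h'
      · exact ht.1 a h' ((ht.2 (t + s) (by omega)).trans h)
      · obtain ⟨b, rfl⟩ := Nat.exists_eq_add_of_le h'
        exact h1 b (by omega) ((suffix_next ht _ _).2 h)
    · obtain ⟨b, rfl⟩ := Nat.exists_eq_add_of_le (show t ≤ a by omega)
      exact (suffix_next ht _ _).1 (h2 b (by omega))
  · rintro ⟨h1, h2⟩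
    exact ⟨fun a ha h => h1 (t + a) (by omega) ((suffix_next ht _ _).1 h),
      fun a ha => (suffix_next ht _ _).2 (h2 (t + a) (by omega))⟩

theorem past_apply {z : Sample} {t s : ℕ} (hs : s ≤ t) : (past t z).2 s = z.2 s := by
  simp [past, hs]

/-- In the past the path is frozen at `X t` from time `t` on. The actual path is then in the subtree
at `X t`, so a condition on times after `t` holds as soon as it holds at `t`. -/
theorem isRegen_past {z : Sample} {t : ℕ} (ht : IsRegen z.2 t) {s : ℕ} (hs : s ≤ t) :
    IsRegen (past t z).2 s ↔ IsRegen z.2 s := by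
  rw [IsRegen, IsRegen, IsFresh, IsFresh]
  refine and_congr (forall₂_congr fun a ha => ?_) ⟨fun h a ha => ?_, fun h a ha => ?_⟩
  · rw [past_apply hs, past_apply (ha.le.trans hs)]
  · rcases le_total a t with h' | h'
    · have := h a ha
      rwa [past_apply hs, past_apply h'] at this
    · have := h t hs
      rw [past_apply hs, past_apply le_rfl] at this
      exact this.trans (ht.2 a h')
  · rw [past_apply hs]
    exact h (min a t) (le_min ha hs)

open Classical in
/-- The number of times before `t` at which the property `Q` holds. -/
noncomputable def cnt (Q : Sample → ℕ → Prop) (t : ℕ) (z : Sample) : ℕ := Nat.count (Q z) t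

/-- Before a regeneration time, the property `Q` depends on the past only, and afterwards it is
the same property of the future. -/
structure IsLocal (I : Set ℝ) (Q : Sample → ℕ → Prop) : Prop where
  measurableSet : ∀ t, MeasurableSet {z | Q z t}
  past : ∀ {z t s}, IsGood I z → IsRegen z.2 t → s < t → (Q (past t z) s ↔ Q z s)
  next : ∀ {z t}, IsGood I z → IsRegen z.2 t → ∀ s, Q (next t z) s ↔ Q z (t + s)

section Cnt

variable {I : Set ℝ} {Q Q' : Sample → ℕ → Prop} {z : Sample}

@[simp]
theorem cnt_zero : cnt Q 0 z = 0 := by simp [cnt]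

theorem cnt_succ_of_pos {t : ℕ} (h : Q z t) : cnt Q (t + 1) z = cnt Q t z + 1 := by
  simp [cnt, Nat.count_succ, h]

theorem cnt_succ_of_neg {t : ℕ} (h : ¬ Q z t) : cnt Q (t + 1) z = cnt Q t z := by
  simp [cnt, Nat.count_succ, h]

theorem monotone_cnt : Monotone fun t => cnt Q t z := by
  classical
  exact Nat.count_monotone (Q z)

theorem cnt_le_cnt (h : ∀ t, Q z t → Q' z t) (t : ℕ) : cnt Q t z ≤ cnt Q' t z := by
  classical
  exact Nat.count_mono_left fun k _ => h k

theorem cnt_congr {z' : Sample} {t : ℕ} (h : ∀ s < t, Q z s ↔ Q' z' s) : cnt Q t z = cnt Q' t z' := by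
  induction t with
  | zero => simp
  | succ t ih =>
    have := ih fun s hs => h s (by omega)
    by_cases hq : Q z t
    · rw [cnt_succ_of_pos hq, cnt_succ_of_pos ((h t (by omega)).1 hq), this]
    · rw [cnt_succ_of_neg hq, cnt_succ_of_neg (mt (h t (by omega)).2 hq), this]

theorem cnt_add (t s : ℕ) : cnt Q (t + s) z = cnt Q t z + cnt (fun z k => Q z (t + k)) s z := by
  classical
  simp only [cnt]
  convert Nat.count_add (p := Q z) t s

theorem IsLocal.measurable_cnt (hQ : IsLocal I Q) (t : ℕ) : Measurable (cnt Q t) := by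
  classical
  induction t with
  | zero => exact (measurable_const (a := 0) : Measurable fun _ : Sample => 0)
  | succ t ih =>
    have : cnt Q (t + 1) = fun z => cnt Q t z + if Q z t then 1 else 0 := by
      funext z
      by_cases h : Q z t
      · rw [cnt_succ_of_pos h, if_pos h]
      · rw [cnt_succ_of_neg h, if_neg h]; rfl
    rw [this]
    exact ih.add (Measurable.ite (hQ.measurableSet t) measurable_const measurable_const)

theorem IsLocal.cnt_past (hQ : IsLocal I Q) {t s : ℕ} (hz : IsGood I z) (ht : IsRegen z.2 t)
    (hs : s ≤ t) : cnt Q s (Env.past t z) = cnt Q s z :=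
  cnt_congr fun r hr => hQ.past hz ht (by omega)

theorem IsLocal.cnt_next (hQ : IsLocal I Q) {t : ℕ} (hz : IsGood I z) (ht : IsRegen z.2 t) (s : ℕ) :
    cnt Q (t + s) z = cnt Q t z + cnt Q s (Env.next t z) := by
  rw [cnt_add]
  congr 1
  exact cnt_congr fun r _ => (hQ.next hz ht r).symm

theorem exists_cnt_eq (h : {t | Q z t}.Infinite) (m : ℕ) : ∃ t, Q z t ∧ cnt Q t z = m := by
  classical
  refine ⟨Nat.nth (Q z) m, Nat.nth_mem_of_infinite h m, ?_⟩
  rw [cnt]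
  convert Nat.count_nth_of_infinite h m

theorem eq_of_cnt_eq {s t : ℕ} (hs : Q z s) (ht : Q z t) (h : cnt Q s z = cnt Q t z) : s = t := by
  rcases lt_trichotomy s t with hlt | rfl | hlt
  · have := (cnt_succ_of_pos hs).symm.trans_le (monotone_cnt (Q := Q) (z := z) (Nat.succ_le_of_lt hlt))
    simp only at this
    omega
  · rfl
  · have := (cnt_succ_of_pos ht).symm.trans_le (monotone_cnt (Q := Q) (z := z) (Nat.succ_le_of_lt hlt))
    simp only at this
    omega

theorem finite_cnt_le (h : {t | Q z t}.Infinite) (m : ℕ) : {t | cnt Q t z ≤ m}.Finite := by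
  obtain ⟨s, hs, hs'⟩ := exists_cnt_eq h m
  refine (Set.finite_le_nat s).subset fun t ht => ?_
  by_contra hlt
  have hlt' : s + 1 ≤ t := by simpa using hlt
  have h1 := monotone_cnt (Q := Q) (z := z) hlt'
  have h2 : cnt Q t z ≤ m := ht
  simp only [cnt_succ_of_pos hs] at h1
  omega

end Cnt

theorem isLocal_isRegen (I : Set ℝ) : IsLocal I fun z t => IsRegen z.2 t where
  measurableSet t := (measurableSet_isRegen t).preimage measurable_snd
  past _ ht hs := isRegen_past ht hs.le
  next _ ht s := isRegen_next ht s

/-- At time `t`, the walk arrives at a new vertex. -/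
def NewVertex (z : Sample) (t : ℕ) : Prop := ∀ s < t, z.2 s ≠ z.2 t

theorem newVertex_past {z : Sample} {t s : ℕ} (hs : s ≤ t) : NewVertex (past t z) s ↔ NewVertex z s := by
  refine forall₂_congr fun a ha => ?_
  rw [past_apply hs, past_apply (ha.le.trans hs)]

theorem newVertex_next {z : Sample} {t : ℕ} (ht : IsRegen z.2 t) (s : ℕ) :
    NewVertex (next t z) s ↔ NewVertex z (t + s) := by
  constructor
  · intro h a ha hne
    rcases lt_or_ge a t with h' | h'
    · exact ht.1 a h' (hne ▸ ht.2 (t + s) (by omega))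
    · obtain ⟨b, rfl⟩ := Nat.exists_eq_add_of_le h'
      exact h b (by omega) ((eq_next ht _ _).2 hne)
  · intro h a ha hne
    exact h (t + a) (by omega) ((eq_next ht _ _).1 hne)

theorem isLocal_newVertex (I : Set ℝ) : IsLocal I NewVertex where
  measurableSet t := by
    have : {z : Sample | NewVertex z t} = ⋂ s < t, {z : Sample | z.2 s ≠ z.2 t} := by
      ext z; simp [NewVertex]
    rw [this]
    exact MeasurableSet.biInter (Set.to_countable _) fun s _ =>
      (measurableSet_path_pair s t fun x y => x ≠ y).preimage measurable_snd
  past _ _ hs := newVertex_past hs.le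
  next _ ht s := newVertex_next ht s

theorem IsGood.infinite_newVertex {I : Set ℝ} {z : Sample} (h : IsGood I z) :
    {t | NewVertex z t}.Infinite := by
  intro hfin
  refine h.infinite ((hfin.image z.2).subset ?_)
  rintro _ ⟨s, rfl⟩
  classical
  have hex : ∃ t, z.2 t = z.2 s := ⟨s, rfl⟩
  refine ⟨Nat.find hex, fun a ha hne => Nat.find_min hex ha (hne.trans (Nat.find_spec hex)),
    Nat.find_spec hex⟩

theorem isLocal_newTrap (I : Set ℝ) : IsLocal I NewTrap where
  measurableSet := measurableSet_newTrap
  past {z t s} hz ht hs := by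
    refine and_congr ?_ (newVertex_past hs.le)
    rw [past_apply hs.le]
    exact isTrapEntrance_glue (hz.mem t) (hz.survives_of_isRegen ht) survives_ray (ht.1 s hs)
  next {z t} hz ht s := by
    refine and_congr ?_ (newVertex_next ht s)
    rw [← next_append ht]
    exact (isTrapEntrance_append (hz.mem t) (hz.survives_of_isRegen ht) _).symm

end Env

namespace Env

/-! ### Renewal equations -/

/-- The walk is at a regeneration under `P`, and it starts afresh at each regeneration. -/
structure IsRegenLaw (I : Set ℝ) (P : Measure Sample) : Prop where
  prob : IsProbabilityMeasure P
  good : ∀ᵐ z ∂P, IsGood I z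
  zero : ∀ᵐ z ∂P, IsRegen z.2 0
  regen : ∀ t, RegenerativeAt P P t

variable {I : Set ℝ} {P μ : Measure Sample} {Q : Sample → ℕ → Prop}

theorem RegenerativeAt.measure_inter {t : ℕ} (h : RegenerativeAt P μ t) {A B : Set Sample}
    (hA : MeasurableSet A) (hB : MeasurableSet B) :
    μ {z | IsRegen z.2 t ∧ past t z ∈ A ∧ next t z ∈ B} = μ {z | IsRegen z.2 t ∧ past t z ∈ A} * P B := by
  have hS : MeasurableSet {z : Sample | IsRegen z.2 t} := (measurableSet_isRegen t).preimage measurable_snd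
  have key := h (A.indicator 1) (B.indicator 1) (measurable_one.indicator hA) (measurable_one.indicator hB)
  rw [lintegral_indicator_one hB] at key
  have h1 : ∀ z, A.indicator (1 : Sample → ℝ≥0∞) (past t z) = (past t ⁻¹' A).indicator 1 z := fun z => rfl
  have h2 : ∀ z, B.indicator (1 : Sample → ℝ≥0∞) (next t z) = (next t ⁻¹' B).indicator 1 z := fun z => rfl
  have h3 : ∀ z, (past t ⁻¹' A).indicator (1 : Sample → ℝ≥0∞) z * (next t ⁻¹' B).indicator 1 z =
      (past t ⁻¹' A ∩ next t ⁻¹' B).indicator 1 z := fun z => by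
    rw [← Set.inter_indicator_mul]
    simp [Set.indicator]
  have mA := hA.preimage (measurable_past t)
  have mB := hB.preimage (measurable_next t)
  simp only [h1, h2, h3] at key
  rw [lintegral_indicator_one (mA.inter mB), lintegral_indicator_one mA,
    Measure.restrict_apply (mA.inter mB), Measure.restrict_apply mA] at key
  rw [show {z | IsRegen z.2 t ∧ past t z ∈ A ∧ next t z ∈ B} =
      past t ⁻¹' A ∩ next t ⁻¹' B ∩ {z : Sample | IsRegen z.2 t} by ext; simp; tauto, key]
  congr 2
  ext; simp; tauto

/-- Form of the regeneration property for events whose decomposition into past and future is valid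
on good samples only. -/
theorem RegenerativeAt.measure_eq {t : ℕ} (h : RegenerativeAt P μ t) {S S' A B : Set Sample}
    (hμ : ∀ᵐ z ∂μ, IsGood I z) (hA : MeasurableSet A) (hB : MeasurableSet B)
    (hS : ∀ z, IsGood I z → (z ∈ S ↔ IsRegen z.2 t ∧ past t z ∈ A ∧ next t z ∈ B))
    (hS' : ∀ z, IsGood I z → (z ∈ S' ↔ IsRegen z.2 t ∧ past t z ∈ A)) :
    μ S = μ S' * P B := by
  have h1 : μ S = μ {z | IsRegen z.2 t ∧ past t z ∈ A ∧ next t z ∈ B} := by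
    refine measure_congr ?_
    filter_upwards [hμ] with z hz
    exact propext (hS z hz)
  have h2 : μ S' = μ {z | IsRegen z.2 t ∧ past t z ∈ A} := by
    refine measure_congr ?_
    filter_upwards [hμ] with z hz
    exact propext (hS' z hz)
  rw [h1, h2, h.measure_inter hA hB]

/-- The expected number of regenerations before which there are `m` occurrences of `Q`. -/
noncomputable def renewal (Q : Sample → ℕ → Prop) (P : Measure Sample) (m : ℕ) : ℝ≥0∞ :=
  ∑' t, P {z | IsRegen z.2 t ∧ cnt Q t z = m}

/-- The paths with more than `j` occurrences of `Q` before the first regeneration. -/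
def late (Q : Sample → ℕ → Prop) (j : ℕ) : Set Sample :=
  {z | ∀ t ≥ 1, IsRegen z.2 t → j < cnt Q t z}

theorem IsLocal.measurableSet_cnt (hQ : IsLocal I Q) (t m : ℕ) : MeasurableSet {z | cnt Q t z = m} :=
  (measurableSet_singleton m).preimage (hQ.measurable_cnt t)

theorem measurableSet_isRegen' (t : ℕ) : MeasurableSet {z : Sample | IsRegen z.2 t} :=
  (measurableSet_isRegen t).preimage measurable_snd

theorem IsLocal.measurableSet_late (hQ : IsLocal I Q) (j : ℕ) : MeasurableSet (late Q j) := by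
  have : late Q j = ⋂ t ≥ 1, ({z : Sample | IsRegen z.2 t}ᶜ ∪ cnt Q t ⁻¹' Set.Ioi j) := by
    ext z
    simp [late, imp_iff_not_or]
  rw [this]
  exact MeasurableSet.biInter (Set.to_countable _) fun t _ =>
    (measurableSet_isRegen' t).compl.union ((Set.to_countable _).measurableSet.preimage (hQ.measurable_cnt t))

/-- The paths for which `t` is a regeneration time with `i` occurrences of `Q` before, and the number of
occurrences before the next regeneration time exceeds `m`. -/
def lastRegen (Q : Sample → ℕ → Prop) (m i t : ℕ) : Set Sample :=
  {z | IsRegen z.2 t ∧ cnt Q t z = i ∧ ∀ t' > t, IsRegen z.2 t' → m < cnt Q t' z}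

theorem IsLocal.measurableSet_lastRegen (hQ : IsLocal I Q) (m i t : ℕ) :
    MeasurableSet (lastRegen Q m i t) := by
  have : lastRegen Q m i t = {z : Sample | IsRegen z.2 t} ∩ ({z | cnt Q t z = i} ∩
      ⋂ t' > t, ({z : Sample | IsRegen z.2 t'}ᶜ ∪ cnt Q t' ⁻¹' Set.Ioi m)) := by
    ext z
    simp [lastRegen, imp_iff_not_or]
  rw [this]
  exact (measurableSet_isRegen' t).inter ((hQ.measurableSet_cnt t i).inter
    (MeasurableSet.biInter (Set.to_countable _) fun t _ =>
      (measurableSet_isRegen' t).compl.union ((Set.to_countable _).measurableSet.preimage (hQ.measurable_cnt t))))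

theorem IsRegenLaw.measure_lastRegen (h : IsRegenLaw I P) (hQ : IsLocal I Q) (i j t : ℕ) :
    P (lastRegen Q (i + j) i t) = P {z | IsRegen z.2 t ∧ cnt Q t z = i} * P (late Q j) := by
  refine (h.regen t).measure_eq h.good (A := {z | cnt Q t z = i}) (hQ.measurableSet_cnt t i)
    (hQ.measurableSet_late j) (fun z hz => ?_) (fun z hz => ?_)
  · refine and_congr_right fun ht => ?_
    rw [Set.mem_ofPred_eq, hQ.cnt_past hz ht le_rfl]
    refine and_congr_right fun hi => ⟨fun h' s hs hs' => ?_, fun h' t' ht' hr => ?_⟩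
    · have := h' (t + s) (by omega) ((isRegen_next ht s).1 hs')
      rw [hQ.cnt_next hz ht] at this
      omega
    · obtain ⟨s, rfl⟩ := Nat.exists_eq_add_of_le ht'.le
      have := h' s (by omega) ((isRegen_next ht s).2 hr)
      rw [hQ.cnt_next hz ht]
      omega
  · refine and_congr_right fun ht => ?_
    rw [Set.mem_ofPred_eq, hQ.cnt_past hz ht le_rfl]

theorem disjoint_lastRegen {m i i' t t' : ℕ} (hi : i ≤ m) (hi' : i' ≤ m) (h : t ≠ t') :
    Disjoint (lastRegen Q m i t) (lastRegen Q m i' t') := by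
  rw [Set.disjoint_left]
  rintro z ⟨h1, h2, h3⟩ ⟨h1', h2', h3'⟩
  rcases lt_or_gt_of_ne h with hlt | hlt
  · have := h3 t' hlt h1'
    omega
  · have := h3' t hlt h1
    omega

/-- Given `i`, a path has at most one regeneration preceded by `i` occurrences such that every later
one is preceded by more. So the corresponding probabilities sum to at most `1`. -/
theorem IsRegenLaw.renewal_mul_le (h : IsRegenLaw I P) (hQ : IsLocal I Q) (i : ℕ) :
    renewal Q P i * P (late Q 0) ≤ 1 := by
  have := h.prob
  rw [renewal, ← ENNReal.tsum_mul_right]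
  simp only [← h.measure_lastRegen hQ, add_zero]
  rw [← measure_iUnion (fun t t' hne => disjoint_lastRegen le_rfl le_rfl hne)
    fun t => hQ.measurableSet_lastRegen _ _ t]
  exact prob_le_one

theorem IsRegenLaw.ae_finite (h : IsRegenLaw I P) (hQ : IsLocal I Q) (h0 : P (late Q 0) ≠ 0) (m : ℕ) :
    ∀ᵐ z ∂P, {t | IsRegen z.2 t ∧ cnt Q t z ≤ m}.Finite := by
  have hU : ∀ i, renewal Q P i ≠ ∞ := fun i hi => by
    have := h.renewal_mul_le hQ i
    rw [hi, ENNReal.top_mul h0] at this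
    exact absurd this (by simp)
  have key : ∀ i, ∀ᵐ z ∂P, ∀ᶠ t in atTop, z ∉ {z | IsRegen z.2 t ∧ cnt Q t z = i} :=
    fun i => ae_eventually_notMem (hU i)
  filter_upwards [ae_all_iff.2 key] with z hz
  have : {t | IsRegen z.2 t ∧ cnt Q t z ≤ m} ⊆
      ⋃ i ∈ Finset.range (m + 1), {t | IsRegen z.2 t ∧ cnt Q t z = i} := by
    rintro t ⟨h1, h2⟩
    simp only [Set.mem_iUnion]
    exact ⟨_, Finset.mem_range.2 (by omega), h1, rfl⟩
  refine (Set.Finite.biUnion (Finset.finite_toSet _) fun i _ => ?_).subset this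
  have := hz i
  rw [← Nat.cofinite_eq_atTop, Filter.eventually_cofinite] at this
  simpa using this

/-- The renewal equation. Almost every path has exactly one last regeneration preceded by at most
`m` occurrences: finiteness is assumed, and time `0` is a candidate. The terms sort the paths by the
number `i` of occurrences before it. -/
theorem IsRegenLaw.sum_renewal_mul (h : IsRegenLaw I P) (hQ : IsLocal I Q) (m : ℕ)
    (hfin : ∀ᵐ z ∂P, {t | IsRegen z.2 t ∧ cnt Q t z ≤ m}.Finite) :
    ∑ i ∈ Finset.range (m + 1), renewal Q P i * P (late Q (m - i)) = 1 := by
  have := h.prob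
  have e : ∀ i ∈ Finset.range (m + 1), renewal Q P i * P (late Q (m - i)) =
      ∑' t, P (lastRegen Q m i t) := by
    intro i hi
    rw [renewal, ← ENNReal.tsum_mul_right]
    refine tsum_congr fun t => ?_
    rw [← h.measure_lastRegen hQ, Nat.add_sub_cancel' (by simpa [Nat.lt_succ_iff] using hi)]
  rw [Finset.sum_congr rfl e, ← Summable.tsum_finsetSum fun _ _ => ENNReal.summable]
  have e2 : ∀ t, ∑ i ∈ Finset.range (m + 1), P (lastRegen Q m i t) =
      P (⋃ i ∈ Finset.range (m + 1), lastRegen Q m i t) := by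
    intro t
    rw [measure_biUnion_finset _ fun i _ => hQ.measurableSet_lastRegen _ _ t]
    intro i _ i' _ hne
    rw [Function.onFun, Set.disjoint_left]
    rintro z ⟨-, h2, -⟩ ⟨-, h2', -⟩
    exact hne (h2.symm.trans h2')
  simp only [e2]
  rw [← measure_iUnion]
  · rw [← measure_univ (μ := P)]
    refine measure_congr ?_
    filter_upwards [hfin, h.zero] with z hz h0
    refine propext (iff_of_true ?_ trivial)
    obtain ⟨t, ⟨ht, htm⟩, hmax⟩ := hz.exists_maximalFor id _ ⟨0, h0, by simp⟩
    refine Set.mem_iUnion.2 ⟨t, Set.mem_iUnion₂.2 ⟨cnt Q t z, Finset.mem_range.2 (by omega), ht, rfl, ?_⟩⟩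
    intro t' htt' hr
    by_contra hle
    have := hmax ⟨hr, by omega⟩ htt'.le
    simp only [id] at this
    omega
  · intro t t' hne
    simp only [Function.onFun, Set.disjoint_iUnion_left, Set.disjoint_iUnion_right]
    intro i hi i' hi'
    exact disjoint_lastRegen (by simpa [Nat.lt_succ_iff] using hi') (by simpa [Nat.lt_succ_iff] using hi) hne
  · exact fun t => Finset.measurableSet_biUnion _ fun i _ => hQ.measurableSet_lastRegen _ _ t

end Env

/-! ### The renewal theorem -/

namespace Renewal

variable {g V : ℕ → ℝ} {L M : ℝ}

/-- Along a filter along which a solution of the renewal equation approaches its upper limit, the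
shifted solutions approach it as well. -/
theorem tendsto_shift {F : Filter ℕ} (hF : F ≤ atTop) (hg : ∀ j, 0 ≤ g j) (hg0 : 0 < g 0)
    (hsum : HasSum g 1) (hM : ∀ n, |V n| ≤ M)
    (hV : ∀ m, V (m + 1) = ∑ j ∈ Finset.range (m + 1), g j * V (m - j))
    (hup : ∀ ε > 0, ∀ᶠ n in atTop, V n ≤ L + ε) (hL : Tendsto V F (𝓝 L)) :
    Tendsto (fun n => V (n - 1)) F (𝓝 L) := by
  have hM0 : 0 ≤ M := (abs_nonneg _).trans (hM 0)
  rw [Metric.tendsto_nhds]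
  intro ε hε
  -- The constant collects the errors below: `δ` from `V (m + 1)`, `(|L| + 1) * δ` from the middle
  -- terms and `M * δ` from the tail, with some room to spare.
  obtain ⟨δ, hδ, hδε⟩ : ∃ δ > 0, (4 + |L| + M) * δ < g 0 * ε :=
    ⟨g 0 * ε / (2 * (4 + |L| + M)), by positivity, by
      have : 0 < 4 + |L| + M := by positivity
      have h2 : 0 < g 0 * ε := mul_pos hg0 hε
      field_simp
      linarith⟩
  obtain ⟨N, hN⟩ := eventually_atTop.1 (hup δ hδ)
  obtain ⟨J, hJ⟩ := eventually_atTop.1 (hsum.tendsto_sum_nat.eventually (lt_mem_nhds (show 1 - δ < 1 by linarith)))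
  have e1 : ∀ᶠ n in F, |V n - L| < δ := by
    have := (Metric.tendsto_nhds.1 hL) δ hδ
    simpa [Real.dist_eq] using this
  have e2 : ∀ᶠ n in F, N + J + 2 ≤ n := hF (eventually_ge_atTop _)
  have hε' : ε < ε + 1 := by linarith
  have e3 : ∀ᶠ n in F, V (n - 1) ≤ L + min δ (ε / 2) := by
    obtain ⟨N', hN'⟩ := eventually_atTop.1 (hup (min δ (ε / 2)) (lt_min hδ (by linarith)))
    have : ∀ᶠ n in F, N' + 1 ≤ n := hF (eventually_ge_atTop _)
    filter_upwards [this] with n hn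
    exact hN' _ (by omega)
  filter_upwards [e1, e2, e3] with n h1 h2 h3
  obtain ⟨m, rfl⟩ : ∃ m, n = m + 1 := ⟨n - 1, by omega⟩
  rw [Nat.add_sub_cancel] at h3 ⊢
  have hle : ∑ j ∈ Finset.range J, g (j + 1) * V (m - (j + 1)) ≤
      ∑ j ∈ Finset.range J, g (j + 1) * (L + δ) := by
    refine Finset.sum_le_sum fun j hj => mul_le_mul_of_nonneg_left (hN _ ?_) (hg _)
    have := Finset.mem_range.1 hj
    omega
  -- The term `j = 0` is to be bounded below. The next `J` terms are at most about `L` each, and the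
  -- remaining ones carry weight at most `δ`. As the total is nearly `L`, the term `g 0 * V m`
  -- cannot be much below `g 0 * L`.
  have hsplit : V (m + 1) = g 0 * V m + (∑ j ∈ Finset.range J, g (j + 1) * V (m - (j + 1)) +
      ∑ j ∈ Finset.range (m - J), g (j + 1 + J) * V (m - (j + 1 + J))) := by
    rw [hV, Finset.sum_range_succ', add_comm]
    simp only [Nat.sub_zero]
    congr 1
    conv_lhs => rw [show m = J + (m - J) by omega, Finset.sum_range_add]
    congr 1
    · refine Finset.sum_congr rfl fun j _ => ?_
      congr 2; omega
    · refine Finset.sum_congr rfl fun j _ => ?_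
      rw [show J + j + 1 = j + 1 + J by omega]
      congr 2; omega
  have hpart : 1 - δ < ∑ j ∈ Finset.range (J + 1), g j := hJ _ (by omega)
  rw [Finset.sum_range_succ'] at hpart
  have htot : ∀ n, ∑ j ∈ Finset.range n, g j ≤ 1 := fun n =>
    hsum.tsum_eq ▸ hsum.summable.sum_le_tsum _ fun j _ => hg j
  have htail : ∑ j ∈ Finset.range (m - J), g (j + 1 + J) * V (m - (j + 1 + J)) ≤ δ * M := by
    have h5 : ∑ j ∈ Finset.range (m - J), g (j + 1 + J) ≤ δ := by
      have := htot (J + 1 + (m - J))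
      rw [Finset.sum_range_add, Finset.sum_range_succ'] at this
      have e : ∑ j ∈ Finset.range (m - J), g (j + 1 + J) = ∑ j ∈ Finset.range (m - J), g (J + 1 + j) :=
        Finset.sum_congr rfl fun j _ => by congr 1; omega
      linarith
    calc ∑ j ∈ Finset.range (m - J), g (j + 1 + J) * V (m - (j + 1 + J))
        ≤ ∑ j ∈ Finset.range (m - J), g (j + 1 + J) * M :=
          Finset.sum_le_sum fun j _ => mul_le_mul_of_nonneg_left ((le_abs_self _).trans (hM _)) (hg _)
      _ = (∑ j ∈ Finset.range (m - J), g (j + 1 + J)) * M := by rw [Finset.sum_mul]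
      _ ≤ δ * M := by gcongr
  rw [← Finset.sum_mul] at hle
  set G := ∑ j ∈ Finset.range J, g (j + 1)
  have hG1 : G ≤ 1 - g 0 := by
    have := htot (J + 1)
    rw [Finset.sum_range_succ'] at this
    linarith
  have hG0 : 1 - g 0 - δ ≤ G := by linarith
  have hGnn : 0 ≤ G := Finset.sum_nonneg fun j _ => hg _
  have hGL : G * (L + δ) ≤ (1 - g 0) * L + |L| * δ + δ := by
    have h6 : G * L ≤ (1 - g 0) * L + |L| * δ := by
      have h7 : ((1 - g 0) - G) * -L ≤ ((1 - g 0) - G) * |L| :=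
        mul_le_mul_of_nonneg_left (neg_le_abs L) (by linarith)
      have h8 : ((1 - g 0) - G) * |L| ≤ δ * |L| :=
        mul_le_mul_of_nonneg_right (by linarith) (abs_nonneg L)
      linarith
    have h9 : G * δ ≤ δ := by nlinarith
    linarith [mul_add G L δ]
  have hmain : g 0 * (L - V m) ≤ (4 + |L| + M) * δ := by
    have := abs_lt.1 h1
    nlinarith
  have hlow : L - V m < ε := by
    by_contra hc
    have : g 0 * ε ≤ g 0 * (L - V m) := mul_le_mul_of_nonneg_left (not_lt.1 hc) hg0.le
    linarith
  rw [Real.dist_eq, abs_lt]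
  constructor
  · linarith
  · have := min_le_right δ (ε / 2)
    linarith

theorem tendsto_shift_add {F : Filter ℕ} (hF : F ≤ atTop) (hg : ∀ j, 0 ≤ g j) (hg0 : 0 < g 0)
    (hsum : HasSum g 1) (hM : ∀ n, |V n| ≤ M)
    (hV : ∀ m, V (m + 1) = ∑ j ∈ Finset.range (m + 1), g j * V (m - j))
    (hup : ∀ ε > 0, ∀ᶠ n in atTop, V n ≤ L + ε) (hL : Tendsto V F (𝓝 L)) (d : ℕ) :
    Tendsto (fun n => V (n - d)) F (𝓝 L) := by
  induction d generalizing F with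
  | zero => simpa using hL
  | succ d ih =>
    have h1 := tendsto_shift hF hg hg0 hsum hM hV hup hL
    have h2 : F.map (fun n => n - 1) ≤ atTop := (tendsto_sub_atTop_nat 1).mono_left hF
    have := ih h2 (tendsto_map'_iff.2 h1)
    have h3 := tendsto_map'_iff.1 this
    refine h3.congr fun n => ?_
    simp only [Function.comp]
    congr 1; omega

/-- A cluster value of the solution with all its shifts is determined by the mean. -/
theorem mul_tsum_eq {F : Filter ℕ} [F.NeBot] (hF : F ≤ atTop) {r : ℕ → ℝ} (hr : Summable r)
    (hr0 : ∀ j, 0 ≤ r j) (hM : ∀ n, |V n| ≤ M) {c : ℝ}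
    (hV : ∀ m, ∑ j ∈ Finset.range (m + 1), r j * V (m - j) = c)
    (hL : ∀ d, Tendsto (fun n => V (n - d)) F (𝓝 L)) [F.IsCountablyGenerated] :
    L * ∑' j, r j = c := by
  have h1 : Tendsto (fun n => ∑' j, if j < n + 1 then r j * V (n - j) else 0) F (𝓝 (∑' j, r j * L)) := by
    refine tendsto_tsum_of_dominated_convergence (bound := fun j => r j * M) (hr.mul_right M) ?_ ?_
    · intro j
      refine ((hL j).const_mul (r j)).congr' ?_
      have : ∀ᶠ n in F, j ≤ n := hF (eventually_ge_atTop _)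
      filter_upwards [this] with n hn
      rw [if_pos (by omega)]
    · refine Eventually.of_forall fun n j => ?_
      split_ifs
      · rw [Real.norm_eq_abs, abs_mul, abs_of_nonneg (hr0 j)]
        exact mul_le_mul_of_nonneg_left (hM _) (hr0 j)
      · rw [norm_zero]
        exact mul_nonneg (hr0 j) ((abs_nonneg _).trans (hM 0))
  have h2 : ∀ n, (∑' j, if j < n + 1 then r j * V (n - j) else 0) = c := by
    intro n
    rw [← hV n, tsum_eq_sum (s := Finset.range (n + 1))]
    · exact Finset.sum_congr rfl fun j hj => if_pos (Finset.mem_range.1 hj)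
    · exact fun j hj => if_neg (by simpa using hj)
  simp only [h2] at h1
  have := tendsto_nhds_unique h1 tendsto_const_nhds
  rw [← this, tsum_mul_right, mul_comm]

/-- Near times at which `V` approaches its upper limit all shifts of `V` approach it as well, so
dominated convergence in the renewal equation identifies the upper limit. -/
theorem limsup_mul_tsum_eq {r : ℕ → ℝ} (hr : Summable r) (hanti : Antitone r) (hr1 : r 1 < r 0)
    (hM : ∀ n, |V n| ≤ M) {c : ℝ}
    (hV : ∀ m, ∑ j ∈ Finset.range (m + 1), r j * V (m - j) = c) :
    limsup V atTop * ∑' j, r j = c := by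
  have hr0 : ∀ j, 0 ≤ r j := fun j => hanti.le_of_tendsto hr.tendsto_atTop_zero j
  have hr00 : 0 < r 0 := (hr0 1).trans_lt hr1
  have hb1 : IsBoundedUnder (· ≤ ·) atTop V := isBoundedUnder_of ⟨M, fun n => (abs_le.1 (hM n)).2⟩
  have hb2 : IsBoundedUnder (· ≥ ·) atTop V := isBoundedUnder_of ⟨-M, fun n => (abs_le.1 (hM n)).1⟩
  set L := limsup V atTop
  have hup : ∀ ε > 0, ∀ᶠ n in atTop, V n ≤ L + ε := fun ε hε =>
    (eventually_lt_of_limsup_lt (show limsup V atTop < L + ε by linarith) hb1).mono fun _ h => h.le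
  have hlow : ∀ ε > 0, ∃ᶠ n in atTop, L - ε < V n := fun ε hε =>
    frequently_lt_of_lt_limsup hb2.isCoboundedUnder_le (show L - ε < limsup V atTop by linarith)
  -- Large times at which `V` is close to its upper limit; this filter does the work of a
  -- subsequence.
  let F : Filter ℕ := atTop ⊓ comap V (𝓝 L)
  have hFn : F.NeBot := by
    have : MapClusterPt L atTop V := by
      rw [mapClusterPt_iff_frequently]
      intro s hs
      obtain ⟨ε, hε, hs'⟩ := Metric.mem_nhds_iff.1 hs
      refine ((hlow ε hε).and_eventually (hup (ε / 2) (by linarith))).mono fun n hn => hs' ?_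
      rw [Metric.mem_ball, Real.dist_eq, abs_lt]
      constructor <;> linarith [hn.1, hn.2]
    rw [neBot_inf_comap_iff_map, inf_comm]
    exact this
  have hF : F ≤ atTop := inf_le_left
  -- Subtracting consecutive renewal equations writes `V (m + 1)` as an average of earlier values
  -- with these weights. They telescope to total mass `1`, and `r 1 < r 0` makes `g 0` positive.
  set g : ℕ → ℝ := fun j => (r j - r (j + 1)) / r 0
  have hg : ∀ j, 0 ≤ g j := fun j => div_nonneg (sub_nonneg.2 (hanti (Nat.le_succ j))) hr00.le
  have hg0 : 0 < g 0 := div_pos (by linarith) hr00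
  have hsum : HasSum g 1 := by
    rw [hasSum_iff_tendsto_nat_of_nonneg hg]
    have h1 : ∀ n, ∑ j ∈ Finset.range n, g j = (r 0 - r n) / r 0 := fun n => by
      rw [← Finset.sum_div, Finset.sum_range_sub']
    simp only [h1]
    have := (hr.tendsto_atTop_zero.const_sub (r 0)).div_const (r 0)
    rwa [sub_zero, div_self hr00.ne'] at this
  have hVg : ∀ m, V (m + 1) = ∑ j ∈ Finset.range (m + 1), g j * V (m - j) := by
    intro m
    have h1 := hV (m + 1)
    have h2 := hV m
    rw [Finset.sum_range_succ'] at h1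
    simp only [Nat.sub_zero, Nat.add_sub_add_right] at h1
    have h3 : ∑ j ∈ Finset.range (m + 1), g j * V (m - j) =
        (∑ j ∈ Finset.range (m + 1), r j * V (m - j) -
          ∑ j ∈ Finset.range (m + 1), r (j + 1) * V (m - j)) / r 0 := by
      rw [← Finset.sum_sub_distrib, Finset.sum_div]
      exact Finset.sum_congr rfl fun j _ => by ring
    rw [h3, h2, eq_div_iff hr00.ne']
    linarith
  exact mul_tsum_eq hF hr hr0 hM hV (tendsto_shift_add hF hg hg0 hsum hM hVg hup
    (tendsto_comap.mono_left inf_le_right))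

/-- The renewal theorem. -/
theorem tendsto {r : ℕ → ℝ} (hr : Summable r) (hanti : Antitone r) (hr1 : r 1 < r 0)
    {U : ℕ → ℝ} (hM : ∀ n, |U n| ≤ M)
    (hU : ∀ m, ∑ j ∈ Finset.range (m + 1), r j * U (m - j) = 1) :
    Tendsto U atTop (𝓝 (∑' j, r j)⁻¹) := by
  have hb1 : IsBoundedUnder (· ≤ ·) atTop U := isBoundedUnder_of ⟨M, fun n => (abs_le.1 (hM n)).2⟩
  have h1 := limsup_mul_tsum_eq hr hanti hr1 hM hU
  -- Applied to `-U`, the same identity gives the lower limit.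
  have h2 := limsup_mul_tsum_eq (V := fun n => - U n) (c := -1) hr hanti hr1 (fun n => by rw [abs_neg]; exact hM n)
    fun m => by
      rw [← hU m, ← Finset.sum_neg_distrib]
      exact Finset.sum_congr rfl fun j _ => by ring
  have hb3 : IsBoundedUnder (· ≤ ·) atTop fun n => - U n :=
    isBoundedUnder_of ⟨M, fun n => by linarith [(abs_le.1 (hM n)).1]⟩
  have e1 : limsup U atTop = (∑' j, r j)⁻¹ := eq_inv_of_mul_eq_one_left h1
  have e2 : limsup (fun n => - U n) atTop = - (∑' j, r j)⁻¹ := by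
    rw [← neg_eq_iff_eq_neg]
    refine eq_inv_of_mul_eq_one_left ?_
    linarith
  rw [Metric.tendsto_nhds]
  intro ε hε
  filter_upwards [eventually_lt_of_limsup_lt (show limsup U atTop < (∑' j, r j)⁻¹ + ε by linarith) hb1,
    eventually_lt_of_limsup_lt (show limsup (fun n => - U n) atTop < - (∑' j, r j)⁻¹ + ε by linarith) hb3]
    with n h3 h4
  rw [Real.dist_eq, abs_lt]
  constructor <;> linarith

end Renewal

/-! ### Renewal theorem at regenerations; integrability of a block -/

namespace Env

section Abstract

variable {I : Set ℝ} {P μ : Measure Sample} {Q Q' : Sample → ℕ → Prop}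

theorem late_anti (Q : Sample → ℕ → Prop) : Antitone (late Q) := fun _ _ h _ hz t ht hr =>
  h.trans_lt (hz t ht hr)

theorem late_subset (h : ∀ z t, Q z t → Q' z t) (j : ℕ) : late Q j ⊆ late Q' j :=
  fun z hz t ht hr => (hz t ht hr).trans_le (cnt_le_cnt (h z) t)

/-- The renewal theorem for the occurrences of `Q` at regeneration times. -/
theorem IsRegenLaw.tendsto_renewal (h : IsRegenLaw I P) (hQ : IsLocal I Q)
    (h1 : P (late Q 1) < P (late Q 0)) (hsum : ∑' j, P (late Q j) ≠ ∞) :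
    (∀ m, renewal Q P m ≠ ∞) ∧
    Tendsto (fun m => (renewal Q P m).toReal) atTop (𝓝 (∑' j, P (late Q j)).toReal⁻¹) := by
  have := h.prob
  have h0 : P (late Q 0) ≠ 0 := ne_bot_of_gt h1
  have hU : ∀ m, renewal Q P m ≤ (P (late Q 0))⁻¹ := fun m => by
    rw [ENNReal.le_inv_iff_mul_le]
    exact h.renewal_mul_le hQ m
  have hUtop : ∀ m, renewal Q P m ≠ ∞ := fun m => ne_top_of_le_ne_top (ENNReal.inv_ne_top.2 h0) (hU m)
  refine ⟨hUtop, ?_⟩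
  rw [ENNReal.tsum_toReal_eq fun j => measure_ne_top _ _]
  refine Renewal.tendsto (r := fun j => (P (late Q j)).toReal) (M := ((P (late Q 0))⁻¹).toReal)
    (ENNReal.summable_toReal hsum) ?_ ?_ ?_ ?_
  · exact fun i j hij => ENNReal.toReal_mono (measure_ne_top _ _) (measure_mono (late_anti Q hij))
  · exact (ENNReal.toReal_lt_toReal (measure_ne_top _ _) (measure_ne_top _ _)).2 h1
  · intro n
    rw [abs_of_nonneg ENNReal.toReal_nonneg]
    exact ENNReal.toReal_mono (ENNReal.inv_ne_top.2 h0) (hU n)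
  · intro m
    have key := h.sum_renewal_mul hQ m (h.ae_finite hQ h0 m)
    rw [← Finset.sum_range_reflect] at key
    have := congrArg ENNReal.toReal key
    rw [ENNReal.toReal_sum fun j _ => ENNReal.mul_ne_top (hUtop _) (measure_ne_top _ _), ENNReal.toReal_one] at this
    rw [← this]
    refine Finset.sum_congr rfl fun j hj => ?_
    have := Finset.mem_range.1 hj
    rw [ENNReal.toReal_mul, mul_comm, show m + 1 - 1 - j = m - j by omega, show m - (m - j) = j by omega]

end Abstract

variable (p : PMF ℕ) (ν : Measure ℝ) [IsProbabilityMeasure ν]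

theorem ae_escapeLaw_bias_nil : ∀ᵐ z ∂escapeLaw p ν, (z.1 []).2 = 0 := by
  rw [ae_escapeLaw_iff p ν (P := fun z => (z.1 []).2 = 0)]
  · exact Eventually.of_forall fun z _ => by simp [sub]
  · exact (measurableSet_singleton (0 : ℝ)).preimage (f := fun z : Sample => (z.1 []).2) (by fun_prop)

theorem isRegenLaw_regenLaw (he : escapeLaw p ν Set.univ ≠ 0) : IsRegenLaw ν.support (regenLaw p ν) where
  prob := isProbabilityMeasure_regenLaw p ν he
  good := Measure.ae_smul_measure (ae_escapeLaw_isGood p ν) _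
  zero := by
    refine Measure.ae_smul_measure ?_ _
    filter_upwards [ae_escapeLaw_isGood p ν] with z hz
    exact ⟨fun s hs => absurd hs (by omega), fun s _ => by rw [hz.zero]; exact List.nil_suffix⟩
  regen t := by
    rcases Nat.eq_zero_or_pos t with rfl | ht
    · intro F G hF hG
      have hP := isProbabilityMeasure_regenLaw p ν he
      -- At time `0` the past is deterministic and the future is the whole sample. This uses that
      -- the meaningless bias of the root has been set to `0` in the escape law.
      have hall : ∀ᵐ z ∂regenLaw p ν, IsRegen z.2 0 ∧ past 0 z = (fun _ => (1, 0), fun _ => []) ∧ next 0 z = z := by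
        refine Measure.ae_smul_measure ?_ _
        filter_upwards [ae_escapeLaw_isGood p ν, ae_escapeLaw_bias_nil p ν] with z hz hz0
        refine ⟨⟨fun s hs => absurd hs (by omega), fun s _ => by rw [hz.zero]; exact List.nil_suffix⟩, ?_, ?_⟩
        · refine Prod.ext ?_ ?_
          · funext w
            by_cases hw : w = []
            · subst hw; simp [past, glue, hz.zero, hz0]
            · simp [past, glue, hz.zero, hw]
          · funext s
            simp [past, hz.zero]
        · refine Prod.ext ?_ ?_
          · funext w
            by_cases hw : w = []
            · subst hw; simp [next, sub, hz.zero, Prod.ext_iff, hz0]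
            · simp [next, sub, hz.zero, hw]
          · funext s
            simp [next, strip, hz.zero]
      have hr : (regenLaw p ν).restrict {z | IsRegen z.2 0} = regenLaw p ν :=
        Measure.restrict_eq_self_of_ae_mem (hall.mono fun z hz => hz.1)
      rw [hr]
      have e1 : ∫⁻ z, F (past 0 z) * G (next 0 z) ∂regenLaw p ν =
          ∫⁻ z, F (fun _ => (1, 0), fun _ => []) * G z ∂regenLaw p ν :=
        lintegral_congr_ae (hall.mono fun z hz => by simp only [hz.2.1, hz.2.2])
      have e2 : ∫⁻ z, F (past 0 z) ∂regenLaw p ν =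
          ∫⁻ z, F (fun _ => (1, 0), fun _ => []) ∂regenLaw p ν :=
        lintegral_congr_ae (hall.mono fun z hz => by simp only [hz.2.1])
      rw [e1, e2, lintegral_const_mul _ hG, lintegral_const, measure_univ, mul_one]
    · exact regenerative_regenLaw p ν he t ht

theorem measurableSet_isFresh' (t : ℕ) : MeasurableSet {z : Sample | IsFresh z.2 t} :=
  (measurableSet_isFresh t).preimage measurable_snd

theorem escapeLaw_regen_inter {t : ℕ} (ht : 1 ≤ t) {A : Set Sample} (hA : MeasurableSet A) :
    escapeLaw p ν {z | IsRegen z.2 t ∧ past t z ∈ A} =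
      (∫⁻ z in {z | IsFresh z.2 t}, weightUpTo z.1 z.2 t *
        A.indicator 1 (sub [] (past t z).1, (past t z).2) ∂freeLaw p ν) * escapeLaw p ν Set.univ := by
  have key := lintegral_escapeLaw_regen p ν ht (F := A.indicator 1) (G := fun _ => 1)
    (measurable_one.indicator hA) measurable_const
  simp only [mul_one, lintegral_one] at key
  have h1 : ∀ z, A.indicator (1 : Sample → ℝ≥0∞) (past t z) = (past t ⁻¹' A).indicator 1 z := fun z => rfl
  simp only [h1] at key
  have mA := hA.preimage (measurable_past t)
  rw [lintegral_indicator_one mA, Measure.restrict_apply mA] at key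
  rw [show {z | IsRegen z.2 t ∧ past t z ∈ A} = past t ⁻¹' A ∩ {z : Sample | IsRegen z.2 t} by
    ext; simp; tauto, key]
  congr 1
  refine setLIntegral_congr_fun (measurableSet_isFresh' t) fun z hz => ?_
  simp only [weightUpTo_past (ne_nil_of_isFresh ht hz)]

/-- At the arrival at the new vertex preceded by `m` others, the subtree is untouched, so the walk
then regenerates with a chance equal to the escape mass. In `regenLaw` this mass cancels against the
normalisation. What remains is the integral of `weightUpTo` at that arrival, which is at least the
integral of `weight`, that is, the escape mass. -/
theorem le_renewal_newVertex (he : escapeLaw p ν Set.univ ≠ 0) (m : ℕ) :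
    escapeLaw p ν Set.univ ≤ renewal NewVertex (regenLaw p ν) m := by
  have hR := isRegenLaw_regenLaw p ν he
  have hP := hR.prob
  rcases Nat.eq_zero_or_pos m with rfl | hm
  · refine (escapeLaw_univ_le_one p ν).trans ?_
    rw [renewal]
    refine le_trans ?_ (ENNReal.le_tsum 0)
    simp only [cnt_zero, and_true]
    rw [← measure_univ (μ := regenLaw p ν)]
    exact measure_mono_ae (hR.zero.mono fun z hz _ => hz)
  · have htop : escapeLaw p ν Set.univ ≠ ∞ := ne_top_of_le_ne_top ENNReal.one_ne_top (escapeLaw_univ_le_one p ν)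
    set A : ℕ → Set Sample := fun t => {z | cnt NewVertex t z = m}
    have hA : ∀ t, MeasurableSet (A t) := fun t => (isLocal_newVertex ν.support).measurableSet_cnt t m
    have hB : ∀ t, MeasurableSet {z : Sample | IsFresh z.2 t ∧ cnt NewVertex t z = m} := fun t =>
      (measurableSet_isFresh' t).inter (hA t)
    have hterm : ∀ t, ∫⁻ z, weight z.1 z.2 * {z : Sample | IsFresh z.2 t ∧ cnt NewVertex t z = m}.indicator 1 z
        ∂freeLaw p ν ≤ regenLaw p ν {z | IsRegen z.2 t ∧ cnt NewVertex t z = m} := by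
      intro t
      rcases Nat.eq_zero_or_pos t with rfl | ht
      · have : {z : Sample | IsFresh z.2 0 ∧ cnt NewVertex 0 z = m} = ∅ := by
          ext z; simp; omega
        rw [this]
        simp
      · have hcnt : ∀ z, cnt NewVertex t (past t z) = cnt NewVertex t z := fun z =>
          cnt_congr fun s hs => newVertex_past hs.le
        have e1 : {z : Sample | IsRegen z.2 t ∧ cnt NewVertex t z = m} = {z | IsRegen z.2 t ∧ past t z ∈ A t} := by
          ext z
          simp only [A, Set.mem_ofPred_eq, hcnt]
        rw [e1, regenLaw, Measure.smul_apply, smul_eq_mul, escapeLaw_regen_inter p ν ht (hA t), mul_comm,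
          mul_assoc, ENNReal.mul_inv_cancel he htop, mul_one, ← lintegral_indicator (measurableSet_isFresh' t)]
        refine lintegral_mono fun z => ?_
        by_cases hz : IsFresh z.2 t ∧ cnt NewVertex t z = m
        · have h2 : ((sub [] (past t z).1, (past t z).2) : Sample) ∈ A t := by
            have : cnt NewVertex t (sub [] (past t z).1, (past t z).2) = cnt NewVertex t (past t z) :=
              cnt_congr fun s _ => Iff.rfl
            exact this.trans ((hcnt z).trans hz.2)
          simp only []
          rw [Set.indicator_of_mem (by exact hz), Set.indicator_of_mem (by exact hz.1),
            Set.indicator_of_mem h2, Pi.one_apply, Pi.one_apply]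
          gcongr
          exact iInf_le _ t
        · simp only []
          rw [Set.indicator_of_notMem (by exact hz), mul_zero]
          exact bot_le
    rw [renewal]
    refine le_trans ?_ (ENNReal.tsum_le_tsum hterm)
    have := lintegral_escapeLaw p ν (G := fun _ => 1) measurable_const
    simp only [mul_one, lintegral_one] at this
    have hm : ∀ t, Measurable fun z : Sample =>
        weight z.1 z.2 * {z : Sample | IsFresh z.2 t ∧ cnt NewVertex t z = m}.indicator 1 z :=
      fun t => measurable_weight.mul (measurable_one.indicator (hB t))
    rw [this, ← lintegral_tsum fun t => (hm t).aemeasurable]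
    refine lintegral_mono_ae ?_
    filter_upwards [ae_freeLaw_isGood p ν] with z hz
    by_cases hw : weight z.1 z.2 = 0
    · rw [hw]; exact bot_le
    · have hg := hz (finVisits_of_weight_ne_zero hw)
      obtain ⟨t, ht, htm⟩ := exists_cnt_eq hg.infinite_newVertex m
      refine le_trans ?_ (ENNReal.le_tsum t)
      rw [Set.indicator_of_mem (by exact ⟨hg.isFresh ht, htm⟩)]
      simp

/-- In the renewal equation every renewal mass is at least the escape mass, so the partial sums of
the tails are at most its inverse. Hence a block has finitely many new vertices on average. -/
theorem tsum_late_newVertex_ne_top (he : escapeLaw p ν Set.univ ≠ 0) :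
    ∑' j, regenLaw p ν (late NewVertex j) ≠ ∞ := by
  have hR := isRegenLaw_regenLaw p ν he
  refine ne_top_of_le_ne_top (ENNReal.inv_ne_top.2 he) ?_
  rw [ENNReal.tsum_eq_iSup_nat]
  refine iSup_le fun m => ?_
  rcases m with _ | m
  · simp
  rw [ENNReal.le_inv_iff_mul_le, ← hR.sum_renewal_mul (isLocal_newVertex _) m ?_, ← Finset.sum_range_reflect,
    Finset.sum_mul]
  · refine Finset.sum_le_sum fun j hj => ?_
    have := Finset.mem_range.1 hj
    rw [mul_comm, show m + 1 - 1 - j = m - j by omega]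
    exact mul_le_mul_left (le_renewal_newVertex p ν he j) _
  · filter_upwards [hR.good] with z hz
    exact (finite_cnt_le hz.infinite_newVertex m).subset fun t ht => ht.2

theorem tsum_late_newTrap_ne_top (he : escapeLaw p ν Set.univ ≠ 0) :
    ∑' j, regenLaw p ν (late NewTrap j) ≠ ∞ :=
  ne_top_of_le_ne_top (tsum_late_newVertex_ne_top p ν he)
    (ENNReal.tsum_le_tsum fun j => measure_mono (late_subset (fun _ _ h => h.2) j))

/-- A path without a further regeneration belongs to every `late NewVertex j`, and these
probabilities are summable. -/
theorem ae_regenLaw_exists_isRegen (he : escapeLaw p ν Set.univ ≠ 0) :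
    ∀ᵐ z ∂regenLaw p ν, ∃ t ≥ 1, IsRegen z.2 t := by
  have h := ENNReal.tendsto_atTop_zero_of_tsum_ne_top (tsum_late_newVertex_ne_top p ν he)
  rw [ae_iff]
  refine le_antisymm (ge_of_tendsto' h fun j => measure_mono fun z hz => ?_) bot_le
  simp only [Set.mem_ofPred_eq, not_exists, not_and] at hz
  exact fun t ht hr => absurd hr (hz t ht)

theorem ae_jointLaw_exists_isRegen (he : escapeLaw p ν Set.univ ≠ 0) (hν : ν.support ⊆ Set.Ioi 1) :
    ∀ᵐ z ∂jointLaw p ν, ∃ t ≥ 1, IsRegen z.2 t := by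
  have h1 : ∀ᵐ z ∂escapeLaw p ν, ∃ t ≥ 1, IsRegen z.2 t := by
    have := ae_regenLaw_exists_isRegen p ν he
    rwa [regenLaw, Measure.ae_ennreal_smul_measure_iff] at this
    rw [ENNReal.inv_ne_zero]
    exact ne_top_of_le_ne_top ENNReal.one_ne_top (escapeLaw_univ_le_one p ν)
  have hm : MeasurableSet {z : Sample | ∃ t ≥ 1, IsRegen z.2 t} := by
    have : {z : Sample | ∃ t ≥ 1, IsRegen z.2 t} = ⋃ t ≥ 1, {z : Sample | IsRegen z.2 t} := by
      ext z; simp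
    rw [this]
    exact MeasurableSet.biUnion (Set.to_countable _) fun t _ => measurableSet_isRegen' t
  rw [ae_escapeLaw_iff p ν hm] at h1
  refine ae_jointLaw p ν _ ?_
  filter_upwards [h1, ae_freeLaw_weight_ne_zero p ν hν] with z h2 h3 h4
  exact h2 (h3 h4)

end Env

/-! ### Aperiodicity of the number of trap entrances in a block -/

namespace Env

variable (p : PMF ℕ) (ν : Measure ℝ) [IsProbabilityMeasure ν]

theorem exists_two_le (hmean : 1 < ∑' i : ℕ, (i : ℝ≥0∞) * p i) : ∃ m, 2 ≤ m ∧ p m ≠ 0 := by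
  by_contra! h
  refine absurd hmean (not_lt.2 ?_)
  rw [← p.tsum_coe]
  refine ENNReal.tsum_le_tsum fun i => ?_
  rcases lt_or_ge i 2 with hi | hi
  · refine mul_le_of_le_one_left bot_le ?_
    exact_mod_cast (by omega : i ≤ 1)
  · rw [h i hi, mul_zero]

/-- The root has `m` children, the second of which has none. -/
def stub (m : ℕ) : Set Env := {ω | (ω []).1 = m ∧ (ω [1]).1 = 0}

theorem measurableSet_stub (m : ℕ) : MeasurableSet (stub m) :=
  ((measurableSet_singleton m).preimage (f := fun ω : Env => (ω []).1) (by fun_prop)).inter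
    ((measurableSet_singleton 0).preimage (f := fun ω : Env => (ω [1]).1) (by fun_prop))

theorem envLaw_stub (m : ℕ) : envLaw p ν (stub m) = p m * p 0 := by
  have hD : ∀ m, MeasurableSet {ω : Env | (ω []).1 = m} := fun m =>
    (measurableSet_singleton m).preimage (f := fun ω : Env => (ω []).1) (by fun_prop)
  have key := lintegral_envLaw_glue p ν [1] (h := {ω : Env | (ω []).1 = m}.indicator 1)
    (r := {ω : Env | (ω []).1 = 0}.indicator 1) (measurable_one.indicator (hD m))
    (measurable_one.indicator (hD 0)) (fun ω ω' => by
      have h : glue [1] ω ω' ∈ {ω : Env | (ω []).1 = m} ↔ ω ∈ {ω : Env | (ω []).1 = m} := by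
        rw [Set.mem_ofPred_eq, glue_of_not_suffix _ _ (by simp), Set.mem_ofPred_eq]
      by_cases hω : ω ∈ {ω : Env | (ω []).1 = m}
      · rw [Set.indicator_of_mem hω, Set.indicator_of_mem (h.2 hω), Pi.one_apply, Pi.one_apply]
      · rw [Set.indicator_of_notMem hω, Set.indicator_of_notMem (mt h.1 hω)])
  have e1 : ∀ ω : Env, {ω : Env | (ω []).1 = m}.indicator (1 : Env → ℝ≥0∞) ω *
      {ω : Env | (ω []).1 = 0}.indicator 1 (sub [1] ω) = (stub m).indicator 1 ω := by
    intro ω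
    simp only [Set.indicator, Set.mem_ofPred_eq, stub, sub, List.nil_append, Pi.one_apply]
    by_cases h1 : (ω []).1 = m <;> by_cases h2 : (ω [1]).1 = 0 <;> simp [h1, h2]
  have e2 : ∀ ω : Env, {ω : Env | (ω []).1 = 0}.indicator (1 : Env → ℝ≥0∞) (sub [] ω) =
      {ω : Env | (ω []).1 = 0}.indicator 1 ω := fun ω => rfl
  simp only [e1, e2] at key
  rwa [lintegral_indicator_one (measurableSet_stub m), lintegral_indicator_one (hD m),
    lintegral_indicator_one (hD 0), envLaw_offspring, envLaw_offspring] at key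

/-- A visit to the second child of the root, and then to the first. -/
def detour : ℕ → Vertex := fun s => if s = 1 then [1] else if s = 3 then [0] else []

theorem walkFrom_detour_ne_zero {ω : Env} {m : ℕ} (hm : 2 ≤ m) (hω : ω ∈ stub m)
    (hb : ∀ v, 0 < (ω v).2) : walkFrom (ω, []) {X | ∀ i ≤ 3, X i = detour i} ≠ 0 := by
  have hc : childRate ω [] ≠ 0 := by
    intro h
    rw [childRate, Finset.sum_eq_zero_iff] at h
    have := h 0 (Finset.mem_range.2 (by rw [hω.1]; omega))
    exact absurd (ENNReal.ofReal_eq_zero.1 this) (not_le.2 (hb _))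
  have hchild : ∀ i < m, jump (ω, []) {[i]} ≠ 0 := by
    intro i hi
    rw [jump_nil ω hc, Measure.smul_apply, smul_eq_mul]
    refine mul_ne_zero (ENNReal.inv_ne_zero.2 (childRate_ne_top _ _)) ?_
    have h2 := lintegral_rates ω [] (({[i]} : Set Vertex).indicator 1)
    rw [lintegral_indicator_one (measurableSet_singleton _), if_pos rfl, zero_add] at h2
    rw [h2]
    intro h0
    rw [Finset.sum_eq_zero_iff] at h0
    have := h0 i (Finset.mem_range.2 (by rw [hω.1]; exact hi))
    rw [Set.indicator_of_mem (Set.mem_singleton _), Pi.one_apply, mul_one] at this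
    exact absurd (ENNReal.ofReal_eq_zero.1 this) (not_le.2 (hb _))
  have hback : jump (ω, [1]) {[]} ≠ 0 := by
    have h2 := lintegral_jump_of_ne_nil ω (x := [1]) (by simp) (({[]} : Set Vertex).indicator 1)
    rw [lintegral_indicator_one (measurableSet_singleton _)] at h2
    rw [h2]
    refine mul_ne_zero (ENNReal.inv_ne_zero.2 (ENNReal.add_ne_top.2 ⟨by simp, childRate_ne_top _ _⟩)) ?_
    simp
  rw [walkFrom_cylinder]
  simp only [detour, Finset.prod_range_succ, Finset.prod_range_zero]
  simp only [show (0 : ℕ) ≠ 1 by norm_num, if_false, if_true, one_mul, zero_add,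
    show (0 : ℕ) ≠ 3 by norm_num, show (2 : ℕ) ≠ 1 by norm_num, show (2 : ℕ) ≠ 3 by norm_num,
    show (1 + 1 : ℕ) = 2 by norm_num, show (2 + 1 : ℕ) = 3 by norm_num, show (3 : ℕ) ≠ 1 by norm_num]
  exact mul_ne_zero (mul_ne_zero (hchild 1 (by omega)) hback) (hchild 0 (by omega))

/-- The excursion to the childless vertex `[1]` is the only arrival at a trap entrance before the
regeneration at `[0]`. An earlier regeneration at time `1` is impossible because the walk returns,
so one trap entrance precedes every regeneration. -/
theorem cnt_detour {I : Set ℝ} {z : Sample} (hz : IsGood I z) {m : ℕ} (hm : 2 ≤ m) (h1 : z.1 ∈ stub m)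
    (h2 : ∀ i ≤ 3, z.2 i = detour i) (h3 : IsRegen z.2 3) :
    z ∈ late NewTrap 0 \ late NewTrap 1 := by
  have x0 : z.2 0 = [] := h2 0 (by norm_num)
  have x1 : z.2 1 = [1] := h2 1 (by norm_num)
  have x2 : z.2 2 = [] := h2 2 (by norm_num)
  have t0 : ¬ NewTrap z 0 := by
    rintro ⟨h, -⟩
    rw [x0] at h
    exact h.not_survives hz.survives_nil
  have t1 : NewTrap z 1 := by
    refine ⟨?_, fun s hs => ?_⟩
    · rw [x1, isTrapEntrance_iff]
      refine ⟨1, [], rfl, ⟨trivial, by rw [h1.1]; omega⟩, hz.survives_nil, fun h => ?_⟩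
      obtain ⟨i, hi, -⟩ := h.exists_child
      rw [h1.2] at hi
      omega
    · obtain rfl : s = 0 := by omega
      rw [x0, x1]
      simp
  have t2 : ¬ NewTrap z 2 := fun h => h.2 0 (by norm_num) (by rw [x0, x2])
  have c1 : cnt NewTrap 1 z = 0 := by rw [cnt_succ_of_neg t0, cnt_zero]
  have c2 : cnt NewTrap 2 z = 1 := by rw [cnt_succ_of_pos t1, c1]
  have c3 : cnt NewTrap 3 z = 1 := by rw [cnt_succ_of_neg t2, c2]
  refine ⟨fun t ht hr => ?_, fun h => ?_⟩
  · have : t ≠ 1 := by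
      rintro rfl
      have := hr.2 2 (by norm_num)
      rw [x1, x2] at this
      simp at this
    have := monotone_cnt (Q := NewTrap) (z := z) (show 2 ≤ t by omega)
    simp only [c2] at this
    omega
  · have := h 3 (by norm_num) h3
    omega

/-- A block with exactly one trap entrance has positive probability: the root has some `m ≥ 2`
children, the second is childless because `p 0 ≠ 0`, and the walk makes the detour and then
regenerates. -/
theorem late_one_lt_late_zero (he : escapeLaw p ν Set.univ ≠ 0)
    (hmean : 1 < ∑' i : ℕ, (i : ℝ≥0∞) * p i) (hp0 : p 0 ≠ 0) (hν : ν.support ⊆ Set.Ioi 1) :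
    regenLaw p ν (late NewTrap 1) < regenLaw p ν (late NewTrap 0) := by
  have hR := isRegenLaw_regenLaw p ν he
  have hP := hR.prob
  obtain ⟨m, hm, hpm⟩ := exists_two_le p hmean
  have htop : escapeLaw p ν Set.univ ≠ ∞ := ne_top_of_le_ne_top ENNReal.one_ne_top (escapeLaw_univ_le_one p ν)
  set A : Set Sample := {z | z.1 ∈ stub m} ∩ {z | ∀ i ≤ 3, z.2 i = detour i} with hAdef
  have hcyl : MeasurableSet {X : ℕ → Vertex | ∀ i ≤ 3, X i = detour i} := measurableSet_cylinder _ _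
  have hA : MeasurableSet A := ((measurableSet_stub m).preimage measurable_fst).inter
    (hcyl.preimage measurable_snd)
  have hpast : ∀ z : Sample, z.2 3 = [0] → (past 3 z ∈ A ↔ z ∈ A) := by
    intro z hz
    simp only [hAdef, Set.mem_inter_iff, Set.mem_ofPred_eq, stub, past, hz]
    rw [glue_of_not_suffix _ _ (by simp), glue_of_not_suffix _ _ (by decide)]
    refine and_congr_right fun _ => forall₂_congr fun i hi => ?_
    rw [min_eq_left hi]
  -- Regeneration at time `3` factorises off the escape mass. It remains to integrate a positive
  -- weight over a set of positive probability for the unconditioned law, given by the local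
  -- environment and the first three steps.
  have hmain : escapeLaw p ν {z | IsRegen z.2 3 ∧ past 3 z ∈ A} ≠ 0 := by
    rw [escapeLaw_regen_inter p ν (by norm_num) hA]
    refine mul_ne_zero ?_ he
    have hmeas : Measurable fun z : Sample => weightUpTo z.1 z.2 3 *
        A.indicator (1 : Sample → ℝ≥0∞) (sub [] (past 3 z).1, (past 3 z).2) :=
      (measurable_weightUpTo 3).mul ((measurable_one.indicator hA).comp
        (((measurable_sub []).prodMap measurable_id).comp (measurable_past 3)))
    intro h0
    rw [lintegral_eq_zero_iff hmeas, Filter.EventuallyEq, ae_restrict_iff' (measurableSet_isFresh' 3)] at h0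
    have hpos : ∀ᵐ z ∂freeLaw p ν, ∀ v, 0 < (z.1 v).2 := by
      refine ae_freeLaw p ν ?_ ?_
      · have : {z : Sample | ∀ v, 0 < (z.1 v).2} = ⋂ v, {z : Sample | (z.1 v).2 ∈ Set.Ioi 0} := by
          ext z; simp
        rw [this]
        exact MeasurableSet.iInter fun v =>
          measurableSet_Ioi.preimage (f := fun z : Sample => (z.1 v).2) (by fun_prop)
      · filter_upwards [ae_all_iff.2 fun v => ae_envLaw_bias p ν v] with ω hω
        exact Eventually.of_forall fun X v => lt_trans one_pos (hν (hω v))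
    have hnot : ∀ᵐ z ∂freeLaw p ν, z ∉ A := by
      filter_upwards [h0, hpos] with z h1 h2 hzA
      have x0 : z.2 0 = [] := hzA.2 0 (by norm_num)
      have x1 : z.2 1 = [1] := hzA.2 1 (by norm_num)
      have x2 : z.2 2 = [] := hzA.2 2 (by norm_num)
      have x3 : z.2 3 = [0] := hzA.2 3 (by norm_num)
      have hf : IsFresh z.2 3 := by
        intro s hs
        rw [x3]
        interval_cases s <;> simp only [x0, x1, x2] <;> decide
      have h3 := h1 hf
      have h4 : ((sub [] (past 3 z).1, (past 3 z).2) : Sample) ∈ A := by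
        have := (hpast z x3).2 hzA
        exact ⟨by simpa [stub, sub] using this.1, this.2⟩
      rw [Set.indicator_of_mem h4, Pi.one_apply, mul_one, Pi.zero_apply, weightUpTo,
        Finset.prod_eq_zero_iff] at h3
      obtain ⟨s, -, hs⟩ := h3
      split_ifs at hs
      · rw [stayProb, mul_eq_zero] at hs
        rcases hs with hs | hs
        · rw [childRate, Finset.sum_eq_zero_iff] at hs
          have := hs 0 (Finset.mem_range.2 (by rw [hzA.1.1]; omega))
          exact absurd (ENNReal.ofReal_eq_zero.1 this) (not_le.2 (h2 _))
        · rw [ENNReal.inv_eq_zero] at hs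
          exact ENNReal.add_ne_top.2 ⟨by simp, childRate_ne_top _ _⟩ hs
      · exact one_ne_zero hs
    have hA0 : freeLaw p ν A = 0 := by
      rw [ae_iff] at hnot
      simpa using hnot
    rw [freeLaw, Measure.compProd_apply hA, lintegral_eq_zero_iff (Kernel.measurable_kernel_prodMk_left hA)] at hA0
    have hz : ∀ᵐ ω ∂envLaw p ν, ω ∉ stub m := by
      filter_upwards [hA0, ae_all_iff.2 fun v => ae_envLaw_bias p ν v] with ω h1 h2 h3
      refine walkFrom_detour_ne_zero hm h3 (fun v => lt_trans one_pos (hν (h2 v))) ?_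
      rw [walkKernel_apply] at h1
      refine le_antisymm (le_trans (measure_mono ?_) h1.le) bot_le
      intro X hX
      exact ⟨h3, hX⟩
    rw [ae_iff] at hz
    have := envLaw_stub p ν m
    rw [show stub m = {ω | ¬ ω ∉ stub m} by ext; simp, hz] at this
    exact mul_ne_zero hpm hp0 this.symm
  have hdiff : regenLaw p ν (late NewTrap 0 \ late NewTrap 1) ≠ 0 := by
    intro h0
    refine hmain ?_
    have h1 : regenLaw p ν {z | IsRegen z.2 3 ∧ past 3 z ∈ A} = 0 := by
      refine measure_mono_null_ae ?_ h0
      filter_upwards [hR.good] with z hz hzA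
      have x3 : z.2 3 = [0] := by
        have := hzA.2.2 3 le_rfl
        rwa [past_apply le_rfl] at this
      have := (hpast z x3).1 hzA.2
      exact cnt_detour hz hm this.1 this.2 hzA.1
    rw [regenLaw, Measure.smul_apply, smul_eq_mul, mul_eq_zero] at h1
    exact h1.resolve_left (ENNReal.inv_ne_zero.2 htop)
  have h0 := late_anti NewTrap (zero_le_one)
  rw [measure_sdiff h0 ((isLocal_newTrap ν.support).measurableSet_late 1).nullMeasurableSet (measure_ne_top _ _)] at hdiff
  exact tsub_pos_iff_lt.1 (pos_iff_ne_zero.2 hdiff)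

end Env

/-! ### Trees with a rank function; the backbone at a trap entrance -/

namespace WTree

variable {S T : WTree}

/-- Every edge is a bridge: the descendants of its lower end can be left through this edge only,
since parents are unique, and the rank keeps the upper end from being one of them. -/
theorem isTree_of_rank {V : Type} {par : V → V → Prop} (huniq : ∀ w w' v, par w v → par w' v → w = w')
    (rank : V → ℤ) (hrank : ∀ v w, par v w → rank w = rank v + 1)
    (hconn : (SimpleGraph.fromRel par).Connected) : (SimpleGraph.fromRel par).IsTree := by
  refine ⟨hconn, ?_⟩
  have bridge : ∀ v w, par v w → (SimpleGraph.fromRel par).IsBridge s(v, w) := by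
    intro v w hvw
    rw [SimpleGraph.isBridge_iff]
    rintro ⟨q⟩
    let D : Set V := {x | Relation.ReflTransGen par w x}
    have hD : ∀ x ∈ D, rank w ≤ rank x := by
      intro x hx
      induction hx with
      | refl => exact le_rfl
      | tail _ h ih => rw [hrank _ _ h]; omega
    have step : ∀ a b, par a b → s(a, b) ≠ s(v, w) → (a ∈ D ↔ b ∈ D) := by
      intro a b hab hne
      refine ⟨fun h => Relation.ReflTransGen.tail h hab, fun h => ?_⟩
      rcases Relation.ReflTransGen.cases_tail h with h' | ⟨c, h1, h2⟩
      · subst h'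
        exact absurd (by rw [huniq _ _ _ hab hvw]) hne
      · rwa [huniq _ _ _ hab h2]
    have inv : ∀ x y (q : ((SimpleGraph.fromRel par).deleteEdges {s(v, w)}).Walk x y),
        (x ∈ D ↔ y ∈ D) := by
      intro x y q
      induction q with
      | nil => rfl
      | cons hadj _ ih =>
        rw [← ih]
        rw [SimpleGraph.deleteEdges_adj, SimpleGraph.fromRel_adj, Set.mem_singleton_iff] at hadj
        rcases hadj.1.2 with h | h
        · exact step _ _ h hadj.2
        · exact (step _ _ h (by rw [Sym2.eq_swap]; exact hadj.2)).symm
    have := hD v ((inv _ _ q).2 Relation.ReflTransGen.refl)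
    have := hrank _ _ hvw
    omega
  rw [SimpleGraph.isAcyclic_iff_forall_adj_isBridge]
  intro v w h
  rw [SimpleGraph.fromRel_adj] at h
  rcases h.2 with h | h
  · exact bridge v w h
  · rw [Sym2.eq_swap]
    exact bridge w v h

theorem IsEmb.pt_mem_exteriorBoundary {f : S.V → T.V} (h : IsEmb S T f) (hS : S.pt ∈ S.exteriorBoundary) :
    T.pt ∈ T.exteriorBoundary := by
  obtain ⟨h1, w, h2, h3⟩ := hS
  rw [← h.pt]
  exact ⟨fun h' => h1 ((h.backbone _).1 h'), f w, (h.backbone w).2 h2, (h.adj _ _).1 h3⟩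

theorem mem_backbone_of_par {v w : T.V} (h : T.par v w) (hw : w ∈ T.backbone) : v ∈ T.backbone := by
  obtain ⟨x, rfl, hx⟩ := hw
  refine ⟨fun n => Nat.casesOn n v x, rfl, fun n => ?_⟩
  cases n with
  | zero => exact h
  | succ n => exact hx n

theorem exists_par_of_mem_exteriorBoundary (hT : T.pt ∈ T.exteriorBoundary) :
    ∃ w ∈ T.backbone, T.par w T.pt := by
  obtain ⟨h1, w, h2, h3⟩ := hT
  rcases T.graph_adj.1 h3 with h | h
  · exact absurd (mem_backbone_of_par h h2) h1
  · exact ⟨w, h2, h⟩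

/-- Backbone vertices have a parent and a child in the backbone, hence two neighbours. The marked
vertex keeps its parent only, since a child in the backbone would put it into the backbone. -/
theorem sub_backbone_properties (hT : T.IsEndDistinguished) (hpt : T.pt ∈ T.exteriorBoundary)
    (rank : T.V → ℤ) (hrank : ∀ v w, T.par v w → rank w = rank v + 1) :
    (T.sub T.backbone).IsEndDistinguished ∧
      ∀ v, (T.sub T.backbone).IsLeaf v ↔ v = (T.sub T.backbone).pt := by
  obtain ⟨w0, hw0, hw0'⟩ := exists_par_of_mem_exteriorBoundary hpt
  have hparent : ∀ v ∈ T.reach T.backbone, ∀ w, T.par w v → w ∈ T.backbone := by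
    intro v hv w hwv
    rcases mem_of_mem_reach hv with rfl | h
    · rwa [T.par_unique _ _ _ hwv hw0']
    · exact mem_backbone_of_par hwv h
  have hex : ∀ v : (T.sub T.backbone).V, ∃ w : (T.sub T.backbone).V, w.1 ∈ T.backbone ∧ T.par w.1 v.1 := by
    intro v
    obtain ⟨w, hw, -⟩ := hT.2 v.1
    have hb := hparent v.1 v.2 w hw
    exact ⟨⟨w, reach_step v.2 (T.graph_adj.2 (Or.inr hw)) hb⟩, hb, hw⟩
  have hb0 : T.pt ∉ T.backbone := hpt.1
  refine ⟨⟨?_, fun v => ?_⟩, fun v => ⟨?_, ?_⟩⟩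
  -- Iterating the parent map lowers the rank by `1` each time, so the ancestors are distinct.
  · choose g _ hg' using hex
    have hr : ∀ n, rank (g^[n] (T.sub T.backbone).pt).1 = rank T.pt - n := by
      intro n
      induction n with
      | zero => simp; rfl
      | succ n ih =>
        rw [Function.iterate_succ_apply']
        have := hrank _ _ (hg' (g^[n] (T.sub T.backbone).pt))
        push_cast
        omega
    refine Infinite.of_injective (fun n => g^[n] (T.sub T.backbone).pt) fun m n hmn => ?_
    have h1 := hr m
    have h2 := hr n
    simp only at hmn
    rw [hmn] at h1
    omega
  · obtain ⟨w, -, hw⟩ := hex v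
    exact ⟨w, hw, fun y hy => Subtype.ext (T.par_unique _ _ _ hy hw)⟩
  · rintro ⟨u, -, hu⟩
    by_contra hne
    have hv : v.1 ∈ T.backbone := (mem_of_mem_reach v.2).resolve_left fun h => hne (Subtype.ext h)
    obtain ⟨x, hx0, hx⟩ := id hv
    have hadj : T.graph.Adj v.1 (x 1) := T.graph_adj.2 (Or.inl (hx0 ▸ hx 0))
    have hx1 : x 1 ∈ T.backbone := ⟨fun n => x (n + 1), rfl, fun n => hx (n + 1)⟩
    obtain ⟨w, -, hw⟩ := hex v
    have h1 := hu ⟨x 1, reach_step v.2 hadj hx1⟩ ((T.sub_adj _).2 hadj)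
    have h2 := hu w ((T.sub_adj _).2 (T.graph_adj.2 (Or.inr hw)))
    have h3 : x 1 = w.1 := congrArg Subtype.val (h1.trans h2.symm)
    have h4 : T.par v.1 (x 1) := hx0 ▸ hx 0
    rw [h3] at h4
    exact T.par_asymm _ _ h4 hw
  · rintro rfl
    obtain ⟨w, hwb, hw⟩ := hex (T.sub T.backbone).pt
    refine ⟨w, (T.sub_adj _).2 (T.graph_adj.2 (Or.inr hw)), fun y hy => Subtype.ext ?_⟩
    rcases T.graph_adj.1 ((T.sub_adj _).1 hy) with h | h
    · rcases mem_of_mem_reach y.2 with h' | h'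
      · rw [h'] at h
        exact absurd h (T.par_asymm _ _ h)
      · exact absurd (mem_backbone_of_par h h') hb0
    · exact T.par_unique _ _ _ h hw

end WTree

namespace Env

/-! ### Trees given by environments -/

theorem tree_pt_eq {ω : Env} {u : Vertex} (hu : ω.Mem u) : (ω.tree u).pt.1 = u := by
  rw [tree_pt_val hu]

theorem isPresentation_tree : WTree.IsPresentation (fun q : Env × Vertex => q.1.tree q.2) fun _ v => v.1 where
  injective _ := Subtype.val_injective
  measurableSet_par a b B hB := by
    have : {q : Env × Vertex | ∃ v w : (q.1.tree q.2).V, v.1 = a ∧ w.1 = b ∧ (q.1.tree q.2).par v w ∧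
        (q.1.tree q.2).bias v w ∈ B} = {q : Env × Vertex | q.1.Mem a} ∩ ({q : Env × Vertex | q.1.Mem b} ∩
          ({q : Env × Vertex | ∃ i, b = i :: a} ∩ {q : Env × Vertex | (q.1 b).2 ∈ B})) := by
      ext q
      constructor
      · rintro ⟨v, w, rfl, rfl, h1, h2⟩
        exact ⟨v.2, w.2, h1, h2⟩
      · rintro ⟨h1, h2, h3, h4⟩
        exact ⟨⟨a, h1⟩, ⟨b, h2⟩, rfl, rfl, h3, h4⟩
    rw [this]
    refine ((measurableSet_mem a).preimage measurable_fst).inter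
      (((measurableSet_mem b).preimage measurable_fst).inter ((MeasurableSet.const _).inter ?_))
    exact hB.preimage (f := fun q : Env × Vertex => (q.1 b).2) (by fun_prop)
  measurableSet_pt a := by
    have : {q : Env × Vertex | (q.1.tree q.2).pt.1 = a} =
        ({q : Env × Vertex | q.1.Mem a} ∩ {q : Env × Vertex | q.2 ∈ ({a} : Set Vertex)}) ∪
        ({q : Env × Vertex | q.1.Mem q.2}ᶜ ∩ {q : Env × Vertex | a = []}) := by
      ext q
      by_cases h : q.1.Mem q.2
      · rw [Set.mem_ofPred_eq, tree_pt_eq h]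
        simp only [Set.mem_union, Set.mem_inter_iff, Set.mem_ofPred_eq, Set.mem_compl_iff, h, not_true,
          false_and, or_false, Set.mem_singleton_iff]
        exact ⟨fun h' => ⟨h' ▸ h, h'⟩, fun h' => h'.2⟩
      · have : (q.1.tree q.2).pt.1 = [] := by simp [tree, h]
        rw [Set.mem_ofPred_eq, this]
        simp only [Set.mem_union, Set.mem_inter_iff, Set.mem_ofPred_eq, Set.mem_compl_iff, h, not_false_iff,
          true_and, Set.mem_singleton_iff]
        refine ⟨fun h' => Or.inr h'.symm, ?_⟩
        rintro (⟨h1, h2⟩ | h1)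
        · exact absurd (h2 ▸ h1) h
        · exact h1.symm
    have hm : MeasurableSet {q : Env × Vertex | q.1.Mem q.2} :=
      measurableSet_setOfPred.2 (measurable_from_prod_countable_left fun u =>
        measurableSet_setOfPred.1 (measurableSet_mem u))
    rw [this]
    exact (((measurableSet_mem a).preimage measurable_fst).inter
      ((Set.to_countable _).measurableSet.preimage measurable_snd)).union
      (hm.compl.inter (MeasurableSet.const _))
  measurableSet_mem a := by
    have : {q : Env × Vertex | ∃ v : (q.1.tree q.2).V, v.1 = a} = {q : Env × Vertex | q.1.Mem a} := by
      ext q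
      constructor
      · rintro ⟨v, rfl⟩
        exact v.2
      · exact fun h => ⟨⟨a, h⟩, rfl⟩
    rw [this]
    exact (measurableSet_mem a).preimage measurable_fst

theorem length_le_dist (ω : Env) (u : Vertex) (v w : (ω.tree u).V) :
    v.1.length ≤ w.1.length + (ω.tree u).graph.dist v w := by
  have key : ∀ (x y : (ω.tree u).V) (q : (ω.tree u).graph.Walk x y), x.1.length ≤ y.1.length + q.length := by
    intro x y q
    induction q with
    | nil => exact Nat.le_add_right _ _
    | cons hadj q ih =>
      rw [SimpleGraph.Walk.length_cons]
      rcases (graph_tree_adj _ _ _ _).1 hadj with ⟨i, h⟩ | ⟨i, h⟩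
      · have := congrArg List.length h
        simp only [List.length_cons] at this
        omega
      · have := congrArg List.length h
        simp only [List.length_cons] at this
        omega
  obtain ⟨q, hq⟩ := ((ω.tree u).graph_connected v w).exists_walk_length_eq_dist
  have := key v w q
  omega

/-- The embedding of a subtree. -/
theorem isEmb_sub {ω : Env} {v y : Vertex} (hv : ω.Mem v) (hy : (sub v ω).Mem y) :
    WTree.IsEmb ((sub v ω).tree y) (ω.tree (y ++ v)) fun x => ⟨x.1 ++ v, (mem_append _ _ _).2 ⟨hv, x.2⟩⟩ where
  injective a b h := by
    have := congrArg Subtype.val h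
    simp only [List.append_cancel_right_eq] at this
    exact Subtype.ext this
  pt := by
    refine Subtype.ext ?_
    rw [tree_pt_eq ((mem_append _ _ _).2 ⟨hv, hy⟩)]
    simp only [tree_pt_eq hy]
  par a b := by
    refine exists_congr fun i => ?_
    rw [← List.cons_append, List.append_cancel_right_eq]
  bias a b h := by
    obtain ⟨i, hi⟩ := h
    have : b.1 ≠ [] := by rw [hi]; simp
    show (sub v ω b.1).2 = (ω (b.1 ++ v)).2
    simp [sub, this]
  child a w h := by
    obtain ⟨i, hi⟩ := h
    have hm := w.2
    rw [hi, ← List.cons_append, mem_append] at hm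
    exact ⟨⟨i :: a.1, hm.2⟩, Subtype.ext hi.symm⟩

/-- Only the root of the subtree lacks its parent, and its distance from the marked vertex is at
least `y.length > k + 1`. -/
theorem outNbhd_sub_iso {ω : Env} {v y : Vertex} (hv : ω.Mem v) (hy : (sub v ω).Mem y) {k : ℕ}
    (hk : k + 1 < y.length) : (((sub v ω).tree y).outNbhd k).Iso ((ω.tree (y ++ v)).outNbhd k) := by
  refine (isEmb_sub hv hy).outNbhd_iso fun a w ha h => ?_
  obtain ⟨i, hi⟩ := h
  have h1 := length_le_dist (sub v ω) y ((sub v ω).tree y).pt a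
  rw [tree_pt_eq hy] at h1
  obtain ⟨x, hx⟩ := a
  cases x with
  | nil => simp at h1; omega
  | cons j x =>
    refine ⟨⟨x, hx.1⟩, Subtype.ext ?_⟩
    simp only [List.cons_append, List.cons.injEq] at hi
    exact hi.2

end Env

/-- A tree with a marked vertex, which is not the root. -/
abbrev Stem := {q : Env × Vertex // q.2 ≠ [] ∧ q.1.Mem q.2}

/-! ### The limit tree as an infinite stack of stems -/

namespace Stem

open Env

/-- The tree `c` in which the subtree at the marked vertex is replaced by `b`. -/
def star (c b : Stem) : Stem :=
  ⟨(glue c.1.2 c.1.1 b.1.1, b.1.2 ++ c.1.2), by simp [b.2.1],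
    (mem_append _ _ _).2 ⟨(mem_glue fun _ => rfl).2 c.2.2, by
      rw [sub_glue, mem_sub_nil]; exact b.2.2⟩⟩

/-- The base of the limit tree for `i = 0`, and the trees that it consists of further up. -/
def level (q : Stem × (ℕ → Stem)) : ℕ → Env × Vertex
  | 0 => q.1.1
  | i + 1 => (q.2 i).1

variable {q : Stem × (ℕ → Stem)}

/-- The vertices of the limit tree. -/
def IsVertex (q : Stem × (ℕ → Stem)) (a : ℕ × Vertex) : Prop :=
  (level q a.1).1.Mem a.2 ∧ (a.1 ≠ 0 → ¬ (level q a.1).2 <:+ a.2)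

theorem level_ne_nil (i : ℕ) : (level q i).2 ≠ [] := by
  cases i with
  | zero => exact q.1.2.1
  | succ i => exact (q.2 i).2.1

theorem mem_level (i : ℕ) : (level q i).1.Mem (level q i).2 := by
  cases i with
  | zero => exact q.1.2.2
  | succ i => exact (q.2 i).2.2

theorem isVertex_nil (i : ℕ) : IsVertex q (i, []) :=
  ⟨trivial, fun _ h => level_ne_nil i (List.suffix_nil.1 h)⟩

theorem isVertex_tail {i : ℕ} {x : Vertex} (h : IsVertex q (i, x)) : IsVertex q (i, x.tail) :=
  ⟨h.1.of_suffix (List.tail_suffix x), fun hi h' => h.2 hi (h'.trans (List.tail_suffix x))⟩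

theorem isVertex_level_tail (i : ℕ) : IsVertex q (i, (level q i).2.tail) := by
  refine ⟨(mem_level i).of_suffix (List.tail_suffix _), fun _ h => ?_⟩
  have h1 : (level q i).2.length ≤ (level q i).2.tail.length := h.length_le
  have h2 := List.length_pos_of_ne_nil (level_ne_nil (q := q) i)
  rw [List.length_tail] at h1
  omega

/-- The parent relation of the limit tree. -/
def LimitPar (q : Stem × (ℕ → Stem)) (a b : {a : ℕ × Vertex // IsVertex q a}) : Prop :=
  (b.1.1 = a.1.1 ∧ ∃ i, b.1.2 = i :: a.1.2) ∨
    (b.1.2 = [] ∧ a.1.1 = b.1.1 + 1 ∧ a.1.2 = (level q (b.1.1 + 1)).2.tail)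

/-- The distance to the root of the base, with a sign. -/
def rank (q : Stem × (ℕ → Stem)) (a : ℕ × Vertex) : ℤ :=
  a.2.length - ∑ j ∈ Finset.range a.1, ((level q (j + 1)).2.length : ℤ)

theorem rank_of_limitPar {a b : {a : ℕ × Vertex // IsVertex q a}} (h : LimitPar q a b) :
    rank q b.1 = rank q a.1 + 1 := by
  unfold rank
  rcases h with ⟨h1, i, h2⟩ | ⟨h1, h2, h3⟩
  · rw [h1, h2, List.length_cons]
    push_cast
    ring
  · have := List.length_pos_of_ne_nil (level_ne_nil (q := q) (b.1.1 + 1))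
    rw [h1, h2, h3, Finset.sum_range_succ, List.length_tail, Nat.cast_sub this]
    simp only [List.length_nil]
    push_cast
    ring

theorem limitPar_unique {a a' b : {a : ℕ × Vertex // IsVertex q a}} (h : LimitPar q a b)
    (h' : LimitPar q a' b) : a = a' := by
  refine Subtype.ext (Prod.ext ?_ ?_) <;> rcases h with ⟨h1, i, h2⟩ | ⟨h1, h2, h3⟩ <;>
    rcases h' with ⟨h1', i', h2'⟩ | ⟨h1', h2', h3'⟩ <;> simp_all

theorem exists_limitPar (b : {a : ℕ × Vertex // IsVertex q a}) : ∃ a, LimitPar q a b := by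
  obtain ⟨⟨j, y⟩, h⟩ := b
  cases y with
  | nil => exact ⟨⟨_, isVertex_level_tail (j + 1)⟩, Or.inr ⟨rfl, rfl, rfl⟩⟩
  | cons i y => exact ⟨⟨_, isVertex_tail h⟩, Or.inl ⟨rfl, i, rfl⟩⟩

theorem adj_of_limitPar {a b : {a : ℕ × Vertex // IsVertex q a}} (h : LimitPar q a b) :
    (SimpleGraph.fromRel (LimitPar q)).Adj a b := by
  rw [SimpleGraph.fromRel_adj]
  refine ⟨fun hab => ?_, Or.inl h⟩
  have := rank_of_limitPar h
  rw [hab] at this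
  omega

theorem limit_connected (q : Stem × (ℕ → Stem)) : (SimpleGraph.fromRel (LimitPar q)).Connected := by
  have h1 : ∀ i x (h : IsVertex q (i, x)),
      (SimpleGraph.fromRel (LimitPar q)).Reachable ⟨(i, []), isVertex_nil i⟩ ⟨(i, x), h⟩ := by
    intro i x
    induction x with
    | nil => exact fun _ => SimpleGraph.Reachable.refl _
    | cons a x ih =>
      intro h
      have hx : IsVertex q (i, x) := isVertex_tail h
      exact (ih hx).trans (adj_of_limitPar (a := ⟨(i, x), hx⟩) (b := ⟨(i, a :: x), h⟩)
        (Or.inl ⟨rfl, a, rfl⟩)).reachable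
  have h2 : ∀ i, (SimpleGraph.fromRel (LimitPar q)).Reachable ⟨(0, []), isVertex_nil 0⟩
      ⟨(i, []), isVertex_nil i⟩ := by
    intro i
    induction i with
    | zero => exact SimpleGraph.Reachable.refl _
    | succ i ih =>
      refine ih.trans (SimpleGraph.Reachable.trans ?_ (h1 _ _ (isVertex_level_tail (i + 1))).symm)
      exact (adj_of_limitPar (Or.inr ⟨rfl, rfl, rfl⟩)).symm.reachable
  exact (SimpleGraph.connected_iff_exists_forall_reachable _).2
    ⟨⟨(0, []), isVertex_nil 0⟩, fun a => (h2 a.1.1).trans (h1 _ _ a.2)⟩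

open Classical in
/-- The tree that consists of the levels of `q`, each of them attached to the marked vertex of the
next one. -/
noncomputable def limitTree (q : Stem × (ℕ → Stem)) : WTree where
  V := {a : ℕ × Vertex // IsVertex q a}
  par := LimitPar q
  -- The root of a level takes the place of the marked vertex of the next level, so the edge above
  -- it carries the bias recorded there.
  bias _ b := if b.1.2 = [] then ((level q (b.1.1 + 1)).1 (level q (b.1.1 + 1)).2).2 else
    ((level q b.1.1).1 b.1.2).2
  pt := ⟨(0, q.1.1.2), q.1.2.2, fun h => absurd rfl h⟩
  par_unique _ _ _ := limitPar_unique
  par_asymm a b h h' := by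
    have h1 := rank_of_limitPar h
    have h2 := rank_of_limitPar h'
    omega
  isTree := WTree.isTree_of_rank (fun _ _ _ => limitPar_unique) (fun a => rank q a.1)
    (fun _ _ => rank_of_limitPar) (limit_connected q)
  locallyFinite a := by
    refine Set.Finite.of_finite_image (f := Subtype.val) ?_ Subtype.val_injective.injOn
    refine (((Set.finite_singleton (a.1.1, a.1.2.tail)).union
      (Set.finite_singleton (a.1.1 + 1, (level q (a.1.1 + 1)).2.tail))).union
      (((Set.finite_lt_nat ((level q a.1.1).1 a.1.2).1).image fun i => (a.1.1, i :: a.1.2)).union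
      (Set.finite_singleton (a.1.1 - 1, ([] : Vertex))))).subset ?_
    rintro _ ⟨⟨⟨j, y⟩, hb⟩, h, rfl⟩
    have h' : (SimpleGraph.fromRel (LimitPar q)).Adj a ⟨(j, y), hb⟩ := h
    rw [SimpleGraph.fromRel_adj] at h'
    rcases h'.2 with (⟨h1, i, h2⟩ | ⟨h1, h2, -⟩) | (⟨h1, i, h2⟩ | ⟨-, h2, h3⟩)
    · simp only at h1 h2
      subst h1 h2
      exact Or.inr (Or.inl ⟨i, hb.1.2, rfl⟩)
    · simp only at h1 h2
      subst h1
      exact Or.inr (Or.inr (by simp [h2]))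
    · simp only at h1 h2
      exact Or.inl (Or.inl (by simp [h1, h2]))
    · simp only at h2 h3
      exact Or.inl (Or.inr (by simp [h2, h3]))

theorem isEndDistinguished_limitTree (q : Stem × (ℕ → Stem)) : (limitTree q).IsEndDistinguished := by
  refine ⟨Infinite.of_injective (fun i => (⟨(i, []), isVertex_nil i⟩ : (limitTree q).V)) fun i j h => ?_, fun b => ?_⟩
  · exact congrArg (fun a : (limitTree q).V => a.1.1) h
  · obtain ⟨a, ha⟩ := exists_limitPar b
    exact ⟨a, ha, fun a' h' => limitPar_unique h' ha⟩

/-- The embedding of the base. -/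
theorem isEmb_base (q : Stem × (ℕ → Stem)) : WTree.IsEmb (q.1.1.1.tree q.1.1.2) (limitTree q)
    fun x => ⟨(0, x.1), x.2, fun h => absurd rfl h⟩ where
  injective a b h := Subtype.ext (congrArg (fun a : (limitTree q).V => a.1.2) h)
  pt := by
    refine Subtype.ext (Prod.ext rfl ?_)
    exact tree_pt_eq q.1.2.2
  par a b := by
    constructor
    · exact fun h => Or.inl ⟨rfl, h⟩
    · rintro (h | h)
      · exact h.2
      · exact absurd h.2.1 (by simp)
  bias a b h := by
    obtain ⟨i, h⟩ := h
    show _ = if b.1 = [] then _ else _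
    rw [if_neg (by rw [h]; simp)]
    rfl
  child a b h := by
    rcases h with h | h
    · obtain ⟨⟨j, y⟩, hb⟩ := b
      obtain ⟨rfl, i, hi⟩ := h
      exact ⟨⟨y, hb.1⟩, rfl⟩
    · exact absurd h.2.1 (by simp)

/-- Join the first two levels. -/
def merge (q : Stem × (ℕ → Stem)) : Stem × (ℕ → Stem) := (star (q.2 0) q.1, fun i => q.2 (i + 1))

/-- The action of `merge` on vertices. -/
def mergeFun (q : Stem × (ℕ → Stem)) : ℕ × Vertex → ℕ × Vertex
  | (0, x) => (0, x ++ (q.2 0).1.2)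
  | (i + 1, x) => (i, x)

theorem isVertex_mergeFun {a : ℕ × Vertex} (h : IsVertex q a) : IsVertex (merge q) (mergeFun q a) := by
  match a, h with
  | (0, x), h =>
    refine ⟨?_, fun h => absurd rfl h⟩
    refine (mem_append _ _ _).2 ⟨((mem_append _ _ _).1 (star (q.2 0) q.1).2.2).1, ?_⟩
    show (sub _ (glue _ _ _)).Mem x
    rw [sub_glue, mem_sub_nil]
    exact h.1
  | (1, x), h =>
    refine ⟨?_, fun h => absurd rfl h⟩
    exact (mem_glue fun h' => absurd h' (h.2 one_ne_zero)).2 h.1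
  | (i + 2, x), h => exact ⟨h.1, fun _ => h.2 (by simp)⟩

/-- Gluing the base into the next level only changes the addresses of the vertices, not the tree. -/
theorem isEmb_merge (q : Stem × (ℕ → Stem)) : WTree.IsEmb (limitTree q) (limitTree (merge q))
    (fun a => ⟨mergeFun q a.1, isVertex_mergeFun a.2⟩) ∧
    Function.Surjective fun a : (limitTree q).V => (⟨mergeFun q a.1, isVertex_mergeFun a.2⟩ : (limitTree (merge q)).V) := by
  have hinj : Function.Injective fun a : (limitTree q).V =>
      (⟨mergeFun q a.1, isVertex_mergeFun a.2⟩ : (limitTree (merge q)).V) := by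
    rintro ⟨⟨i, x⟩, ha⟩ ⟨⟨j, y⟩, hb⟩ h
    have h' : mergeFun q (i, x) = mergeFun q (j, y) := congrArg Subtype.val h
    refine Subtype.ext ?_
    match i, j, ha, hb, h' with
    | 0, 0, _, _, h' => simpa [mergeFun] using h'
    | i + 1, j + 1, _, _, h' => simpa [mergeFun] using h'
    | 0, j + 1, _, hb, h' =>
      simp only [mergeFun, Prod.mk.injEq] at h'
      obtain ⟨rfl, rfl⟩ := h'
      exact absurd (List.suffix_append _ _) (hb.2 one_ne_zero)
    | i + 1, 0, ha, _, h' =>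
      simp only [mergeFun, Prod.mk.injEq] at h'
      obtain ⟨rfl, rfl⟩ := h'
      exact absurd (List.suffix_append _ _) (ha.2 one_ne_zero)
  have hpar : ∀ a b : (limitTree q).V, LimitPar q a b → LimitPar (merge q)
      ⟨mergeFun q a.1, isVertex_mergeFun a.2⟩ ⟨mergeFun q b.1, isVertex_mergeFun b.2⟩ := by
    rintro ⟨⟨i, x⟩, ha⟩ ⟨⟨j, y⟩, hb⟩ (⟨h1, l, h2⟩ | ⟨h1, h2, h3⟩)
    · simp only at h1 h2
      subst h1 h2
      cases j with
      | zero => exact Or.inl ⟨rfl, l, rfl⟩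
      | succ j => exact Or.inl ⟨rfl, l, rfl⟩
    · simp only at h1 h2 h3
      subst h1 h2 h3
      cases j with
      | zero =>
        refine Or.inl ⟨rfl, ((q.2 0).1.2).head (q.2 0).2.1, ?_⟩
        exact (List.cons_head_tail (q.2 0).2.1).symm
      | succ j => exact Or.inr ⟨rfl, rfl, rfl⟩
  have hsurj : Function.Surjective fun a : (limitTree q).V =>
      (⟨mergeFun q a.1, isVertex_mergeFun a.2⟩ : (limitTree (merge q)).V) := by
    rintro ⟨⟨j, z⟩, hb⟩
    cases j with
    | succ j => exact ⟨⟨(j + 2, z), hb.1, fun _ => hb.2 (by simp)⟩, rfl⟩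
    | zero =>
      by_cases h : (q.2 0).1.2 <:+ z
      · obtain ⟨x, rfl⟩ := h
        refine ⟨⟨(0, x), ?_, fun h => absurd rfl h⟩, rfl⟩
        have h2 := ((mem_append _ _ _).1 hb.1).2
        have h2' : (sub _ (glue (q.2 0).1.2 (q.2 0).1.1 q.1.1.1)).Mem x := h2
        rwa [sub_glue, mem_sub_nil] at h2'
      · exact ⟨⟨(1, z), (mem_glue fun h' => absurd h' h).1 hb.1, fun _ => h⟩, rfl⟩
  refine ⟨⟨hinj, rfl, fun a b => ⟨hpar a b, fun h => ?_⟩, fun a b h => ?_, fun a b h => hsurj b⟩, hsurj⟩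
  · obtain ⟨a', ha'⟩ := exists_limitPar b
    have := limitPar_unique h (hpar a' b ha')
    rwa [hinj this]
  · obtain ⟨⟨j, y⟩, hb⟩ := b
    show (if y = [] then _ else _) = if (mergeFun q (j, y)).2 = [] then _ else _
    cases j with
    | succ j =>
      by_cases hy : y = []
      · rw [if_pos hy, if_pos (by exact hy)]
        rfl
      · rw [if_neg hy, if_neg (by exact hy)]
        cases j with
        | zero =>
          show _ = (glue _ _ _ y).2
          have : ¬ (q.2 0).1.2 <:+ y := hb.2 one_ne_zero
          rw [glue_of_not_suffix _ _ this]
          rfl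
        | succ j => rfl
    | zero =>
      have : (mergeFun q (0, y)).2 ≠ [] := by simp [mergeFun, (q.2 0).2.1]
      rw [if_neg this]
      show _ = (glue (q.2 0).1.2 _ _ (y ++ (q.2 0).1.2)).2
      rw [glue_append]
      by_cases hy : y = []
      · rw [if_pos hy, if_pos hy]
        rfl
      · rw [if_neg hy, if_neg hy]
        rfl

theorem length_iterate_merge (q : Stem × (ℕ → Stem)) (r : ℕ) : r < (merge^[r] q).1.1.2.length := by
  induction r generalizing q with
  | zero => exact List.length_pos_of_ne_nil q.1.2.1
  | succ r ih =>
    rw [Function.iterate_succ_apply']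
    have h1 : (merge (merge^[r] q)).1.1.2 = (merge^[r] q).1.1.2 ++ ((merge^[r] q).2 0).1.2 := rfl
    have h2 := List.length_pos_of_ne_nil ((merge^[r] q).2 0).2.1
    rw [h1, List.length_append]
    have := ih q
    omega

/-- Each merge lengthens the address of the marked vertex in the base. After `k + 2` of them the
base reaches more than `k + 1` generations above the marked vertex and contains the whole
neighbourhood. -/
theorem outNbhd_limitTree_iso (q : Stem × (ℕ → Stem)) (k : ℕ) : ((limitTree q).outNbhd k).Iso
    (((merge^[k + 2] q).1.1.1.tree (merge^[k + 2] q).1.1.2).outNbhd k) := by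
  have h1 : ∀ r, ((limitTree q).outNbhd k).Iso ((limitTree (merge^[r] q)).outNbhd k) := by
    intro r
    induction r with
    | zero => exact WTree.Iso.refl _
    | succ r ih =>
      rw [Function.iterate_succ_apply']
      obtain ⟨h1, h2⟩ := isEmb_merge (merge^[r] q)
      exact ih.trans (h1.outNbhd_iso fun v w _ _ => h2 w)
  refine (h1 (k + 2)).trans (WTree.Iso.symm ?_)
  refine (isEmb_base (merge^[k + 2] q)).outNbhd_iso fun v w hv h => ?_
  have hl := length_iterate_merge q (k + 2)
  have h1 := length_le_dist _ _ (((merge^[k + 2] q).1.1.1.tree (merge^[k + 2] q).1.1.2)).pt v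
  rw [tree_pt_eq (merge^[k + 2] q).1.2.2] at h1
  obtain ⟨⟨i, x⟩, hw⟩ := w
  rcases h with ⟨h2, l, h3⟩ | ⟨h2, -, -⟩
  · simp only at h2
    subst h2
    exact ⟨⟨x, hw.1⟩, rfl⟩
  · simp only at h2
    rw [h2] at h1
    simp only [List.length_nil] at h1
    omega

end Stem

/-! ### Measurability and almost sure properties of the limit tree -/

namespace Stem

open Env

variable {q : Stem × (ℕ → Stem)}

theorem measurable_level (i : ℕ) : Measurable fun q : Stem × (ℕ → Stem) => level q i := by
  cases i with
  | zero => exact measurable_subtype_coe.comp measurable_fst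
  | succ i => exact measurable_subtype_coe.comp ((measurable_pi_apply i).comp measurable_snd)

theorem measurableSet_isVertex (a : ℕ × Vertex) : MeasurableSet {q | IsVertex q a} := by
  have h1 : MeasurableSet {q : Stem × (ℕ → Stem) | (level q a.1).1.Mem a.2} :=
    (Env.measurableSet_mem a.2).preimage (measurable_level a.1).fst
  have h2 : MeasurableSet {q : Stem × (ℕ → Stem) | (level q a.1).2 ∈ {v | a.1 ≠ 0 → ¬ v <:+ a.2}} :=
    (Set.to_countable _).measurableSet.preimage (measurable_level a.1).snd
  exact h1.inter h2

theorem isPresentation_limitTree : WTree.IsPresentation limitTree fun _ a => a.1 where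
  injective _ := Subtype.val_injective
  measurableSet_par a b B hB := by
    have : {q | ∃ v w : (limitTree q).V, v.1 = a ∧ w.1 = b ∧ (limitTree q).par v w ∧
        (limitTree q).bias v w ∈ B} = ({q | IsVertex q a} ∩ {q | IsVertex q b}) ∩
          ({q | (b.1 = a.1 ∧ ∃ i, b.2 = i :: a.2) ∨
            ((b.2 = [] ∧ a.1 = b.1 + 1) ∧ (level q (b.1 + 1)).2 ∈ {v : Vertex | a.2 = v.tail})} ∩
          {q | if b.2 = [] then ((level q (b.1 + 1)).1 (level q (b.1 + 1)).2).2 ∈ B else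
            ((level q b.1).1 b.2).2 ∈ B}) := by
      ext q
      constructor
      · rintro ⟨v, w, rfl, rfl, h1, h2⟩
        refine ⟨⟨v.2, w.2⟩, h1.imp id fun h => ⟨⟨h.1, h.2.1⟩, h.2.2⟩, ?_⟩
        rw [Set.mem_ofPred_eq, ← apply_ite (· ∈ B)]
        exact h2
      · rintro ⟨⟨h1, h2⟩, h3, h4⟩
        refine ⟨⟨a, h1⟩, ⟨b, h2⟩, rfl, rfl, h3.imp id fun h => ⟨h.1.1, h.1.2, h.2⟩, ?_⟩
        rw [Set.mem_ofPred_eq, ← apply_ite (· ∈ B)] at h4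
        exact h4
    rw [this]
    refine ((measurableSet_isVertex a).inter (measurableSet_isVertex b)).inter (MeasurableSet.inter ?_ ?_)
    · refine (MeasurableSet.const _).union ((MeasurableSet.const _).inter ?_)
      exact (Set.to_countable {v : Vertex | a.2 = v.tail}).measurableSet.preimage (measurable_level (b.1 + 1)).snd
    · split_ifs with h
      · exact hB.preimage (measurable_eval_env.comp (measurable_level (b.1 + 1))).snd
      · exact hB.preimage ((measurable_pi_apply b.2).comp (measurable_level b.1).fst).snd
  measurableSet_pt a := by
    have : {q | (limitTree q).pt.1 = a} =
        {q : Stem × (ℕ → Stem) | (level q 0).2 ∈ {v : Vertex | (0, v) = a}} := rfl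
    rw [this]
    exact (Set.to_countable {v : Vertex | (0, v) = a}).measurableSet.preimage (measurable_level 0).snd
  measurableSet_mem a := by
    have : {q | ∃ v : (limitTree q).V, v.1 = a} = {q | IsVertex q a} := by
      ext q
      exact ⟨fun ⟨v, hv⟩ => hv ▸ v.2, fun h => ⟨⟨a, h⟩, rfl⟩⟩
    rw [this]
    exact measurableSet_isVertex a

theorem measurable_star : Measurable fun x : Stem × Stem => star x.1 x.2 := by
  refine Measurable.subtype_mk ?_
  have h1 : Measurable fun x : Stem × Stem => x.1.1 := measurable_subtype_coe.comp measurable_fst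
  have h2 : Measurable fun x : Stem × Stem => x.2.1 := measurable_subtype_coe.comp measurable_snd
  refine Measurable.prodMk ?_ ?_
  · exact measurable_glue_uncurry.comp ((h1.fst.prodMk h2.fst).prodMk h1.snd)
  · exact (measurable_from_prod_countable_right (f := fun x : Vertex × Vertex => x.1 ++ x.2)
      fun _ => measurable_of_countable _).comp (h2.snd.prodMk h1.snd)

theorem measurable_merge : Measurable merge := by
  have h : Measurable fun q : Stem × (ℕ → Stem) => (q.2 0, q.1) :=
    ((measurable_pi_apply 0).comp measurable_snd).prodMk measurable_fst
  exact Measurable.prodMk (measurable_star.comp h) (measurable_pi_lambda _ fun i => (measurable_pi_apply (i + 1)).comp measurable_snd)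

/-- All biases lie in `I`, with the possible exception of the one at the root. -/
def BiasesIn (I : Set ℝ) (c : Stem) : Prop := ∀ v ≠ [], (c.1.1 v).2 ∈ I

/-- All biases outside the subtree at the marked vertex lie in `I`, with the possible exception of
the one at the root. -/
def BiasesOutsideIn (I : Set ℝ) (c : Stem) : Prop :=
  ∀ v ≠ [], (c.1.2 <:+ v → v = c.1.2) → (c.1.1 v).2 ∈ I

/-- The bias at the root of a level and the biases in the cut-off subtree of an upper level never
enter the limit tree, so they need not be controlled. -/
theorem biasesIn_limitTree {I : Set ℝ} (h : BiasesIn I q.1) (h' : ∀ i, BiasesOutsideIn I (q.2 i)) :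
    (limitTree q).BiasesIn I := by
  rintro a ⟨⟨j, y⟩, hb⟩ -
  show (if y = [] then _ else _) ∈ I
  split_ifs with hy
  · exact h' j _ (q.2 j).2.1 fun _ => rfl
  · cases j with
    | zero => exact h _ hy
    | succ j => exact h' j _ hy fun hs => absurd hs (hb.2 (by simp))

theorem pt_mem_exteriorBoundary_limitTree (h : IsTrapEntrance q.1.1.1 q.1.1.2) :
    (limitTree q).pt ∈ (limitTree q).exteriorBoundary :=
  (isEmb_base q).pt_mem_exteriorBoundary h

theorem limit_properties {I : Set ℝ} (h : BiasesIn I q.1) (h' : ∀ i, BiasesOutsideIn I (q.2 i))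
    (ht : IsTrapEntrance q.1.1.1 q.1.1.2) :
    ((limitTree q).sub (limitTree q).backbone).IsEndDistinguished ∧
      ((limitTree q).sub (limitTree q).backbone).BiasesIn I ∧
      ∀ v, ((limitTree q).sub (limitTree q).backbone).IsLeaf v ↔
        v = ((limitTree q).sub (limitTree q).backbone).pt := by
  obtain ⟨h1, h2⟩ := WTree.sub_backbone_properties (isEndDistinguished_limitTree q)
    (pt_mem_exteriorBoundary_limitTree ht) (fun a => rank q a.1) fun _ _ => rank_of_limitPar
  exact ⟨h1, fun a b hab => biasesIn_limitTree h h' _ _ hab, h2⟩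

/-- A law on sequences of stems is preserved under removing the first one. -/
theorem map_peel_infinitePi {α : Type*} [MeasurableSpace α] (μ : Measure α) [IsProbabilityMeasure μ] :
    (Measure.infinitePi fun _ : ℕ => μ).map (fun s => (s 0, fun i => s (i + 1))) =
      μ.prod (Measure.infinitePi fun _ : ℕ => μ) := by
  have hm : Measurable fun x : α × (ℕ → α) => (fun i => Nat.casesOn i x.1 x.2 : ℕ → α) := by
    refine measurable_pi_lambda _ fun i => ?_
    cases i with
    | zero => exact measurable_fst
    | succ i => exact (measurable_pi_apply i).comp measurable_snd
  have hm' : Measurable fun s : ℕ → α => (s 0, fun i => s (i + 1)) :=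
    (measurable_pi_apply 0).prodMk (measurable_pi_lambda _ fun i => measurable_pi_apply (i + 1))
  have : (μ.prod (Measure.infinitePi fun _ : ℕ => μ)).map
      (fun x : α × (ℕ → α) => (fun i => Nat.casesOn i x.1 x.2 : ℕ → α)) = Measure.infinitePi fun _ : ℕ => μ := by
    refine Measure.eq_infinitePi _ fun s t ht => ?_
    rw [Measure.map_apply hm (MeasurableSet.pi s.countable_toSet fun i _ => ht i)]
    let t' : ℕ → Set α := fun i => if i ∈ s then t i else Set.univ
    have ht' : ∀ i, MeasurableSet (t' i) := fun i => by
      simp only [t']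
      split_ifs
      exacts [ht i, MeasurableSet.univ]
    let s' : Finset ℕ := Finset.range (s.sup id)
    have hpi : (fun x : α × (ℕ → α) => (fun i => Nat.casesOn i x.1 x.2 : ℕ → α)) ⁻¹' Set.pi s t =
        t' 0 ×ˢ Set.pi s' fun i => t' (i + 1) := by
      ext x
      simp only [Set.mem_preimage, Set.mem_pi, Set.mem_prod, t', s']
      constructor
      · intro h
        refine ⟨?_, fun i _ => ?_⟩
        · split_ifs with h0
          exacts [h 0 h0, trivial]
        · split_ifs with h0
          exacts [h (i + 1) h0, trivial]
      · rintro ⟨h1, h2⟩ i hi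
        have hi' : i ∈ s := hi
        cases i with
        | zero => rwa [if_pos hi'] at h1
        | succ i =>
          have := h2 i (by
            have := Finset.le_sup (f := id) hi'
            simp only [id] at this
            simp only [Finset.coe_range, Set.mem_Iio]
            omega)
          rwa [if_pos hi'] at this
    rw [hpi, Measure.prod_prod, Measure.infinitePi_pi _ fun i _ => ht' (i + 1)]
    have h1 : ∏ i ∈ s, μ (t i) = ∏ i ∈ Finset.range (s.sup id + 1), μ (t' i) := by
      have h0 : ∏ i ∈ s, μ (t i) = ∏ i ∈ s, μ (t' i) :=
        Finset.prod_congr rfl fun i hi => by simp only [t', if_pos hi]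
      rw [h0]
      refine Finset.prod_subset (fun i hi => ?_) fun i _ hi => ?_
      · have := Finset.le_sup (f := id) hi
        simp only [id] at this
        rw [Finset.mem_range]
        omega
      · simp only [t', if_neg hi, measure_univ]
    rw [h1, Finset.prod_range_succ', mul_comm]
  conv_lhs => rw [← this]
  rw [Measure.map_map hm' hm]
  exact Measure.map_id

end Stem

namespace Env

/-! ### The trees seen from trap entrances and from regenerations -/

/-- The regeneration times, as a property of samples. -/
abbrev Reg (z : Sample) (t : ℕ) : Prop := IsRegen z.2 t

theorem isLocal_reg (I : Set ℝ) : IsLocal I Reg := isLocal_isRegen I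

theorem measurableSet_stem : MeasurableSet {q : Env × Vertex | q.2 ≠ [] ∧ q.1.Mem q.2} := by
  have hm : MeasurableSet {q : Env × Vertex | q.1.Mem q.2} :=
    measurableSet_setOfPred.2 (measurable_from_prod_countable_left fun u =>
      measurableSet_setOfPred.1 (measurableSet_mem u))
  exact ((Set.to_countable {v : Vertex | v ≠ []}).measurableSet.preimage measurable_snd).inter hm

open Classical in
/-- Turn a tree with a marked vertex into a stem. -/
noncomputable def toStem (q : Env × Vertex) : Stem :=
  ⟨if q.2 ≠ [] ∧ q.1.Mem q.2 then q else (fun _ => (1, 0), [0]), by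
    split_ifs with h
    exacts [h, ⟨by simp, trivial, Nat.zero_lt_one⟩]⟩

theorem toStem_val {q : Env × Vertex} (h : q.2 ≠ []) (h' : q.1.Mem q.2) : (toStem q).1 = q :=
  if_pos ⟨h, h'⟩

theorem measurable_toStem : Measurable toStem := by
  classical
  exact Measurable.subtype_mk (Measurable.ite measurableSet_stem measurable_id measurable_const)

/-- At time `t`, after `L + 1` regenerations, the walk arrives at a new trap entrance. -/
def trapAt (L t : ℕ) : Set Sample := {z | NewTrap z t ∧ cnt Reg t z = L + 1}

/-- The tree with the position at time `t` as its marked vertex. -/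
noncomputable def trapStem (t : ℕ) (z : Sample) : Stem := toStem (z.1, z.2 t)

/-- The tree seen from the new trap entrances after `L + 1` regenerations. -/
noncomputable def trapMeas (P : Measure Sample) (L : ℕ) : Measure Stem :=
  Measure.sum fun t => (P.restrict (trapAt L t)).map (trapStem t)

/-- The first regeneration after time `0` takes place at time `t`. -/
def firstRegen (t : ℕ) : Set Sample := {z | Reg z t ∧ cnt Reg t z = 1}

/-- The tree outside the subtree at the position at time `t`. -/
noncomputable def cutStem (t : ℕ) (z : Sample) : Stem := toStem ((past t z).1, z.2 t)

/-- The law of the tree outside the subtree at the first regeneration. -/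
noncomputable def cutMeas (P : Measure Sample) : Measure Stem :=
  Measure.sum fun t => (P.restrict (firstRegen t)).map (cutStem t)

variable {I : Set ℝ} {P μ : Measure Sample} {Q : Sample → ℕ → Prop} {z : Sample}

theorem measurable_trapStem (t : ℕ) : Measurable (trapStem t) :=
  measurable_toStem.comp (by fun_prop)

theorem measurable_cutStem (t : ℕ) : Measurable (cutStem t) := by
  have h : Measurable fun z : Sample => z.2 t := by fun_prop
  exact measurable_toStem.comp ((measurable_past t).fst.prodMk h)

theorem measurableSet_trapAt (L t : ℕ) : MeasurableSet (trapAt L t) :=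
  (measurableSet_newTrap t).inter ((isLocal_reg Set.univ).measurableSet_cnt t (L + 1))

theorem measurableSet_firstRegen (t : ℕ) : MeasurableSet (firstRegen t) :=
  (measurableSet_isRegen' t).inter ((isLocal_reg Set.univ).measurableSet_cnt t 1)

theorem trapMeas_apply (L : ℕ) {A : Set Stem} (hA : MeasurableSet A) :
    trapMeas P L A = ∑' t, P {z | z ∈ trapAt L t ∧ trapStem t z ∈ A} := by
  rw [trapMeas, Measure.sum_apply _ hA]
  refine tsum_congr fun t => ?_
  rw [Measure.map_apply (measurable_trapStem t) hA, Measure.restrict_apply (hA.preimage (measurable_trapStem t)),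
    Set.inter_comm]
  rfl

theorem cutMeas_apply {A : Set Stem} (hA : MeasurableSet A) :
    cutMeas P A = ∑' t, P {z | z ∈ firstRegen t ∧ cutStem t z ∈ A} := by
  rw [cutMeas, Measure.sum_apply _ hA]
  refine tsum_congr fun t => ?_
  rw [Measure.map_apply (measurable_cutStem t) hA, Measure.restrict_apply (hA.preimage (measurable_cutStem t)),
    Set.inter_comm]
  rfl

theorem ae_trapMeas {L : ℕ} {p : Stem → Prop} (hp : MeasurableSet {c | p c})
    (h : ∀ t, ∀ᵐ z ∂P, z ∈ trapAt L t → p (trapStem t z)) : ∀ᵐ c ∂trapMeas P L, p c := by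
  rw [trapMeas, Measure.ae_sum_iff' hp]
  intro t
  rw [ae_map_iff (measurable_trapStem t).aemeasurable hp, ae_restrict_iff' (measurableSet_trapAt L t)]
  exact h t

theorem ae_cutMeas {p : Stem → Prop} (hp : MeasurableSet {c | p c})
    (h : ∀ t, ∀ᵐ z ∂P, z ∈ firstRegen t → p (cutStem t z)) : ∀ᵐ c ∂cutMeas P, p c := by
  rw [cutMeas, Measure.ae_sum_iff' hp]
  intro t
  rw [ae_map_iff (measurable_cutStem t).aemeasurable hp, ae_restrict_iff' (measurableSet_firstRegen t)]
  exact h t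

theorem _root_.IsTrapEntrance.ne_nil {ω : Env} {u : Vertex} (h : IsTrapEntrance ω u) : u ≠ [] := by
  obtain ⟨i, w, rfl, -⟩ := (isTrapEntrance_iff ω u).1 h
  simp

theorem trapStem_val {t : ℕ} (h : NewTrap z t) : (trapStem t z).1 = (z.1, z.2 t) :=
  toStem_val h.1.ne_nil h.1.mem

theorem IsGood.ne_nil_of_isRegen (hz : IsGood I z) {t : ℕ} (ht : 1 ≤ t) (hr : Reg z t) : z.2 t ≠ [] :=
  fun h => hr.1 0 ht (by rw [h, hz.zero])

theorem pos_of_mem_firstRegen {t : ℕ} (h : z ∈ firstRegen t) : 1 ≤ t := by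
  by_contra h'
  obtain rfl : t = 0 := by omega
  have := h.2
  simp at this

theorem cutStem_val (hz : IsGood I z) {t : ℕ} (ht : 1 ≤ t) (hr : Reg z t) :
    (cutStem t z).1 = (glue (z.2 t) z.1 (fun _ => (1, 0)), z.2 t) :=
  toStem_val (hz.ne_nil_of_isRegen ht hr) 
    ((mem_glue (ω := z.1) (ω' := fun _ => (1, 0)) fun _ => rfl).2 (hz.mem t))

/-- The ray that fills the gap in the past is overwritten by the true subtree, and the addresses of
the marked vertices concatenate. -/
theorem star_cutStem (hz : IsGood I z) {ρ t : ℕ} (hρ : z ∈ firstRegen ρ) (ht : NewTrap z (ρ + t)) :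
    (cutStem ρ z).star (trapStem t (next ρ z)) = trapStem (ρ + t) z := by
  refine Subtype.ext ?_
  have h1 := cutStem_val hz (pos_of_mem_firstRegen hρ) hρ.1
  have h2 := trapStem_val (((isLocal_newTrap I).next hz hρ.1 t).2 ht)
  rw [trapStem_val ht]
  show (glue (cutStem ρ z).1.2 (cutStem ρ z).1.1 (trapStem t (next ρ z)).1.1,
    (trapStem t (next ρ z)).1.2 ++ (cutStem ρ z).1.2) = _
  rw [h1, h2]
  exact Prod.ext (glue_glue_sub (z.2 ρ) z.1 fun _ => (1, 0)) (next_append hρ.1 t)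

theorem next_mem_trapAt_iff (hz : IsGood I z) {L ρ t : ℕ} (hρ : z ∈ firstRegen ρ) :
    next ρ z ∈ trapAt L t ↔ z ∈ trapAt (L + 1) (ρ + t) := by
  refine and_congr ((isLocal_newTrap I).next hz hρ.1 t) ?_
  rw [(isLocal_reg I).cnt_next hz hρ.1, hρ.2]
  omega

theorem firstRegen_eq {t t' : ℕ} (h : z ∈ firstRegen t) (h' : z ∈ firstRegen t') : t = t' :=
  eq_of_cnt_eq h.1 h'.1 (h.2.trans h'.2.symm)

theorem tsum_measure_and_eq (μ : Measure Sample) {S : Set Sample} (hS : MeasurableSet S) {f : Sample → ℕ}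
    (hf : Measurable f) : ∑' j, μ {z | z ∈ S ∧ f z = j} = μ S := by
  rw [← measure_iUnion]
  · congr 1
    ext z
    simp
  · intro i j hij
    rw [Function.onFun, Set.disjoint_left]
    rintro z ⟨-, h⟩ ⟨-, h'⟩
    exact hij (h.symm.trans h')
  · exact fun j => hS.inter ((measurableSet_singleton j).preimage hf)

theorem exists_of_lt_cnt {j τ : ℕ} (h : j < cnt Q τ z) : ∃ t < τ, Q z t ∧ cnt Q t z = j := by
  induction τ with
  | zero => simp at h
  | succ τ ih =>
    by_cases hq : Q z τ
    · rw [cnt_succ_of_pos hq] at h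
      rcases (Nat.lt_succ_iff.1 h).eq_or_lt with rfl | h'
      · exact ⟨τ, by omega, hq, rfl⟩
      · obtain ⟨t, h1, h2⟩ := ih h'
        exact ⟨t, by omega, h2⟩
    · rw [cnt_succ_of_neg hq] at h
      obtain ⟨t, h1, h2⟩ := ih h
      exact ⟨t, by omega, h2⟩

/-- The occurrence at time `0` is counted. For regenerations this is the reason why the first one
after time `0` has count `1`, and why `trapAt L` asks for the count `L + 1`. -/
theorem cnt_eq_one {t : ℕ} (h0 : Q z 0) (ht : 1 ≤ t) (h : ∀ s, 1 ≤ s → s < t → ¬ Q z s) : cnt Q t z = 1 := by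
  induction t, ht using Nat.le_induction with
  | base => rw [cnt_succ_of_pos h0, cnt_zero]
  | succ t ht ih => rw [cnt_succ_of_neg (h t ht (by omega)), ih fun s h1 h2 => h s h1 (by omega)]

theorem exists_firstRegen (h0 : Reg z 0) (h : ∃ t ≥ 1, Reg z t) :
    ∃ t, z ∈ firstRegen t ∧ ∀ s, 1 ≤ s → s < t → ¬ Reg z s := by
  classical
  obtain ⟨h1, h2⟩ := Nat.find_spec h
  have h3 : ∀ s, 1 ≤ s → s < Nat.find h → ¬ Reg z s := fun s hs hs' hr => Nat.find_min h hs' ⟨hs, hr⟩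
  exact ⟨_, ⟨h2, cnt_eq_one h0 h1 h3⟩, h3⟩

theorem tsum_measure_firstRegen [IsProbabilityMeasure μ] (h0 : ∀ᵐ z ∂μ, Reg z 0)
    (hex : ∀ᵐ z ∂μ, ∃ t ≥ 1, Reg z t) : ∑' t, μ (firstRegen t) = 1 := by
  rw [← measure_iUnion (fun t t' hne => Set.disjoint_left.2 fun z h h' => hne (firstRegen_eq h h'))
    measurableSet_firstRegen, ← measure_univ (μ := μ)]
  refine measure_congr ?_
  filter_upwards [h0, hex] with z h0 hz
  obtain ⟨t, ht, -⟩ := exists_firstRegen h0 hz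
  exact propext (iff_of_true (Set.mem_iUnion.2 ⟨t, ht⟩) trivial)

theorem IsRegenLaw.isProbabilityMeasure_cutMeas (h : IsRegenLaw I P) (hex : ∀ᵐ z ∂P, ∃ t ≥ 1, Reg z t) :
    IsProbabilityMeasure (cutMeas P) := by
  have := h.prob
  refine ⟨?_⟩
  rw [cutMeas_apply MeasurableSet.univ]
  simp only [Set.mem_univ, and_true, Set.ofPred_mem_eq]
  exact tsum_measure_firstRegen h.zero hex

theorem IsGood.reg_zero (hz : IsGood I z) : Reg z 0 :=
  ⟨fun s hs => absurd hs (by omega), fun s _ => by rw [hz.zero]; exact List.nil_suffix⟩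

theorem IsGood.not_newTrap (hz : IsGood I z) {t : ℕ} (hr : Reg z t) : ¬ NewTrap z t :=
  fun h => h.1.not_survives (hz.survives_of_isRegen hr)

/-- Both sides are the expected number of trap entrances before the first regeneration after time
`0`: it exceeds `j` if and only if there is one preceded by exactly `j` others. -/
theorem IsRegenLaw.trapMeas_zero_univ (h : IsRegenLaw I P) (hex : ∀ᵐ z ∂P, ∃ t ≥ 1, Reg z t) :
    trapMeas P 0 Set.univ = ∑' j, P (late NewTrap j) := by
  have hm := (isLocal_newTrap I).measurable_cnt
  have h1 : ∀ j, P (late NewTrap j) = ∑' t, P {z | z ∈ trapAt 0 t ∧ cnt NewTrap t z = j} := by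
    intro j
    rw [← measure_iUnion]
    · refine measure_congr ?_
      filter_upwards [h.zero, h.good, hex] with z h0 hz he
      refine propext (Iff.trans ?_ Set.mem_iUnion.symm)
      constructor
      · intro hj
        obtain ⟨τ, hτ, hmin⟩ := exists_firstRegen h0 he
        obtain ⟨t, ht, h2, h3⟩ := exists_of_lt_cnt (hj τ (pos_of_mem_firstRegen hτ) hτ.1)
        refine ⟨t, ⟨h2, ?_⟩, h3⟩
        refine cnt_eq_one h0 ?_ fun s hs hs' => hmin s hs (by omega)
        by_contra h'
        obtain rfl : t = 0 := by omega
        exact hz.not_newTrap h0 h2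
      · rintro ⟨t, ⟨h2, h3⟩, h4⟩ t' ht' hr
        have hlt : t < t' := by
          by_contra hle
          rcases (not_lt.1 hle).eq_or_lt with rfl | hlt
          · exact hz.not_newTrap hr h2
          · have e1 := cnt_succ_of_pos (Q := Reg) hr
            have e2 := monotone_cnt (Q := Reg) (z := z) (show t' + 1 ≤ t from hlt)
            have e3 := monotone_cnt (Q := Reg) (z := z) ht'
            simp only at e2 e3
            rw [cnt_succ_of_pos (Q := Reg) h0] at e3
            omega
        have e1 := cnt_succ_of_pos h2
        have e2 := monotone_cnt (Q := NewTrap) (z := z) (show t + 1 ≤ t' from hlt)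
        simp only at e2
        omega
    · intro t t' hne
      rw [Function.onFun, Set.disjoint_left]
      rintro z ⟨h1, h2⟩ ⟨h1', h2'⟩
      exact hne (eq_of_cnt_eq h1.1 h1'.1 (h2.trans h2'.symm))
    · exact fun t => (measurableSet_trapAt 0 t).inter ((measurableSet_singleton j).preimage (hm t))
  simp only [h1]
  rw [ENNReal.tsum_comm, trapMeas_apply 0 MeasurableSet.univ]
  refine tsum_congr fun t => ?_
  rw [tsum_measure_and_eq P (measurableSet_trapAt 0 t) (hm t)]
  congr 1
  ext z
  simp

end Env

/-! ### The law of the limit tree -/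

namespace Env

variable {I : Set ℝ} {P μ : Measure Sample} {z : Sample}

theorem tsum_eq_tsum_add {f : ℕ → ℝ≥0∞} {n : ℕ} (h : ∀ m < n, f m = 0) : ∑' m, f m = ∑' m, f (n + m) := by
  rw [← (ENNReal.summable (f := fun i => f (i + n))).sum_add_tsum_nat_add', Finset.sum_eq_zero fun i hi => h i (Finset.mem_range.1 hi),
    zero_add]
  exact tsum_congr fun m => by rw [add_comm]

theorem le_of_mem_trapAt {L ρ T : ℕ} (hρ : z ∈ firstRegen ρ)
    (hT : z ∈ trapAt (L + 1) T) : ρ ≤ T := by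
  by_contra h
  have := monotone_cnt (Q := Reg) (z := z) (not_le.1 h).le
  simp only [hρ.2, hT.2] at this
  omega

/-- Cut at the first regeneration after time `0`. The stem above it is independent of the tree and
the walk below, which start afresh and see the same trap entrance after one regeneration less;
`star` puts the two together. -/
theorem IsRegenLaw.trapMeas_succ (h : IsRegenLaw I P) (hex : ∀ᵐ z ∂P, ∃ t ≥ 1, Reg z t) {L : ℕ}
    (hL : trapMeas P L Set.univ ≠ ∞) :
    trapMeas P (L + 1) = ((cutMeas P).prod (trapMeas P L)).map fun x => x.1.star x.2 := by
  have := h.prob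
  have := h.isProbabilityMeasure_cutMeas hex
  have : IsFiniteMeasure (trapMeas P L) := ⟨hL.lt_top⟩
  let S : ℕ × ℕ → Set Sample := fun i => firstRegen i.1 ∩ next i.1 ⁻¹' trapAt L i.2
  let g : ℕ × ℕ → Sample → Stem × Stem := fun i z => (cutStem i.1 z, trapStem i.2 (next i.1 z))
  have hS : ∀ i, MeasurableSet (S i) := fun i =>
    (measurableSet_firstRegen i.1).inter ((measurableSet_trapAt L i.2).preimage (measurable_next i.1))
  have hg : ∀ i, Measurable (g i) := fun i =>
    (measurable_cutStem i.1).prodMk ((measurable_trapStem i.2).comp (measurable_next i.1))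
  have hprod : (cutMeas P).prod (trapMeas P L) = Measure.sum fun i => (P.restrict (S i)).map (g i) := by
    refine Measure.prod_eq fun A B hA hB => ?_
    rw [Measure.sum_apply _ (hA.prod hB), ENNReal.tsum_prod', cutMeas_apply hA, trapMeas_apply L hB,
      ← ENNReal.tsum_mul_right]
    refine tsum_congr fun ρ => ?_
    rw [← ENNReal.tsum_mul_left]
    refine tsum_congr fun t => ?_
    rw [Measure.map_apply (hg _) (hA.prod hB), Measure.restrict_apply ((hA.prod hB).preimage (hg _))]
    -- The stem above the cut depends on the past only, with the position read off from the frozen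
    -- path.
    refine (h.regen ρ).measure_eq h.good (A := {z | cnt Reg ρ z = 1 ∧ toStem (z.1, z.2 ρ) ∈ A})
      (B := {z | z ∈ trapAt L t ∧ trapStem t z ∈ B}) ?_ ?_ (fun z hz => ?_) (fun z hz => ?_)
    · have hm : Measurable fun z : Sample => (z.1, z.2 ρ) := by fun_prop
      exact ((isLocal_reg I).measurableSet_cnt ρ 1).inter (hA.preimage (measurable_toStem.comp hm))
    · exact (measurableSet_trapAt L t).inter (hB.preimage (measurable_trapStem t))
    · constructor
      · rintro ⟨⟨h1, h2⟩, ⟨h3, h4⟩, h5⟩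
        exact ⟨h3, ⟨((isLocal_reg I).cnt_past hz h3 le_rfl).trans h4, by
          rw [past_apply le_rfl]; exact h1⟩, h5, h2⟩
      · rintro ⟨h3, ⟨h4, h1⟩, h5, h2⟩
        rw [past_apply le_rfl] at h1
        exact ⟨⟨h1, h2⟩, ⟨h3, ((isLocal_reg I).cnt_past hz h3 le_rfl).symm.trans h4⟩, h5⟩
    · constructor
      · rintro ⟨⟨h3, h4⟩, h1⟩
        exact ⟨h3, ((isLocal_reg I).cnt_past hz h3 le_rfl).trans h4, by rw [past_apply le_rfl]; exact h1⟩
      · rintro ⟨h3, h4, h1⟩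
        rw [past_apply le_rfl] at h1
        exact ⟨⟨h3, ((isLocal_reg I).cnt_past hz h3 le_rfl).symm.trans h4⟩, h1⟩
  ext A hA
  have hA' := hA.preimage Stem.measurable_star
  rw [Measure.map_apply Stem.measurable_star hA, hprod, Measure.sum_apply _ hA', ENNReal.tsum_prod',
    trapMeas_apply (L + 1) hA]
  have h1 : ∀ T, P {z | z ∈ trapAt (L + 1) T ∧ trapStem T z ∈ A} =
      ∑' ρ, P {z | z ∈ firstRegen ρ ∧ z ∈ trapAt (L + 1) T ∧ trapStem T z ∈ A} := by
    intro T
    have hm : MeasurableSet {z | z ∈ trapAt (L + 1) T ∧ trapStem T z ∈ A} :=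
      (measurableSet_trapAt (L + 1) T).inter (hA.preimage (measurable_trapStem T))
    rw [← measure_iUnion]
    · refine measure_congr ?_
      filter_upwards [h.zero, hex] with z h0 hz
      obtain ⟨t, ht, -⟩ := exists_firstRegen h0 hz
      refine propext ⟨fun h => Set.mem_iUnion.2 ⟨t, ht, h⟩, fun h => ?_⟩
      obtain ⟨_, _, h⟩ := Set.mem_iUnion.1 h
      exact h
    · intro t t' hne
      exact Set.disjoint_left.2 fun z h h' => hne (firstRegen_eq h.1 h'.1)
    · exact fun t => (measurableSet_firstRegen t).inter hm
  simp only [h1]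
  rw [ENNReal.tsum_comm]
  refine tsum_congr fun ρ => ?_
  rw [tsum_eq_tsum_add (n := ρ)]
  · refine tsum_congr fun t => ?_
    rw [Measure.map_apply (hg _) hA', Measure.restrict_apply (hA'.preimage (hg _))]
    refine measure_congr ?_
    filter_upwards [h.good] with z hz
    refine propext ⟨?_, ?_⟩
    · rintro ⟨h1, h2, h3⟩
      rw [← star_cutStem hz h1 h2.1] at h3
      exact ⟨h3, h1, (next_mem_trapAt_iff hz h1).2 h2⟩
    · rintro ⟨h3, h1, h2⟩
      have h2' := (next_mem_trapAt_iff hz h1).1 h2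
      refine ⟨h1, h2', ?_⟩
      rw [← star_cutStem hz h1 h2'.1]
      exact h3
  · intro T hT
    refine measure_mono_null (t := ∅) ?_ measure_empty
    rintro z ⟨h1, h2, -⟩
    have := le_of_mem_trapAt h1 h2
    omega

/-- The total mass does not depend on the number of regenerations. -/
theorem IsRegenLaw.trapMeas_univ (h : IsRegenLaw I P) (hex : ∀ᵐ z ∂P, ∃ t ≥ 1, Reg z t)
    (h0 : trapMeas P 0 Set.univ ≠ ∞) (L : ℕ) : trapMeas P L Set.univ = trapMeas P 0 Set.univ := by
  have := h.prob
  have := h.isProbabilityMeasure_cutMeas hex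
  induction L with
  | zero => rfl
  | succ L ih =>
    have hL : trapMeas P L Set.univ ≠ ∞ := ih ▸ h0
    have : IsFiniteMeasure (trapMeas P L) := ⟨hL.lt_top⟩
    rw [h.trapMeas_succ hex hL, Measure.map_apply Stem.measurable_star MeasurableSet.univ, Set.preimage_univ,
      ← Set.univ_prod_univ, Measure.prod_prod, measure_univ, one_mul, ih]

/-- The law of the levels of the limit tree. -/
noncomputable def levelsLaw (P : Measure Sample) (L : ℕ) : Measure (Stem × (ℕ → Stem)) :=
  ((trapMeas P 0 Set.univ)⁻¹ • trapMeas P L).prod (Measure.infinitePi fun _ => cutMeas P)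

/-- Merging uses up the first of the i.i.d. stems, and the remaining sequence has the same law and
is independent of it. -/
theorem map_merge_prod (μ C : Measure Stem) [IsProbabilityMeasure C] [SFinite μ] :
    (μ.prod (Measure.infinitePi fun _ => C)).map Stem.merge =
      ((C.prod μ).map fun x => x.1.star x.2).prod (Measure.infinitePi fun _ => C) := by
  set D := Measure.infinitePi fun _ : ℕ => C
  have hp : Measurable fun s : ℕ → Stem => (s 0, fun i => s (i + 1)) :=
    (measurable_pi_apply 0).prodMk (measurable_pi_lambda _ fun i => measurable_pi_apply (i + 1))
  have hr : Measurable fun x : Stem × (Stem × (ℕ → Stem)) => ((x.2.1, x.1), x.2.2) := by fun_prop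
  have e : Stem.merge = (Prod.map (fun x : Stem × Stem => x.1.star x.2) id) ∘
      (fun x : Stem × (Stem × (ℕ → Stem)) => ((x.2.1, x.1), x.2.2)) ∘
      (Prod.map id fun s : ℕ → Stem => (s 0, fun i => s (i + 1))) := rfl
  rw [e, ← Measure.map_map (Stem.measurable_star.prodMap measurable_id) (hr.comp (measurable_id.prodMap hp)),
    ← Measure.map_map hr (measurable_id.prodMap hp), ← Measure.map_prod_map _ _ measurable_id hp,
    Stem.map_peel_infinitePi, Measure.map_id]
  have h1 : ((C.prod μ).map fun x => x.1.star x.2).prod D =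
      ((C.prod μ).prod D).map (Prod.map (fun x : Stem × Stem => x.1.star x.2) id) := by
    rw [← Measure.map_prod_map _ _ Stem.measurable_star measurable_id, Measure.map_id]
  have h2 : (C.prod μ).prod D = ((μ.prod C).prod D).map (Prod.map Prod.swap id) := by
    rw [← Measure.map_prod_map _ _ measurable_swap measurable_id, Measure.map_id, Measure.prod_swap]
  rw [h1, h2, ← Measure.prodAssoc_prod, Measure.map_map hr (by fun_prop)]
  rfl

/-- Merging produces exactly the decomposition at one more regeneration. Hence a single law of
levels represents the views from trap entrances after any number of regenerations. -/
theorem IsRegenLaw.map_merge_levelsLaw (h : IsRegenLaw I P) (hex : ∀ᵐ z ∂P, ∃ t ≥ 1, Reg z t)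
    (h0 : trapMeas P 0 Set.univ ≠ ∞) (L : ℕ) : (levelsLaw P L).map Stem.merge = levelsLaw P (L + 1) := by
  have := h.isProbabilityMeasure_cutMeas hex
  have hL : trapMeas P L Set.univ ≠ ∞ := h.trapMeas_univ hex h0 L ▸ h0
  have : IsFiniteMeasure (trapMeas P L) := ⟨hL.lt_top⟩
  rw [levelsLaw, map_merge_prod, levelsLaw, Measure.prod_smul_right, Measure.map_smul, h.trapMeas_succ hex hL]

theorem IsRegenLaw.map_iterate_merge_levelsLaw (h : IsRegenLaw I P) (hex : ∀ᵐ z ∂P, ∃ t ≥ 1, Reg z t)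
    (h0 : trapMeas P 0 Set.univ ≠ ∞) (L : ℕ) : (levelsLaw P 0).map Stem.merge^[L] = levelsLaw P L := by
  induction L with
  | zero => exact Measure.map_id
  | succ L ih =>
    rw [Function.iterate_succ', ← Measure.map_map Stem.measurable_merge (Stem.measurable_merge.iterate L), ih,
      h.map_merge_levelsLaw hex h0]

theorem IsRegenLaw.isProbabilityMeasure_levelsLaw (h : IsRegenLaw I P) (hex : ∀ᵐ z ∂P, ∃ t ≥ 1, Reg z t)
    (h0 : trapMeas P 0 Set.univ ≠ ∞) (h0' : trapMeas P 0 Set.univ ≠ 0) (L : ℕ) :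
    IsProbabilityMeasure (levelsLaw P L) := by
  have := h.isProbabilityMeasure_cutMeas hex
  have : IsProbabilityMeasure ((trapMeas P 0 Set.univ)⁻¹ • trapMeas P L) := ⟨by
    rw [Measure.smul_apply, smul_eq_mul, h.trapMeas_univ hex h0 L, ENNReal.inv_mul_cancel h0' h0]⟩
  unfold levelsLaw
  infer_instance

/-- The law of the backbone neighbourhood of the marked vertex of the limit tree. -/
theorem IsRegenLaw.map_outNbhd_limitTree (h : IsRegenLaw I P) (hex : ∀ᵐ z ∂P, ∃ t ≥ 1, Reg z t)
    (h0 : trapMeas P 0 Set.univ ≠ ∞) (k : ℕ) :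
    (levelsLaw P 0).map (fun q => (Stem.limitTree q).outNbhd k) =
      (trapMeas P 0 Set.univ)⁻¹ • (trapMeas P (k + 2)).map fun c => (c.1.1.tree c.1.2).outNbhd k := by
  have := h.isProbabilityMeasure_cutMeas hex
  have hm : Measurable fun c : Stem => (c.1.1.tree c.1.2).outNbhd k :=
    (isPresentation_tree.measurable_outNbhd k).comp measurable_subtype_coe
  have hi := Stem.measurable_merge.iterate (k + 2)
  rw [WTree.map_congr_iso (Stem.isPresentation_limitTree.measurable_outNbhd k)
    ((hm.comp measurable_fst).comp hi) (ae_of_all _ fun q => Stem.outNbhd_limitTree_iso q k),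
    ← Measure.map_map (hm.comp measurable_fst) hi, h.map_iterate_merge_levelsLaw hex h0,
    ← Measure.map_map hm measurable_fst, levelsLaw, Measure.map_fst_prod, measure_univ, one_smul, Measure.map_smul]

theorem measurableSet_biasesIn (hI : MeasurableSet I) : MeasurableSet {c | Stem.BiasesIn I c} := by
  have : {c | Stem.BiasesIn I c} = ⋂ v ≠ [], {c : Stem | (c.1.1 v).2 ∈ I} := by
    ext c
    simp [Stem.BiasesIn]
  rw [this]
  refine MeasurableSet.biInter (Set.to_countable _) fun v _ => ?_
  exact hI.preimage ((measurable_pi_apply v).comp measurable_subtype_coe.fst).snd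

theorem measurableSet_biasesOutsideIn (hI : MeasurableSet I) :
    MeasurableSet {c | Stem.BiasesOutsideIn I c} := by
  have : {c | Stem.BiasesOutsideIn I c} = ⋂ v ≠ [], ({c : Stem | c.1.2 ∈ {u | v ∈ {v | u <:+ v → v = u}}}ᶜ ∪
      {c : Stem | (c.1.1 v).2 ∈ I}) := by
    ext c
    simp only [Stem.BiasesOutsideIn, Set.mem_ofPred_eq, Set.mem_iInter, Set.mem_union, Set.mem_compl_iff,
      ← imp_iff_not_or]
  rw [this]
  refine MeasurableSet.biInter (Set.to_countable _) fun v _ => MeasurableSet.union (MeasurableSet.compl ?_) ?_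
  · exact (Set.to_countable {u : Vertex | v ∈ {v | u <:+ v → v = u}}).measurableSet.preimage
      measurable_subtype_coe.snd
  · exact hI.preimage ((measurable_pi_apply v).comp measurable_subtype_coe.fst).snd

/-- A cut stem contains a ray with bias `0` below its marked vertex, so its biases are controlled
only outside this subtree, apart from the edge that leads to it. -/
theorem IsRegenLaw.ae_levelsLaw (h : IsRegenLaw I P) (hI : MeasurableSet I)
    (hex : ∀ᵐ z ∂P, ∃ t ≥ 1, Reg z t) (h0 : trapMeas P 0 Set.univ ≠ ∞) :
    ∀ᵐ q ∂levelsLaw P 0, IsTrapEntrance q.1.1.1 q.1.1.2 ∧ Stem.BiasesIn I q.1 ∧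
      ∀ i, Stem.BiasesOutsideIn I (q.2 i) := by
  have := h.isProbabilityMeasure_cutMeas hex
  have : IsFiniteMeasure (trapMeas P 0) := ⟨h0.lt_top⟩
  have h1 : ∀ᵐ c ∂trapMeas P 0, IsTrapEntrance c.1.1 c.1.2 ∧ Stem.BiasesIn I c := by
    refine ae_trapMeas ?_ fun t => ?_
    · have hm : MeasurableSet {q : Env × Vertex | IsTrapEntrance q.1 q.2} :=
        measurableSet_setOfPred.2 (measurable_from_prod_countable_left fun u =>
          measurableSet_setOfPred.1 (measurableSet_isTrapEntrance u))
      exact (hm.preimage measurable_subtype_coe).inter (measurableSet_biasesIn hI)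
    · filter_upwards [h.good] with z hz ht
      rw [Stem.BiasesIn, trapStem_val ht.1]
      exact ⟨ht.1.1, hz.bias⟩
  have h2 : ∀ᵐ c ∂cutMeas P, Stem.BiasesOutsideIn I c := by
    refine ae_cutMeas (measurableSet_biasesOutsideIn hI) fun t => ?_
    filter_upwards [h.good] with z hz ht
    rw [Stem.BiasesOutsideIn, cutStem_val hz (pos_of_mem_firstRegen ht) ht.1]
    intro v hv hs
    have : (glue (z.2 t) z.1 (fun _ => (1, 0)) v).2 = (z.1 v).2 := by
      by_cases hvs : z.2 t <:+ v
      · rw [hs hvs, glue_self_snd]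
      · rw [glue_of_not_suffix _ _ hvs]
    rw [this]
    exact hz.bias v hv
  have h3 : ∀ᵐ s ∂Measure.infinitePi fun _ : ℕ => cutMeas P, ∀ i, Stem.BiasesOutsideIn I (s i) :=
    ae_all_iff.2 fun i => (measurePreserving_eval_infinitePi (fun _ : ℕ => cutMeas P) i).quasiMeasurePreserving.ae h2
  have h4 := Measure.ae_smul_measure h1 (trapMeas P 0 Set.univ)⁻¹
  have : SFinite ((trapMeas P 0 Set.univ)⁻¹ • trapMeas P 0) := inferInstance
  have h5 := Measure.quasiMeasurePreserving_fst (μ := (trapMeas P 0 Set.univ)⁻¹ • trapMeas P 0)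
    (ν := Measure.infinitePi fun _ : ℕ => cutMeas P)
  have h6 := Measure.quasiMeasurePreserving_snd (μ := (trapMeas P 0 Set.univ)⁻¹ • trapMeas P 0)
    (ν := Measure.infinitePi fun _ : ℕ => cutMeas P)
  filter_upwards [h5.ae h4, h6.ae h3] with q h h'
  exact ⟨h.1, h.2, h'⟩

end Env

/-! ### Total variation and convolution estimates -/

theorem tvDist_nonneg {α : Type*} [MeasurableSpace α] (μ ν : Measure α) : 0 ≤ tvDist μ ν :=
  Real.iSup_nonneg fun _ => abs_nonneg _

/-- For probability measures a one-sided bound on all events suffices: applied to the complement, it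
is the bound in the other direction. -/
theorem tvDist_le {α : Type*} [MeasurableSpace α] {μ ν : Measure α} [IsProbabilityMeasure μ]
    [IsProbabilityMeasure ν] {ε : ℝ≥0∞} (hε : ε ≠ ∞) (h : ∀ A, MeasurableSet A → ν A ≤ μ A + ε) :
    tvDist μ ν ≤ ε.toReal := by
  have key : ∀ A, MeasurableSet A → ν.real A ≤ μ.real A + ε.toReal := fun A hA => by
    rw [measureReal_def, measureReal_def, ← ENNReal.toReal_add (measure_ne_top _ _) hε]
    exact ENNReal.toReal_mono (ENNReal.add_ne_top.2 ⟨measure_ne_top _ _, hε⟩) (h A hA)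
  have : Nonempty {A : Set α // MeasurableSet A} := ⟨⟨∅, MeasurableSet.empty⟩⟩
  refine ciSup_le fun ⟨A, hA⟩ => abs_le.2 ⟨?_, ?_⟩
  · have := key A hA
    simp only
    linarith
  · have := key Aᶜ hA.compl
    rw [probReal_compl_eq_one_sub hA, probReal_compl_eq_one_sub hA] at this
    simp only
    linarith

/-- Dominated convergence in `j`. The value `B` stands for the terms that the index has not yet
reached. -/
theorem ENNReal.tendsto_tsum_convolution {c b : ℕ → ℝ≥0∞} {B M : ℝ≥0∞} (hc : ∑' j, c j ≠ ∞)
    (hb : Tendsto b atTop (𝓝 0)) (hbM : ∀ n, b n ≤ M) (hB : B ≤ M) (hM : M ≠ ∞) :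
    Tendsto (fun n => ∑' j, c j * if j ≤ n then b (n - j) else B) atTop (𝓝 0) := by
  have hle : ∀ n j, (if j ≤ n then b (n - j) else B) ≤ M := fun n j => by
    split_ifs
    exacts [hbM _, hB]
  simp only [← lintegral_count]
  have h0 : ∫⁻ _ : ℕ, (0 : ℝ≥0∞) ∂Measure.count = 0 := lintegral_zero
  rw [← h0]
  refine tendsto_lintegral_of_dominated_convergence (fun j => c j * M) (fun n => measurable_of_countable _)
    (fun n => ae_of_all _ fun j => mul_le_mul_right (hle n j) (c j)) ?_ (ae_of_all _ fun j => ?_)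
  · rw [lintegral_count, ENNReal.tsum_mul_right]
    exact ENNReal.mul_ne_top hc hM
  · have hcj : c j ≠ ∞ := ENNReal.ne_top_of_tsum_ne_top hc j
    have h1 : Tendsto (fun n => c j * b (n - j)) atTop (𝓝 (c j * 0)) :=
      ENNReal.Tendsto.const_mul (hb.comp (tendsto_sub_atTop_nat j)) (Or.inr hcj)
    rw [mul_zero] at h1
    refine h1.congr' ?_
    filter_upwards [eventually_ge_atTop j] with n hn
    rw [if_pos hn]

namespace Env

variable {I : Set ℝ} {P μ : Measure Sample} {z : Sample} {k : ℕ} {A : Set WTree}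

/-! ### Regenerations and arrivals at trap entrances -/

/-- The backbone neighbourhood of the position at time `t`. -/
noncomputable def nbhd (k t : ℕ) (z : Sample) : WTree := (z.1.tree (z.2 t)).outNbhd k

theorem measurable_nbhd (k t : ℕ) : Measurable (nbhd k t) := by
  have h : Measurable fun z : Sample => (z.1, z.2 t) := by fun_prop
  exact (isPresentation_tree.measurable_outNbhd k).comp h

/-- The walk is far away from the root when it arrives at a new trap entrance after it has
encountered `n` others, and the neighbourhood of the new one lies in `A`. -/
def Hit (k n : ℕ) (A : Set WTree) : Set Sample :=
  {z | ∃ t, NewTrap z t ∧ cnt NewTrap t z = n ∧ nbhd k t z ∈ A ∧ k + 1 < (z.2 t).length}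

theorem measurableSet_length (k t : ℕ) : MeasurableSet {z : Sample | k < (z.2 t).length} :=
  measurableSet_path t {v | k < v.length} |>.preimage measurable_snd

theorem measurableSet_hit (hA : MeasurableSet A) (k n : ℕ) : MeasurableSet (Hit k n A) := by
  have : Hit k n A = ⋃ t, ({z | NewTrap z t} ∩ ({z | cnt NewTrap t z = n} ∩ (nbhd k t ⁻¹' A ∩
      {z : Sample | k + 1 < (z.2 t).length}))) := by
    ext z
    simp [Hit]
  rw [this]
  exact MeasurableSet.iUnion fun t => (measurableSet_newTrap t).inter
    (((isLocal_newTrap Set.univ).measurableSet_cnt t n).inter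
      ((hA.preimage (measurable_nbhd k t)).inter (measurableSet_length _ t)))

/-- The neighbourhood does not reach up to the regeneration vertex, so it looks the same in the
subtree and in the whole tree. -/
theorem nbhd_next_mem_iff (hz : IsGood I z) (hA : MeasurableSet A) {ρ t : ℕ} (hr : Reg z ρ)
    (ht : NewTrap (next ρ z) t) (hk : k + 1 < ((next ρ z).2 t).length) :
    nbhd k t (next ρ z) ∈ A ↔ nbhd k (ρ + t) z ∈ A := by
  have := outNbhd_sub_iso (hz.mem ρ) ht.1.mem hk
  rw [next_append hr] at this
  exact this.mem_iff hA

theorem mem_hit_of_next (hz : IsGood I z) (hA : MeasurableSet A) {ρ m : ℕ} (hr : Reg z ρ)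
    (h : next ρ z ∈ Hit k m A) : z ∈ Hit k (cnt NewTrap ρ z + m) A := by
  obtain ⟨t, h1, rfl, h3, h4⟩ := h
  refine ⟨ρ + t, ((isLocal_newTrap I).next hz hr t).1 h1, (isLocal_newTrap I).cnt_next hz hr t,
    (nbhd_next_mem_iff hz hA hr h1 h4).1 h3, ?_⟩
  rw [← next_append hr t, List.length_append]
  omega

/-- Each regeneration vertex is a proper descendant of the preceding ones. -/
theorem cnt_reg_le_length {t : ℕ} (hr : Reg z t) : cnt Reg t z ≤ (z.2 t).length := by
  induction t using Nat.strong_induction_on with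
  | _ t ih =>
    rcases Nat.eq_zero_or_pos (cnt Reg t z) with h0 | h0
    · omega
    · obtain ⟨s, hs, hrs, hc⟩ := exists_of_lt_cnt (show cnt Reg t z - 1 < cnt Reg t z by omega)
      have h1 := ih s hs hrs
      have h2 : z.2 s <:+ z.2 t := hrs.2 t hs.le
      have h3 : (z.2 s).length ≠ (z.2 t).length := fun h =>
        hr.1 s hs (by rw [h2.eq_of_length h])
      have h4 := h2.length_le
      omega

theorem length_of_mem_trapAt {L t : ℕ} (h : z ∈ trapAt L t) : L ≤ (z.2 t).length := by
  obtain ⟨s, hs, hrs, hc⟩ := exists_of_lt_cnt (show L < cnt Reg t z by rw [h.2]; omega)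
  have h1 := cnt_reg_le_length hrs
  have h2 := (hrs.2 t hs.le).length_le
  omega

/-- The arrivals at new trap entrances after `m` others and after `k + 3` regenerations. -/
def arrivals (k m t : ℕ) (A : Set WTree) : Set Sample :=
  {z | z ∈ trapAt (k + 2) t ∧ cnt NewTrap t z = m ∧ nbhd k t z ∈ A}

theorem measurableSet_arrivals (hA : MeasurableSet A) (k m t : ℕ) : MeasurableSet (arrivals k m t A) :=
  (measurableSet_trapAt _ t).inter (((isLocal_newTrap Set.univ).measurableSet_cnt t m).inter
    (hA.preimage (measurable_nbhd k t)))

/-- The probability of an arrival at a new trap entrance after `m` others and after `k + 3`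
regenerations. -/
noncomputable def arrivalProb (P : Measure Sample) (k m : ℕ) (A : Set WTree) : ℝ≥0∞ :=
  ∑' t, P (arrivals k m t A)

theorem tsum_arrivalProb (hA : MeasurableSet A) :
    ∑' m, arrivalProb P k m A = (trapMeas P (k + 2)).map (fun c => (c.1.1.tree c.1.2).outNbhd k) A := by
  have hm : Measurable fun c : Stem => (c.1.1.tree c.1.2).outNbhd k :=
    (isPresentation_tree.measurable_outNbhd k).comp measurable_subtype_coe
  rw [Measure.map_apply hm hA, trapMeas_apply _ (hA.preimage hm)]
  unfold arrivalProb
  rw [ENNReal.tsum_comm]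
  refine tsum_congr fun t => ?_
  have h1 := tsum_measure_and_eq P ((measurableSet_trapAt (k + 2) t).inter (hA.preimage (measurable_nbhd k t)))
    ((isLocal_newTrap Set.univ).measurable_cnt t)
  have h2 : {z | z ∈ trapAt (k + 2) t ∧ trapStem t z ∈ (fun c : Stem => (c.1.1.tree c.1.2).outNbhd k) ⁻¹' A} =
      trapAt (k + 2) t ∩ nbhd k t ⁻¹' A := by
    ext z
    refine and_congr_right fun hz => ?_
    rw [Set.mem_preimage, trapStem_val hz.1]
    rfl
  rw [h2, ← h1]
  refine tsum_congr fun m => ?_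
  congr 1
  ext z
  simp only [arrivals, Set.mem_ofPred_eq, Set.mem_inter_iff, Set.mem_preimage]
  tauto

/-- Split at the regeneration that leaves exactly `k + 3` regenerations, itself included, before the
arrival: the past gives the renewal mass, the future the arrival probability. Only a lower bound
results, because arrivals with too few regenerations before them are not covered. -/
theorem IsRegenLaw.sum_renewal_mul_arrivalProb_le (h : IsRegenLaw I P) (hA : MeasurableSet A) (n : ℕ) :
    ∑' m, (if m ≤ n then renewal NewTrap P (n - m) else 0) * arrivalProb P k m A ≤ P (Hit k n A) := by
  have := h.prob
  have hQ := isLocal_newTrap I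
  let E : ℕ × ℕ × ℕ → Set Sample := fun i => {z | i.1 ≤ n ∧ Reg z i.2.1 ∧ cnt NewTrap i.2.1 z = n - i.1 ∧
    next i.2.1 z ∈ arrivals k i.1 i.2.2 A}
  have hE : ∀ i, MeasurableSet (E i) := fun i => (MeasurableSet.const _).inter
    ((measurableSet_isRegen' _).inter ((hQ.measurableSet_cnt _ _).inter
      ((measurableSet_arrivals hA _ _ _).preimage (measurable_next _))))
  have hE' : ∀ m ρ t, P (E (m, ρ, t)) = (if m ≤ n then P {z | Reg z ρ ∧ cnt NewTrap ρ z = n - m} else 0) *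
      P (arrivals k m t A) := by
    intro m ρ t
    split_ifs with hm
    · refine (h.regen ρ).measure_eq h.good (A := {z | cnt NewTrap ρ z = n - m}) (hQ.measurableSet_cnt _ _)
        (measurableSet_arrivals hA _ _ _) (fun z hz => ?_) fun z hz => ?_
      · simp only [E, Set.mem_ofPred_eq, hm, true_and]
        exact and_congr_right fun hr => by rw [hQ.cnt_past hz hr le_rfl]
      · exact and_congr_right fun hr => by rw [Set.mem_ofPred_eq, hQ.cnt_past hz hr le_rfl]
    · rw [zero_mul, measure_eq_zero_iff_ae_notMem]
      exact ae_of_all _ fun z hz => hm hz.1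
  have hsum : ∑' m, (if m ≤ n then renewal NewTrap P (n - m) else 0) * arrivalProb P k m A = ∑' i, P (E i) := by
    rw [ENNReal.tsum_prod']
    refine tsum_congr fun m => ?_
    rw [ENNReal.tsum_prod']
    simp only [hE']
    simp only [ENNReal.tsum_mul_left, ENNReal.tsum_mul_right]
    rw [arrivalProb]
    congr 1
    split_ifs
    · rfl
    · rw [tsum_zero]
  rw [hsum]
  let G : Set Sample := {z | IsGood I z}
  have hmono : ∀ i, E i ∩ G ⊆ Hit k n A := by
    rintro ⟨m, ρ, t⟩ z ⟨⟨h1, h2, h3, h4⟩, hz⟩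
    have h5 : next ρ z ∈ Hit k m A :=
      ⟨t, h4.1.1, h4.2.1, h4.2.2, (Nat.lt_succ_self (k + 1)).trans_le (length_of_mem_trapAt h4.1)⟩
    have := mem_hit_of_next hz hA h2 h5
    simp only at h1 h3
    rwa [h3, Nat.sub_add_cancel h1] at this
  have hae : ∀ i, P (E i) = P (E i ∩ G) := by
    intro i
    refine measure_congr ?_
    filter_upwards [h.good] with z hz
    exact propext ⟨fun h => ⟨h, hz⟩, fun h => h.1⟩
  -- The total count `n` determines the arrival time. The number of regenerations before it
  -- determines the cut `ρ`, and then `t` and `m` are determined too.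
  have hdisj : ∀ i j, i ≠ j → Disjoint (E i ∩ G) (E j ∩ G) := by
    rintro ⟨m, ρ, t⟩ ⟨m', ρ', t'⟩ hne
    rw [Set.disjoint_left]
    rintro z ⟨⟨h1, h2, h3, h4⟩, hz⟩ ⟨⟨h1', h2', h3', h4'⟩, -⟩
    simp only at h1 h2 h3 h4 h1' h2' h3' h4'
    have e1 := hQ.cnt_next hz h2 t
    have e1' := hQ.cnt_next hz h2' t'
    rw [h4.2.1] at e1
    rw [h4'.2.1] at e1'
    have e2 : ρ + t = ρ' + t' := eq_of_cnt_eq ((hQ.next hz h2 t).1 h4.1.1) ((hQ.next hz h2' t').1 h4'.1.1) (by omega)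
    have e3 := (isLocal_reg I).cnt_next hz h2 t
    have e3' := (isLocal_reg I).cnt_next hz h2' t'
    rw [h4.1.2] at e3
    rw [h4'.1.2, ← e2] at e3'
    obtain rfl : ρ = ρ' := eq_of_cnt_eq (Q := Reg) h2 h2' (by omega)
    obtain rfl : t = t' := by omega
    obtain rfl : m = m' := by omega
    exact hne rfl
  have hnull : NullMeasurableSet G P := by
    have : G =ᵐ[P] Set.univ := by
      filter_upwards [h.good] with z hz
      exact propext (iff_of_true hz trivial)
    exact (MeasurableSet.univ.nullMeasurableSet).congr this.symm
  calc ∑' i, P (E i) = ∑' i, P (E i ∩ G) := tsum_congr hae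
    _ = P (⋃ i, E i ∩ G) := (measure_iUnion₀ (fun i j hij => (hdisj i j hij).aedisjoint)
        fun i => (hE i).nullMeasurableSet.inter hnull).symm
    _ ≤ P (Hit k n A) := measure_mono (Set.iUnion_subset hmono)

/-- Split at the first regeneration after time `0`, from which on the sample has law `P`. This
transfers lower bounds from `P` to `μ`. -/
theorem sum_mul_hit_le (hμ : ∀ᵐ z ∂μ, IsGood I z) (hR : Regenerative P μ)
    (hA : MeasurableSet A) (n : ℕ) :
    ∑' j, (∑' ρ, μ {z | z ∈ firstRegen ρ ∧ cnt NewTrap ρ z = j}) * (if j ≤ n then P (Hit k (n - j) A) else 0) ≤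
      μ (Hit k n A) := by
  have hQ := isLocal_newTrap I
  let E : ℕ × ℕ → Set Sample := fun i => {z | i.1 ≤ n ∧ (z ∈ firstRegen i.2 ∧ cnt NewTrap i.2 z = i.1) ∧
    next i.2 z ∈ Hit k (n - i.1) A}
  have hE : ∀ i, MeasurableSet (E i) := fun i => (MeasurableSet.const _).inter
    (((measurableSet_firstRegen _).inter (hQ.measurableSet_cnt _ _)).inter
      ((measurableSet_hit hA _ _).preimage (measurable_next _)))
  have hE' : ∀ j ρ, μ (E (j, ρ)) = μ {z | z ∈ firstRegen ρ ∧ cnt NewTrap ρ z = j} *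
      (if j ≤ n then P (Hit k (n - j) A) else 0) := by
    intro j ρ
    split_ifs with hj
    · rcases Nat.eq_zero_or_pos ρ with rfl | hρ
      · have h0 : ∀ z, z ∉ firstRegen 0 := fun z hz => absurd (pos_of_mem_firstRegen hz) (by omega)
        simp [E, h0]
      · refine (hR ρ hρ).measure_eq hμ (A := {z | cnt Reg ρ z = 1 ∧ cnt NewTrap ρ z = j})
          (((isLocal_reg I).measurableSet_cnt _ _).inter (hQ.measurableSet_cnt _ _))
          (measurableSet_hit hA _ _) (fun z hz => ?_) fun z hz => ?_
        · simp only [E, firstRegen, Set.mem_ofPred_eq, hj, true_and, and_assoc]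
          exact and_congr_right fun hr => by
            rw [hQ.cnt_past hz hr le_rfl, (isLocal_reg I).cnt_past hz hr le_rfl]
        · simp only [firstRegen, Set.mem_ofPred_eq, and_assoc]
          exact and_congr_right fun hr => by
            rw [hQ.cnt_past hz hr le_rfl, (isLocal_reg I).cnt_past hz hr le_rfl]
    · rw [mul_zero, measure_eq_zero_iff_ae_notMem]
      exact ae_of_all _ fun z hz => hj hz.1
  simp only [← ENNReal.tsum_mul_right, ← hE']
  rw [← ENNReal.tsum_prod' (f := fun i => μ (E i)), ← measure_iUnion _ hE]
  · refine measure_mono_ae ?_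
    filter_upwards [hμ] with z hz hzE
    obtain ⟨⟨j, ρ⟩, h1, ⟨h2, h3⟩, h4⟩ := Set.mem_iUnion.1 hzE
    have := mem_hit_of_next hz hA h2.1 h4
    rwa [h3, Nat.add_sub_cancel' h1] at this
  · rintro ⟨j, ρ⟩ ⟨j', ρ'⟩ hne
    rw [Function.onFun, Set.disjoint_left]
    rintro z ⟨-, ⟨h2, h3⟩, -⟩ ⟨-, ⟨h2', h3'⟩, -⟩
    simp only at h2 h3 h2' h3'
    obtain rfl := firstRegen_eq h2 h2'
    exact hne (by rw [← h3, ← h3'])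

end Env

/-! ### Lower bounds for the laws at arrival times -/

namespace Env

variable {I : Set ℝ} {P μ : Measure Sample} {z : Sample} {k : ℕ} {A : Set WTree}

theorem arrivalTime_of_newTrap {t n : ℕ} (h : NewTrap z t) (hc : cnt NewTrap t z = n) :
    arrivalTime z.1 z.2 (n + 1) = t := by
  classical
  have := Nat.nth_count (p := NewTrap z) h
  rw [← this, ← hc]
  unfold arrivalTime cnt
  rw [Nat.add_sub_cancel]
  rfl

/-- If there are too few trap entrances, `Nat.nth` takes its default value `0`. This case matters
only for the measurability of the arrival time. -/
theorem arrivalTime_of_forall_not {n : ℕ} (h : ∀ t, ¬ (NewTrap z t ∧ cnt NewTrap t z = n)) :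
    arrivalTime z.1 z.2 (n + 1) = 0 := by
  classical
  have : ∃ hf : (Set.ofPred (NewTrap z)).Finite, hf.toFinset.card ≤ n := by
    by_contra! hcon
    refine h (Nat.nth (NewTrap z) n) ⟨Nat.nth_mem n hcon, ?_⟩
    have := Nat.count_nth (p := NewTrap z) hcon
    unfold cnt
    convert this
  obtain ⟨hf, hn⟩ := this
  exact Nat.nth_of_card_le hf hn

theorem measurable_arrivalTime (n : ℕ) : Measurable fun z : Sample => arrivalTime z.1 z.2 (n + 1) := by
  have hm : ∀ t, MeasurableSet {z | NewTrap z t ∧ cnt NewTrap t z = n} := fun t =>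
    (measurableSet_newTrap t).inter ((isLocal_newTrap Set.univ).measurableSet_cnt t n)
  refine measurable_to_countable' fun t => ?_
  have : (fun z : Sample => arrivalTime z.1 z.2 (n + 1)) ⁻¹' {t} = {z | NewTrap z t ∧ cnt NewTrap t z = n} ∪
      ((⋂ s, {z | NewTrap z s ∧ cnt NewTrap s z = n}ᶜ) ∩ {_z | t = 0}) := by
    ext z
    by_cases h : ∃ s, NewTrap z s ∧ cnt NewTrap s z = n
    · obtain ⟨s, hs, hs'⟩ := h
      simp only [Set.mem_preimage, Set.mem_singleton_iff, arrivalTime_of_newTrap hs hs', Set.mem_union,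
        Set.mem_inter_iff, Set.mem_iInter]
      constructor
      · rintro rfl
        exact Or.inl ⟨hs, hs'⟩
      · rintro (⟨h1, h2⟩ | ⟨h1, -⟩)
        · exact eq_of_cnt_eq hs h1 (hs'.trans h2.symm)
        · exact absurd ⟨hs, hs'⟩ (h1 s)
    · simp only [not_exists] at h
      simp only [Set.mem_preimage, Set.mem_singleton_iff, arrivalTime_of_forall_not h, Set.mem_union,
        Set.mem_inter_iff, Set.mem_iInter]
      constructor
      · rintro rfl
        exact Or.inr ⟨fun s => h s, rfl⟩
      · rintro (h1 | ⟨-, h2⟩)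
        · exact absurd h1 (h t)
        · exact Eq.symm h2
  rw [this]
  exact (hm t).union ((MeasurableSet.iInter fun s => (hm s).compl).inter (MeasurableSet.const _))

theorem measurable_outNbhd_arrivalTime (k n : ℕ) : Measurable fun z : Sample =>
    (z.1.tree (z.2 (arrivalTime z.1 z.2 (n + 1)))).outNbhd k := by
  have h : Measurable fun x : Sample × ℕ => nbhd k x.2 x.1 :=
    measurable_from_prod_countable_left fun t => measurable_nbhd k t
  exact h.comp (measurable_id.prodMk (measurable_arrivalTime n))

theorem hit_subset (k n : ℕ) (A : Set WTree) : Hit k n A ⊆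
    (fun z : Sample => (z.1.tree (z.2 (arrivalTime z.1 z.2 (n + 1)))).outNbhd k) ⁻¹' A := by
  rintro z ⟨t, h1, h2, h3, -⟩
  rw [Set.mem_preimage, arrivalTime_of_newTrap h1 h2]
  exact h3

/-- The limit law is the convolution with all renewal masses replaced by their limit. The error
depends on the total masses of the arrivals only, hence not on `A`. -/
theorem IsRegenLaw.exists_error (h : IsRegenLaw I P) (hμ : ∀ᵐ z ∂μ, IsGood I z) [IsProbabilityMeasure μ]
    (hR : Regenerative P μ) (hex : ∀ᵐ z ∂P, ∃ t ≥ 1, Reg z t) (hex' : ∀ᵐ z ∂μ, ∃ t ≥ 1, Reg z t)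
    (hκ : trapMeas P 0 Set.univ ≠ ∞) (hκ0 : trapMeas P 0 Set.univ ≠ 0)
    (hren : Tendsto (renewal NewTrap P) atTop (𝓝 (trapMeas P 0 Set.univ)⁻¹)) (k : ℕ) :
    ∃ ε : ℕ → ℝ≥0∞, (∀ n, ε n ≤ 1) ∧ Tendsto ε atTop (𝓝 0) ∧ ∀ n A, MeasurableSet A →
      (levelsLaw P 0).map (fun q => (Stem.limitTree q).outNbhd k) A ≤ μ (Hit k n A) + ε n := by
  have hPprob := h.prob
  have hlp := h.isProbabilityMeasure_levelsLaw hex hκ hκ0 0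
  have hout := Stem.isPresentation_limitTree.measurable_outNbhd k
  have hQp : IsProbabilityMeasure ((levelsLaw P 0).map fun q => (Stem.limitTree q).outNbhd k) :=
    Measure.isProbabilityMeasure_map hout.aemeasurable
  have hQ : ∀ A, MeasurableSet A → (levelsLaw P 0).map (fun q => (Stem.limitTree q).outNbhd k) A =
      ∑' m, (trapMeas P 0 Set.univ)⁻¹ * arrivalProb P k m A := by
    intro A hA
    rw [h.map_outNbhd_limitTree hex hκ, Measure.smul_apply, smul_eq_mul, ← tsum_arrivalProb hA,
      ENNReal.tsum_mul_left]
  set κ := trapMeas P 0 Set.univ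
  set Qk := (levelsLaw P 0).map fun q => (Stem.limitTree q).outNbhd k
  have hκ' : κ⁻¹ ≠ ∞ := ENNReal.inv_ne_top.2 hκ0
  have hg1 : ∑' m, arrivalProb P k m Set.univ = κ := by
    have := hQ Set.univ MeasurableSet.univ
    rw [measure_univ, ENNReal.tsum_mul_left] at this
    rw [← inv_inv κ]
    exact ENNReal.eq_inv_of_mul_eq_one_left (by rw [mul_comm]; exact this.symm)
  -- Truncated subtraction is intended: only the shortfall of the renewal mass below its limit
  -- counts in a one-sided bound.
  let b : ℕ → ℝ≥0∞ := fun n => κ⁻¹ - renewal NewTrap P n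
  have hb : Tendsto b atTop (𝓝 0) := by
    have := ENNReal.Tendsto.sub (tendsto_const_nhds (x := κ⁻¹)) hren (Or.inl hκ')
    rwa [tsub_self] at this
  -- For `m > n` there is no renewal mass to compare with, and the whole limit `κ⁻¹` is lost.
  let ε₁ : ℕ → ℝ≥0∞ := fun n => ∑' m, arrivalProb P k m Set.univ * if m ≤ n then b (n - m) else κ⁻¹
  have hε₁ : Tendsto ε₁ atTop (𝓝 0) :=
    ENNReal.tendsto_tsum_convolution (hg1 ▸ hκ) hb (fun n => tsub_le_self) le_rfl hκ'
  have hε₁' : ∀ n, ε₁ n ≤ 1 := fun n => by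
    calc ε₁ n ≤ ∑' m, arrivalProb P k m Set.univ * κ⁻¹ := ENNReal.tsum_le_tsum fun m => by
          gcongr
          split_ifs
          exacts [tsub_le_self, le_rfl]
      _ = 1 := by rw [ENNReal.tsum_mul_right, hg1, ENNReal.mul_inv_cancel hκ0 hκ]
  have hq : ∀ n A, MeasurableSet A → Qk A ≤ P (Hit k n A) + ε₁ n := by
    intro n A hA
    refine le_trans ?_ (add_le_add_left (h.sum_renewal_mul_arrivalProb_le (k := k) hA n) _)
    rw [hQ A hA, ← ENNReal.tsum_add]
    refine ENNReal.tsum_le_tsum fun m => ?_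
    have hgA : arrivalProb P k m A ≤ arrivalProb P k m Set.univ :=
      ENNReal.tsum_le_tsum fun t => measure_mono fun z hz => ⟨hz.1, hz.2.1, trivial⟩
    split_ifs with hm
    · calc κ⁻¹ * arrivalProb P k m A ≤ (renewal NewTrap P (n - m) + b (n - m)) * arrivalProb P k m A := by
            gcongr
            exact le_add_tsub
        _ ≤ _ := by
            rw [add_mul, mul_comm (b (n - m))]
            gcongr
    · rw [zero_mul, zero_add, mul_comm]
      gcongr
  -- The law under `μ` of the number of trap entrances before the first regeneration after time `0`;
  -- its total mass is `1` because there is almost surely such a regeneration.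
  let a : ℕ → ℝ≥0∞ := fun j => ∑' ρ, μ {z | z ∈ firstRegen ρ ∧ cnt NewTrap ρ z = j}
  have ha : ∑' j, a j = 1 := by
    simp only [a]
    rw [ENNReal.tsum_comm]
    have : ∀ ρ, ∑' j, μ {z | z ∈ firstRegen ρ ∧ cnt NewTrap ρ z = j} = μ (firstRegen ρ) := fun ρ =>
      tsum_measure_and_eq μ (measurableSet_firstRegen ρ) ((isLocal_newTrap I).measurable_cnt ρ)
    simp only [this]
    refine tsum_measure_firstRegen ?_ hex'
    filter_upwards [hμ] with z hz
    exact hz.reg_zero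
  refine ⟨fun n => ∑' j, a j * if j ≤ n then ε₁ (n - j) else 1, fun n => ?_,
    ENNReal.tendsto_tsum_convolution (ha ▸ ENNReal.one_ne_top) hε₁ hε₁' le_rfl ENNReal.one_ne_top,
    fun n A hA => ?_⟩
  · calc _ ≤ ∑' j, a j * 1 := ENNReal.tsum_le_tsum fun j => by
          gcongr
          split_ifs
          exacts [hε₁' _, le_rfl]
      _ = 1 := by simp only [mul_one, ha]
  · refine le_trans ?_ (add_le_add_left (sum_mul_hit_le (k := k) hμ hR hA n) _)
    rw [← ENNReal.tsum_add]
    calc Qk A = ∑' j, a j * Qk A := by rw [ENNReal.tsum_mul_right, ha, one_mul]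
      _ ≤ _ := ENNReal.tsum_le_tsum fun j => by
        rw [← mul_add]
        gcongr
        split_ifs with hj
        · exact hq _ A hA
        · rw [zero_add]
          exact prob_le_one

end Env

/-! ### Assembly of the proposition -/

theorem proposition2 (p : PMF ℕ) (ν : Measure ℝ) [IsProbabilityMeasure ν]
    (hmean : 1 < ∑' i : ℕ, (i : ℝ≥0∞) * p i) (hp0 : p 0 ≠ 0)
    (htail : ∃ α C : ℝ, 3 < α ∧ 0 < C ∧ ∀ k : ℕ, 2 ≤ k →
      ∑' i : ℕ, (p (k + i)).toReal ≤ C * (k : ℝ)⁻¹ * Real.log k ^ (-α))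
    (hν : ν.support ⊆ Set.Ioi 1) :
    ∃ Qk : ℕ → Measure WTree,
      (∀ k, IsProbabilityMeasure (Qk k) ∧ (∀ᵐ G ∂(Qk k), G ∈ WTree.Psi ν.support k) ∧
        Tendsto (fun n => tvDist (Qout p ν k n) (Qk k)) atTop (𝓝 0)) ∧
      (∀ j k, j ≤ k → (Qk k).map (WTree.ball (j + 1)) = Qk j) ∧
      ∃! Q : Measure WTree, IsProbabilityMeasure Q ∧
        (∀ᵐ T ∂Q, T.IsEndDistinguished ∧ T.BiasesIn ν.support ∧ ∀ v, T.IsLeaf v ↔ v = T.pt) ∧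
        ∀ k, Q.map (WTree.ball (k + 1)) = Qk k := by
  have he := Env.escapeLaw_univ_ne_zero p ν hmean hν
  have hR := Env.isRegenLaw_regenLaw p ν he
  have hP := hR.prob
  have hex := Env.ae_regenLaw_exists_isRegen p ν he
  have hJ := Env.isProbabilityMeasure_jointLaw p ν hmean
  have hI : MeasurableSet ν.support := Measure.isClosed_support.measurableSet
  have hI' : ν.support.Nonempty := Measure.nonempty_support_iff.2 (IsProbabilityMeasure.ne_zero ν)
  have hlate := Env.late_one_lt_late_zero p ν he hmean hp0 hν
  have hsum := Env.tsum_late_newTrap_ne_top p ν he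
  have htot := hR.trapMeas_zero_univ hex
  have hκ : Env.trapMeas (Env.regenLaw p ν) 0 Set.univ ≠ ∞ := htot ▸ hsum
  have hκ0 : Env.trapMeas (Env.regenLaw p ν) 0 Set.univ ≠ 0 := by
    rw [htot]
    exact ne_bot_of_gt (hlate.trans_le (ENNReal.le_tsum 0))
  obtain ⟨hfin, hren⟩ := hR.tendsto_renewal (Env.isLocal_newTrap ν.support) hlate hsum
  have hren' : Tendsto (Env.renewal Env.NewTrap (Env.regenLaw p ν)) atTop
      (𝓝 (Env.trapMeas (Env.regenLaw p ν) 0 Set.univ)⁻¹) := by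
    rw [← ENNReal.tendsto_toReal_iff hfin (ENNReal.inv_ne_top.2 hκ0), ENNReal.toReal_inv, htot]
    exact hren
  -- All limit laws are images of this one law, of the base together with the i.i.d. stems above it.
  set Θ := Env.levelsLaw (Env.regenLaw p ν) 0
  have hΘ : IsProbabilityMeasure Θ := hR.isProbabilityMeasure_levelsLaw hex hκ hκ0 0
  have hae := hR.ae_levelsLaw hI hex hκ
  have hm := Stem.isPresentation_limitTree.measurable_outNbhd
  have hs := Stem.isPresentation_limitTree.measurable_sub_backbone
  have hQ : ∀ k, (Θ.map fun q => (Stem.limitTree q).sub (Stem.limitTree q).backbone).map (WTree.ball (k + 1)) =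
      Θ.map fun q => (Stem.limitTree q).outNbhd k := by
    intro k
    rw [Measure.map_map (WTree.measurable_ball _) hs]
    exact WTree.map_congr_iso ((WTree.measurable_ball _).comp hs) (hm k)
      (ae_of_all _ fun q => (Stem.limitTree q).ball_sub_backbone_iso k)
  refine ⟨fun k => Θ.map fun q => (Stem.limitTree q).outNbhd k, fun k => ?_, fun j k hjk => ?_,
    Θ.map fun q => (Stem.limitTree q).sub (Stem.limitTree q).backbone, ?_, ?_⟩
  · have hprob : IsProbabilityMeasure (Θ.map fun q => (Stem.limitTree q).outNbhd k) :=
      Measure.isProbabilityMeasure_map (hm k).aemeasurable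
    refine ⟨hprob, WTree.ae_mem_psi hI' hI (hm k) ?_, ?_⟩
    · filter_upwards [hae] with q hq
      exact ⟨Stem.isEndDistinguished_limitTree q, Stem.biasesIn_limitTree hq.2.1 hq.2.2,
        Stem.pt_mem_exteriorBoundary_limitTree hq.1⟩
    · obtain ⟨ε, hε, hε0, hle⟩ := hR.exists_error (Env.ae_jointLaw_isGood p ν hν) (Env.regenerative_jointLaw p ν he)
        hex (Env.ae_jointLaw_exists_isRegen p ν he hν) hκ hκ0 hren' k
      have htop : ∀ n, ε n ≠ ∞ := fun n => ne_top_of_le_ne_top ENNReal.one_ne_top (hε n)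
      -- Trap entrances are numbered from `1`, whereas counts of earlier ones start at `0`.
      rw [← tendsto_add_atTop_iff_nat 1]
      refine squeeze_zero (fun n => tvDist_nonneg _ _) (fun n => ?_)
        ((ENNReal.tendsto_toReal ENNReal.zero_ne_top).comp hε0)
      have hmeas := Env.measurable_outNbhd_arrivalTime k n
      have hprob' : IsProbabilityMeasure (Qout p ν k (n + 1)) :=
        Measure.isProbabilityMeasure_map hmeas.aemeasurable
      refine tvDist_le (htop n) fun A hA => (hle n A hA).trans ?_
      rw [Qout, Measure.map_apply hmeas hA]
      gcongr
      exact Env.hit_subset k n A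
  · rw [Measure.map_map (WTree.measurable_ball _) (hm k)]
    exact WTree.map_congr_iso ((WTree.measurable_ball _).comp (hm k)) (hm j)
      (ae_of_all _ fun q => (Stem.limitTree q).ball_outNbhd_iso hjk)
  · refine ⟨Measure.isProbabilityMeasure_map hs.aemeasurable, WTree.ae_limit hI hs ?_, hQ⟩
    filter_upwards [hae] with q hq
    exact Stem.limit_properties hq.2.1 hq.2.2 hq.1
  · rintro Q ⟨hQprob, -, hQ'⟩
    have : IsProbabilityMeasure (Θ.map fun q => (Stem.limitTree q).sub (Stem.limitTree q).backbone) :=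
      Measure.isProbabilityMeasure_map hs.aemeasurable
    exact WTree.ext_of_map_ball fun k => (hQ' k).trans (hQ k).symm
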